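/- Let $k$ be a field. A quasi-bialgebra $(H,\Delta,\varepsilon,\Phi)$ over $k$ is a unital associative algebra $H$ with algebra maps $\Delta:H\to H\otimes H$, $\varepsilon:H\to k$ and an invertible $\Phi\in H^{\otimes 3}$ such that $(\mathrm{id}\otimes\Delta)\Delta(h)=\Phi\,(\Delta\otimes\mathrm{id})\Delta(h)\,\Phi^{-1}$, $(\mathrm{id}\otimes\varepsilon)\Delta=(\varepsilon\otimes\mathrm{id})\Delta=\mathrm{id}$, $(1\otimes\Phi)(\mathrm{id}\otimes\Delta\otimes\mathrm{id})(\Phi)(\Phi\otimes1)=(\mathrm{id}\otimes\mathrm{id}\otimes\Delta)(\Phi)(\Delta\otimes\mathrm{id}\otimes\mathrm{id})(\Phi)$ and $(\mathrm{id}\otimes\varepsilon\otimes\mathrm{id})(\Phi)=1$. Write $\Phi=X^1\otimes X^2\otimes X^3$, $\Phi^{-1}=x^1\otimes x^2\otimes x^3$, $\Delta(h)=h_1\otimes h_2$ (summation understood). It is a quasi-Hopf algebra if it has an algebra anti-automorphism $S$ and elements $\alpha,\beta\in H$ with $S(h_1)\alpha h_2=\varepsilon(h)\alpha$, $h_1\beta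 S(h_2)=\varepsilon(h)\beta$, $X^1\beta S(X^2)\alpha X^3=1$, $S(x^1)\alpha x^2\beta S(x^3)=1$, normalized by $\varepsilon(\alpha)=\varepsilon(\beta)=1$. Put $$A^1\otimes\cdots\otimes A^4=(\Phi\otimes1)(\Delta\otimes\mathrm{id}\otimes\mathrm{id})(\Phi^{-1}),\qquad B^1\otimes\cdots\otimes B^4=(\Delta\otimes\mathrm{id}\otimes\mathrm{id})(\Phi)(\Phi^{-1}\otimes1),$$ $\gamma=S(A^2)\alpha A^3\otimes S(A^1)\alpha A^4$ and $\delta_0=B^1\beta S(B^4)\otimes B^2\beta S(B^3)$. The Drinfeld twist $f=f^1\otimes f^2$ and its inverse $f^{-1}=g^1\otimes g^2$ are $$f=(S\otimes S)(\Delta^{cop}(x^1))\,\gamma\,\Delta(x^2\beta S(x^3)),\qquad f^{-1}=\Delta(S(x^1)\alpha x^2)\,\delta_0\,(S\otimes S)(\Delta^{cop}(x^3)).$$ A two-sided coaction of $H$ on a unital associative algebra $\mathbb A$ is a pair $(\delta,\Psi)$ with $\delta:\mathbb A\to H\otimes\mathbb A\otimes H$ an algebra map, $\delta(u)=u_{(-1)}\otimes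 u_{(0)}\otimes u_{(1)}$, and $\Psi\in H^{\otimes2}\otimes\mathbb A\otimes H^{\otimes2}$ invertible, such that $(\mathrm{id}\otimes\delta\otimes\mathrm{id})(\delta(u))\Psi=\Psi(\Delta\otimes\mathrm{id}\otimes\Delta)(\delta(u))$, $$(1\otimes\Psi\otimes1)(\mathrm{id}\otimes\Delta\otimes\mathrm{id}\otimes\Delta\otimes\mathrm{id})(\Psi)(\Phi\otimes1\otimes\Phi^{-1})=(\mathrm{id}^{\otimes2}\otimes\delta\otimes\mathrm{id}^{\otimes2})(\Psi)(\Delta\otimes\mathrm{id}^{\otimes3}\otimes\Delta)(\Psi),$$ $(\varepsilon\otimes\mathrm{id}\otimes\varepsilon)\circ\delta=\mathrm{id}$ and $(\mathrm{id}\otimes\varepsilon\otimes\mathrm{id}\otimes\varepsilon\otimes\mathrm{id})(\Psi)=(\varepsilon\otimes\mathrm{id}^{\otimes3}\otimes\varepsilon)(\Psi)=1$. Write $\Psi=\Psi^1\otimes\cdots\otimes\Psi^5$, $\Psi^{-1}=\overline\Psi^1\otimes\cdots\otimes\overline\Psi^5$, and set $$\Omega=\overline\Psi^1\otimes\overline\Psi^2\otimes\overline\Psi^3\otimes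 S^{-1}(f^1\overline\Psi^4)\otimes S^{-1}(f^2\overline\Psi^5),\quad \Omega'=S^{-1}(\Psi^1g^1)\otimes S^{-1}(\Psi^2g^2)\otimes\Psi^3\otimes\Psi^4\otimes\Psi^5,$$ $$p_\delta=p^1\otimes p^2\otimes p^3=\Psi^2S^{-1}(\Psi^1\beta)\otimes\Psi^3\otimes\Psi^4\beta S(\Psi^5),\quad q_\delta=q^1\otimes q^2\otimes q^3=S(\overline\Psi^1)\alpha\overline\Psi^2\otimes\overline\Psi^3\otimes S^{-1}(\alpha\overline\Psi^5)\overline\Psi^4 .$$ An $H$-bimodule algebra is an $H$-bimodule $\mathcal A$ with a bilinear (not necessarily associative) multiplication and a two-sided unit $1_{\mathcal A}$ such that $(\varphi\varphi')\varphi''=(X^1\cdot\varphi\cdot x^1)[(X^2\cdot\varphi'\cdot x^2)(X^3\cdot\varphi''\cdot x^3)]$, $h\cdot(\varphi\varphi')=(h_1\cdot\varphi)(h_2\cdot\varphi')$, $(\varphi\varphi')\cdot h=(\varphi\cdot h_1)(\varphi'\cdot h_2)$ and $h\cdot1_{\mathcal A}=\varepsilon(h)1_{\mathcal A}=1_{\mathcal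 A}\cdot h$. The left and right generalized diagonal crossed products $\mathcal A\bowtie_\delta\mathbb A$ and $\mathbb A\bowtie_\delta\mathcal A$ are the vector spaces $\mathcal A\otimes\mathbb A$ and $\mathbb A\otimes\mathcal A$ with the elements $1_{\mathcal A}\bowtie1_{\mathbb A}$ and $1_{\mathbb A}\bowtie1_{\mathcal A}$ and the products $$(\varphi\bowtie u)(\varphi'\bowtie u')=(\Omega^1\cdot\varphi\cdot\Omega^5)(\Omega^2u_{(-1)}\cdot\varphi'\cdot S^{-1}(u_{(1)})\Omega^4)\bowtie\Omega^3u_{(0)}u',$$ $$(u\bowtie\varphi)(u'\bowtie\varphi')=uu'_{(0)}\Omega'^3\bowtie(\Omega'^2S^{-1}(u'_{(-1)})\cdot\varphi\cdot u'_{(1)}\Omega'^4)(\Omega'^1\cdot\varphi'\cdot\Omega'^5).$$ **Theorem.** Let $H$ be a quasi-Hopf algebra, $\mathbb A$ a unital associative algebra and $\mathcal A$ an $H$-bimodule algebra. (1) For every two-sided coaction $(\delta,\Psi)$ of $H$ on $\mathbb A$, $\mathcal A\bowtie_\delta\mathbb A$ and $\mathbb A\bowtie_\delta\mathcal A$ are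 unital associative algebras, and the map $$\vartheta:\mathcal A\bowtie_\delta\mathbb A\to\mathbb A\bowtie_\delta\mathcal A,\qquad \vartheta(\varphi\bowtie u)=q^2u_{(0)}\bowtie S^{-1}(q^1u_{(-1)})\cdot\varphi\cdot q^3u_{(1)}$$ is an isomorphism of unital algebras, with inverse $\vartheta^{-1}(u\bowtie\varphi)=u_{(-1)}p^1\cdot\varphi\cdot S^{-1}(u_{(1)}p^3)\bowtie u_{(0)}p^2$. (2) Let $\mathbb A$ be an $H$-bicomodule algebra, i.e. let there be algebra maps $\lambda:\mathbb A\to H\otimes\mathbb A$, $\rho:\mathbb A\to\mathbb A\otimes H$ and invertible elements $\Phi_\lambda\in H^{\otimes2}\otimes\mathbb A$, $\Phi_\rho\in\mathbb A\otimes H^{\otimes2}$, $\Phi_{\lambda,\rho}\in H\otimes\mathbb A\otimes H$ such that, for $u\in\mathbb A$, - $(\mathrm{id}\otimes\lambda)(\lambda(u))\Phi_\lambda=\Phi_\lambda(\Delta\otimes\mathrm{id})(\lambda(u))$, $(1\otimes\Phi_\lambda)(\mathrm{id}\otimes\Delta\otimes\mathrm{id})(\Phi_\lambda)(\Phi\otimes1)=(\mathrm{id}^{\otimes2}\otimes\lambda)(\Phi_\lambda)(\Delta\otimes\mathrm{id}^{\otimes2})(\Phi_\lambda)$,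 $(\varepsilon\otimes\mathrm{id})\lambda=\mathrm{id}$, $(\mathrm{id}\otimes\varepsilon\otimes\mathrm{id})(\Phi_\lambda)=(\varepsilon\otimes\mathrm{id}^{\otimes2})(\Phi_\lambda)=1$; - $\Phi_\rho(\rho\otimes\mathrm{id})(\rho(u))=(\mathrm{id}\otimes\Delta)(\rho(u))\Phi_\rho$, $(1\otimes\Phi)(\mathrm{id}\otimes\Delta\otimes\mathrm{id})(\Phi_\rho)(\Phi_\rho\otimes1)=(\mathrm{id}^{\otimes2}\otimes\Delta)(\Phi_\rho)(\rho\otimes\mathrm{id}^{\otimes2})(\Phi_\rho)$, $(\mathrm{id}\otimes\varepsilon)\rho=\mathrm{id}$, $(\mathrm{id}\otimes\varepsilon\otimes\mathrm{id})(\Phi_\rho)=(\mathrm{id}^{\otimes2}\otimes\varepsilon)(\Phi_\rho)=1$; - $\Phi_{\lambda,\rho}(\lambda\otimes\mathrm{id})(\rho(u))=(\mathrm{id}\otimes\rho)(\lambda(u))\Phi_{\lambda,\rho}$, $(1\otimes\Phi_{\lambda,\rho})(\mathrm{id}\otimes\lambda\otimes\mathrm{id})(\Phi_{\lambda,\rho})(\Phi_\lambda\otimes1)=(\mathrm{id}^{\otimes2}\otimes\rho)(\Phi_\lambda)(\Delta\otimes\mathrm{id}^{\otimes2})(\Phi_{\lambda,\rho})$,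 $(1\otimes\Phi_\rho)(\mathrm{id}\otimes\rho\otimes\mathrm{id})(\Phi_{\lambda,\rho})(\Phi_{\lambda,\rho}\otimes1)=(\mathrm{id}^{\otimes2}\otimes\Delta)(\Phi_{\lambda,\rho})(\lambda\otimes\mathrm{id}^{\otimes2})(\Phi_\rho)$. Define $\delta_l=(\lambda\otimes\mathrm{id})\rho$, $\Psi_l=(\mathrm{id}\otimes\lambda\otimes\mathrm{id}^{\otimes2})\big((\Phi_{\lambda,\rho}\otimes1)(\lambda\otimes\mathrm{id}^{\otimes2})(\Phi_\rho^{-1})\big)(\Phi_\lambda\otimes1^{\otimes2})$ and $\delta_r=(\mathrm{id}\otimes\rho)\lambda$, $\Psi_r=(\mathrm{id}^{\otimes2}\otimes\rho\otimes\mathrm{id})\big((1\otimes\Phi_{\lambda,\rho}^{-1})(\mathrm{id}^{\otimes2}\otimes\rho)(\Phi_\lambda)\big)(1^{\otimes2}\otimes\Phi_\rho^{-1})$. Then the four generalized diagonal crossed products $\mathcal A\bowtie_{\delta_l}\mathbb A$, $\mathbb A\bowtie_{\delta_l}\mathcal A$, $\mathcal A\bowtie_{\delta_r}\mathbb A$ and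 $\mathbb A\bowtie_{\delta_r}\mathcal A$ (formed with $\Psi_l$, respectively $\Psi_r$) are unital associative algebras and are all isomorphic as unital algebras. -/

import Mathlib

open scoped TensorProduct
set_option maxSynthPendingDepth 10

noncomputable section

namespace QuasiHopf

/-! All iterated tensor products are bracketed to the right: `X ⊗ (Y ⊗ (Z ⊗ W))`. -/

section Combinators

variable {k : Type*} [CommRing k]

/-- `id ⊗ f`. -/
abbrev tail {X Y : Type*} [Ring X] [Algebra k X] [Ring Y] [Algebra k Y]
    (W : Type*) [Ring W] [Algebra k W] (f : X →ₐ[k] Y) : W ⊗[k] X →ₐ[k] W ⊗[k] Y :=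
  Algebra.TensorProduct.map (AlgHom.id k W) f

/-- `f ⊗ id` for `f : X → Y ⊗ Z`, with values in `Y ⊗ (Z ⊗ W)`. -/
def splitHead {X Y Z : Type*} [Ring X] [Algebra k X] [Ring Y] [Algebra k Y] [Ring Z] [Algebra k Z]
    (f : X →ₐ[k] Y ⊗[k] Z) (W : Type*) [Ring W] [Algebra k W] :
    X ⊗[k] W →ₐ[k] Y ⊗[k] (Z ⊗[k] W) :=
  (Algebra.TensorProduct.assoc k k k Y Z W).toAlgHom.comp
    (Algebra.TensorProduct.map f (AlgHom.id k W))

/-- The reassociation `(x ⊗ (y ⊗ z)) ⊗ w ↦ x ⊗ (y ⊗ (z ⊗ w))`. -/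
def join₃ (X Y Z W : Type*) [Ring X] [Algebra k X] [Ring Y] [Algebra k Y] [Ring Z] [Algebra k Z]
    [Ring W] [Algebra k W] :
    (X ⊗[k] (Y ⊗[k] Z)) ⊗[k] W →ₐ[k] X ⊗[k] (Y ⊗[k] (Z ⊗[k] W)) :=
  (tail X (Algebra.TensorProduct.assoc k k k Y Z W).toAlgHom).comp
    (Algebra.TensorProduct.assoc k k k X (Y ⊗[k] Z) W).toAlgHom

/-- `f ⊗ id` for `f : X → Y ⊗ (Z ⊗ V)`, with values in `Y ⊗ (Z ⊗ (V ⊗ W))`. -/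
def splitHead₃ {X Y Z V : Type*} [Ring X] [Algebra k X] [Ring Y] [Algebra k Y] [Ring Z]
    [Algebra k Z] [Ring V] [Algebra k V]
    (f : X →ₐ[k] Y ⊗[k] (Z ⊗[k] V)) (W : Type*) [Ring W] [Algebra k W] :
    X ⊗[k] W →ₐ[k] Y ⊗[k] (Z ⊗[k] (V ⊗[k] W)) :=
  (join₃ Y Z V W).comp (Algebra.TensorProduct.map f (AlgHom.id k W))

/-- `t ↦ t ⊗ 1_W` on a triple tensor product. -/
def padRight {X Y Z : Type*} [Ring X] [Algebra k X] [Ring Y] [Algebra k Y] [Ring Z] [Algebra k Z]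
    (W : Type*) [Ring W] [Algebra k W] :
    X ⊗[k] (Y ⊗[k] Z) →ₐ[k] X ⊗[k] (Y ⊗[k] (Z ⊗[k] W)) :=
  (join₃ X Y Z W).comp Algebra.TensorProduct.includeLeft

/-- `t ↦ 1_W ⊗ t`. -/
abbrev padLeft {X : Type*} [Ring X] [Algebra k X] (W : Type*) [Ring W] [Algebra k W] :
    X →ₐ[k] W ⊗[k] X :=
  Algebra.TensorProduct.includeRight

/-- `ε ⊗ id`. -/
def counitHead {H : Type*} [Ring H] [Algebra k H] (ε : H →ₐ[k] k)
    (W : Type*) [Ring W] [Algebra k W] : H ⊗[k] W →ₐ[k] W :=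
  (Algebra.TensorProduct.lid k W).toAlgHom.comp
    (Algebra.TensorProduct.map ε (AlgHom.id k W))

/-- `id ⊗ ε`. -/
def counitTail {H : Type*} [Ring H] [Algebra k H] (ε : H →ₐ[k] k)
    (W : Type*) [Ring W] [Algebra k W] : W ⊗[k] H →ₐ[k] W :=
  (Algebra.TensorProduct.rid k k W).toAlgHom.comp
    (Algebra.TensorProduct.map (AlgHom.id k W) ε)

/-- `x ⊗ y ↦ f(x) g(y)`. -/
def mulMap {X Y R : Type*} [AddCommGroup X] [Module k X] [AddCommGroup Y] [Module k Y]
    [Ring R] [Algebra k R] (f : X →ₗ[k] R) (g : Y →ₗ[k] R) : X ⊗[k] Y →ₗ[k] R :=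
  LinearMap.mul' k R ∘ₗ TensorProduct.map f g

/-- `x ⊗ y ⊗ z ⊗ w ↦ (y ⊗ z) ⊗ (x ⊗ w)`. -/
def unnest (X Y Z W : Type*) [AddCommGroup X] [Module k X] [AddCommGroup Y] [Module k Y]
    [AddCommGroup Z] [Module k Z] [AddCommGroup W] [Module k W] :
    X ⊗[k] (Y ⊗[k] (Z ⊗[k] W)) →ₗ[k] (Y ⊗[k] Z) ⊗[k] (X ⊗[k] W) :=
  (TensorProduct.leftComm k X (Y ⊗[k] Z) W).toLinearMap ∘ₗ
    (TensorProduct.assoc k Y Z W).symm.toLinearMap.lTensor X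

/-- `x ⊗ y ⊗ v ⊗ z ⊗ w ↦ v ⊗ ((y ⊗ z) ⊗ (x ⊗ w))`. -/
def unnest₅ (X Y V Z W : Type*) [AddCommGroup X] [Module k X] [AddCommGroup Y] [Module k Y]
    [AddCommGroup V] [Module k V] [AddCommGroup Z] [Module k Z] [AddCommGroup W] [Module k W] :
    X ⊗[k] (Y ⊗[k] (V ⊗[k] (Z ⊗[k] W))) →ₗ[k] V ⊗[k] ((Y ⊗[k] Z) ⊗[k] (X ⊗[k] W)) :=
  (unnest X Y Z W).lTensor V ∘ₗ
    (TensorProduct.leftComm k X V (Y ⊗[k] (Z ⊗[k] W))).toLinearMap ∘ₗ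
      (TensorProduct.leftComm k Y V (Z ⊗[k] W)).toLinearMap.lTensor X

theorem mulMap_tmul {X Y R : Type*} [AddCommGroup X] [Module k X] [AddCommGroup Y] [Module k Y]
    [Ring R] [Algebra k R] (f : X →ₗ[k] R) (g : Y →ₗ[k] R) (x : X) (y : Y) :
    mulMap f g (x ⊗ₜ[k] y) = f x * g y := rfl

theorem unnest₅_tmul {X Y V Z W : Type*} [AddCommGroup X] [Module k X] [AddCommGroup Y]
    [Module k Y] [AddCommGroup V] [Module k V] [AddCommGroup Z] [Module k Z] [AddCommGroup W]
    [Module k W] (x : X) (y : Y) (v : V) (z : Z) (w : W) :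
    unnest₅ (k := k) X Y V Z W (x ⊗ₜ (y ⊗ₜ (v ⊗ₜ (z ⊗ₜ w)))) =
      v ⊗ₜ ((y ⊗ₜ z) ⊗ₜ (x ⊗ₜ w)) := rfl

end Combinators

/-! ### Quasi-bialgebras and quasi-Hopf algebras -/

/-- A quasi-bialgebra structure `(Δ, ε, Φ)` on the unital associative algebra `H`. -/
structure QuasiBialgebra (k H : Type*) [Field k] [Ring H] [Algebra k H] where
  /-- the comultiplication `Δ` -/
  Δ : H →ₐ[k] H ⊗[k] H
  /-- the counit `ε` -/
  ε : H →ₐ[k] k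
  /-- the reassociator `Φ`, an invertible element of `H ⊗ H ⊗ H` -/
  Φ : (H ⊗[k] (H ⊗[k] H))ˣ
  coassoc : ∀ h : H, tail H Δ (Δ h) = (Φ : H ⊗[k] (H ⊗[k] H)) * splitHead Δ H (Δ h) * (Φ⁻¹).val
  counit_right : ∀ h : H, counitTail ε H (Δ h) = h
  counit_left : ∀ h : H, counitHead ε H (Δ h) = h
  cocycle : padLeft H Φ.val * tail H (splitHead Δ H) Φ.val * padRight H Φ.val =
    tail H (tail H Δ) Φ.val * splitHead Δ (H ⊗[k] H) Φ.val
  counit_mid : tail H (counitHead ε H) Φ.val = 1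

/-- A quasi-Hopf algebra structure: a quasi-bialgebra with an algebra anti-automorphism `S` and
elements `α`, `β`, normalised by `ε(α) = ε(β) = 1`. -/
structure QuasiHopfAlgebra (k H : Type*) [Field k] [Ring H] [Algebra k H] extends
    QuasiBialgebra k H where
  /-- the antipode as an algebra isomorphism onto the opposite algebra -/
  antipode : H ≃ₐ[k] Hᵐᵒᵖ
  α : H
  β : H
  antipode_alpha : ∀ h : H,
    mulMap (LinearMap.mulRight k α ∘ₗ (MulOpposite.opLinearEquiv k).symm.toLinearMap ∘ₗ
      antipode.toLinearMap) LinearMap.id (Δ h) = ε h • α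
  antipode_beta : ∀ h : H,
    mulMap (LinearMap.mulRight k β) ((MulOpposite.opLinearEquiv k).symm.toLinearMap ∘ₗ
      antipode.toLinearMap) (Δ h) = ε h • β
  antipode_reassociator :
    mulMap (LinearMap.mulRight k β)
      (mulMap (LinearMap.mulRight k α ∘ₗ (MulOpposite.opLinearEquiv k).symm.toLinearMap ∘ₗ
        antipode.toLinearMap) LinearMap.id) Φ.val = 1
  antipode_reassociator_inv :
    mulMap (LinearMap.mulRight k α ∘ₗ (MulOpposite.opLinearEquiv k).symm.toLinearMap ∘ₗ
        antipode.toLinearMap)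
      (mulMap (LinearMap.mulRight k β) ((MulOpposite.opLinearEquiv k).symm.toLinearMap ∘ₗ
        antipode.toLinearMap)) (Φ⁻¹).val = 1
  counit_alpha : ε α = 1
  counit_beta : ε β = 1

namespace QuasiHopfAlgebra

variable {k H : Type*} [Field k] [Ring H] [Algebra k H] (Q : QuasiHopfAlgebra k H)

/-- The antipode `S` as a linear endomorphism of `H`. -/
def S : H →ₗ[k] H :=
  (MulOpposite.opLinearEquiv k).symm.toLinearMap ∘ₗ Q.antipode.toLinearMap

/-- The inverse antipode `S⁻¹` as a linear endomorphism of `H`. -/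
def Sinv : H →ₗ[k] H :=
  Q.antipode.symm.toLinearMap ∘ₗ (MulOpposite.opLinearEquiv k).toLinearMap

/-- `x ⊗ y ↦ S(x) α y`. -/
def evα : H ⊗[k] H →ₗ[k] H :=
  mulMap (LinearMap.mulRight k Q.α ∘ₗ Q.S) LinearMap.id

/-- `x ⊗ y ↦ x β S(y)`. -/
def evβ : H ⊗[k] H →ₗ[k] H :=
  mulMap (LinearMap.mulRight k Q.β) Q.S

/-- `h ↦ (S ⊗ S)(Δ^cop(h))`. -/
def SSΔcop : H →ₗ[k] H ⊗[k] H :=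
  TensorProduct.map Q.S Q.S ∘ₗ (TensorProduct.comm k H H).toLinearMap ∘ₗ Q.Δ.toLinearMap

/-- `γ = S(A²) α A³ ⊗ S(A¹) α A⁴`, where `A = (Φ ⊗ 1)(Δ ⊗ id ⊗ id)(Φ⁻¹)`. -/
def γ : H ⊗[k] H :=
  TensorProduct.map Q.evα Q.evα
    (unnest H H H H (padRight H Q.Φ.val * splitHead Q.Δ (H ⊗[k] H) (Q.Φ⁻¹).val))

/-- `B¹ β S(B⁴) ⊗ B² β S(B³)`, where `B = (Δ ⊗ id ⊗ id)(Φ)(Φ⁻¹ ⊗ 1)`. -/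
def δ₀ : H ⊗[k] H :=
  TensorProduct.comm k H H (TensorProduct.map Q.evβ Q.evβ
    (unnest H H H H (splitHead Q.Δ (H ⊗[k] H) Q.Φ.val * padRight H (Q.Φ⁻¹).val)))

/-- The Drinfeld twist `f = (S ⊗ S)(Δ^cop(x¹)) γ Δ(x² β S(x³))`, where
`Φ⁻¹ = x¹ ⊗ x² ⊗ x³`. -/
def f : H ⊗[k] H :=
  mulMap (LinearMap.mulRight k Q.γ ∘ₗ Q.SSΔcop) (Q.Δ.toLinearMap ∘ₗ Q.evβ) (Q.Φ⁻¹).val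

/-- The inverse of the Drinfeld twist,
`f⁻¹ = Δ(S(x¹) α x²) δ₀ (S ⊗ S)(Δ^cop(x³))`, where `Φ⁻¹ = x¹ ⊗ x² ⊗ x³`. -/
def fInv : H ⊗[k] H :=
  mulMap (LinearMap.mulRight k Q.δ₀ ∘ₗ Q.Δ.toLinearMap ∘ₗ Q.evα) Q.SSΔcop
    ((TensorProduct.assoc k H H H).symm (Q.Φ⁻¹).val)

end QuasiHopfAlgebra

/-! ### Two-sided coactions -/

/-- The data `(δ, Ψ)` of a two-sided coaction. -/
structure CoactionData (k H A : Type*) [Field k] [Ring H] [Algebra k H] [Ring A]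
    [Algebra k A] where
  δ : A →ₐ[k] H ⊗[k] (A ⊗[k] H)
  Ψ : (H ⊗[k] (H ⊗[k] (A ⊗[k] (H ⊗[k] H))))ˣ

/-- A two-sided coaction `(δ, Ψ)` of a quasi-bialgebra `H` on a unital associative algebra `A`. -/
structure TwoSidedCoaction {k H : Type*} [Field k] [Ring H] [Algebra k H]
    (Q : QuasiBialgebra k H) (A : Type*) [Ring A] [Algebra k A] extends CoactionData k H A where
  /-- `(id ⊗ δ ⊗ id)(δ(u)) Ψ = Ψ (Δ ⊗ id ⊗ Δ)(δ(u))` -/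
  coassoc : ∀ u : A,
    tail H (splitHead₃ δ H) (δ u) * Ψ.val =
      Ψ.val * splitHead Q.Δ (A ⊗[k] (H ⊗[k] H)) (tail H (tail A Q.Δ) (δ u))
  /-- `(1 ⊗ Ψ ⊗ 1)(id ⊗ Δ ⊗ id ⊗ Δ ⊗ id)(Ψ)(Φ ⊗ 1 ⊗ Φ⁻¹)
    = (id ⊗ id ⊗ δ ⊗ id ⊗ id)(Ψ)(Δ ⊗ id ⊗ id ⊗ id ⊗ Δ)(Ψ)` -/
  cocycle :
    padLeft H (tail H (tail H (tail A (tail H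
        (Algebra.TensorProduct.includeLeft : H →ₐ[k] H ⊗[k] H)))) Ψ.val) *
      tail H (splitHead Q.Δ (A ⊗[k] (H ⊗[k] (H ⊗[k] H))))
        (tail H (tail H (tail A (splitHead Q.Δ H))) Ψ.val) *
      join₃ H H H (A ⊗[k] (H ⊗[k] (H ⊗[k] H))) (Q.Φ.val ⊗ₜ[k] ((1 : A) ⊗ₜ[k] (Q.Φ⁻¹).val)) =
    tail H (tail H (splitHead₃ δ (H ⊗[k] H))) Ψ.val *
      splitHead Q.Δ (H ⊗[k] (A ⊗[k] (H ⊗[k] (H ⊗[k] H))))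
        (tail H (tail H (tail A (tail H Q.Δ))) Ψ.val)
  /-- `(ε ⊗ id ⊗ ε) ∘ δ = id` -/
  counit : ∀ u : A, counitHead Q.ε A (tail H (counitTail Q.ε A) (δ u)) = u
  /-- `(id ⊗ ε ⊗ id ⊗ ε ⊗ id)(Ψ) = 1` -/
  counit_inner :
    tail H (counitHead Q.ε (A ⊗[k] H)) (tail H (tail H (tail A (counitHead Q.ε H))) Ψ.val) = 1
  /-- `(ε ⊗ id ⊗ id ⊗ id ⊗ ε)(Ψ) = 1` -/
  counit_outer :
    counitHead Q.ε (H ⊗[k] (A ⊗[k] H)) (tail H (tail H (tail A (counitTail Q.ε H))) Ψ.val) = 1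

/-! ### Comodule algebras and bicomodule algebras -/

/-- A right `H`-comodule algebra structure `(ρ, Φ_ρ)` on `A`. -/
structure RightComoduleAlgebra {k H : Type*} [Field k] [Ring H] [Algebra k H]
    (Q : QuasiBialgebra k H) (A : Type*) [Ring A] [Algebra k A] where
  ρ : A →ₐ[k] A ⊗[k] H
  Φρ : (A ⊗[k] (H ⊗[k] H))ˣ
  coassoc_right : ∀ a : A, Φρ.val * splitHead ρ H (ρ a) = tail A Q.Δ (ρ a) * Φρ.val
  cocycle_right : padLeft A Q.Φ.val * tail A (splitHead Q.Δ H) Φρ.val * padRight H Φρ.val =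
    tail A (tail H Q.Δ) Φρ.val * splitHead ρ (H ⊗[k] H) Φρ.val
  counit_right : ∀ a : A, counitTail Q.ε A (ρ a) = a
  counit_mid_right : tail A (counitHead Q.ε H) Φρ.val = 1
  counit_last_right : tail A (counitTail Q.ε H) Φρ.val = 1

/-- A left `H`-comodule algebra structure `(λ, Φ_λ)` on `A`. -/
structure LeftComoduleAlgebra {k H : Type*} [Field k] [Ring H] [Algebra k H]
    (Q : QuasiBialgebra k H) (A : Type*) [Ring A] [Algebra k A] where
  lam : A →ₐ[k] H ⊗[k] A
  Φlam : (H ⊗[k] (H ⊗[k] A))ˣ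
  coassoc_left : ∀ a : A, tail H lam (lam a) * Φlam.val = Φlam.val * splitHead Q.Δ A (lam a)
  cocycle_left : padLeft H Φlam.val * tail H (splitHead Q.Δ A) Φlam.val * padRight A Q.Φ.val =
    tail H (tail H lam) Φlam.val * splitHead Q.Δ (H ⊗[k] A) Φlam.val
  counit_left : ∀ a : A, counitHead Q.ε A (lam a) = a
  counit_mid_left : tail H (counitHead Q.ε A) Φlam.val = 1
  counit_first_left : counitHead Q.ε (H ⊗[k] A) Φlam.val = 1

/-- An `H`-bicomodule algebra structure `(λ, ρ, Φ_λ, Φ_ρ, Φ_{λ,ρ})` on `A`. -/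
structure BicomoduleAlgebra {k H : Type*} [Field k] [Ring H] [Algebra k H]
    (Q : QuasiBialgebra k H) (A : Type*) [Ring A] [Algebra k A] extends
    LeftComoduleAlgebra Q A, RightComoduleAlgebra Q A where
  Φlr : (H ⊗[k] (A ⊗[k] H))ˣ
  compat : ∀ u : A, Φlr.val * splitHead lam H (ρ u) = tail H ρ (lam u) * Φlr.val
  compat_left : padLeft H Φlr.val * tail H (splitHead lam H) Φlr.val * padRight H Φlam.val =
    tail H (tail H ρ) Φlam.val * splitHead Q.Δ (A ⊗[k] H) Φlr.val
  compat_right : padLeft H Φρ.val * tail H (splitHead ρ H) Φlr.val * padRight H Φlr.val =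
    tail H (tail A Q.Δ) Φlr.val * splitHead lam (H ⊗[k] H) Φρ.val

namespace BicomoduleAlgebra

variable {k H : Type*} [Field k] [Ring H] [Algebra k H] {Q : QuasiBialgebra k H}
  {A : Type*} [Ring A] [Algebra k A] (B : BicomoduleAlgebra Q A)

/-- `δ_l = (λ ⊗ id) ∘ ρ`,
`Ψ_l = (id ⊗ λ ⊗ id ⊗ id)((Φ_{λ,ρ} ⊗ 1)(λ ⊗ id ⊗ id)(Φ_ρ⁻¹)) [Φ_λ ⊗ 1 ⊗ 1]`. -/
def coactionL : CoactionData k H A where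
  δ := (splitHead B.lam H).comp B.ρ
  Ψ := Units.map (tail H (splitHead B.lam (H ⊗[k] H)) : _ →* _)
      (Units.map (padRight H : H ⊗[k] (A ⊗[k] H) →ₐ[k] _).toMonoidHom B.Φlr *
        Units.map (splitHead B.lam (H ⊗[k] H) : _ →* _) B.Φρ⁻¹) *
    Units.map (padRight (H ⊗[k] H) : H ⊗[k] (H ⊗[k] A) →ₐ[k] _).toMonoidHom B.Φlam

/-- `δ_r = (id ⊗ ρ) ∘ λ`,
`Ψ_r = (id ⊗ id ⊗ ρ ⊗ id)((1 ⊗ Φ_{λ,ρ}⁻¹)(id ⊗ id ⊗ ρ)(Φ_λ)) [1 ⊗ 1 ⊗ Φ_ρ⁻¹]`. -/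
def coactionR : CoactionData k H A where
  δ := (tail H B.ρ).comp B.lam
  Ψ := Units.map (tail H (tail H (splitHead B.ρ H)) : _ →* _)
      (Units.map (padLeft H : H ⊗[k] (A ⊗[k] H) →ₐ[k] _).toMonoidHom B.Φlr⁻¹ *
        Units.map (tail H (tail H B.ρ) : _ →* _) B.Φlam) *
    Units.map ((padLeft H).comp (padLeft H : A ⊗[k] (H ⊗[k] H) →ₐ[k] _)).toMonoidHom B.Φρ⁻¹

end BicomoduleAlgebra

/-! ### Bimodule algebras -/

/-- An `H`-bimodule algebra structure on the (not necessarily associative) unital `k`-algebra `𝒜`: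
`lact h φ = h · φ` and `ract h φ = φ · h`. -/
structure BimoduleAlgebra {k H : Type*} [Field k] [Ring H] [Algebra k H]
    (Q : QuasiBialgebra k H) (𝒜 : Type*) [NonAssocRing 𝒜] [Module k 𝒜] [SMulCommClass k 𝒜 𝒜]
    [IsScalarTower k 𝒜 𝒜] where
  lact : H →ₗ[k] 𝒜 →ₗ[k] 𝒜
  ract : H →ₗ[k] 𝒜 →ₗ[k] 𝒜
  one_lact : ∀ φ, lact 1 φ = φ
  mul_lact : ∀ h h' φ, lact (h * h') φ = lact h (lact h' φ)
  one_ract : ∀ φ, ract 1 φ = φ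
  mul_ract : ∀ h h' φ, ract (h * h') φ = ract h' (ract h φ)
  lact_ract : ∀ h h' φ, lact h (ract h' φ) = ract h' (lact h φ)
  /-- `(φ φ') φ'' = (X¹ · φ · x¹) [(X² · φ' · x²) (X³ · φ'' · x³)]` -/
  quasi_assoc : ∀ φ φ' φ'' : 𝒜, (φ * φ') * φ'' =
    (LinearMap.mul' k 𝒜 ∘ₗ (LinearMap.mul' k 𝒜).lTensor 𝒜)
      (TensorProduct.map₂ lact (TensorProduct.map₂ lact lact) Q.Φ.val
        (TensorProduct.map₂ ract (TensorProduct.map₂ ract ract) (Q.Φ⁻¹).val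
          (φ ⊗ₜ[k] (φ' ⊗ₜ[k] φ''))))
  /-- `h · (φ φ') = (h₁ · φ)(h₂ · φ')` -/
  lact_mul : ∀ (h : H) (φ φ' : 𝒜), lact h (φ * φ') =
    LinearMap.mul' k 𝒜 (TensorProduct.map₂ lact lact (Q.Δ h) (φ ⊗ₜ[k] φ'))
  /-- `(φ φ') · h = (φ · h₁)(φ' · h₂)` -/
  ract_mul : ∀ (h : H) (φ φ' : 𝒜), ract h (φ * φ') =
    LinearMap.mul' k 𝒜 (TensorProduct.map₂ ract ract (Q.Δ h) (φ ⊗ₜ[k] φ'))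
  lact_one : ∀ h, lact h 1 = Q.ε h • (1 : 𝒜)
  ract_one : ∀ h, ract h 1 = Q.ε h • (1 : 𝒜)

/-- `x ⊗ y ↦ (φ ↦ x · φ · y)`. -/
def BimoduleAlgebra.act {k H : Type*} [Field k] [Ring H] [Algebra k H]
    {Q : QuasiBialgebra k H} {𝒜 : Type*} [NonAssocRing 𝒜] [Module k 𝒜] [SMulCommClass k 𝒜 𝒜]
    [IsScalarTower k 𝒜 𝒜] (M : BimoduleAlgebra Q 𝒜) : H ⊗[k] H →ₗ[k] 𝒜 →ₗ[k] 𝒜 :=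
  TensorProduct.lift ((LinearMap.mul k (Module.End k 𝒜)).compl₁₂ M.lact M.ract)

/-! ### Unital algebra structures on a vector space -/

/-- A bilinear product with a distinguished element on a vector space. -/
structure AlgebraData (k X : Type*) [Field k] [AddCommGroup X] [Module k X] where
  mul : X →ₗ[k] X →ₗ[k] X
  one : X

/-- The product is associative with unit `one`: the data are a unital associative algebra. -/
structure AlgebraData.IsUnitalAlgebra {k X : Type*} [Field k] [AddCommGroup X] [Module k X]
    (P : AlgebraData k X) : Prop where
  mul_assoc : ∀ x y z, P.mul (P.mul x y) z = P.mul x (P.mul y z)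
  one_mul : ∀ x, P.mul P.one x = x
  mul_one : ∀ x, P.mul x P.one = x

/-- The linear isomorphism `e` preserves products and units. -/
structure IsAlgebraIso {k X Y : Type*} [Field k] [AddCommGroup X] [Module k X]
    [AddCommGroup Y] [Module k Y] (P : AlgebraData k X) (R : AlgebraData k Y)
    (e : X ≃ₗ[k] Y) : Prop where
  map_mul : ∀ x y, e (P.mul x y) = R.mul (e x) (e y)
  map_one : e P.one = R.one

/-! ### Generalized diagonal crossed products -/

section CrossedProducts

variable {k H : Type*} [Field k] [Ring H] [Algebra k H] (Q : QuasiHopfAlgebra k H)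
  {A : Type*} [Ring A] [Algebra k A] (c : CoactionData k H A)

/-- `Ω_δ = Ψ̄¹ ⊗ Ψ̄² ⊗ Ψ̄³ ⊗ S⁻¹(f¹ Ψ̄⁴) ⊗ S⁻¹(f² Ψ̄⁵)`, where `Ψ⁻¹ = Ψ̄¹ ⊗ ⋯ ⊗ Ψ̄⁵`. -/
def Ω : H ⊗[k] (H ⊗[k] (A ⊗[k] (H ⊗[k] H))) :=
  ((((TensorProduct.map Q.Sinv Q.Sinv).lTensor A).lTensor H).lTensor H)
    ((1 : H) ⊗ₜ[k] ((1 : H) ⊗ₜ[k] ((1 : A) ⊗ₜ[k] Q.f)) * (c.Ψ⁻¹).val)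

/-- `Ω'_δ = S⁻¹(Ψ¹ g¹) ⊗ S⁻¹(Ψ² g²) ⊗ Ψ³ ⊗ Ψ⁴ ⊗ Ψ⁵`, where `f⁻¹ = g¹ ⊗ g²`. -/
def Ω' : H ⊗[k] (H ⊗[k] (A ⊗[k] (H ⊗[k] H))) :=
  TensorProduct.map Q.Sinv (TensorProduct.map Q.Sinv LinearMap.id)
    (c.Ψ.val * TensorProduct.assoc k H H (A ⊗[k] (H ⊗[k] H)) (Q.fInv ⊗ₜ[k] 1))

/-- The bilinear map sending `a ⊗ b ⊗ v ⊗ c ⊗ d` and `x ⊗ u ⊗ y` to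
`a ⊗ b x ⊗ v u ⊗ S⁻¹(y) c ⊗ d`. -/
def starLeft : H ⊗[k] (H ⊗[k] (A ⊗[k] (H ⊗[k] H))) →ₗ[k] H ⊗[k] (A ⊗[k] H) →ₗ[k]
    H ⊗[k] (H ⊗[k] (A ⊗[k] (H ⊗[k] H))) :=
  (TensorProduct.map₂ (LinearMap.mul k H) (TensorProduct.map₂ (LinearMap.mul k H)
    (TensorProduct.map₂ (LinearMap.mul k A) (TensorProduct.map₂ (LinearMap.mul k H).flip
      (LinearMap.mul k H))))).compl₂
    (TensorProduct.mk k H _ 1 ∘ₗ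
      (((TensorProduct.mk k H H).flip 1 ∘ₗ Q.Sinv).lTensor A).lTensor H)

/-- The bilinear map sending `a ⊗ b ⊗ v ⊗ c ⊗ d` and `x ⊗ u ⊗ y` to
`a ⊗ b S⁻¹(x) ⊗ u v ⊗ y c ⊗ d`. -/
def starRight : H ⊗[k] (H ⊗[k] (A ⊗[k] (H ⊗[k] H))) →ₗ[k] H ⊗[k] (A ⊗[k] H) →ₗ[k]
    H ⊗[k] (H ⊗[k] (A ⊗[k] (H ⊗[k] H))) :=
  (TensorProduct.map₂ (LinearMap.mul k H) (TensorProduct.map₂ (LinearMap.mul k H)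
    (TensorProduct.map₂ (LinearMap.mul k A).flip (TensorProduct.map₂ (LinearMap.mul k H).flip
      (LinearMap.mul k H))))).compl₂
    (TensorProduct.mk k H _ 1 ∘ₗ
      TensorProduct.map Q.Sinv (((TensorProduct.mk k H H).flip 1).lTensor A))

/-- `p_δ = Ψ² S⁻¹(Ψ¹ β) ⊗ Ψ³ ⊗ Ψ⁴ β S(Ψ⁵)`. -/
def pElt : H ⊗[k] (A ⊗[k] H) :=
  TensorProduct.map
    (mulMap LinearMap.id (Q.Sinv ∘ₗ LinearMap.mulRight k Q.β) ∘ₗ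
      (TensorProduct.comm k H H).toLinearMap)
    (Q.evβ.lTensor A)
    ((TensorProduct.assoc k H H (A ⊗[k] (H ⊗[k] H))).symm c.Ψ.val)

/-- `q_δ = S(Ψ̄¹) α Ψ̄² ⊗ Ψ̄³ ⊗ S⁻¹(α Ψ̄⁵) Ψ̄⁴`, where `Ψ⁻¹ = Ψ̄¹ ⊗ ⋯ ⊗ Ψ̄⁵`. -/
def qElt : H ⊗[k] (A ⊗[k] H) :=
  TensorProduct.map Q.evα
    ((mulMap (Q.Sinv ∘ₗ LinearMap.mulLeft k Q.α) LinearMap.id ∘ₗ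
      (TensorProduct.comm k H H).toLinearMap).lTensor A)
    ((TensorProduct.assoc k H H (A ⊗[k] (H ⊗[k] H))).symm (c.Ψ⁻¹).val)

variable {𝒜 : Type*} [NonAssocRing 𝒜] [Module k 𝒜] [SMulCommClass k 𝒜 𝒜] [IsScalarTower k 𝒜 𝒜]
  {Q} (M : BimoduleAlgebra Q.toQuasiBialgebra 𝒜)

/-- The bilinear map sending `a ⊗ b ⊗ v ⊗ c ⊗ d` and `(φ ⊗ φ') ⊗ u'` to
`(a · φ · d)(b · φ' · c) ⊗ v u'`. -/
def opLeft : H ⊗[k] (H ⊗[k] (A ⊗[k] (H ⊗[k] H))) →ₗ[k] (𝒜 ⊗[k] 𝒜) ⊗[k] A →ₗ[k] 𝒜 ⊗[k] A :=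
  ((TensorProduct.map₂ (TensorProduct.map₂ M.act M.act) (LinearMap.mul k A)).compr₂
      ((LinearMap.mul' k 𝒜).rTensor A)) ∘ₗ
    ((TensorProduct.comm k (H ⊗[k] H) (H ⊗[k] H)).toLinearMap).rTensor A ∘ₗ
      (TensorProduct.comm k A _).toLinearMap ∘ₗ unnest₅ H H A H H

/-- The bilinear map sending `a ⊗ b ⊗ v ⊗ c ⊗ d` and `u ⊗ (φ ⊗ φ')` to
`u v ⊗ (b · φ · c)(a · φ' · d)`. -/
def opRight : H ⊗[k] (H ⊗[k] (A ⊗[k] (H ⊗[k] H))) →ₗ[k] A ⊗[k] (𝒜 ⊗[k] 𝒜) →ₗ[k] A ⊗[k] 𝒜 :=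
  ((TensorProduct.map₂ (LinearMap.mul k A).flip (TensorProduct.map₂ M.act M.act)).compr₂
      ((LinearMap.mul' k 𝒜).lTensor A)) ∘ₗ unnest₅ H H A H H

/-- The left generalized diagonal crossed product `𝒜 ⋈_δ A`, with product
`(φ ⋈ u)(φ' ⋈ u') = (Ω¹ · φ · Ω⁵)(Ω² u₍₋₁₎ · φ' · S⁻¹(u₍₁₎) Ω⁴) ⋈ Ω³ u₍₀₎ u'`. -/
def leftCrossed : AlgebraData k (𝒜 ⊗[k] A) where
  mul := TensorProduct.curry
    (TensorProduct.lift (opLeft M ∘ₗ starLeft Q (Ω Q c) ∘ₗ c.δ.toLinearMap) ∘ₗ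
      (TensorProduct.leftComm k (𝒜 ⊗[k] 𝒜) A A).toLinearMap ∘ₗ
        (TensorProduct.tensorTensorTensorComm k 𝒜 A 𝒜 A).toLinearMap)
  one := 1 ⊗ₜ[k] 1

/-- The right generalized diagonal crossed product `A ⋈_δ 𝒜`, with product
`(u ⋈ φ)(u' ⋈ φ') = u u'₍₀₎ Ω'³ ⋈ (Ω'² S⁻¹(u'₍₋₁₎) · φ · u'₍₁₎ Ω'⁴)(Ω'¹ · φ' · Ω'⁵)`. -/
def rightCrossed : AlgebraData k (A ⊗[k] 𝒜) where
  mul := TensorProduct.curry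
    (TensorProduct.lift (opRight M ∘ₗ starRight Q (Ω' Q c) ∘ₗ c.δ.toLinearMap) ∘ₗ
      (TensorProduct.leftComm k A A (𝒜 ⊗[k] 𝒜)).toLinearMap ∘ₗ
        (TensorProduct.assoc k A A (𝒜 ⊗[k] 𝒜)).toLinearMap ∘ₗ
          (TensorProduct.tensorTensorTensorComm k A 𝒜 A 𝒜).toLinearMap)
  one := 1 ⊗ₜ[k] 1

/-- `a ⊗ v ⊗ b ↦ v ⊗ S⁻¹(a) · φ · b`. -/
def thetaTerm (φ : 𝒜) : H ⊗[k] (A ⊗[k] H) →ₗ[k] A ⊗[k] 𝒜 :=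
  ((M.act.flip φ ∘ₗ Q.Sinv.rTensor H).lTensor A) ∘ₗ
    (TensorProduct.leftComm k H A H).toLinearMap

/-- `a ⊗ v ⊗ b ↦ a · φ · S⁻¹(b) ⊗ v`. -/
def thetaInvTerm (φ : 𝒜) : H ⊗[k] (A ⊗[k] H) →ₗ[k] 𝒜 ⊗[k] A :=
  (TensorProduct.comm k A 𝒜).toLinearMap ∘ₗ
    ((M.act.flip φ ∘ₗ Q.Sinv.lTensor H).lTensor A) ∘ₗ
      (TensorProduct.leftComm k H A H).toLinearMap

theorem starLeft_tmul (a b x y d e : H) (v u : A) :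
    starLeft Q (a ⊗ₜ[k] (b ⊗ₜ[k] (v ⊗ₜ[k] (d ⊗ₜ[k] e)))) (x ⊗ₜ[k] (u ⊗ₜ[k] y)) =
      a ⊗ₜ ((b * x) ⊗ₜ ((v * u) ⊗ₜ ((Q.Sinv y * d) ⊗ₜ e))) := by
  simp [starLeft]

theorem starRight_tmul (a b x y d e : H) (v u : A) :
    starRight Q (a ⊗ₜ[k] (b ⊗ₜ[k] (v ⊗ₜ[k] (d ⊗ₜ[k] e)))) (x ⊗ₜ[k] (u ⊗ₜ[k] y)) =
      a ⊗ₜ ((b * Q.Sinv x) ⊗ₜ ((u * v) ⊗ₜ ((y * d) ⊗ₜ e))) := by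
  simp [starRight]

theorem opLeft_tmul (a b d e : H) (v u' : A) (φ φ' : 𝒜) :
    opLeft M (a ⊗ₜ[k] (b ⊗ₜ[k] (v ⊗ₜ[k] (d ⊗ₜ[k] e)))) ((φ ⊗ₜ[k] φ') ⊗ₜ[k] u') =
      (M.lact a (M.ract e φ) * M.lact b (M.ract d φ')) ⊗ₜ (v * u') := rfl

theorem opRight_tmul (a b d e : H) (v u : A) (φ φ' : 𝒜) :
    opRight M (a ⊗ₜ[k] (b ⊗ₜ[k] (v ⊗ₜ[k] (d ⊗ₜ[k] e)))) (u ⊗ₜ[k] (φ ⊗ₜ[k] φ')) =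
      (u * v) ⊗ₜ (M.lact b (M.ract d φ) * M.lact a (M.ract e φ')) := rfl

theorem leftCrossed_mul_tmul (φ φ' : 𝒜) (u u' : A) :
    (leftCrossed c M).mul (φ ⊗ₜ[k] u) (φ' ⊗ₜ[k] u') =
      opLeft M (starLeft Q (Ω Q c) (c.δ u)) ((φ ⊗ₜ[k] φ') ⊗ₜ[k] u') := rfl

theorem rightCrossed_mul_tmul (φ φ' : 𝒜) (u u' : A) :
    (rightCrossed c M).mul (u ⊗ₜ[k] φ) (u' ⊗ₜ[k] φ') =
      opRight M (starRight Q (Ω' Q c) (c.δ u')) (u ⊗ₜ[k] (φ ⊗ₜ[k] φ')) := rfl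

theorem thetaTerm_tmul (φ : 𝒜) (a b : H) (v : A) :
    thetaTerm M φ (a ⊗ₜ[k] (v ⊗ₜ[k] b)) = v ⊗ₜ M.lact (Q.Sinv a) (M.ract b φ) := rfl

theorem thetaInvTerm_tmul (φ : 𝒜) (a b : H) (v : A) :
    thetaInvTerm M φ (a ⊗ₜ[k] (v ⊗ₜ[k] b)) = M.lact a (M.ract (Q.Sinv b) φ) ⊗ₜ v := rfl

end CrossedProducts

end QuasiHopf

end

/-!
A *letter* is an algebra map `H →ₐ[k] R` (or `A →ₐ[k] R`), and letters with commuting ranges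
(`Comm`) can be combined to a map from a tensor product by `pair`. The identities between iterated
tensors in `H` and `A` are proved as identities between units `Q.P i j l`, `D.Ps i j n l m` of an
arbitrary algebra `R`, where the reassociators `Φ` and `Ψ` are placed at given letters. The axioms
become pentagons (`QuasiBialgebra.pentagon`) and hexagons (`TwoSidedCoaction.hexagon`), and
quasi-coassociativity becomes the statement that these units intertwine (`Intw`) letters, hence are
natural under conjugation. Contractions with `S`, `α` and `β` are linear maps `ζ` out of `R` which
replace a comultiplied pair of letters by the counit, on the right (`RRed`) or on the left (`LRed`);
under them, factors of a word become trivial by counit normalisation. Each identity thus splits into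
a computation in a group and a few reductions under `ζ`.

*The Drinfeld twist.* The data `(S, α, β)` exhibit a dual of the identity map of `H`, and such
duals are unique: two dual data for one algebra map `ρ : H → B` are related by a canonical
invertible element (`DualData.comparison`, `DualData.comparison_mul_comparison`). The map `Δ` has
two duals, the image of `(S, α, β)` under `Δ` and the tensor square of `(S, α, β)`, whose evaluation
and coevaluation are `γ` and `δ₀` (`zigΔ`, `zagΔ`). The twist `f` is their comparison
(`f_eq_comparison`), which yields `f f⁻¹ = 1`, `f Δ(S h) = (S ⊗ S)(Δ^cop h) f` and `f Δ(α) = γ`. An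
element intertwining `S` is determined by its product with `α`, and so `f` transforms `Φ` into its
image under the antipode (`f_cocycle`).

*Associativity.* By `f_cocycle`, twisting the multiplication of `𝒜` by `f` gives a product
`M.star` for which the right action through `S⁻¹` is an action of the same kind as the left one, and
which is associative up to `Φ` on the left and `Φ⁻¹` on the right (`star_star`). The product of
`𝒜 ⋈ A` is `M.star` after `Ψ⁻¹`, after the action of `A` through `δ` (`leftCrossed_mul`). Hence its
associativity is the hexagon for `Ψ`.

*The isomorphism `ϑ`.* The maps `ϑ` and `ϑ⁻¹` are mutually inverse because the contractions `p` of
`Ψ` and `q` of `Ψ⁻¹` are (`q_p_word`, `p_q_word`). For `ϑ⁻¹`, multiplicativity reduces, by left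
`A`-linearity and associativity of the left crossed product, to the products of the elements
`ϑ⁻¹(1 ⋈ φ)` (`leftCrossed_mul_lead_eq`). That case is an identity of words in nine letters
(`product_coherence`). The right crossed product is unital and associative by transport along `ϑ`.

*Bicomodule algebras.* Read in letters, `Ψ_l` and `Ψ_r` are words in `Φ_λ`, `Φ_ρ` and `Φ_{λ,ρ}`, and
`Φ_{λ,ρ}` twists one coaction into the other (`coactionR_Ps_mul_FLR`). The cocycle condition is
computed for `Ψ_l` (`hexagon_coactionL`) and transported to `Ψ_r`. The action of `Φ_{λ,ρ}` on
`𝒜 ⊗ A` is then an isomorphism between the two left crossed products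
(`twistEquiv_isAlgebraIso`), and the isomorphisms `ϑ` connect the remaining ones.
-/

noncomputable section

namespace QuasiHopf

/-! ### Letters: algebra maps with commuting ranges -/

section Letters

variable {k : Type*} [Field k]
  {X Y Z W V R : Type*} [Ring X] [Algebra k X] [Ring Y] [Algebra k Y] [Ring Z] [Algebra k Z]
  [Ring W] [Algebra k W] [Ring V] [Algebra k V] [Ring R] [Algebra k R]

/-- The ranges of the algebra maps `i` and `j` commute elementwise. -/
class Comm (i : X →ₐ[k] R) (j : Y →ₐ[k] R) : Prop where
  comm : ∀ x y, Commute (i x) (j y)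

/-- The algebra map `x ⊗ y ↦ i(x) j(y)` defined by two letters with commuting ranges. -/
def pair (i : X →ₐ[k] R) (j : Y →ₐ[k] R) [Comm i j] : X ⊗[k] Y →ₐ[k] R :=
  Algebra.TensorProduct.lift i j Comm.comm

@[simp]
theorem pair_tmul (i : X →ₐ[k] R) (j : Y →ₐ[k] R) [Comm i j] (x : X) (y : Y) :
    pair i j (x ⊗ₜ y) = i x * j y := by
  simp [pair]

instance Comm.comp_left (i : X →ₐ[k] R) (j : Y →ₐ[k] R) [Comm i j] (f : Z →ₐ[k] X) :
    Comm (i.comp f) j := ⟨fun x y => Comm.comm (f x) y⟩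

instance Comm.comp_right (i : X →ₐ[k] R) (j : Y →ₐ[k] R) [Comm i j] (f : Z →ₐ[k] Y) :
    Comm i (j.comp f) := ⟨fun x y => Comm.comm x (f y)⟩

instance Comm.pair_left (i : X →ₐ[k] R) (j : Y →ₐ[k] R) (l : Z →ₐ[k] R) [Comm i j] [Comm i l]
    [Comm j l] : Comm (pair i j) l := ⟨fun t z => by
  induction t with
  | zero => simp
  | tmul x y => simpa using (Comm.comm (i := i) (j := l) x z).mul_left (Comm.comm y z)
  | add a b ha hb => simpa using ha.add_left hb⟩

instance Comm.pair_right (i : X →ₐ[k] R) (j : Y →ₐ[k] R) (l : Z →ₐ[k] R) [Comm i j] [Comm l i]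
    [Comm l j] : Comm l (pair i j) := ⟨fun z t => by
  induction t with
  | zero => simp
  | tmul x y => simpa using (Comm.comm (i := l) (j := i) z x).mul_right (Comm.comm z y)
  | add a b ha hb => simpa using ha.add_right hb⟩

instance Comm.postcomp (f : R →ₐ[k] V) (i : X →ₐ[k] R) (j : Y →ₐ[k] R) [Comm i j] :
    Comm (f.comp i) (f.comp j) := ⟨fun x y => (Comm.comm (i := i) (j := j) x y).map f⟩

instance Comm.inl_inr : Comm (Algebra.TensorProduct.includeLeft : X →ₐ[k] X ⊗[k] Y)
    (Algebra.TensorProduct.includeRight : Y →ₐ[k] X ⊗[k] Y) :=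
  ⟨fun _ _ => by simp [Commute, SemiconjBy]⟩

instance (priority := 10) Comm.symm (i : X →ₐ[k] R) (j : Y →ₐ[k] R) [h : Comm j i] : Comm i j :=
  ⟨fun x y => (h.comm y x).symm⟩

@[simp]
theorem pair_tail (i : W →ₐ[k] R) (j : Y →ₐ[k] R) [Comm i j] (f : X →ₐ[k] Y) (t : W ⊗[k] X) :
    pair i j (tail W f t) = pair i (j.comp f) t := by
  induction t with
  | zero => simp
  | tmul x y => simp
  | add a b ha hb => simp only [map_add, ha, hb]

@[simp]
theorem pair_map_id (i : W →ₐ[k] R) (j : Y →ₐ[k] R) [Comm i j] (f : X →ₐ[k] Y) (t : W ⊗[k] X) :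
    pair i j (Algebra.TensorProduct.map (AlgHom.id k W) f t) = pair i (j.comp f) t :=
  pair_tail i j f t

@[simp]
theorem pair_padLeft (i : X →ₐ[k] R) (j : Y →ₐ[k] R) [Comm i j] (y : Y) :
    pair i j (Algebra.TensorProduct.includeRight y) = j y := by
  simp [Algebra.TensorProduct.includeRight_apply]

@[simp]
theorem pair_includeLeft (i : X →ₐ[k] R) (j : Y →ₐ[k] R) [Comm i j] (x : X) :
    pair i j ((Algebra.TensorProduct.includeLeft : X →ₐ[k] X ⊗[k] Y) x) = i x := by
  simp [Algebra.TensorProduct.includeLeft_apply]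

theorem pair_assoc (i : X →ₐ[k] R) (j : Y →ₐ[k] R) (l : Z →ₐ[k] R) [Comm i j] [Comm i l]
    [Comm j l] (t : (X ⊗[k] Y) ⊗[k] Z) :
    pair i (pair j l) (Algebra.TensorProduct.assoc k k k X Y Z t) = pair (pair i j) l t := by
  induction t with
  | zero => simp
  | tmul x z =>
    induction x with
    | zero => simp
    | tmul x y => simp [mul_assoc]
    | add a b ha hb => simp only [TensorProduct.add_tmul, map_add, ha, hb]
  | add a b ha hb => simp only [map_add, ha, hb]

@[simp]
theorem pair_splitHead (i : X →ₐ[k] R) (j : Y →ₐ[k] R) (l : Z →ₐ[k] R) [Comm i j] [Comm i l]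
    [Comm j l] (f : W →ₐ[k] X ⊗[k] Y) (t : W ⊗[k] Z) :
    pair i (pair j l) (splitHead f Z t) = pair ((pair i j).comp f) l t := by
  induction t with
  | zero => simp
  | tmul x z =>
    have := pair_assoc i j l (f x ⊗ₜ z)
    simpa [splitHead] using this
  | add a b ha hb => simp only [map_add, ha, hb]

theorem pair_join₃ (i : X →ₐ[k] R) (j : Y →ₐ[k] R) (l : Z →ₐ[k] R) (m : W →ₐ[k] R) [Comm i j]
    [Comm i l] [Comm i m] [Comm j l] [Comm j m] [Comm l m] (t : (X ⊗[k] (Y ⊗[k] Z)) ⊗[k] W) :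
    pair i (pair j (pair l m)) (join₃ X Y Z W t) = pair (pair i (pair j l)) m t := by
  simp only [join₃, AlgHom.comp_apply, pair_tail]
  have : (pair j (pair l m)).comp (Algebra.TensorProduct.assoc k k k Y Z W).toAlgHom =
      pair (pair j l) m := AlgHom.ext fun t => pair_assoc j l m t
  simp only [this]
  exact pair_assoc i (pair j l) m t

@[simp]
theorem pair_padRight (i : X →ₐ[k] R) (j : Y →ₐ[k] R) (l : Z →ₐ[k] R) (m : W →ₐ[k] R) [Comm i j]
    [Comm i l] [Comm i m] [Comm j l] [Comm j m] [Comm l m] (t : X ⊗[k] (Y ⊗[k] Z)) :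
    pair i (pair j (pair l m)) (padRight W t) = pair i (pair j l) t := by
  simp only [padRight, AlgHom.comp_apply, pair_join₃, pair_includeLeft]

@[simp]
theorem pair_splitHead₃ (i : X →ₐ[k] R) (j : Y →ₐ[k] R) (l : Z →ₐ[k] R) (m : W →ₐ[k] R)
    [Comm i j] [Comm i l] [Comm i m] [Comm j l] [Comm j m] [Comm l m]
    (f : V →ₐ[k] X ⊗[k] (Y ⊗[k] Z)) (t : V ⊗[k] W) :
    pair i (pair j (pair l m)) (splitHead₃ f W t) = pair ((pair i (pair j l)).comp f) m t := by
  simp only [splitHead₃, AlgHom.comp_apply, pair_join₃]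
  induction t with
  | zero => simp
  | tmul x z => simp
  | add a b ha hb => simp only [map_add, ha, hb]

@[simp]
theorem pair_comp_tail (i : W →ₐ[k] R) (j : Y →ₐ[k] R) [Comm i j] (f : X →ₐ[k] Y) :
    (pair i j).comp (tail W f) = pair i (j.comp f) := AlgHom.ext fun t => pair_tail i j f t

@[simp]
theorem pair_comp_padLeft (i : X →ₐ[k] R) (j : Y →ₐ[k] R) [Comm i j] :
    (pair i j).comp (Algebra.TensorProduct.includeRight) = j := AlgHom.ext fun t => by simp

@[simp]
theorem pair_comp_includeLeft (i : X →ₐ[k] R) (j : Y →ₐ[k] R) [Comm i j] :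
    (pair i j).comp (Algebra.TensorProduct.includeLeft) = i := AlgHom.ext fun t => by simp

@[simp]
theorem pair_comp_splitHead (i : X →ₐ[k] R) (j : Y →ₐ[k] R) (l : Z →ₐ[k] R) [Comm i j] [Comm i l]
    [Comm j l] (f : W →ₐ[k] X ⊗[k] Y) :
    (pair i (pair j l)).comp (splitHead f Z) = pair ((pair i j).comp f) l :=
  AlgHom.ext fun t => by simp

@[simp]
theorem pair_comp_splitHead₃ (i : X →ₐ[k] R) (j : Y →ₐ[k] R) (l : Z →ₐ[k] R) (m : W →ₐ[k] R)
    [Comm i j] [Comm i l] [Comm i m] [Comm j l] [Comm j m] [Comm l m]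
    (f : V →ₐ[k] X ⊗[k] (Y ⊗[k] Z)) :
    (pair i (pair j (pair l m))).comp (splitHead₃ f W) = pair ((pair i (pair j l)).comp f) m :=
  AlgHom.ext fun t => by simp

theorem comp_pair (f : R →ₐ[k] V) (i : X →ₐ[k] R) (j : Y →ₐ[k] R) [Comm i j] :
    f.comp (pair i j) = pair (f.comp i) (f.comp j) :=
  Algebra.TensorProduct.ext' fun x y => by simp

theorem apply_pair (f : R →ₐ[k] V) (i : X →ₐ[k] R) (j : Y →ₐ[k] R) [Comm i j] (t : X ⊗[k] Y) :
    f (pair i j t) = pair (f.comp i) (f.comp j) t := by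
  rw [← comp_pair]; rfl

theorem pair_inl_inr :
    pair (Algebra.TensorProduct.includeLeft : X →ₐ[k] X ⊗[k] Y)
      Algebra.TensorProduct.includeRight = AlgHom.id k _ :=
  Algebra.TensorProduct.ext' fun x y => by simp

/-- The letter `x ↦ ε(x) 1` with values in the scalars of `R`. -/
def scalarLetter (R : Type*) [Ring R] [Algebra k R] (ε : X →ₐ[k] k) : X →ₐ[k] R :=
  (Algebra.ofId k R).comp ε

@[simp]
theorem scalarLetter_apply (ε : X →ₐ[k] k) (x : X) :
    scalarLetter R ε x = algebraMap k R (ε x) := rfl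

instance Comm.scalar_left (ε : X →ₐ[k] k) (j : Y →ₐ[k] R) : Comm (scalarLetter R ε) j :=
  ⟨fun _ _ => Algebra.commutes _ _⟩

instance Comm.scalar_right (ε : X →ₐ[k] k) (j : Y →ₐ[k] R) : Comm j (scalarLetter R ε) :=
  ⟨fun _ _ => (Algebra.commutes _ _).symm⟩

theorem comp_scalarLetter (f : R →ₐ[k] V) (ε : X →ₐ[k] k) :
    f.comp (scalarLetter R ε) = scalarLetter V ε := AlgHom.ext fun x => by simp

@[simp]
theorem pair_scalar_left (ε : X →ₐ[k] k) (j : Y →ₐ[k] R) :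
    pair (scalarLetter R ε) j = j.comp (counitHead ε Y) :=
  Algebra.TensorProduct.ext' fun x y => by simp [counitHead, Algebra.smul_def]

@[simp]
theorem pair_scalar_right (ε : X →ₐ[k] k) (j : Y →ₐ[k] R) :
    pair j (scalarLetter R ε) = j.comp (counitTail ε Y) :=
  Algebra.TensorProduct.ext' fun x y => by
    simp [counitTail, Algebra.smul_def, Algebra.commutes]

/-- The unit `F(U)` of `R`. -/
def ap (F : X →ₐ[k] R) : Xˣ →* Rˣ := Units.map (F : X →* R)

theorem ap_val (F : X →ₐ[k] R) (U : Xˣ) : ((ap F U : Rˣ) : R) = F U := rfl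

theorem ap_inv_val (F : X →ₐ[k] R) (U : Xˣ) : (((ap F U)⁻¹ : Rˣ) : R) = F (U⁻¹).val := by
  rw [← map_inv, ap_val]

theorem ap_comp (F : Y →ₐ[k] R) (G : X →ₐ[k] Y) (U : Xˣ) : ap (F.comp G) U = ap F (ap G U) := rfl

/-- The unit `u` intertwines the letters `F` and `F'`: `u F(x) = F'(x) u`. -/
class Intw (u : Rˣ) (F F' : X →ₐ[k] R) : Prop where
  intw : ∀ x, (u : R) * F x = F' x * u

theorem Intw.ap {u : Rˣ} {F F' : X →ₐ[k] R} [h : Intw u F F'] (U : Xˣ) :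
    u * QuasiHopf.ap F U = QuasiHopf.ap F' U * u := Units.ext (h.intw _)

instance (priority := 900) Intw.comp (u : Rˣ) (F F' : X →ₐ[k] R) [h : Intw u F F']
    (f : Y →ₐ[k] X) : Intw u (F.comp f) (F'.comp f) := ⟨fun _ => h.intw _⟩

instance Intw.pair (u : Rˣ) (i i' : X →ₐ[k] R) (j j' : Y →ₐ[k] R) [Comm i j] [Comm i' j']
    [h : Intw u i i'] [h' : Intw u j j'] : Intw u (pair i j) (pair i' j') := ⟨fun t => by
  induction t with
  | zero => simp
  | tmul x y => rw [pair_tmul, pair_tmul, ← mul_assoc, h.intw, mul_assoc, h'.intw, mul_assoc]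
  | add a b ha hb => rw [map_add, map_add, mul_add, add_mul, ha, hb]⟩

instance Intw.of_comm (F : X →ₐ[k] R) (U : Xˣ) (j : Y →ₐ[k] R) [h : Comm F j] :
    Intw (QuasiHopf.ap F U) j j := ⟨fun y => h.comm _ y⟩

instance (priority := 800) Intw.inv (u : Rˣ) (F F' : X →ₐ[k] R) [h : Intw u F F'] :
    Intw u⁻¹ F' F := ⟨fun _ => by
  rw [Units.inv_mul_eq_iff_eq_mul, ← mul_assoc, h.intw, mul_assoc, Units.mul_inv, mul_one]⟩

theorem Intw.mul {u v : Rˣ} {F F' F'' : X →ₐ[k] R} (h : Intw u F' F'') (h' : Intw v F F') :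
    Intw (u * v) F F'' := ⟨fun _ => by
  rw [Units.val_mul, mul_assoc, h'.intw, ← mul_assoc, h.intw, mul_assoc]⟩

instance Intw.mul_self (u v : Rˣ) (F : X →ₐ[k] R) [h : Intw u F F] [h' : Intw v F F] :
    Intw (u * v) F F := h.mul h'

/-! ### Reductions under a linear functional -/

variable {E : Type*} [AddCommGroup E] [Module k E]

/-- The linear map `ζ` does not distinguish `t F(x)` from `t F'(x)`. -/
class RRed (ζ : R →ₗ[k] E) (F F' : X →ₐ[k] R) : Prop where
  red : ∀ t x, ζ (t * F x) = ζ (t * F' x)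

/-- The linear map `ζ` does not distinguish `F(x) t` from `F'(x) t`. -/
class LRed (ζ : R →ₗ[k] E) (F F' : X →ₐ[k] R) : Prop where
  red : ∀ t x, ζ (F x * t) = ζ (F' x * t)

instance (priority := 1100) RRed.rfl' (ζ : R →ₗ[k] E) (F : X →ₐ[k] R) : RRed ζ F F :=
  ⟨fun _ _ => rfl⟩

instance (priority := 1100) LRed.rfl' (ζ : R →ₗ[k] E) (F : X →ₐ[k] R) : LRed ζ F F :=
  ⟨fun _ _ => rfl⟩

instance (priority := 900) RRed.comp (ζ : R →ₗ[k] E) (F F' : X →ₐ[k] R) [h : RRed ζ F F']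
    (f : Y →ₐ[k] X) : RRed ζ (F.comp f) (F'.comp f) := ⟨fun _ _ => h.red _ _⟩

instance (priority := 900) LRed.comp (ζ : R →ₗ[k] E) (F F' : X →ₐ[k] R) [h : LRed ζ F F']
    (f : Y →ₐ[k] X) : LRed ζ (F.comp f) (F'.comp f) := ⟨fun _ _ => h.red _ _⟩

instance RRed.pair (ζ : R →ₗ[k] E) (i i' : X →ₐ[k] R) (j j' : Y →ₐ[k] R) [Comm i j] [Comm i' j']
    [hc : Comm i j'] [h : RRed ζ i i'] [h' : RRed ζ j j'] : RRed ζ (pair i j) (pair i' j') :=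
  ⟨fun t x => by
    induction x with
    | zero => simp
    | tmul x y =>
      rw [pair_tmul, pair_tmul, ← mul_assoc, h'.red, mul_assoc, (hc.comm x y).eq, ← mul_assoc,
        h.red, mul_assoc, (Comm.comm (i := i') (j := j') x y).eq]
    | add a b ha hb => simp only [map_add, mul_add, ha, hb]⟩

instance LRed.pair (ζ : R →ₗ[k] E) (i i' : X →ₐ[k] R) (j j' : Y →ₐ[k] R) [Comm i j] [Comm i' j']
    [hc : Comm i' j] [h : LRed ζ i i'] [h' : LRed ζ j j'] : LRed ζ (pair i j) (pair i' j') :=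
  ⟨fun t x => by
    induction x with
    | zero => simp
    | tmul x y =>
      rw [pair_tmul, pair_tmul, mul_assoc, h.red, ← mul_assoc, (hc.comm x y).eq, mul_assoc,
        h'.red, ← mul_assoc, (Comm.comm (i := i') (j := j') x y).eq]
    | add a b ha hb => simp only [map_add, add_mul, ha, hb]⟩

theorem RRed.ap {ζ : R →ₗ[k] E} {F F' : X →ₐ[k] R} [h : RRed ζ F F'] (t : Rˣ) (U : Xˣ) :
    ζ (t * QuasiHopf.ap F U : Rˣ) = ζ (t * QuasiHopf.ap F' U : Rˣ) := h.red _ _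

theorem LRed.ap {ζ : R →ₗ[k] E} {F F' : X →ₐ[k] R} [h : LRed ζ F F'] (t : Rˣ) (U : Xˣ) :
    ζ (QuasiHopf.ap F U * t : Rˣ) = ζ (QuasiHopf.ap F' U * t : Rˣ) := h.red _ _

/-- `t ↦ ζ(t u)` inherits right reductions between letters with which `u` commutes. -/
theorem RRed.mulRight {ζ : R →ₗ[k] E} {F F' : X →ₐ[k] R} [h : RRed ζ F F'] (u : Rˣ)
    [hu : Intw u F F] [hu' : Intw u F' F'] :
    RRed (ζ ∘ₗ LinearMap.mulRight k (u : R)) F F' := ⟨fun _ _ => by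
  simp only [LinearMap.comp_apply, LinearMap.mulRight_apply]
  rw [mul_assoc, ← hu.intw, ← mul_assoc, h.red, mul_assoc, hu'.intw, mul_assoc]⟩

/-- `t ↦ ζ(u t)` inherits left reductions between letters with which `u` commutes. -/
theorem LRed.mulLeft {ζ : R →ₗ[k] E} {F F' : X →ₐ[k] R} [h : LRed ζ F F'] (u : Rˣ)
    [hu : Intw u F F] [hu' : Intw u F' F'] :
    LRed (ζ ∘ₗ LinearMap.mulLeft k (u : R)) F F' := ⟨fun _ _ => by
  simp only [LinearMap.comp_apply, LinearMap.mulLeft_apply]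
  rw [← mul_assoc, hu.intw, mul_assoc, h.red, ← mul_assoc, ← hu'.intw, mul_assoc]⟩

end Letters

/-! ### Reassociators in letters -/

namespace QuasiBialgebra

variable {k H : Type*} [Field k] [Ring H] [Algebra k H] (Q : QuasiBialgebra k H)
  {R : Type*} [Ring R] [Algebra k R]

/-- The letter `h ↦ i(h₁) j(h₂)`. -/
abbrev cv (i j : H →ₐ[k] R) [Comm i j] : H →ₐ[k] R := (pair i j).comp Q.Δ

/-- The unit letter `h ↦ ε(h) 1`. -/
abbrev e (R : Type*) [Ring R] [Algebra k R] : H →ₐ[k] R := scalarLetter R Q.ε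

/-- The reassociator on three letters, as a unit: `i(X¹) j(X²) l(X³)`. -/
abbrev P (i j l : H →ₐ[k] R) [Comm i j] [Comm i l] [Comm j l] : Rˣ := ap (pair i (pair j l)) Q.Φ

/-- The cocycle condition on `Φ`, read in four letters. -/
theorem pentagon (i j l m : H →ₐ[k] R) [Comm i j] [Comm i l] [Comm i m] [Comm j l] [Comm j m]
    [Comm l m] :
    Q.P j l m * Q.P i (Q.cv j l) m * Q.P i j l = Q.P i j (Q.cv l m) * Q.P (Q.cv i j) l m := by
  have := congrArg (pair i (pair j (pair l m))) Q.cocycle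
  simp only [map_mul, pair_padLeft, pair_tail, pair_comp_splitHead, pair_padRight,
    pair_comp_tail, pair_splitHead] at this
  exact Units.ext this

section Pentagons

variable (i j l m : H →ₐ[k] R) [Comm i j] [Comm i l] [Comm i m] [Comm j l] [Comm j m] [Comm l m]

theorem pentagon_outer_right : Q.P i j (Q.cv l m) =
    Q.P j l m * Q.P i (Q.cv j l) m * Q.P i j l * (Q.P (Q.cv i j) l m)⁻¹ :=
  eq_mul_inv_of_mul_eq (Q.pentagon i j l m).symm

theorem pentagon_outer_left : Q.P (Q.cv i j) l m =
    (Q.P i j (Q.cv l m))⁻¹ * Q.P j l m * Q.P i (Q.cv j l) m * Q.P i j l := by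
  rw [mul_assoc, mul_assoc, eq_inv_mul_iff_mul_eq, ← mul_assoc]; exact (Q.pentagon i j l m).symm

theorem pentagon_middle : Q.P i (Q.cv j l) m =
    (Q.P j l m)⁻¹ * Q.P i j (Q.cv l m) * Q.P (Q.cv i j) l m * (Q.P i j l)⁻¹ := by
  rw [mul_assoc (Q.P j l m)⁻¹, ← Q.pentagon]; group

theorem pentagon_left : Q.P i j l =
    (Q.P i (Q.cv j l) m)⁻¹ * (Q.P j l m)⁻¹ * Q.P i j (Q.cv l m) * Q.P (Q.cv i j) l m := by
  rw [mul_assoc _ (Q.P i j (Q.cv l m)), ← Q.pentagon]; group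

end Pentagons

/-- Quasi-coassociativity, read in three letters. -/
instance intw_P (i j l : H →ₐ[k] R) [Comm i j] [Comm i l] [Comm j l] :
    Intw (Q.P i j l) (Q.cv (Q.cv i j) l) (Q.cv i (Q.cv j l)) := ⟨fun h => by
  have := congrArg (pair i (pair j l)) (Q.coassoc h)
  simp only [map_mul, pair_tail, pair_splitHead] at this
  simp only [AlgHom.comp_apply, ap_val, this]
  rw [mul_assoc, mul_assoc, ← map_mul, Units.inv_mul, map_one, mul_one]⟩

@[simp]
theorem cv_e_left (j : H →ₐ[k] R) : Q.cv (Q.e R) j = j :=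
  AlgHom.ext fun h => by simp [Q.counit_left]

@[simp]
theorem cv_e_right (j : H →ₐ[k] R) : Q.cv j (Q.e R) = j :=
  AlgHom.ext fun h => by simp [Q.counit_right]

@[simp]
theorem P_mid (i j : H →ₐ[k] R) [Comm i j] : Q.P i (Q.e R) j = 1 := Units.ext <| by
  have := congrArg (pair i j) Q.counit_mid
  simpa [ap_val] using this

/-- The outer normalisations of `Φ` follow from the middle one and the pentagon: with two counits
inserted, all but one of the factors cancel. -/
@[simp]
theorem P_left (i j : H →ₐ[k] R) [Comm i j] : Q.P (Q.e R) i j = 1 := by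
  have := Q.pentagon (Q.e R) (Q.e R) i j
  simpa only [cv_e_left, P_mid, mul_one, one_mul, mul_eq_right] using this

@[simp]
theorem P_right (i j : H →ₐ[k] R) [Comm i j] : Q.P i j (Q.e R) = 1 := by
  have := Q.pentagon i j (Q.e R) (Q.e R)
  simpa only [cv_e_left, cv_e_right, P_mid, mul_one, one_mul, mul_eq_left] using this

theorem comp_cv {V : Type*} [Ring V] [Algebra k V] (f : R →ₐ[k] V) (i j : H →ₐ[k] R) [Comm i j] :
    f.comp (Q.cv i j) = Q.cv (f.comp i) (f.comp j) := by
  rw [cv, ← AlgHom.comp_assoc, comp_pair]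

theorem comp_e {V : Type*} [Ring V] [Algebra k V] (f : R →ₐ[k] V) :
    f.comp (Q.e R) = Q.e V := comp_scalarLetter f Q.ε

theorem P_nat (u : Rˣ) {i j l i' j' l' : H →ₐ[k] R} [Comm i j] [Comm i l] [Comm j l] [Comm i' j']
    [Comm i' l'] [Comm j' l'] [Intw u i i'] [Intw u j j'] [Intw u l l'] :
    u * Q.P i j l = Q.P i' j' l' * u := Intw.ap _

theorem P_conj (u : Rˣ) {i j l i' j' l' : H →ₐ[k] R} [Comm i j] [Comm i l] [Comm j l] [Comm i' j']
    [Comm i' l'] [Comm j' l'] [Intw u i i'] [Intw u j j'] [Intw u l l'] :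
    Q.P i j l = u⁻¹ * Q.P i' j' l' * u := by
  rw [mul_assoc, ← Q.P_nat u (i := i) (j := j) (l := l), inv_mul_cancel_left]

theorem P_conj' (u : Rˣ) {i j l i' j' l' : H →ₐ[k] R} [Comm i j] [Comm i l] [Comm j l] [Comm i' j']
    [Comm i' l'] [Comm j' l'] [Intw u i i'] [Intw u j j'] [Intw u l l'] :
    Q.P i' j' l' = u * Q.P i j l * u⁻¹ := by
  rw [Q.P_nat u (i' := i') (j' := j') (l' := l'), mul_inv_cancel_right]

section Reductions

variable {E : Type*} [AddCommGroup E] [Module k E] {ζ : R →ₗ[k] E} (i j l i' j' l' : H →ₐ[k] R)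
  [Comm i j] [Comm i l] [Comm j l] [Comm i' j'] [Comm i' l'] [Comm j' l'] (t : Rˣ)

instance rred_cv_right [h : RRed ζ j (Q.e R)] : RRed ζ (Q.cv i j) i := by
  have : RRed ζ (Q.cv i j) (Q.cv i (Q.e R)) := inferInstance
  rwa [Q.cv_e_right] at this

instance rred_cv_left [h : RRed ζ i (Q.e R)] : RRed ζ (Q.cv i j) j := by
  have : RRed ζ (Q.cv i j) (Q.cv (Q.e R) j) := inferInstance
  rwa [Q.cv_e_left] at this

instance lred_cv_right [h : LRed ζ j (Q.e R)] : LRed ζ (Q.cv i j) i := by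
  have : LRed ζ (Q.cv i j) (Q.cv i (Q.e R)) := inferInstance
  rwa [Q.cv_e_right] at this

instance lred_cv_left [h : LRed ζ i (Q.e R)] : LRed ζ (Q.cv i j) j := by
  have : LRed ζ (Q.cv i j) (Q.cv (Q.e R) j) := inferInstance
  rwa [Q.cv_e_left] at this

theorem P_rred [Comm j l'] [Comm i (pair j' l')] [RRed ζ i i'] [RRed ζ j j'] [RRed ζ l l'] :
    ζ (t * Q.P i j l : Rˣ) = ζ (t * Q.P i' j' l' : Rˣ) := RRed.ap _ _

theorem P_inv_rred [Comm j l'] [Comm i (pair j' l')] [RRed ζ i i'] [RRed ζ j j'] [RRed ζ l l'] :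
    ζ (t * (Q.P i j l)⁻¹ : Rˣ) = ζ (t * (Q.P i' j' l')⁻¹ : Rˣ) := by
  rw [← map_inv, ← map_inv]; exact RRed.ap _ _

theorem P_lred [Comm j' l] [Comm i' (pair j l)] [LRed ζ i i'] [LRed ζ j j'] [LRed ζ l l'] :
    ζ (Q.P i j l * t : Rˣ) = ζ (Q.P i' j' l' * t : Rˣ) := LRed.ap _ _

theorem P_inv_lred [Comm j' l] [Comm i' (pair j l)] [LRed ζ i i'] [LRed ζ j j'] [LRed ζ l l'] :
    ζ ((Q.P i j l)⁻¹ * t : Rˣ) = ζ ((Q.P i' j' l')⁻¹ * t : Rˣ) := by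
  rw [← map_inv, ← map_inv]; exact LRed.ap _ _

end Reductions

end QuasiBialgebra

/-! ### Uniqueness of duals -/

section Duals

variable {k H : Type*} [Field k] [Ring H] [Algebra k H] {Q : QuasiBialgebra k H}
  {B : Type*} [Ring B] [Algebra k B]

/-- Dual data over an algebra map `ρ : H → B`: an anti-multiplicative map `S : H → B` with elements
`α` and `β` of `B` satisfying the antipode axioms relative to `ρ`. -/
structure DualData (Q : QuasiBialgebra k H) (ρ : H →ₐ[k] B) where
  S : H →ₗ[k] B
  α : B
  β : B
  S_one : S 1 = 1
  S_mul : ∀ x y, S (x * y) = S y * S x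
  ev_alpha : ∀ h, mulMap (LinearMap.mulRight k α ∘ₗ S) ρ.toLinearMap (Q.Δ h) = Q.ε h • α
  ev_beta : ∀ h, mulMap (LinearMap.mulRight k β ∘ₗ ρ.toLinearMap) S (Q.Δ h) = Q.ε h • β
  zig : mulMap (LinearMap.mulRight k β ∘ₗ ρ.toLinearMap)
    (mulMap (LinearMap.mulRight k α ∘ₗ S) ρ.toLinearMap) Q.Φ.val = 1
  zag : mulMap (LinearMap.mulRight k α ∘ₗ S)
    (mulMap (LinearMap.mulRight k β ∘ₗ ρ.toLinearMap) S) (Q.Φ⁻¹).val = 1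

/-- The letter `x ↦ x ⊗ 1`. -/
abbrev inl {k X Y : Type*} [Field k] [Ring X] [Algebra k X] [Ring Y] [Algebra k Y] :
    X →ₐ[k] X ⊗[k] Y := Algebra.TensorProduct.includeLeft

/-- The letter `y ↦ 1 ⊗ y`. -/
abbrev inr {k X Y : Type*} [Field k] [Ring X] [Algebra k X] [Ring Y] [Algebra k Y] :
    Y →ₐ[k] X ⊗[k] Y := Algebra.TensorProduct.includeRight

variable {X Y Z : Type*} [Ring X] [Algebra k X] [Ring Y] [Algebra k Y] [Ring Z] [Algebra k Z]

theorem LRed.mulMap_inr (f : X →ₗ[k] B) (ζ : Y →ₗ[k] B) (F F' : Z →ₐ[k] Y) [h : LRed ζ F F'] :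
    LRed (mulMap f ζ) ((inr : Y →ₐ[k] X ⊗[k] Y).comp F) (inr.comp F') := ⟨fun t x => by
  induction t with
  | zero => simp
  | tmul a b => simp [mulMap_tmul, h.red]
  | add a b ha hb => simp only [mul_add, map_add, ha, hb]⟩

theorem RRed.mulMap_inr (f : X →ₗ[k] B) (ζ : Y →ₗ[k] B) (F F' : Z →ₐ[k] Y) [h : RRed ζ F F'] :
    RRed (mulMap f ζ) ((inr : Y →ₐ[k] X ⊗[k] Y).comp F) (inr.comp F') := ⟨fun t x => by
  induction t with
  | zero => simp
  | tmul a b => simp [mulMap_tmul, h.red]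
  | add a b ha hb => simp only [add_mul, map_add, ha, hb]⟩

namespace DualData

variable {ρ : H →ₐ[k] B} (D : DualData Q ρ)

/-- `x ⊗ t ↦ S(x) α g(t)`. -/
def capMap (g : Y →ₗ[k] B) : H ⊗[k] Y →ₗ[k] B := mulMap (LinearMap.mulRight k D.α ∘ₗ D.S) g

/-- `x ⊗ t ↦ ρ(x) β g(t)`. -/
def cupMap (g : Y →ₗ[k] B) : H ⊗[k] Y →ₗ[k] B :=
  mulMap (LinearMap.mulRight k D.β ∘ₗ ρ.toLinearMap) g

theorem capMap_tmul (g : Y →ₗ[k] B) (x : H) (t : Y) :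
    D.capMap g (x ⊗ₜ t) = D.S x * D.α * g t := rfl

theorem cupMap_tmul (g : Y →ₗ[k] B) (x : H) (t : Y) :
    D.cupMap g (x ⊗ₜ t) = ρ x * D.β * g t := rfl

theorem LRed_capMap (g : Y →ₗ[k] B) (y : H →ₐ[k] Y) (hg : ∀ h t, g (y h * t) = ρ h * g t) :
    LRed (D.capMap g) (Q.cv inl (inr.comp y)) (Q.e _) := ⟨fun t h => by
  induction t with
  | zero => simp
  | tmul a b =>
    have key : ∀ z : H ⊗[k] H, D.capMap g (pair inl (inr.comp y) z * (a ⊗ₜ b)) =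
        D.S a * D.capMap ρ.toLinearMap z * g b := by
      intro z
      induction z with
      | zero => simp
      | tmul c d => simp [capMap_tmul, hg, D.S_mul, mul_assoc]
      | add c d hc hd => simp only [add_mul, mul_add, map_add, hc, hd]
    rw [AlgHom.comp_apply, key, capMap, ev_alpha]
    simp [capMap_tmul, Algebra.algebraMap_eq_smul_one, TensorProduct.smul_tmul']
  | add a b ha hb => simp only [mul_add, map_add, ha, hb]⟩

theorem RRed_cupMap (g : Y →ₗ[k] B) (y : H →ₐ[k] Y) (hg : ∀ h t, g (t * y h) = D.S h * g t) :
    RRed (D.cupMap g) (Q.cv inl (inr.comp y)) (Q.e _) := ⟨fun t h => by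
  induction t with
  | zero => simp
  | tmul a b =>
    have key : ∀ z : H ⊗[k] H, D.cupMap g ((a ⊗ₜ b) * pair inl (inr.comp y) z) =
        ρ a * D.cupMap D.S z * g b := by
      intro z
      induction z with
      | zero => simp
      | tmul c d => simp [cupMap_tmul, hg, mul_assoc]
      | add c d hc hd => simp only [add_mul, mul_add, map_add, hc, hd]
    rw [AlgHom.comp_apply, key, cupMap, ev_beta]
    simp [cupMap_tmul, Algebra.algebraMap_eq_smul_one, TensorProduct.smul_tmul']
  | add a b ha hb => simp only [add_mul, map_add, ha, hb]⟩

variable (D' : DualData Q ρ)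

/-- The comparison element `S'(x¹) α' ρ(x²) β S(x³)` from the dual data `D` to `D'`. -/
def comparison : B := D'.capMap (D.cupMap D.S) (Q.Φ⁻¹).val

end DualData
end Duals

/-- Induction principle for additive predicates on a triple tensor product. -/
theorem tensor_induction₃ {k X Y Z : Type*} [Field k] [Ring X] [Algebra k X] [Ring Y] [Algebra k Y]
    [Ring Z] [Algebra k Z] {p : X ⊗[k] (Y ⊗[k] Z) → Prop} (t : X ⊗[k] (Y ⊗[k] Z))
    (zero : p 0) (tmul : ∀ x y z, p (x ⊗ₜ (y ⊗ₜ z))) (add : ∀ a b, p a → p b → p (a + b)) : p t := by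
  induction t with
  | zero => exact zero
  | tmul x t =>
    induction t with
    | zero => simpa using zero
    | tmul y z => exact tmul x y z
    | add a b ha hb => rw [TensorProduct.tmul_add]; exact add _ _ ha hb
  | add a b ha hb => exact add _ _ ha hb

section Pentagon
variable {k H : Type*} [Field k] [Ring H] [Algebra k H] (Q : QuasiBialgebra k H)
  {R : Type*} [Ring R] [Algebra k R] {E : Type*} [AddCommGroup E] [Module k E]
  (i j l m : H →ₐ[k] R) [Comm i j] [Comm i l] [Comm i m] [Comm j l] [Comm j m]
    [Comm l m] (ζ : R →ₗ[k] E)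

/-- If `ζ` contracts the pairs of letters `(1, 2)` and `(3, 4)` from the left and `(2, 3)` from the
right, the pentagon exchanges `Φ⁻¹` in the first three letters for `Φ` in the last three. -/
theorem cap_pentagon [LRed ζ (Q.cv i j) (Q.e R)] [LRed ζ (Q.cv l m) (Q.e R)]
    [RRed ζ (Q.cv j l) (Q.e R)] :
    ζ ((Q.P i j l)⁻¹ : Rˣ) = ζ (Q.P j l m : Rˣ) := by
  have h : (Q.P i j l)⁻¹ = (Q.P (Q.cv i j) l m)⁻¹ *
      ((Q.P i j (Q.cv l m))⁻¹ * (Q.P j l m * Q.P i (Q.cv j l) m)) := by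
    rw [← mul_assoc, ← mul_inv_rev, eq_inv_mul_iff_mul_eq, ← Q.pentagon]
    group
  rw [h, Q.P_inv_lred _ _ _ (Q.e R) l m, Q.P_left, inv_one, one_mul,
    Q.P_inv_lred _ _ _ i j (Q.e R), Q.P_right, inv_one, one_mul,
    Q.P_rred _ _ _ i (Q.e R) m, Q.P_mid, mul_one]

/-- The counterpart of `cap_pentagon` with the two sides of the contractions exchanged. -/
theorem cup_pentagon [RRed ζ (Q.cv i j) (Q.e R)] [RRed ζ (Q.cv l m) (Q.e R)]
    [LRed ζ (Q.cv j l) (Q.e R)] :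
    ζ ((Q.P j l m)⁻¹ : Rˣ) = ζ (Q.P i j l : Rˣ) := by
  have h : (Q.P j l m)⁻¹ = Q.P i (Q.cv j l) m * (Q.P i j l *
      (Q.P (Q.cv i j) l m)⁻¹ * (Q.P i j (Q.cv l m))⁻¹) := by
    rw [mul_assoc, ← mul_inv_rev, ← Q.pentagon]
    group
  rw [h, Q.P_lred _ _ _ i (Q.e R) m, Q.P_mid, one_mul, Q.P_inv_rred _ _ _ i j (Q.e R), Q.P_right,
    inv_one, mul_one, Q.P_inv_rred _ _ _ (Q.e R) l m, Q.P_left, inv_one, mul_one]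

end Pentagon

section Duals2

variable {k H : Type*} [Field k] [Ring H] [Algebra k H] {Q : QuasiBialgebra k H}
  {B : Type*} [Ring B] [Algebra k B]

namespace DualData

variable {ρ : H →ₐ[k] B} (D D' : DualData Q ρ)

/-- The comparison element carries one evaluation to the other: `cap_pentagon`, contracted with
`α'`, `β` and `α`, turns `comparison D D' * D.α` into `D'.α` times the zig-zag of `D`. -/
theorem comparison_mul_alpha : comparison D D' * D.α = D'.α := by
  set ζ := D'.capMap (D.cupMap (D.capMap ρ.toLinearMap)) with hζ
  have k12 : LRed ζ (Q.cv inl (inr.comp inl)) (Q.e _) := D'.LRed_capMap _ _ fun h t => by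
    induction t with
    | zero => simp
    | tmul x y => simp [cupMap_tmul, mul_assoc]
    | add x y hx hy => simp only [mul_add, map_add, hx, hy]
  have k34 : LRed ζ (Q.cv (inr.comp (inr.comp inl)) (inr.comp (inr.comp inr))) (Q.e _) := by
    have h1 : LRed (D.capMap ρ.toLinearMap) (Q.cv inl inr) (Q.e _) := by
      simpa using D.LRed_capMap ρ.toLinearMap (AlgHom.id k H) fun h t => by simp
    have h2 := LRed.mulMap_inr (LinearMap.mulRight k D'.α ∘ₗ D'.S) _ _ _
      (h := LRed.mulMap_inr (LinearMap.mulRight k D.β ∘ₗ ρ.toLinearMap) _ _ _ (h := h1))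
    simp only [Q.comp_cv, Q.comp_e] at h2
    exact h2
  have k23 : RRed ζ (Q.cv (inr.comp inl) (inr.comp (inr.comp inl))) (Q.e _) := by
    have h1 : RRed (D.cupMap (D.capMap ρ.toLinearMap)) (Q.cv inl (inr.comp inl)) (Q.e _) :=
      D.RRed_cupMap _ _ fun h t => by
        induction t with
        | zero => simp
        | tmul x y => simp [capMap_tmul, mul_assoc, D.S_mul]
        | add x y hx hy => simp only [add_mul, mul_add, map_add, hx, hy]
    have h2 := RRed.mulMap_inr (LinearMap.mulRight k D'.α ∘ₗ D'.S) _ _ _ (h := h1)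
    simp only [Q.comp_cv, Q.comp_e] at h2
    exact h2
  have := cap_pentagon Q inl (inr.comp inl) (inr.comp (inr.comp inl)) (inr.comp (inr.comp inr)) ζ
  rw [← map_inv, ap_val, ap_val] at this
  have h1 : ∀ t, ζ (pair inl (pair (inr.comp inl) (inr.comp (inr.comp inl))) t) =
      D'.capMap (D.cupMap D.S) t * D.α := fun t => by
    induction t using tensor_induction₃ with
    | zero => simp
    | tmul x y z => simp [hζ, capMap_tmul, cupMap_tmul, mul_assoc]
    | add a b ha hb => simp only [add_mul, map_add, ha, hb]
  have h2 : ∀ t, ζ (pair (inr.comp inl) (pair (inr.comp (inr.comp inl))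
      (inr.comp (inr.comp inr))) t) = D'.α * D.cupMap (D.capMap ρ.toLinearMap) t := fun t => by
    induction t using tensor_induction₃ with
    | zero => simp
    | tmul x y z => simp [hζ, capMap_tmul, cupMap_tmul, mul_assoc, D'.S_one]
    | add a b ha hb => simp only [mul_add, map_add, ha, hb]
  rw [h1, h2] at this
  rw [comparison, this, cupMap, capMap, D.zig, mul_one]

theorem beta_mul_comparison : D'.β * comparison D D' = D.β := by
  set ζ := D'.cupMap (D'.capMap (D.cupMap D.S)) with hζ
  have k12 : RRed ζ (Q.cv inl (inr.comp inl)) (Q.e _) := D'.RRed_cupMap _ _ fun h t => by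
    induction t with
    | zero => simp
    | tmul x y => simp [capMap_tmul, mul_assoc, D'.S_mul]
    | add x y hx hy => simp only [add_mul, mul_add, map_add, hx, hy]
  have k34 : RRed ζ (Q.cv (inr.comp (inr.comp inl)) (inr.comp (inr.comp inr))) (Q.e _) := by
    have h1 : RRed (D.cupMap D.S) (Q.cv inl inr) (Q.e _) := by
      simpa using D.RRed_cupMap D.S (AlgHom.id k H) fun h t => by simp [D.S_mul]
    have h2 := RRed.mulMap_inr (LinearMap.mulRight k D'.β ∘ₗ ρ.toLinearMap) _ _ _
      (h := RRed.mulMap_inr (LinearMap.mulRight k D'.α ∘ₗ D'.S) _ _ _ (h := h1))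
    simp only [Q.comp_cv, Q.comp_e] at h2
    exact h2
  have k23 : LRed ζ (Q.cv (inr.comp inl) (inr.comp (inr.comp inl))) (Q.e _) := by
    have h1 : LRed (D'.capMap (D.cupMap D.S)) (Q.cv inl (inr.comp inl)) (Q.e _) :=
      D'.LRed_capMap _ _ fun h t => by
        induction t with
        | zero => simp
        | tmul x y => simp [cupMap_tmul, mul_assoc]
        | add x y hx hy => simp only [mul_add, map_add, hx, hy]
    have h2 := LRed.mulMap_inr (LinearMap.mulRight k D'.β ∘ₗ ρ.toLinearMap) _ _ _ (h := h1)
    simp only [Q.comp_cv, Q.comp_e] at h2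
    exact h2
  have := cup_pentagon Q inl (inr.comp inl) (inr.comp (inr.comp inl)) (inr.comp (inr.comp inr)) ζ
  rw [← map_inv, ap_val, ap_val] at this
  have h1 : ∀ t, ζ (pair inl (pair (inr.comp inl) (inr.comp (inr.comp inl))) t) =
      D'.cupMap (D'.capMap ρ.toLinearMap) t * D.β := fun t => by
    induction t using tensor_induction₃ with
    | zero => simp
    | tmul x y z => simp [hζ, capMap_tmul, cupMap_tmul, mul_assoc, D.S_one]
    | add a b ha hb => simp only [add_mul, map_add, ha, hb]
  have h2 : ∀ t, ζ (pair (inr.comp inl) (pair (inr.comp (inr.comp inl))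
      (inr.comp (inr.comp inr))) t) = D'.β * D'.capMap (D.cupMap D.S) t := fun t => by
    induction t using tensor_induction₃ with
    | zero => simp
    | tmul x y z => simp [hζ, capMap_tmul, cupMap_tmul, mul_assoc]
    | add a b ha hb => simp only [mul_add, map_add, ha, hb]
  rw [h1, h2] at this
  rw [comparison, this, cupMap, capMap, D'.zig, one_mul]

/-- The comparison element intertwines the two anti-homomorphisms: this is quasi-coassociativity,
contracted. -/
theorem comparison_mul_S (h : H) : comparison D D' * D.S h = D'.S h * comparison D D' := by
  set ζ := D'.capMap (D.cupMap D.S) with hζ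
  have k12 : LRed ζ (Q.cv inl (inr.comp inl)) (Q.e _) := D'.LRed_capMap _ _ fun h t => by
    induction t with
    | zero => simp
    | tmul x y => simp [cupMap_tmul, mul_assoc]
    | add x y hx hy => simp only [mul_add, map_add, hx, hy]
  have k23 : RRed ζ (Q.cv (inr.comp inl) (inr.comp inr)) (Q.e _) := by
    have h1 : RRed (D.cupMap D.S) (Q.cv inl inr) (Q.e _) := by
      simpa using D.RRed_cupMap D.S (AlgHom.id k H) fun h t => by simp [D.S_mul]
    have h2 := RRed.mulMap_inr (LinearMap.mulRight k D'.α ∘ₗ D'.S) _ _ _ (h := h1)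
    simp only [Q.comp_cv, Q.comp_e] at h2
    exact h2
  have hid : pair (inl : H →ₐ[k] H ⊗[k] (H ⊗[k] H)) (pair (inr.comp inl) (inr.comp inr)) =
      AlgHom.id k _ := by
    refine AlgHom.ext fun t => ?_
    induction t using tensor_induction₃ with
    | zero => simp
    | tmul x y z => simp
    | add a b ha hb => simp only [map_add, ha, hb]
  have hn := (Intw.inv _ _ _ (h := Q.intw_P (inl : H →ₐ[k] H ⊗[k] (H ⊗[k] H)) (inr.comp inl)
    (inr.comp inr))).intw h
  rw [← map_inv, ap_val, hid, AlgHom.id_apply] at hn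
  have hn := congrArg ζ hn
  have e1 : ζ ((Q.Φ⁻¹).val * Q.cv inl (Q.cv (inr.comp inl) (inr.comp inr)) h) =
      ζ ((Q.Φ⁻¹).val * Q.cv inl (Q.e _) h) := RRed.red _ _
  have e2 : ζ (Q.cv (Q.cv inl (inr.comp inl)) (inr.comp inr) h * (Q.Φ⁻¹).val) =
      ζ (Q.cv (Q.e _) (inr.comp inr) h * (Q.Φ⁻¹).val) := LRed.red _ _
  rw [e1, e2, Q.cv_e_left, Q.cv_e_right] at hn
  have h1 : ∀ t, ζ (t * inl h) = D'.S h * ζ t := fun t => by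
    induction t with
    | zero => simp
    | tmul x y => simp [hζ, capMap_tmul, mul_assoc, D'.S_mul]
    | add a b ha hb => simp only [mul_add, add_mul, map_add, ha, hb]
  have h2 : ∀ t, ζ (inr.comp inr h * t) = ζ t * D.S h := fun t => by
    induction t using tensor_induction₃ with
    | zero => simp
    | tmul x y => simp [hζ, capMap_tmul, cupMap_tmul, mul_assoc, D.S_mul]
    | add a b ha hb => simp only [mul_add, add_mul, map_add, ha, hb]
  rw [h1, h2] at hn
  exact hn.symm

/-- An element `u` intertwining `S` with a given map is determined by `u α`. -/
theorem eq_of_intertwines {T : H →ₗ[k] B} {u v : B} (hu : ∀ h, u * D.S h = T h * u)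
    (hv : ∀ h, v * D.S h = T h * v) (hα : u * D.α = v * D.α) : u = v := by
  have key : ∀ t, u * D.capMap (D.cupMap D.S) t = v * D.capMap (D.cupMap D.S) t := fun t => by
    induction t with
    | zero => simp
    | tmul x y =>
      rw [capMap_tmul, ← mul_assoc, ← mul_assoc, hu, mul_assoc _ u, hα, ← mul_assoc, ← hv,
        mul_assoc, mul_assoc, mul_assoc]
    | add a b ha hb => simp only [mul_add, map_add, ha, hb]
  have := key (Q.Φ⁻¹).val
  rwa [capMap, cupMap, D.zag, mul_one, mul_one] at this

/-- The two comparison elements are mutually inverse, by `beta_mul_comparison` and the zig-zag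
identity. -/
theorem comparison_mul_comparison : comparison D' D * comparison D D' = 1 := by
  have key : ∀ t, D.capMap (D'.cupMap D'.S) t * comparison D D' = D.capMap (D.cupMap D.S) t :=
    fun t => by
    induction t using tensor_induction₃ with
    | zero => simp
    | tmul x y z =>
      simp only [capMap_tmul, cupMap_tmul]
      rw [← beta_mul_comparison D D']
      simp only [mul_assoc, comparison_mul_S]
    | add a b ha hb => simp only [add_mul, map_add, ha, hb]
  rw [comparison, key, capMap, cupMap, D.zag]

end DualData

end Duals2

/-! ### The dual of a tensor product: coherence -/

section Coherence

variable {k H : Type*} [Field k] [Ring H] [Algebra k H] (Q : QuasiBialgebra k H)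
  {R : Type*} [Ring R] [Algebra k R] {E : Type*} [AddCommGroup E] [Module k E]

/-- The isomorphism `(i j)(l m) → (i (j l)) m` on letters, `(Φ ⊗ 1)(Δ ⊗ id ⊗ id)(Φ⁻¹)`. -/
def QuasiBialgebra.nest (i j l m : H →ₐ[k] R) [Comm i j] [Comm i l] [Comm i m] [Comm j l]
    [Comm j m] [Comm l m] : Rˣ := Q.P i j l * (Q.P (Q.cv i j) l m)⁻¹

/-- The isomorphism `(i (j l)) m → (i j)(l m)` on letters, `(Δ ⊗ id ⊗ id)(Φ)(Φ⁻¹ ⊗ 1)`. -/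
def QuasiBialgebra.unfold (i j l m : H →ₐ[k] R) [Comm i j] [Comm i l] [Comm i m] [Comm j l]
    [Comm j m] [Comm l m] : Rˣ := Q.P (Q.cv i j) l m * (Q.P i j l)⁻¹

variable (a₁ a₂ a₃ a₄ a₅ a₆ : H →ₐ[k] R)
    [Comm a₁ a₂] [Comm a₁ a₃] [Comm a₁ a₄] [Comm a₁ a₅] [Comm a₁ a₆] [Comm a₂ a₃] [Comm a₂ a₄]
    [Comm a₂ a₅] [Comm a₂ a₆] [Comm a₃ a₄] [Comm a₃ a₅] [Comm a₃ a₆] [Comm a₄ a₅] [Comm a₄ a₆]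
    [Comm a₅ a₆]

/-- An identity of words that holds before any contraction: pentagons, and naturality of `Φ` with
respect to conjugation by other reassociators. -/
theorem zig_word : Q.nest a₃ a₄ a₅ a₆ * Q.P (Q.cv a₁ a₂) (Q.cv a₃ a₄) (Q.cv a₅ a₆) *
      Q.unfold a₁ a₂ a₃ a₄ =
    Q.P (Q.cv a₁ a₂) (Q.cv a₃ (Q.cv a₄ a₅)) a₆ * (Q.P (Q.cv a₁ a₂) a₃ (Q.cv a₄ a₅) *
      ((Q.P a₁ a₂ a₃)⁻¹ * Q.P (Q.cv a₁ (Q.cv a₂ a₃)) a₄ a₅ *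
        (Q.P (Q.cv (Q.cv a₁ (Q.cv a₂ a₃)) a₄) a₅ a₆)⁻¹)) := by
  -- Naturality: a reassociator moves past another one, rebracketing its arguments.
  have n1 := Q.P_conj (Q.P a₃ a₄ a₅) (i := Q.cv a₁ a₂) (i' := Q.cv a₁ a₂)
    (j := Q.cv (Q.cv a₃ a₄) a₅) (j' := Q.cv a₃ (Q.cv a₄ a₅)) (l := a₆) (l' := a₆)
  have n2 := Q.P_conj (Q.P a₁ a₂ a₃) (i := Q.cv (Q.cv (Q.cv a₁ a₂) a₃) a₄)
    (i' := Q.cv (Q.cv a₁ (Q.cv a₂ a₃)) a₄) (j := a₅) (j' := a₅) (l := a₆) (l' := a₆)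
  have n3 := Q.P_conj' (Q.P (Q.cv a₁ a₂) a₃ a₄) (i := Q.cv (Q.cv (Q.cv a₁ a₂) a₃) a₄)
    (i' := Q.cv (Q.cv a₁ a₂) (Q.cv a₃ a₄)) (j := a₅) (j' := a₅) (l := a₆) (l' := a₆)
  have n4 := Q.P_conj (Q.P a₁ a₂ a₃) (i := Q.cv (Q.cv a₁ a₂) a₃)
    (i' := Q.cv a₁ (Q.cv a₂ a₃)) (j := a₄) (j' := a₄) (l := a₅) (l' := a₅)
  rw [QuasiBialgebra.nest, QuasiBialgebra.unfold,
    Q.pentagon_outer_right (Q.cv a₁ a₂) (Q.cv a₃ a₄) a₅ a₆, n1,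
    Q.pentagon_middle (Q.cv a₁ a₂) a₃ a₄ a₅, n3, n2, n4]
  group

theorem zag_word : Q.nest a₁ a₂ a₃ a₄ * (Q.P (Q.cv a₁ a₂) (Q.cv a₃ a₄) (Q.cv a₅ a₆))⁻¹ *
      Q.unfold a₃ a₄ a₅ a₆ =
    (Q.P (Q.cv a₁ (Q.cv a₂ a₃)) a₄ (Q.cv a₅ a₆))⁻¹ * (Q.P a₁ a₂ a₃ * Q.P a₄ a₅ a₆ *
      (Q.P (Q.cv a₁ a₂) a₃ (Q.cv (Q.cv a₄ a₅) a₆))⁻¹ * Q.P a₃ (Q.cv a₄ a₅) a₆) := by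
  have n1 := Q.P_conj' (Q.P a₁ a₂ a₃) (i := Q.cv (Q.cv a₁ a₂) a₃)
    (i' := Q.cv a₁ (Q.cv a₂ a₃)) (j := a₄) (j' := a₄) (l := Q.cv a₅ a₆) (l' := Q.cv a₅ a₆)
  have n2 := Q.P_conj (Q.P a₄ a₅ a₆) (i := Q.cv a₁ a₂) (i' := Q.cv a₁ a₂) (j := a₃) (j' := a₃)
    (l := Q.cv (Q.cv a₄ a₅) a₆) (l' := Q.cv a₄ (Q.cv a₅ a₆))
  rw [QuasiBialgebra.nest, QuasiBialgebra.unfold,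
    Q.pentagon_middle (Q.cv a₁ a₂) a₃ a₄ (Q.cv a₅ a₆), Q.pentagon_outer_left a₃ a₄ a₅ a₆, n1, n2]
  group

variable {a₁ a₂ a₃ a₄ a₅ a₆} (ζ : R →ₗ[k] E)

/-- The zig-zag identity for the tensor product of two duals reduces, when the pairs `(1, 4)`,
`(2, 3)`, `(4, 5)`, `(3, 6)` are contracted, to the two zig-zags of the factors. -/
theorem zig_coherence [RRed ζ (Q.cv a₁ a₄) (Q.e R)] [RRed ζ (Q.cv a₂ a₃) (Q.e R)]
    [LRed ζ (Q.cv a₄ a₅) (Q.e R)] [LRed ζ (Q.cv a₃ a₆) (Q.e R)] :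
    ζ (Q.nest a₃ a₄ a₅ a₆ * Q.P (Q.cv a₁ a₂) (Q.cv a₃ a₄) (Q.cv a₅ a₆) *
      Q.unfold a₁ a₂ a₃ a₄ : Rˣ) = ζ (Q.P a₂ a₃ a₆ * Q.P a₁ a₄ a₅ : Rˣ) := by
  rw [zig_word, Q.P_lred _ _ _ (Q.cv a₁ a₂) a₃ a₆]
  have : LRed (ζ ∘ₗ LinearMap.mulLeft k (Q.P (Q.cv a₁ a₂) a₃ a₆ : R)) (Q.cv a₄ a₅) (Q.e R) :=
    LRed.mulLeft _
  have h := Q.P_lred (ζ := ζ ∘ₗ LinearMap.mulLeft k (Q.P (Q.cv a₁ a₂) a₃ a₆ : R))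
    (Q.cv a₁ a₂) a₃ (Q.cv a₄ a₅) (Q.cv a₁ a₂) a₃ (Q.e R)
  rw [Q.P_right] at h
  simp only [LinearMap.comp_apply, LinearMap.mulLeft_apply, ← Units.val_mul, one_mul] at h
  rw [h, ← mul_assoc, Q.P_inv_rred _ _ _ (Q.cv a₁ a₄) a₅ a₆,
    Q.P_inv_rred _ _ _ (Q.e R) a₅ a₆, Q.P_left, inv_one, mul_one, ← mul_assoc,
    Q.P_rred _ _ _ a₁ a₄ a₅, Q.pentagon_outer_left a₁ a₂ a₃ a₆]
  have e1 : (Q.P a₁ a₂ (Q.cv a₃ a₆))⁻¹ * Q.P a₂ a₃ a₆ * Q.P a₁ (Q.cv a₂ a₃) a₆ * Q.P a₁ a₂ a₃ *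
      (Q.P a₁ a₂ a₃)⁻¹ * Q.P a₁ a₄ a₅ = (Q.P a₁ a₂ (Q.cv a₃ a₆))⁻¹ * (Q.P a₂ a₃ a₆ *
        Q.P a₁ (Q.cv a₂ a₃) a₆ * Q.P a₁ a₄ a₅) := by group
  rw [e1, Q.P_inv_lred _ _ _ a₁ a₂ (Q.e R), Q.P_right, inv_one, one_mul]
  have : RRed (ζ ∘ₗ LinearMap.mulRight k (Q.P a₁ a₄ a₅ : R)) (Q.cv a₂ a₃) (Q.e R) :=
    RRed.mulRight _
  have h := Q.P_rred (ζ := ζ ∘ₗ LinearMap.mulRight k (Q.P a₁ a₄ a₅ : R))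
    a₁ (Q.cv a₂ a₃) a₆ a₁ (Q.e R) a₆ (Q.P a₂ a₃ a₆)
  rw [Q.P_mid] at h
  simpa only [LinearMap.comp_apply, LinearMap.mulRight_apply, ← Units.val_mul, mul_one] using h

/-- The counterpart of `zig_coherence` for `Φ⁻¹`. -/
theorem zag_coherence [LRed ζ (Q.cv a₂ a₃) (Q.e R)] [LRed ζ (Q.cv a₁ a₄) (Q.e R)]
    [RRed ζ (Q.cv a₃ a₆) (Q.e R)] [RRed ζ (Q.cv a₄ a₅) (Q.e R)] :
    ζ (Q.nest a₁ a₂ a₃ a₄ * (Q.P (Q.cv a₁ a₂) (Q.cv a₃ a₄) (Q.cv a₅ a₆))⁻¹ *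
      Q.unfold a₃ a₄ a₅ a₆ : Rˣ) = ζ ((Q.P a₁ a₄ a₅)⁻¹ * (Q.P a₂ a₃ a₆)⁻¹ : Rˣ) := by
  rw [zag_word, Q.P_inv_lred _ _ _ a₁ a₄ (Q.cv a₅ a₆), ← mul_assoc,
    Q.P_rred _ _ _ a₃ (Q.e R) a₆, Q.P_mid, mul_one, ← mul_assoc,
    Q.P_inv_rred _ _ _ (Q.cv a₁ a₂) a₃ a₆]
  have c1 : Q.P a₁ a₂ a₃ * Q.P a₄ a₅ a₆ = Q.P a₄ a₅ a₆ * Q.P a₁ a₂ a₃ := Q.P_nat _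
  have p1 : Q.P a₁ a₂ a₃ * (Q.P (Q.cv a₁ a₂) a₃ a₆)⁻¹ =
      (Q.P a₁ (Q.cv a₂ a₃) a₆)⁻¹ * (Q.P a₂ a₃ a₆)⁻¹ * Q.P a₁ a₂ (Q.cv a₃ a₆) := by
    rw [Q.pentagon_left a₁ a₂ a₃ a₆]; group
  have p2 : (Q.P a₁ a₄ (Q.cv a₅ a₆))⁻¹ * Q.P a₄ a₅ a₆ =
      Q.P (Q.cv a₁ a₄) a₅ a₆ * (Q.P a₁ a₄ a₅)⁻¹ * (Q.P a₁ (Q.cv a₄ a₅) a₆)⁻¹ := by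
    rw [Q.pentagon_middle a₁ a₄ a₅ a₆]; group
  have c2 : Q.P a₁ a₂ a₃ * Q.P a₄ a₅ a₆ * (Q.P (Q.cv a₁ a₂) a₃ a₆)⁻¹ =
      Q.P a₄ a₅ a₆ * (Q.P a₁ a₂ a₃ * (Q.P (Q.cv a₁ a₂) a₃ a₆)⁻¹) := by rw [c1, mul_assoc]
  rw [mul_assoc, c2, ← mul_assoc, p1, p2, ← mul_assoc, Q.P_rred _ _ _ a₁ a₂ (Q.e R), Q.P_right,
    mul_one, mul_assoc _ (Q.P a₁ a₄ a₅)⁻¹, mul_assoc, Q.P_lred _ _ _ (Q.e R) a₅ a₆, Q.P_left,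
    one_mul, mul_assoc, ← mul_assoc]
  have : RRed (ζ ∘ₗ LinearMap.mulRight k ((Q.P a₁ (Q.cv a₂ a₃) a₆)⁻¹ * (Q.P a₂ a₃ a₆)⁻¹ : Rˣ).val)
    (Q.cv a₄ a₅) (Q.e R) := RRed.mulRight _
  have h1 := Q.P_inv_rred (ζ := ζ ∘ₗ LinearMap.mulRight k
    ((Q.P a₁ (Q.cv a₂ a₃) a₆)⁻¹ * (Q.P a₂ a₃ a₆)⁻¹ : Rˣ).val)
    a₁ (Q.cv a₄ a₅) a₆ a₁ (Q.e R) a₆ (Q.P a₁ a₄ a₅)⁻¹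
  rw [Q.P_mid, inv_one, mul_one] at h1
  simp only [LinearMap.comp_apply, LinearMap.mulRight_apply, ← Units.val_mul] at h1
  have : LRed (ζ ∘ₗ LinearMap.mulLeft k ((Q.P a₁ a₄ a₅)⁻¹ : Rˣ).val) (Q.cv a₂ a₃) (Q.e R) :=
    LRed.mulLeft _
  have h2 := Q.P_inv_lred (ζ := ζ ∘ₗ LinearMap.mulLeft k ((Q.P a₁ a₄ a₅)⁻¹ : Rˣ).val)
    a₁ (Q.cv a₂ a₃) a₆ a₁ (Q.e R) a₆ (Q.P a₂ a₃ a₆)⁻¹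
  rw [Q.P_mid, inv_one, one_mul] at h2
  simp only [LinearMap.comp_apply, LinearMap.mulLeft_apply, ← Units.val_mul] at h2
  rw [h1, h2]

end Coherence

/-! ### The Drinfeld twist -/

/-- Induction principle for additive predicates on `(X ⊗ Y) ⊗ (Z ⊗ W)`. -/
theorem tensor_induction₂₂ {k X Y Z W : Type*} [Field k] [Ring X] [Algebra k X] [Ring Y]
    [Algebra k Y] [Ring Z] [Algebra k Z] [Ring W] [Algebra k W]
    {p : (X ⊗[k] Y) ⊗[k] (Z ⊗[k] W) → Prop} (t : (X ⊗[k] Y) ⊗[k] (Z ⊗[k] W))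
    (zero : p 0) (tmul : ∀ x y z w, p ((x ⊗ₜ y) ⊗ₜ (z ⊗ₜ w)))
    (add : ∀ a b, p a → p b → p (a + b)) : p t := by
  induction t with
  | zero => exact zero
  | tmul x t =>
    induction x with
    | zero => simpa using zero
    | tmul x y =>
      induction t with
      | zero => simpa using zero
      | tmul z w => exact tmul x y z w
      | add a b ha hb => rw [TensorProduct.tmul_add]; exact add _ _ ha hb
    | add a b ha hb => rw [TensorProduct.add_tmul]; exact add _ _ ha hb
  | add a b ha hb => exact add _ _ ha hb

/-- Induction principle for additive predicates on `X ⊗ (Y ⊗ (Z ⊗ W))`. -/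
theorem tensor_induction₄ {k X Y Z W : Type*} [Field k] [Ring X] [Algebra k X] [Ring Y]
    [Algebra k Y] [Ring Z] [Algebra k Z] [Ring W] [Algebra k W]
    {p : X ⊗[k] (Y ⊗[k] (Z ⊗[k] W)) → Prop} (t : X ⊗[k] (Y ⊗[k] (Z ⊗[k] W)))
    (zero : p 0) (tmul : ∀ x y z w, p (x ⊗ₜ (y ⊗ₜ (z ⊗ₜ w))))
    (add : ∀ a b, p a → p b → p (a + b)) : p t := by
  induction t using tensor_induction₃ with
  | zero => exact zero
  | tmul x y t =>
    induction t with
    | zero => simpa using zero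
    | tmul z w => exact tmul x y z w
    | add a b ha hb => rw [TensorProduct.tmul_add, TensorProduct.tmul_add]; exact add _ _ ha hb
  | add a b ha hb => exact add _ _ ha hb

section MapReductions

variable {k X Y Z E E' : Type*} [Field k] [Ring X] [Algebra k X] [Ring Y] [Algebra k Y]
  [Ring Z] [Algebra k Z] [AddCommGroup E] [Module k E] [AddCommGroup E'] [Module k E']

theorem RRed.map_inl (ζ : X →ₗ[k] E) (ξ : Y →ₗ[k] E') (F F' : Z →ₐ[k] X) [h : RRed ζ F F'] :
    RRed (TensorProduct.map ζ ξ) ((inl : X →ₐ[k] X ⊗[k] Y).comp F) (inl.comp F') :=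
  ⟨fun t x => by
  induction t with
  | zero => simp
  | tmul a b => simp [h.red]
  | add a b ha hb => simp only [add_mul, map_add, ha, hb]⟩

theorem RRed.map_inr (ζ : X →ₗ[k] E) (ξ : Y →ₗ[k] E') (F F' : Z →ₐ[k] Y) [h : RRed ξ F F'] :
    RRed (TensorProduct.map ζ ξ) ((inr : Y →ₐ[k] X ⊗[k] Y).comp F) (inr.comp F') :=
  ⟨fun t x => by
  induction t with
  | zero => simp
  | tmul a b => simp [h.red]
  | add a b ha hb => simp only [add_mul, map_add, ha, hb]⟩

theorem LRed.map_inl (ζ : X →ₗ[k] E) (ξ : Y →ₗ[k] E') (F F' : Z →ₐ[k] X) [h : LRed ζ F F'] :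
    LRed (TensorProduct.map ζ ξ) ((inl : X →ₐ[k] X ⊗[k] Y).comp F) (inl.comp F') :=
  ⟨fun t x => by
  induction t with
  | zero => simp
  | tmul a b => simp [h.red]
  | add a b ha hb => simp only [mul_add, map_add, ha, hb]⟩

theorem LRed.map_inr (ζ : X →ₗ[k] E) (ξ : Y →ₗ[k] E') (F F' : Z →ₐ[k] Y) [h : LRed ξ F F'] :
    LRed (TensorProduct.map ζ ξ) ((inr : Y →ₐ[k] X ⊗[k] Y).comp F) (inr.comp F') :=
  ⟨fun t x => by
  induction t with
  | zero => simp
  | tmul a b => simp [h.red]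
  | add a b ha hb => simp only [mul_add, map_add, ha, hb]⟩

variable {H : Type*} [Ring H] [Algebra k H] (Q : QuasiBialgebra k H)

instance RRed.cv_map_inl (ζ : X →ₗ[k] E) (ξ : Y →ₗ[k] E') (i j : H →ₐ[k] X) [Comm i j]
    [h : RRed ζ (Q.cv i j) (Q.e X)] : RRed (TensorProduct.map ζ ξ)
      (Q.cv ((inl : X →ₐ[k] X ⊗[k] Y).comp i) (inl.comp j)) (Q.e _) := by
  have := RRed.map_inl ζ ξ (Q.cv i j) (Q.e X)
  rwa [Q.comp_cv, Q.comp_e] at this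

instance RRed.cv_map_inr (ζ : X →ₗ[k] E) (ξ : Y →ₗ[k] E') (i j : H →ₐ[k] Y) [Comm i j]
    [h : RRed ξ (Q.cv i j) (Q.e Y)] : RRed (TensorProduct.map ζ ξ)
      (Q.cv ((inr : Y →ₐ[k] X ⊗[k] Y).comp i) (inr.comp j)) (Q.e _) := by
  have := RRed.map_inr ζ ξ (Q.cv i j) (Q.e Y)
  rwa [Q.comp_cv, Q.comp_e] at this

instance LRed.cv_map_inl (ζ : X →ₗ[k] E) (ξ : Y →ₗ[k] E') (i j : H →ₐ[k] X) [Comm i j]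
    [h : LRed ζ (Q.cv i j) (Q.e X)] : LRed (TensorProduct.map ζ ξ)
      (Q.cv ((inl : X →ₐ[k] X ⊗[k] Y).comp i) (inl.comp j)) (Q.e _) := by
  have := LRed.map_inl ζ ξ (Q.cv i j) (Q.e X)
  rwa [Q.comp_cv, Q.comp_e] at this

instance LRed.cv_map_inr (ζ : X →ₗ[k] E) (ξ : Y →ₗ[k] E') (i j : H →ₐ[k] Y) [Comm i j]
    [h : LRed ξ (Q.cv i j) (Q.e Y)] : LRed (TensorProduct.map ζ ξ)
      (Q.cv ((inr : Y →ₐ[k] X ⊗[k] Y).comp i) (inr.comp j)) (Q.e _) := by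
  have := LRed.map_inr ζ ξ (Q.cv i j) (Q.e Y)
  rwa [Q.comp_cv, Q.comp_e] at this

end MapReductions

namespace DualData

variable {k H : Type*} [Field k] [Ring H] [Algebra k H] {Q : QuasiBialgebra k H}
  {B : Type*} [Ring B] [Algebra k B] {ρ : H →ₐ[k] B} (D : DualData Q ρ)

/-- `x ⊗ y ↦ S(x) α ρ(y)`. -/
def cap : H ⊗[k] H →ₗ[k] B := D.capMap ρ.toLinearMap

/-- `x ⊗ y ↦ ρ(x) β S(y)`. -/
def cup : H ⊗[k] H →ₗ[k] B := D.cupMap D.S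

/-- `x ⊗ y ⊗ z ↦ ρ(x) β S(y) α ρ(z)`. -/
def zigMap : H ⊗[k] (H ⊗[k] H) →ₗ[k] B := D.cupMap D.cap

/-- `x ⊗ y ⊗ z ↦ S(x) α ρ(y) β S(z)`. -/
def zagMap : H ⊗[k] (H ⊗[k] H) →ₗ[k] B := D.capMap D.cup

@[simp] theorem cap_tmul (x y : H) : D.cap (x ⊗ₜ y) = D.S x * D.α * ρ y := rfl
@[simp] theorem cup_tmul (x y : H) : D.cup (x ⊗ₜ y) = ρ x * D.β * D.S y := rfl
@[simp] theorem zigMap_tmul (x y z : H) : D.zigMap (x ⊗ₜ (y ⊗ₜ z)) =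
    ρ x * D.β * (D.S y * D.α * ρ z) := rfl
@[simp] theorem zagMap_tmul (x y z : H) : D.zagMap (x ⊗ₜ (y ⊗ₜ z)) =
    D.S x * D.α * (ρ y * D.β * D.S z) := rfl

instance lred_cap : LRed D.cap (Q.cv inl inr) (Q.e _) :=
  D.LRed_capMap ρ.toLinearMap (AlgHom.id k H) fun h t => by simp

instance rred_cup : RRed D.cup (Q.cv inl inr) (Q.e _) :=
  D.RRed_cupMap D.S (AlgHom.id k H) fun h t => by simp [D.S_mul]

instance rred_zigMap : RRed D.zigMap (Q.cv inl (inr.comp inl)) (Q.e _) :=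
  D.RRed_cupMap _ _ fun h t => by
    induction t with
    | zero => simp
    | tmul x y => simp [mul_assoc, D.S_mul]
    | add x y hx hy => simp only [add_mul, mul_add, map_add, hx, hy]

instance lred_zagMap : LRed D.zagMap (Q.cv inl (inr.comp inl)) (Q.e _) :=
  D.LRed_capMap _ _ fun h t => by
    induction t with
    | zero => simp
    | tmul x y => simp [mul_assoc]
    | add x y hx hy => simp only [mul_add, map_add, hx, hy]

instance lred_zigMap : LRed D.zigMap (Q.cv (inr.comp inl) (inr.comp inr)) (Q.e _) := by
  have h2 := LRed.mulMap_inr (LinearMap.mulRight k D.β ∘ₗ ρ.toLinearMap) _ _ _ (h := D.lred_cap)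
  simp only [Q.comp_cv, Q.comp_e] at h2
  exact h2

instance rred_zagMap : RRed D.zagMap (Q.cv (inr.comp inl) (inr.comp inr)) (Q.e _) := by
  have h2 := RRed.mulMap_inr (LinearMap.mulRight k D.α ∘ₗ D.S) _ _ _ (h := D.rred_cup)
  simp only [Q.comp_cv, Q.comp_e] at h2
  exact h2

theorem zigMap_Phi : D.zigMap Q.Φ.val = 1 := D.zig

theorem zagMap_Phi_inv : D.zagMap (Q.Φ⁻¹).val = 1 := D.zag

/-- Dual data transport along algebra maps. -/
def map {C : Type*} [Ring C] [Algebra k C] (g : B →ₐ[k] C) : DualData Q (g.comp ρ) where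
  S := g.toLinearMap ∘ₗ D.S
  α := g D.α
  β := g D.β
  S_one := by simp [D.S_one]
  S_mul x y := by simp [D.S_mul]
  ev_alpha h := by
    have key : ∀ t, mulMap (LinearMap.mulRight k (g D.α) ∘ₗ g.toLinearMap ∘ₗ D.S)
        (g.comp ρ).toLinearMap t = g (D.cap t) := fun t => by
      induction t with
      | zero => simp
      | tmul x y => simp [mulMap_tmul]
      | add x y hx hy => simp only [map_add, hx, hy]
    rw [key, cap, capMap, D.ev_alpha, map_smul]
  ev_beta h := by
    have key : ∀ t, mulMap (LinearMap.mulRight k (g D.β) ∘ₗ (g.comp ρ).toLinearMap)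
        (g.toLinearMap ∘ₗ D.S) t = g (D.cup t) := fun t => by
      induction t with
      | zero => simp
      | tmul x y => simp [mulMap_tmul]
      | add x y hx hy => simp only [map_add, hx, hy]
    rw [key, cup, cupMap, D.ev_beta, map_smul]
  zig := by
    have key : ∀ t, mulMap (LinearMap.mulRight k (g D.β) ∘ₗ (g.comp ρ).toLinearMap)
        (mulMap (LinearMap.mulRight k (g D.α) ∘ₗ g.toLinearMap ∘ₗ D.S)
          (g.comp ρ).toLinearMap) t = g (D.zigMap t) := fun t => by
      induction t using tensor_induction₃ with
      | zero => simp
      | tmul x y => simp [mulMap_tmul]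
      | add x y hx hy => simp only [map_add, hx, hy]
    rw [key, zigMap_Phi, map_one]
  zag := by
    have key : ∀ t, mulMap (LinearMap.mulRight k (g D.α) ∘ₗ g.toLinearMap ∘ₗ D.S)
        (mulMap (LinearMap.mulRight k (g D.β) ∘ₗ (g.comp ρ).toLinearMap)
          (g.toLinearMap ∘ₗ D.S)) t = g (D.zagMap t) := fun t => by
      induction t using tensor_induction₃ with
      | zero => simp
      | tmul x y => simp [mulMap_tmul]
      | add x y hx hy => simp only [map_add, hx, hy]
    rw [key, zagMap_Phi_inv, map_one]

end DualData

namespace QuasiHopfAlgebra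

variable {k H : Type*} [Field k] [Ring H] [Algebra k H] (Q : QuasiHopfAlgebra k H)

theorem S_one : Q.S 1 = 1 := by simp [S]

theorem S_mul (x y : H) : Q.S (x * y) = Q.S y * Q.S x := by simp [S]

@[simp] theorem S_Sinv (x : H) : Q.S (Q.Sinv x) = x := by simp [S, Sinv]

@[simp] theorem Sinv_S (x : H) : Q.Sinv (Q.S x) = x := by simp [S, Sinv]

theorem Sinv_one : Q.Sinv 1 = 1 := by simp [Sinv]

theorem Sinv_mul (x y : H) : Q.Sinv (x * y) = Q.Sinv y * Q.Sinv x := by simp [Sinv]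

/-- The antipode as dual data over the identity of `H`. -/
def std : DualData Q.toQuasiBialgebra (AlgHom.id k H) where
  S := Q.S
  α := Q.α
  β := Q.β
  S_one := Q.S_one
  S_mul := Q.S_mul
  ev_alpha := Q.antipode_alpha
  ev_beta := Q.antipode_beta
  zig := Q.antipode_reassociator
  zag := Q.antipode_reassociator_inv

@[simp] theorem evα_tmul (x y : H) : Q.evα (x ⊗ₜ y) = Q.S x * Q.α * y := rfl
@[simp] theorem evβ_tmul (x y : H) : Q.evβ (x ⊗ₜ y) = x * Q.β * Q.S y := rfl

instance lred_evα : LRed Q.evα (Q.cv inl inr) (Q.e _) := Q.std.lred_cap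
instance rred_evβ : RRed Q.evβ (Q.cv inl inr) (Q.e _) := Q.std.rred_cup

/-- `x ⊗ y ↦ S(y) ⊗ S(x)`. -/
def SS : H ⊗[k] H →ₗ[k] H ⊗[k] H :=
  TensorProduct.map Q.S Q.S ∘ₗ (TensorProduct.comm k H H).toLinearMap

@[simp] theorem SS_tmul (x y : H) : Q.SS (x ⊗ₜ y) = Q.S y ⊗ₜ Q.S x := rfl

theorem SSΔcop_apply (h : H) : Q.SSΔcop h = Q.SS (Q.Δ h) := rfl

theorem SS_mul (s t : H ⊗[k] H) : Q.SS (s * t) = Q.SS t * Q.SS s := by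
  induction s with
  | zero => simp
  | tmul x y =>
    induction t with
    | zero => simp
    | tmul z w => simp [S_mul]
    | add a b ha hb => simp only [mul_add, add_mul, map_add, ha, hb]
  | add a b ha hb => simp only [mul_add, add_mul, map_add, ha, hb]

theorem SS_one : Q.SS 1 = 1 := by
  rw [Algebra.TensorProduct.one_def, SS_tmul, S_one]

section Nested

variable {R : Type*} [Ring R] [Algebra k R]

theorem nest_val (i j l m : H →ₐ[k] R) [Comm i j] [Comm i l] [Comm i m] [Comm j l]
    [Comm j m] [Comm l m] : (Q.nest i j l m : R) = pair i (pair j (pair l m))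
      (padRight H Q.Φ.val * splitHead Q.Δ (H ⊗[k] H) (Q.Φ⁻¹).val) := by
  simp [QuasiBialgebra.nest, ap_val, ap_inv_val]

theorem unfold_val (i j l m : H →ₐ[k] R) [Comm i j] [Comm i l] [Comm i m] [Comm j l]
    [Comm j m] [Comm l m] : (Q.unfold i j l m : R) = pair i (pair j (pair l m))
      (splitHead Q.Δ (H ⊗[k] H) Q.Φ.val * padRight H (Q.Φ⁻¹).val) := by
  simp [QuasiBialgebra.unfold, ap_val, ap_inv_val]

theorem unnest_eq_pair (t : H ⊗[k] (H ⊗[k] (H ⊗[k] H))) : unnest H H H H t =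
    pair (inr.comp inl) (pair (inl.comp inl) (pair (inl.comp inr) (inr.comp inr))) t := by
  induction t using tensor_induction₄ with
  | zero => simp
  | tmul x y z w => simp [unnest]
  | add a b ha hb => simp only [map_add, ha, hb]

end Nested

/-- `(x ⊗ y) ⊗ (z ⊗ w) ↦ S(x) α y ⊗ S(z) α w`. -/
abbrev capcap : (H ⊗[k] H) ⊗[k] (H ⊗[k] H) →ₗ[k] H ⊗[k] H := TensorProduct.map Q.evα Q.evα

/-- `(x ⊗ y) ⊗ (z ⊗ w) ↦ x β S(y) ⊗ z β S(w)`. -/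
abbrev cupcup : (H ⊗[k] H) ⊗[k] (H ⊗[k] H) →ₗ[k] H ⊗[k] H := TensorProduct.map Q.evβ Q.evβ

theorem γ_eq : Q.γ = Q.capcap
    (Q.nest (inr.comp inl) (inl.comp inl) (inl.comp inr) (inr.comp inr)).val := by
  rw [nest_val, ← unnest_eq_pair]; rfl

theorem δ₀_eq : Q.δ₀ = Q.cupcup
    (Q.unfold (inl.comp inl) (inr.comp inl) (inr.comp inr) (inl.comp inr)).val := by
  have key : ∀ t, TensorProduct.comm k H H (Q.cupcup (unnest H H H H t)) = Q.cupcup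
      (pair (inl.comp inl) (pair (inr.comp inl) (pair (inr.comp inr) (inl.comp inr))) t) :=
    fun t => by
    induction t using tensor_induction₄ with
    | zero => simp
    | tmul x y z w => simp [unnest]
    | add a b ha hb => simp only [map_add, ha, hb]
  rw [unfold_val, ← key]; rfl

theorem SS_mul_capcap (u v : H ⊗[k] H) (t : (H ⊗[k] H) ⊗[k] (H ⊗[k] H)) :
    Q.SS u * Q.capcap t * v = Q.capcap (t * (pair (inr.comp inl) (inl.comp inl) u *
      pair (inl.comp inr) (inr.comp inr) v)) := by
  induction t using tensor_induction₂₂ with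
  | zero => simp
  | tmul x y z w =>
    induction u with
    | zero => simp
    | tmul a b =>
      induction v with
      | zero => simp
      | tmul c d => simp [S_mul, mul_assoc]
      | add a b ha hb => simp only [mul_add, map_add, ha, hb]
    | add a b ha hb => simp only [mul_add, add_mul, map_add, ha, hb]
  | add a b ha hb => simp only [mul_add, add_mul, map_add, ha, hb]

theorem mul_cupcup_SS (u v : H ⊗[k] H) (t : (H ⊗[k] H) ⊗[k] (H ⊗[k] H)) :
    u * Q.cupcup t * Q.SS v = Q.cupcup (pair (inl.comp inl) (inr.comp inl) u *
      pair (inr.comp inr) (inl.comp inr) v * t) := by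
  induction t using tensor_induction₂₂ with
  | zero => simp
  | tmul x y z w =>
    induction u with
    | zero => simp
    | tmul a b =>
      induction v with
      | zero => simp
      | tmul c d => simp [S_mul, mul_assoc]
      | add a b ha hb => simp only [mul_add, add_mul, map_add, ha, hb]
    | add a b ha hb => simp only [add_mul, map_add, ha, hb]
  | add a b ha hb => simp only [mul_add, add_mul, map_add, ha, hb]

end QuasiHopfAlgebra

section NestIntertwines

variable {k H : Type*} [Field k] [Ring H] [Algebra k H] (Q : QuasiBialgebra k H)
  {R : Type*} [Ring R] [Algebra k R] (i j l m : H →ₐ[k] R) [Comm i j] [Comm i l] [Comm i m]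
  [Comm j l] [Comm j m] [Comm l m]

instance intw_nest : Intw (Q.nest i j l m) (Q.cv (Q.cv i j) (Q.cv l m))
    (Q.cv (Q.cv i (Q.cv j l)) m) :=
  Intw.mul (F' := Q.cv (Q.cv (Q.cv i j) l) m) inferInstance inferInstance

instance intw_unfold : Intw (Q.unfold i j l m) (Q.cv (Q.cv i (Q.cv j l)) m)
    (Q.cv (Q.cv i j) (Q.cv l m)) :=
  Intw.mul (F' := Q.cv (Q.cv (Q.cv i j) l) m) inferInstance inferInstance

end NestIntertwines

namespace QuasiHopfAlgebra

variable {k H : Type*} [Field k] [Ring H] [Algebra k H] (Q : QuasiHopfAlgebra k H)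

/-- The element `γ` is an evaluation for the tensor square of the dual: it absorbs
`(S ⊗ S)Δ^cop(h₁) _ Δ(h₂)`. -/
theorem capΔ_γ (h : H) : mulMap (LinearMap.mulRight k Q.γ ∘ₗ Q.SSΔcop) Q.Δ.toLinearMap (Q.Δ h) =
    Q.ε h • Q.γ := by
  rw [γ_eq]
  set N := Q.nest (inr.comp inl) (inl.comp inl) (inl.comp inr) (inr.comp inr) with hN
  have key : ∀ y : H ⊗[k] H, mulMap (LinearMap.mulRight k (Q.capcap N.val) ∘ₗ Q.SSΔcop)
      Q.Δ.toLinearMap y = Q.capcap (N.val * pair (Q.cv (inr.comp inl) (inl.comp inl))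
        (Q.cv (inl.comp inr) (inr.comp inr)) y) := fun y => by
    induction y with
    | zero => simp
    | tmul a b =>
      rw [pair_tmul, AlgHom.comp_apply, AlgHom.comp_apply, ← SS_mul_capcap]
      rfl
    | add a b ha hb => simp only [map_add, mul_add, ha, hb]
  have hn := (intw_nest Q.toQuasiBialgebra (inr.comp inl) (inl.comp inl) (inl.comp inr)
    (inr.comp (inr : H →ₐ[k] H ⊗[k] H) : H →ₐ[k] (H ⊗[k] H) ⊗[k] (H ⊗[k] H))).intw h
  rw [key]
  refine (congrArg Q.capcap hn).trans ?_
  rw [LRed.red (F' := Q.cv (inr.comp inl) (inr.comp inr)), LRed.red (F' := Q.e _)]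
  simp [Algebra.algebraMap_eq_smul_one]
  rfl

theorem cupΔ_δ₀ (h : H) : mulMap (LinearMap.mulRight k Q.δ₀ ∘ₗ Q.Δ.toLinearMap) Q.SSΔcop (Q.Δ h) =
    Q.ε h • Q.δ₀ := by
  rw [δ₀_eq]
  set N := Q.unfold (inl.comp inl) (inr.comp inl) (inr.comp inr) (inl.comp inr) with hN
  have key : ∀ y : H ⊗[k] H, mulMap (LinearMap.mulRight k (Q.cupcup N.val) ∘ₗ Q.Δ.toLinearMap)
      Q.SSΔcop y = Q.cupcup (pair (Q.cv (inl.comp inl) (inr.comp inl))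
        (Q.cv (inr.comp inr) (inl.comp inr)) y * N.val) := fun y => by
    induction y with
    | zero => simp
    | tmul a b =>
      rw [pair_tmul, AlgHom.comp_apply, AlgHom.comp_apply, ← mul_cupcup_SS]
      rfl
    | add a b ha hb => simp only [map_add, add_mul, ha, hb]
  have hn := (intw_unfold Q.toQuasiBialgebra (inl.comp inl) (inr.comp inl) (inr.comp inr)
    (inl.comp (inr : H →ₐ[k] H ⊗[k] H) : H →ₐ[k] (H ⊗[k] H) ⊗[k] (H ⊗[k] H))).intw h
  rw [key]
  refine (congrArg Q.cupcup hn.symm).trans ?_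
  rw [RRed.red (F' := Q.cv (inl.comp inl) (inl.comp inr)), RRed.red (F' := Q.e _)]
  simp [Algebra.algebraMap_eq_smul_one]
  rfl

end QuasiHopfAlgebra

section NestMap

variable {k H : Type*} [Field k] [Ring H] [Algebra k H] (Q : QuasiBialgebra k H)
  {R R' : Type*} [Ring R] [Algebra k R] [Ring R'] [Algebra k R'] (i j l m : H →ₐ[k] R)
  [Comm i j] [Comm i l] [Comm i m] [Comm j l] [Comm j m] [Comm l m] (g : R →ₐ[k] R')

theorem ap_P : ap g (Q.P i j l) = Q.P (g.comp i) (g.comp j) (g.comp l) := Units.ext <| by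
  simp only [ap_val, apply_pair, comp_pair]

theorem ap_nest : ap g (Q.nest i j l m) = Q.nest (g.comp i) (g.comp j) (g.comp l) (g.comp m) := by
  simp only [QuasiBialgebra.nest, map_mul, map_inv, ap_P, Q.comp_cv]

theorem ap_unfold :
    ap g (Q.unfold i j l m) = Q.unfold (g.comp i) (g.comp j) (g.comp l) (g.comp m) := by
  simp only [QuasiBialgebra.unfold, map_mul, map_inv, ap_P, Q.comp_cv]

end NestMap

namespace QuasiHopfAlgebra

variable {k H : Type*} [Field k] [Ring H] [Algebra k H] (Q : QuasiHopfAlgebra k H)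

theorem mul_cupcup (u : H ⊗[k] H) (t : (H ⊗[k] H) ⊗[k] (H ⊗[k] H)) :
    u * Q.cupcup t = Q.cupcup (pair (inl.comp inl) (inr.comp inl) u * t) := by
  have := Q.mul_cupcup_SS u 1 t
  rwa [SS_one, mul_one, map_one, mul_one] at this

theorem SS_mul_capcap' (u : H ⊗[k] H) (t : (H ⊗[k] H) ⊗[k] (H ⊗[k] H)) :
    Q.SS u * Q.capcap t = Q.capcap (t * pair (inr.comp inl) (inl.comp inl) u) := by
  have := Q.SS_mul_capcap u 1 t
  rwa [mul_one, map_one, mul_one] at this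

/-- The first position in `H ⊗ (H ⊗ H)`. -/
abbrev pos₁ (k H : Type*) [Field k] [Ring H] [Algebra k H] : H →ₐ[k] H ⊗[k] (H ⊗[k] H) := inl
/-- The second position in `H ⊗ (H ⊗ H)`. -/
abbrev pos₂ (k H : Type*) [Field k] [Ring H] [Algebra k H] : H →ₐ[k] H ⊗[k] (H ⊗[k] H) :=
  inr.comp inl
/-- The third position in `H ⊗ (H ⊗ H)`. -/
abbrev pos₃ (k H : Type*) [Field k] [Ring H] [Algebra k H] : H →ₐ[k] H ⊗[k] (H ⊗[k] H) :=
  inr.comp inr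

local notation "p₁" => pos₁ k H
local notation "p₂" => pos₂ k H
local notation "p₃" => pos₃ k H

theorem pair_p : pair p₁ (pair p₂ p₃) = AlgHom.id k _ := by
  refine AlgHom.ext fun t => ?_
  induction t using tensor_induction₃ with
  | zero => simp
  | tmul x y z => simp
  | add a b ha hb => simp only [map_add, ha, hb]

theorem pair_comp_p {R : Type*} [Ring R] [Algebra k R] (g : H ⊗[k] (H ⊗[k] H) →ₐ[k] R) :
    pair (g.comp p₁) (pair (g.comp p₂) (g.comp p₃)) = g := by
  have h : g.comp (pair p₁ (pair p₂ p₃)) = g := by rw [pair_p, AlgHom.comp_id]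
  rw [← h]
  simp only [comp_pair, ← AlgHom.comp_assoc, pair_comp_includeLeft, pair_comp_padLeft]

theorem cupcup_mul_capcap (s t : (H ⊗[k] H) ⊗[k] (H ⊗[k] H)) :
    Q.cupcup s * Q.capcap t = TensorProduct.map Q.std.zigMap Q.std.zigMap
      (pair (pair (inl.comp p₂) (inl.comp p₃)) (pair (inr.comp p₂) (inr.comp p₃)) t *
        pair (pair (inl.comp p₁) (inl.comp p₂)) (pair (inr.comp p₁) (inr.comp p₂)) s) := by
  induction t using tensor_induction₂₂ with
  | zero => simp
  | tmul x y z w =>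
    induction s using tensor_induction₂₂ with
    | zero => simp
    | tmul a b c d => simp [std, S_mul, mul_assoc]
    | add a b ha hb => simp only [mul_add, add_mul, map_add, ha, hb]
  | add a b ha hb => simp only [mul_add, add_mul, map_add, ha, hb]

theorem capcap_mul_cupcup (s t : (H ⊗[k] H) ⊗[k] (H ⊗[k] H)) :
    Q.capcap s * Q.cupcup t = TensorProduct.map Q.std.zagMap Q.std.zagMap
      (pair (pair (inl.comp p₁) (inl.comp p₂)) (pair (inr.comp p₁) (inr.comp p₂)) s *
        pair (pair (inl.comp p₂) (inl.comp p₃)) (pair (inr.comp p₂) (inr.comp p₃)) t) := by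
  induction t using tensor_induction₂₂ with
  | zero => simp
  | tmul x y z w =>
    induction s using tensor_induction₂₂ with
    | zero => simp
    | tmul a b c d => simp [std, mul_assoc]
    | add a b ha hb => simp only [add_mul, map_add, ha, hb]
  | add a b ha hb => simp only [mul_add, map_add, ha, hb]

section Abstract

variable {R : Type*} [Ring R] [Algebra k R] (a₁ a₂ a₃ a₄ a₅ a₆ : H →ₐ[k] R)
    [Comm a₁ a₂] [Comm a₁ a₃] [Comm a₁ a₄] [Comm a₁ a₅] [Comm a₁ a₆] [Comm a₂ a₃] [Comm a₂ a₄]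
    [Comm a₂ a₅] [Comm a₂ a₆] [Comm a₃ a₄] [Comm a₃ a₅] [Comm a₃ a₆] [Comm a₄ a₅] [Comm a₄ a₆]
    [Comm a₅ a₆]
  (ζ : R →ₗ[k] H ⊗[k] H)

theorem zigΔ_eq (hζ : ∀ s t : (H ⊗[k] H) ⊗[k] (H ⊗[k] H), 
      Q.cupcup s * Q.capcap t = ζ (pair (pair a₄ a₅) (pair a₃ a₆) t *
        pair (pair a₁ a₄) (pair a₂ a₃) s))
    (t : H ⊗[k] (H ⊗[k] H)) : mulMap (LinearMap.mulRight k Q.δ₀ ∘ₗ Q.Δ.toLinearMap)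
    (mulMap (LinearMap.mulRight k Q.γ ∘ₗ Q.SSΔcop) Q.Δ.toLinearMap) t =
      ζ ((Q.nest a₃ a₄ a₅ a₆).val *
        pair (Q.cv a₁ a₂) (pair (Q.cv a₃ a₄) (Q.cv a₅ a₆)) t * (Q.unfold a₁ a₂ a₃ a₄).val) := by
  induction t using tensor_induction₃ with
  | zero => simp
  | tmul x y z =>
    simp only [mulMap_tmul, LinearMap.comp_apply, LinearMap.mulRight_apply,
      AlgHom.toLinearMap_apply, SSΔcop_apply]
    rw [γ_eq, δ₀_eq, SS_mul_capcap, mul_cupcup, hζ]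
    simp only [map_mul, ← ap_val, ap_nest, ap_unfold, ← AlgHom.comp_assoc, pair_comp_padLeft,
      pair_comp_includeLeft, apply_pair]
    simp only [pair_tmul, AlgHom.comp_apply]
    refine congrArg _ ?_
    have c := (Comm.comm (i := pair a₁ a₂) (j := pair (pair a₃ a₄) (pair a₅ a₆)) (Q.Δ x)
      (Q.Δ y ⊗ₜ Q.Δ z)).eq
    rw [pair_tmul] at c
    rw [mul_assoc, ← mul_assoc (_ * _) (pair a₁ a₂ _), ← c]
    simp only [mul_assoc]
  | add a b ha hb => simp only [mul_add, add_mul, map_add, ha, hb]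

theorem zagΔ_eq (hζ : ∀ s t : (H ⊗[k] H) ⊗[k] (H ⊗[k] H), 
      Q.capcap s * Q.cupcup t = ζ (pair (pair a₂ a₃) (pair a₁ a₄) s *
        pair (pair a₃ a₆) (pair a₄ a₅) t))
    (t : H ⊗[k] (H ⊗[k] H)) : mulMap (LinearMap.mulRight k Q.γ ∘ₗ Q.SSΔcop)
    (mulMap (LinearMap.mulRight k Q.δ₀ ∘ₗ Q.Δ.toLinearMap) Q.SSΔcop) t =
      ζ ((Q.nest a₁ a₂ a₃ a₄).val *
        pair (Q.cv a₁ a₂) (pair (Q.cv a₃ a₄) (Q.cv a₅ a₆)) t * (Q.unfold a₃ a₄ a₅ a₆).val) := by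
  induction t using tensor_induction₃ with
  | zero => simp
  | tmul x y z =>
    simp only [mulMap_tmul, LinearMap.comp_apply, LinearMap.mulRight_apply,
      AlgHom.toLinearMap_apply, SSΔcop_apply]
    rw [γ_eq, δ₀_eq, mul_cupcup_SS, SS_mul_capcap', hζ]
    simp only [map_mul, ← ap_val, ap_nest, ap_unfold, ← AlgHom.comp_assoc, pair_comp_padLeft,
      pair_comp_includeLeft, apply_pair]
    simp only [pair_tmul, AlgHom.comp_apply]
    refine congrArg _ ?_
    simp only [mul_assoc]
  | add a b ha hb => simp only [mul_add, add_mul, map_add, ha, hb]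

end Abstract

/-- The first zig-zag identity for `((S ⊗ S)Δ^cop, γ, δ₀)` as dual data for `Δ`. -/
theorem zigΔ : mulMap (LinearMap.mulRight k Q.δ₀ ∘ₗ Q.Δ.toLinearMap)
    (mulMap (LinearMap.mulRight k Q.γ ∘ₗ Q.SSΔcop) Q.Δ.toLinearMap) Q.Φ.val = 1 := by
  have h := Q.zigΔ_eq (inl.comp p₁) (inr.comp p₁) (inr.comp p₂) (inl.comp p₂) (inl.comp p₃)
    (inr.comp p₃) (TensorProduct.map Q.std.zigMap Q.std.zigMap) Q.cupcup_mul_capcap Q.Φ.val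
  have h' := zig_coherence Q.toQuasiBialgebra (a₁ := inl.comp p₁) (a₂ := inr.comp p₁)
    (a₃ := inr.comp p₂) (a₄ := inl.comp p₂) (a₅ := inl.comp p₃) (a₆ := inr.comp p₃)
    (TensorProduct.map Q.std.zigMap Q.std.zigMap)
  rw [Units.val_mul, Units.val_mul, ap_val] at h'
  rw [h, h', Units.val_mul, ap_val, ap_val, pair_comp_p, pair_comp_p]
  simp only [Algebra.TensorProduct.includeRight_apply, Algebra.TensorProduct.includeLeft_apply,
    Algebra.TensorProduct.tmul_mul_tmul, one_mul, mul_one, TensorProduct.map_tmul, Q.std.zigMap_Phi]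
  rfl

/-- The second zig-zag identity for `((S ⊗ S)Δ^cop, γ, δ₀)` as dual data for `Δ`. -/
theorem zagΔ : mulMap (LinearMap.mulRight k Q.γ ∘ₗ Q.SSΔcop)
    (mulMap (LinearMap.mulRight k Q.δ₀ ∘ₗ Q.Δ.toLinearMap) Q.SSΔcop) (Q.Φ⁻¹).val = 1 := by
  have h := Q.zagΔ_eq (inr.comp p₁) (inl.comp p₁) (inl.comp p₂) (inr.comp p₂) (inr.comp p₃)
    (inl.comp p₃) (TensorProduct.map Q.std.zagMap Q.std.zagMap) Q.capcap_mul_cupcup (Q.Φ⁻¹).val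
  have h' := zag_coherence Q.toQuasiBialgebra (a₁ := inr.comp p₁) (a₂ := inl.comp p₁)
    (a₃ := inl.comp p₂) (a₄ := inr.comp p₂) (a₅ := inr.comp p₃) (a₆ := inl.comp p₃)
    (TensorProduct.map Q.std.zagMap Q.std.zagMap)
  rw [Units.val_mul, Units.val_mul, ap_inv_val] at h'
  rw [h, h', Units.val_mul, ap_inv_val, ap_inv_val, pair_comp_p, pair_comp_p]
  simp only [Algebra.TensorProduct.includeRight_apply, Algebra.TensorProduct.includeLeft_apply,
    Algebra.TensorProduct.tmul_mul_tmul, one_mul, mul_one, TensorProduct.map_tmul,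
    Q.std.zagMap_Phi_inv]
  rfl

end QuasiHopfAlgebra

namespace QuasiHopfAlgebra

variable {k H : Type*} [Field k] [Ring H] [Algebra k H] (Q : QuasiHopfAlgebra k H)

/-- The dual of a tensor product: `h ↦ (S ⊗ S)(Δ^cop(h))` with `γ` and `δ₀` is dual to `Δ`. -/
def tensorDual : DualData Q.toQuasiBialgebra Q.Δ where
  S := Q.SSΔcop
  α := Q.γ
  β := Q.δ₀
  S_one := by rw [SSΔcop_apply, map_one, SS_one]
  S_mul x y := by rw [SSΔcop_apply, map_mul, SS_mul]; rfl
  ev_alpha := Q.capΔ_γ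
  ev_beta := Q.cupΔ_δ₀
  zig := Q.zigΔ
  zag := Q.zagΔ

/-- The image under `Δ` of the antipode data. -/
def imageDual : DualData Q.toQuasiBialgebra Q.Δ := Q.std.map Q.Δ

/-- The Drinfeld twist compares two duals of `Δ`: the image of the antipode under `Δ`, and the
tensor square of the antipode. -/
theorem f_eq_comparison : Q.f = DualData.comparison Q.imageDual Q.tensorDual := by
  have h : Q.Δ.toLinearMap ∘ₗ Q.evβ = Q.imageDual.cupMap Q.imageDual.S :=
    TensorProduct.ext' fun x y => by simp [DualData.cupMap_tmul, imageDual, DualData.map, std]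
  rw [f, h]; rfl

theorem fInv_eq_comparison : Q.fInv = DualData.comparison Q.tensorDual Q.imageDual := by
  have key : ∀ t : H ⊗[k] (H ⊗[k] H), mulMap (LinearMap.mulRight k Q.δ₀ ∘ₗ Q.Δ.toLinearMap ∘ₗ Q.evα)
      Q.SSΔcop ((TensorProduct.assoc k H H H).symm t) =
      Q.imageDual.capMap (Q.tensorDual.cupMap Q.tensorDual.S) t := fun t => by
    induction t using tensor_induction₃ with
    | zero => simp
    | tmul x y z =>
      simp [mulMap_tmul, DualData.cupMap_tmul, DualData.capMap_tmul, imageDual, tensorDual,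
        DualData.map, std, mul_assoc]
    | add a b ha hb => simp only [map_add, ha, hb]
  rw [fInv, key]; rfl

theorem fInv_mul_f : Q.fInv * Q.f = 1 := by
  rw [f_eq_comparison, fInv_eq_comparison]
  exact Q.imageDual.comparison_mul_comparison Q.tensorDual

theorem f_mul_fInv : Q.f * Q.fInv = 1 := by
  rw [f_eq_comparison, fInv_eq_comparison]
  exact Q.tensorDual.comparison_mul_comparison Q.imageDual

theorem f_mul_Δ_S (h : H) : Q.f * Q.Δ (Q.S h) = Q.SS (Q.Δ h) * Q.f := by
  rw [f_eq_comparison]; exact Q.imageDual.comparison_mul_S Q.tensorDual h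

theorem f_mul_Δ_α : Q.f * Q.Δ Q.α = Q.γ := by
  rw [f_eq_comparison]; exact Q.imageDual.comparison_mul_alpha Q.tensorDual

theorem Δ_β_mul_fInv : Q.Δ Q.β * Q.fInv = Q.δ₀ := by
  rw [fInv_eq_comparison]; exact Q.tensorDual.beta_mul_comparison Q.imageDual

theorem fInv_mul_SS (h : H) : Q.fInv * Q.SS (Q.Δ h) = Q.Δ (Q.S h) * Q.fInv := by
  rw [fInv_eq_comparison]; exact (Q.tensorDual.comparison_mul_S Q.imageDual h)

end QuasiHopfAlgebra

/-! ### The twisted cocycle identity of the Drinfeld twist -/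

section TwistCoherence

variable {k H : Type*} [Field k] [Ring H] [Algebra k H] (Q : QuasiBialgebra k H)
  {R : Type*} [Ring R] [Algebra k R] {E : Type*} [AddCommGroup E] [Module k E]
  (a₁ a₂ a₃ a₄ a₅ a₆ : H →ₐ[k] R)
    [Comm a₁ a₂] [Comm a₁ a₃] [Comm a₁ a₄] [Comm a₁ a₅] [Comm a₁ a₆] [Comm a₂ a₃] [Comm a₂ a₄]
    [Comm a₂ a₅] [Comm a₂ a₆] [Comm a₃ a₄] [Comm a₃ a₅] [Comm a₃ a₆] [Comm a₄ a₅] [Comm a₄ a₆]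
    [Comm a₅ a₆]

theorem twist_word_left :
    Q.nest a₁ a₂ a₅ a₆ * Q.nest (Q.cv a₁ a₂) a₃ a₄ (Q.cv a₅ a₆) * Q.P a₄ a₅ a₆ =
    Q.nest a₁ a₂ a₅ a₆ * (Q.P (Q.cv (Q.cv a₁ a₂) (Q.cv a₃ a₄)) a₅ a₆ *
      (Q.P (Q.cv a₁ a₂) a₃ a₄ * (Q.P (Q.cv (Q.cv a₁ a₂) a₃) a₄ a₅)⁻¹ *
        (Q.P (Q.cv (Q.cv a₁ a₂) a₃) (Q.cv a₄ a₅) a₆)⁻¹)) := by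
  have n1 := Q.P_conj' (Q.P (Q.cv a₁ a₂) a₃ a₄) (i := Q.cv (Q.cv (Q.cv a₁ a₂) a₃) a₄)
    (i' := Q.cv (Q.cv a₁ a₂) (Q.cv a₃ a₄)) (j := a₅) (j' := a₅) (l := a₆) (l' := a₆)
  rw [QuasiBialgebra.nest, QuasiBialgebra.nest, n1,
    Q.pentagon_outer_right (Q.cv (Q.cv a₁ a₂) a₃) a₄ a₅ a₆]
  group

theorem twist_word_right :
    Q.nest a₂ a₃ a₄ a₅ * Q.nest a₁ (Q.cv a₂ a₃) (Q.cv a₄ a₅) a₆ * Q.P a₁ a₂ a₃ =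
    Q.P a₁ (Q.cv a₂ (Q.cv a₃ a₄)) a₅ * (Q.P a₁ a₂ (Q.cv a₃ a₄) *
      (Q.P (Q.cv a₁ a₂) a₃ a₄ * (Q.P (Q.cv (Q.cv a₁ a₂) a₃) a₄ a₅)⁻¹ *
        (Q.P (Q.cv (Q.cv a₁ a₂) a₃) (Q.cv a₄ a₅) a₆)⁻¹)) := by
  have n1 := Q.P_conj' (Q.P a₁ a₂ a₃) (i := Q.cv (Q.cv a₁ a₂) a₃)
    (i' := Q.cv a₁ (Q.cv a₂ a₃)) (j := Q.cv a₄ a₅) (j' := Q.cv a₄ a₅) (l := a₆) (l' := a₆)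
  have n2 := Q.P_conj' (Q.P a₁ a₂ a₃) (i := Q.cv (Q.cv a₁ a₂) a₃)
    (i' := Q.cv a₁ (Q.cv a₂ a₃)) (j := a₄) (j' := a₄) (l := a₅) (l' := a₅)
  have n3 := Q.P_conj' (Q.P a₂ a₃ a₄) (i := a₁) (i' := a₁) (j := Q.cv (Q.cv a₂ a₃) a₄)
    (j' := Q.cv a₂ (Q.cv a₃ a₄)) (l := a₅) (l' := a₅)
  rw [QuasiBialgebra.nest, QuasiBialgebra.nest, n1,
    Q.pentagon_outer_right a₁ (Q.cv a₂ a₃) a₄ a₅, n2, n3, Q.pentagon_outer_right a₁ a₂ a₃ a₄]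
  group

variable {a₁ a₂ a₃ a₄ a₅ a₆} (ζ : R →ₗ[k] E)

/-- Two ways of nesting three contractions around each other differ by the reassociators of the
outer letters, once the innermost pair `(3, 4)` is contracted. -/
theorem twist_coherence [LRed ζ (Q.cv a₃ a₄) (Q.e R)] :
    ζ (Q.nest a₁ a₂ a₅ a₆ * Q.nest (Q.cv a₁ a₂) a₃ a₄ (Q.cv a₅ a₆) * Q.P a₄ a₅ a₆ : Rˣ) =
    ζ (Q.nest a₂ a₃ a₄ a₅ * Q.nest a₁ (Q.cv a₂ a₃) (Q.cv a₄ a₅) a₆ * Q.P a₁ a₂ a₃ : Rˣ) := by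
  rw [twist_word_left, twist_word_right, Q.P_lred _ _ _ a₁ a₂ a₅]
  have i1 : LRed (ζ ∘ₗ LinearMap.mulLeft k (Q.P a₁ a₂ a₅ : R)) (Q.cv a₃ a₄) (Q.e R) :=
    LRed.mulLeft _
  have h1 := Q.P_lred (ζ := ζ ∘ₗ LinearMap.mulLeft k (Q.P a₁ a₂ a₅ : R))
    a₁ a₂ (Q.cv a₃ a₄) a₁ a₂ (Q.e R)
  rw [Q.P_right] at h1
  simp only [LinearMap.comp_apply, LinearMap.mulLeft_apply, ← Units.val_mul, one_mul] at h1
  rw [h1]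
  have i2 : LRed (ζ ∘ₗ LinearMap.mulLeft k (Q.nest a₁ a₂ a₅ a₆ : R)) (Q.cv a₃ a₄) (Q.e R) :=
    LRed.mulLeft (hu := by unfold QuasiBialgebra.nest; infer_instance)
      (hu' := by unfold QuasiBialgebra.nest; infer_instance) _
  have h2 := Q.P_lred (ζ := ζ ∘ₗ LinearMap.mulLeft k (Q.nest a₁ a₂ a₅ a₆ : R))
    (Q.cv (Q.cv a₁ a₂) (Q.cv a₃ a₄)) a₅ a₆ (Q.cv a₁ a₂) a₅ a₆
  simp only [LinearMap.comp_apply, LinearMap.mulLeft_apply, ← Units.val_mul] at h2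
  rw [h2, QuasiBialgebra.nest, ← mul_assoc _ (Q.P (Q.cv a₁ a₂) a₅ a₆), inv_mul_cancel_right]

end TwistCoherence

namespace QuasiHopfAlgebra

variable {k H : Type*} [Field k] [Ring H] [Algebra k H] (Q : QuasiHopfAlgebra k H)

/-- `x ⊗ y ⊗ z ↦ S(z) ⊗ S(y) ⊗ S(x)`. -/
def SSS : H ⊗[k] (H ⊗[k] H) →ₗ[k] H ⊗[k] (H ⊗[k] H) :=
  (TensorProduct.assoc k H H H).toLinearMap ∘ₗ TensorProduct.map Q.SS Q.S ∘ₗ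
    (TensorProduct.comm k H (H ⊗[k] H)).toLinearMap

@[simp] theorem SSS_tmul (x y z : H) : Q.SSS (x ⊗ₜ (y ⊗ₜ z)) = Q.S z ⊗ₜ (Q.S y ⊗ₜ Q.S x) := rfl

theorem SSS_mul (s t : H ⊗[k] (H ⊗[k] H)) : Q.SSS (s * t) = Q.SSS t * Q.SSS s := by
  induction s using tensor_induction₃ with
  | zero => simp
  | tmul x y z =>
    induction t using tensor_induction₃ with
    | zero => simp
    | tmul a b c => simp [S_mul]
    | add a b ha hb => simp only [mul_add, add_mul, map_add, ha, hb]
  | add a b ha hb => simp only [mul_add, add_mul, map_add, ha, hb]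

local notation "p₁" => pos₁ k H
local notation "p₂" => pos₂ k H
local notation "p₃" => pos₃ k H

theorem SSS_pair₁₂ (t : H ⊗[k] H) : Q.SSS (pair p₁ p₂ t) = pair p₂ p₃ (Q.SS t) := by
  induction t with
  | zero => simp
  | tmul a b => simp [S_one]
  | add a b ha hb => simp only [map_add, ha, hb]

theorem SSS_pair₂₃ (t : H ⊗[k] H) : Q.SSS (pair p₂ p₃ t) = pair p₁ p₂ (Q.SS t) := by
  induction t with
  | zero => simp
  | tmul a b => simp [S_one]
  | add a b ha hb => simp only [map_add, ha, hb]

theorem SSS_p₁ (h : H) : Q.SSS (p₁ h) = p₃ (Q.S h) := by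
  simp [Algebra.TensorProduct.one_def, S_one]

theorem SSS_p₃ (h : H) : Q.SSS (p₃ h) = p₁ (Q.S h) := by
  simp [Algebra.TensorProduct.one_def, S_one]

theorem p₁_comm (b : H) (x : H ⊗[k] H) : p₁ b * pair p₂ p₃ x = pair p₂ p₃ x * p₁ b :=
  Comm.comm b x

theorem p₃_comm (b : H) (x : H ⊗[k] H) : p₃ b * pair p₁ p₂ x = pair p₁ p₂ x * p₃ b :=
  Comm.comm b x

theorem f₂₃_mul (y : H ⊗[k] H) :
    pair p₂ p₃ Q.f * pair p₁ (Q.cv p₂ p₃) (Q.SS y) =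
      Q.SSS (pair (Q.cv p₁ p₂) p₃ y) * pair p₂ p₃ Q.f := by
  induction y with
  | zero => simp
  | tmul a b =>
    change _ * pair p₁ (Q.cv p₂ p₃) (Q.S b ⊗ₜ Q.S a) = _
    rw [pair_tmul, pair_tmul, SSS_mul, SSS_p₃]
    change pair p₂ p₃ Q.f * (p₁ (Q.S b) * pair p₂ p₃ (Q.Δ (Q.S a))) =
      p₁ (Q.S b) * Q.SSS (pair p₁ p₂ (Q.Δ a)) * pair p₂ p₃ Q.f
    rw [SSS_pair₁₂, ← mul_assoc, ← p₁_comm, mul_assoc, ← map_mul, f_mul_Δ_S, map_mul, mul_assoc]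
  | add a b ha hb => simp only [mul_add, add_mul, map_add, ha, hb]

theorem f₁₂_mul (y : H ⊗[k] H) :
    pair p₁ p₂ Q.f * pair (Q.cv p₁ p₂) p₃ (Q.SS y) =
      Q.SSS (pair p₁ (Q.cv p₂ p₃) y) * pair p₁ p₂ Q.f := by
  induction y with
  | zero => simp
  | tmul a b =>
    change _ * pair (Q.cv p₁ p₂) p₃ (Q.S b ⊗ₜ Q.S a) = _
    rw [pair_tmul, pair_tmul, SSS_mul, SSS_p₁]
    change pair p₁ p₂ Q.f * (pair p₁ p₂ (Q.Δ (Q.S b)) * p₃ (Q.S a)) =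
      Q.SSS (pair p₂ p₃ (Q.Δ b)) * p₃ (Q.S a) * pair p₁ p₂ Q.f
    rw [SSS_pair₂₃, ← mul_assoc, ← map_mul, f_mul_Δ_S, map_mul, mul_assoc, mul_assoc, p₃_comm]
  | add a b ha hb => simp only [mul_add, add_mul, map_add, ha, hb]

theorem f_mul_Δ_evα (x y : H) :
    Q.f * Q.Δ (Q.evα (x ⊗ₜ y)) = Q.SS (Q.Δ x) * Q.γ * Q.Δ y := by
  rw [evα_tmul, map_mul, map_mul, ← mul_assoc, ← mul_assoc, f_mul_Δ_S, mul_assoc _ Q.f, f_mul_Δ_α]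

section Abstract

variable {R : Type*} [Ring R] [Algebra k R] (a₁ a₂ a₃ a₄ a₅ a₆ : H →ₐ[k] R)
    [Comm a₁ a₂] [Comm a₁ a₃] [Comm a₁ a₄] [Comm a₁ a₅] [Comm a₁ a₆] [Comm a₂ a₃] [Comm a₂ a₄]
    [Comm a₂ a₅] [Comm a₂ a₆] [Comm a₃ a₄] [Comm a₃ a₅] [Comm a₃ a₆] [Comm a₄ a₅] [Comm a₄ a₆]
    [Comm a₅ a₆]
  (ζ : R →ₗ[k] H ⊗[k] (H ⊗[k] H))

/-- The element `(1 ⊗ f)(id ⊗ Δ)(γ)` as a contraction of a word in six letters. The map `ζ` is meant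
to be the contraction of the three nested pairs of letters `(3, 4)`, `(2, 5)`, `(1, 6)`. -/
theorem f₂₃_mul_γ (hζ : ∀ (s : H ⊗[k] H) (t : (H ⊗[k] H) ⊗[k] (H ⊗[k] H)),
      p₁ (Q.evα s) * pair p₂ p₃ (Q.capcap t) =
        ζ (pair a₃ a₄ s * pair (pair a₂ a₅) (pair a₁ a₆) t))
    (hζ' : ∀ t X, ζ t * X = ζ (t * pair a₄ (pair a₅ a₆) X)) (X : H ⊗[k] (H ⊗[k] H)) :
    pair p₂ p₃ Q.f * pair p₁ (Q.cv p₂ p₃) Q.γ * X =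
      ζ ((Q.nest a₁ a₂ a₅ a₆).val * (Q.nest (Q.cv a₁ a₂) a₃ a₄ (Q.cv a₅ a₆)).val *
        pair a₄ (pair a₅ a₆) X) := by
  have key : ∀ t, pair p₂ p₃ Q.f * pair p₁ (Q.cv p₂ p₃) (Q.capcap t) =
      ζ ((Q.nest a₁ a₂ a₅ a₆).val *
        pair (pair a₃ a₄) (pair (Q.cv a₁ a₂) (Q.cv a₅ a₆)) t) := fun t => by
    induction t using tensor_induction₂₂ with
    | zero => simp
    | tmul x y z w =>
      rw [TensorProduct.map_tmul, pair_tmul]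
      change pair p₂ p₃ Q.f * (_ * pair p₂ p₃ (Q.Δ (Q.evα (z ⊗ₜ w)))) = _
      rw [← mul_assoc, ← p₁_comm, mul_assoc, ← map_mul, f_mul_Δ_evα, γ_eq, SS_mul_capcap, hζ]
      simp only [map_mul, ← ap_val, ap_nest, ← AlgHom.comp_assoc, pair_comp_padLeft,
        pair_comp_includeLeft, apply_pair]
      simp only [pair_tmul, AlgHom.comp_apply]
      have c : Intw (Q.nest a₁ a₂ a₅ a₆) (pair a₃ a₄) (pair a₃ a₄) := by
        unfold QuasiBialgebra.nest; infer_instance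
      have c := c.intw (x ⊗ₜ y)
      rw [pair_tmul] at c
      rw [← mul_assoc, ← c, mul_assoc]
    | add a b ha hb => simp only [mul_add, map_add, ha, hb]
  rw [γ_eq, key, hζ']
  simp only [← ap_val, ap_nest, ← AlgHom.comp_assoc, pair_comp_padLeft, pair_comp_includeLeft]

/-- The counterpart of `f₂₃_mul_γ` for the element `(f ⊗ 1)(Δ ⊗ id)(γ)`. -/
theorem f₁₂_mul_γ (hζ : ∀ (s : H ⊗[k] H) (t : (H ⊗[k] H) ⊗[k] (H ⊗[k] H)),
      pair p₁ p₂ (Q.capcap t) * p₃ (Q.evα s) =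
        ζ (pair (pair a₃ a₄) (pair a₂ a₅) t * pair a₁ a₆ s))
    (hζ' : ∀ t X, Q.SSS X * ζ t = ζ (t * pair a₁ (pair a₂ a₃) X)) (X : H ⊗[k] (H ⊗[k] H)) :
    Q.SSS X * (pair p₁ p₂ Q.f * pair (Q.cv p₁ p₂) p₃ Q.γ) =
      ζ ((Q.nest a₂ a₃ a₄ a₅).val * (Q.nest a₁ (Q.cv a₂ a₃) (Q.cv a₄ a₅) a₆).val *
        pair a₁ (pair a₂ a₃) X) := by
  have key : ∀ t, pair p₁ p₂ Q.f * pair (Q.cv p₁ p₂) p₃ (Q.capcap t) =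
      ζ ((Q.nest a₂ a₃ a₄ a₅).val *
        pair (pair (Q.cv a₂ a₃) (Q.cv a₄ a₅)) (pair a₁ a₆) t) := fun t => by
    induction t using tensor_induction₂₂ with
    | zero => simp
    | tmul x y z w =>
      rw [TensorProduct.map_tmul, pair_tmul]
      change pair p₁ p₂ Q.f * (pair p₁ p₂ (Q.Δ (Q.evα (x ⊗ₜ y))) * _) = _
      rw [← mul_assoc, ← map_mul, f_mul_Δ_evα, γ_eq, SS_mul_capcap, hζ]
      simp only [map_mul, ← ap_val, ap_nest, ← AlgHom.comp_assoc, pair_comp_padLeft,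
        pair_comp_includeLeft, apply_pair]
      simp only [pair_tmul, AlgHom.comp_apply, mul_assoc]
    | add a b ha hb => simp only [mul_add, map_add, ha, hb]
  rw [γ_eq, key, hζ']
  simp only [← ap_val, ap_nest, ← AlgHom.comp_assoc, pair_comp_padLeft, pair_comp_includeLeft]

end Abstract

end QuasiHopfAlgebra

namespace QuasiHopfAlgebra

variable {k H : Type*} [Field k] [Ring H] [Algebra k H] (Q : QuasiHopfAlgebra k H)

local notation "p₁" => pos₁ k H
local notation "p₂" => pos₂ k H
local notation "p₃" => pos₃ k H

section CapThree

/-- `(x ⊗ y) ⊗ ((z ⊗ w) ⊗ (u ⊗ v)) ↦ S(x) α y ⊗ (S(z) α w ⊗ S(u) α v)`. -/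
abbrev capcapcap : (H ⊗[k] H) ⊗[k] ((H ⊗[k] H) ⊗[k] (H ⊗[k] H)) →ₗ[k] H ⊗[k] (H ⊗[k] H) :=
  TensorProduct.map Q.evα Q.capcap

theorem p₁_evα_mul (s : H ⊗[k] H) (t : (H ⊗[k] H) ⊗[k] (H ⊗[k] H)) :
    p₁ (Q.evα s) * pair p₂ p₃ (Q.capcap t) = Q.capcapcap
      (pair (inl.comp inl) (inl.comp inr) s * pair (pair (inr.comp (inl.comp inl))
        (inr.comp (inl.comp inr))) (pair (inr.comp (inr.comp inl)) (inr.comp (inr.comp inr))) t) := by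
  induction s with
  | zero => simp
  | tmul x y =>
    induction t using tensor_induction₂₂ with
    | zero => simp
    | tmul a b c d => simp
    | add a b ha hb => simp only [mul_add, map_add, ha, hb]
  | add a b ha hb => simp only [add_mul, map_add, ha, hb]

theorem pair_capcap_mul (s : H ⊗[k] H) (t : (H ⊗[k] H) ⊗[k] (H ⊗[k] H)) :
    pair p₁ p₂ (Q.capcap t) * p₃ (Q.evα s) = Q.capcapcap
      (pair (pair (inl.comp inl) (inl.comp inr)) (pair (inr.comp (inl.comp inl))
        (inr.comp (inl.comp inr))) t * pair (inr.comp (inr.comp inl)) (inr.comp (inr.comp inr)) s) := by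
  induction s with
  | zero => simp
  | tmul x y =>
    induction t using tensor_induction₂₂ with
    | zero => simp
    | tmul a b c d => simp
    | add a b ha hb => simp only [add_mul, map_add, ha, hb]
  | add a b ha hb => simp only [mul_add, map_add, ha, hb]

/-- Induction on `(X ⊗ X) ⊗ ((X ⊗ X) ⊗ (X ⊗ X))` over pure tensors. -/
theorem tensor_induction₂₂₂ {k X : Type*} [Field k] [Ring X] [Algebra k X]
    {p : (X ⊗[k] X) ⊗[k] ((X ⊗[k] X) ⊗[k] (X ⊗[k] X)) → Prop}
    (t : (X ⊗[k] X) ⊗[k] ((X ⊗[k] X) ⊗[k] (X ⊗[k] X)))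
    (zero : p 0) (tmul : ∀ x y z w u v, p ((x ⊗ₜ y) ⊗ₜ ((z ⊗ₜ w) ⊗ₜ (u ⊗ₜ v))))
    (add : ∀ a b, p a → p b → p (a + b)) : p t := by
  induction t using tensor_induction₃ with
  | zero => exact zero
  | tmul x y z =>
    induction x with
    | zero => simpa using zero
    | tmul x x' =>
      induction y with
      | zero => simpa using zero
      | tmul y y' =>
        induction z with
        | zero => simpa using zero
        | tmul z z' => exact tmul _ _ _ _ _ _
        | add a b ha hb => simp only [TensorProduct.tmul_add]; exact add _ _ ha hb
      | add a b ha hb =>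
        simp only [TensorProduct.tmul_add, TensorProduct.add_tmul]; exact add _ _ ha hb
    | add a b ha hb => simp only [TensorProduct.add_tmul]; exact add _ _ ha hb
  | add a b ha hb => exact add _ _ ha hb

theorem capcapcap_mul (t : (H ⊗[k] H) ⊗[k] ((H ⊗[k] H) ⊗[k] (H ⊗[k] H)))
    (X : H ⊗[k] (H ⊗[k] H)) : Q.capcapcap t * X = Q.capcapcap (t *
      pair (inl.comp inr) (pair (inr.comp (inl.comp inr)) (inr.comp (inr.comp inr))) X) := by
  induction t using tensor_induction₂₂₂ with
  | zero => simp
  | tmul x y z w u v =>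
    induction X using tensor_induction₃ with
    | zero => simp
    | tmul a b c => simp [mul_assoc]
    | add a b ha hb => simp only [mul_add, map_add, ha, hb]
  | add a b ha hb => simp only [add_mul, map_add, ha, hb]

theorem SSS_mul_capcapcap (t : (H ⊗[k] H) ⊗[k] ((H ⊗[k] H) ⊗[k] (H ⊗[k] H)))
    (X : H ⊗[k] (H ⊗[k] H)) : Q.SSS X * Q.capcapcap t = Q.capcapcap (t *
      pair (inr.comp (inr.comp inl)) (pair (inr.comp (inl.comp inl)) (inl.comp inl)) X) := by
  induction t using tensor_induction₂₂₂ with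
  | zero => simp
  | tmul x y z w u v =>
    induction X using tensor_induction₃ with
    | zero => simp
    | tmul a b c => simp [S_mul, mul_assoc]
    | add a b ha hb => simp only [mul_add, add_mul, map_add, ha, hb]
  | add a b ha hb => simp only [mul_add, add_mul, map_add, ha, hb]

instance lred_capcapcap :
    LRed Q.capcapcap (Q.cv (inl.comp inl) (inl.comp inr)) (Q.e _) := ⟨fun t h => by
  induction t with
  | zero => simp
  | tmul a b =>
    have h1 := Q.lred_evα.red a h
    have h2 : ∀ y : H ⊗[k] H, Q.capcapcap (pair (inl.comp inl) (inl.comp inr) y * (a ⊗ₜ b)) =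
        Q.evα (y * a) ⊗ₜ Q.capcap b := fun y => by
      induction y with
      | zero => simp
      | tmul c d => simp
      | add c d hc hd => simp only [add_mul, map_add, hc, hd, TensorProduct.add_tmul]
    rw [AlgHom.comp_apply, h2]
    have h3 : Q.Δ h = Q.cv inl inr h := by rw [AlgHom.comp_apply, pair_inl_inr]; rfl
    rw [h3, h1]
    simp [Algebra.algebraMap_eq_smul_one, TensorProduct.smul_tmul']
  | add a b ha hb => simp only [mul_add, map_add, ha, hb]⟩

/-- The value on `α` of the two sides of the twisted cocycle identity; see `f_cocycle`. -/
theorem twist_γ : pair p₂ p₃ Q.f * pair p₁ (Q.cv p₂ p₃) Q.γ * Q.Φ.val =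
    Q.SSS Q.Φ.val * (pair p₁ p₂ Q.f * pair (Q.cv p₁ p₂) p₃ Q.γ) := by
  rw [Q.f₂₃_mul_γ (inr.comp (inr.comp inl)) (inr.comp (inl.comp inl)) (inl.comp inl)
    (inl.comp inr) (inr.comp (inl.comp inr)) (inr.comp (inr.comp inr)) Q.capcapcap
    Q.p₁_evα_mul Q.capcapcap_mul,
    Q.f₁₂_mul_γ (inr.comp (inr.comp inl)) (inr.comp (inl.comp inl)) (inl.comp inl)
    (inl.comp inr) (inr.comp (inl.comp inr)) (inr.comp (inr.comp inr)) Q.capcapcap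
    Q.pair_capcap_mul Q.SSS_mul_capcapcap]
  exact twist_coherence Q.toQuasiBialgebra Q.capcapcap

end CapThree

theorem intw_Φ (h : H) : Q.Φ.val * Q.cv (Q.cv p₁ p₂) p₃ h = Q.cv p₁ (Q.cv p₂ p₃) h * Q.Φ.val := by
  have := (Q.intw_P p₁ p₂ p₃).intw h
  rwa [ap_val, pair_p] at this

theorem intw_Φ_inv (h : H) :
    (Q.Φ⁻¹).val * Q.cv p₁ (Q.cv p₂ p₃) h = Q.cv (Q.cv p₁ p₂) p₃ h * (Q.Φ⁻¹).val := by
  rw [Units.inv_mul_eq_iff_eq_mul, ← mul_assoc, intw_Φ, mul_assoc, Units.mul_inv, mul_one]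

/-- The Drinfeld twist makes `S` anti-comonoidal: it transforms the reassociator into its image
under the antipode. -/
theorem f_cocycle : pair p₂ p₃ Q.f * pair p₁ (Q.cv p₂ p₃) Q.f * Q.Φ.val =
    Q.SSS Q.Φ.val * (pair p₁ p₂ Q.f * pair (Q.cv p₁ p₂) p₃ Q.f) := by
  rw [← Units.eq_mul_inv_iff_mul_eq]
  have hS : ∀ h, (Q.std.map (Q.cv p₁ (Q.cv p₂ p₃))).S h = pair p₁ (Q.cv p₂ p₃) (Q.Δ (Q.S h)) :=
    fun h => rfl
  have hα : (Q.std.map (Q.cv p₁ (Q.cv p₂ p₃))).α = pair p₁ (Q.cv p₂ p₃) (Q.Δ Q.α) := rfl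
  have hG : ∀ h, pair (Q.cv p₁ p₂) p₃ (Q.Δ h) = Q.cv (Q.cv p₁ p₂) p₃ h := fun h => rfl
  have hF : ∀ h, pair p₁ (Q.cv p₂ p₃) (Q.Δ h) = Q.cv p₁ (Q.cv p₂ p₃) h := fun h => rfl
  -- Both sides, times `Φ⁻¹`, intertwine the same two maps, so it suffices to compare them on `α`.
  refine DualData.eq_of_intertwines (Q.std.map (Q.cv p₁ (Q.cv p₂ p₃)))
    (T := Q.SSS ∘ₗ (Q.cv (Q.cv p₁ p₂) p₃).toLinearMap) (fun h => ?_) (fun h => ?_) ?_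
  · rw [hS, mul_assoc, ← map_mul, f_mul_Δ_S, map_mul, ← mul_assoc, f₂₃_mul, mul_assoc, hG]; rfl
  · rw [hS, hF, mul_assoc, intw_Φ_inv, ← mul_assoc, ← hG]
    refine (congrArg (· * (Q.Φ⁻¹).val) (a₂ := Q.SSS (pair (Q.cv p₁ p₂) p₃ (Q.Δ h)) *
      (Q.SSS Q.Φ.val * (pair p₁ p₂ Q.f * pair (Q.cv p₁ p₂) p₃ Q.f))) ?_).trans (mul_assoc _ _ _)
    rw [mul_assoc, mul_assoc, ← map_mul, f_mul_Δ_S, map_mul, ← mul_assoc (pair p₁ p₂ Q.f), f₁₂_mul,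
      mul_assoc, ← mul_assoc, ← SSS_mul, hF, ← intw_Φ, SSS_mul, mul_assoc, hG]
  · rw [hα, mul_assoc, ← map_mul, f_mul_Δ_α, mul_assoc, hF, intw_Φ_inv, ← hG,
      ← mul_assoc, Units.eq_mul_inv_iff_mul_eq, twist_γ, mul_assoc, mul_assoc, ← map_mul, f_mul_Δ_α]

/-! ### Counit normalisations -/

theorem ε_S (h : H) : Q.ε (Q.S h) = Q.ε h := by
  have key : ∀ t, Q.ε (Q.evα t) = Q.ε (Q.S (counitTail Q.ε H t)) := fun t => by
    induction t with
    | zero => simp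
    | tmul x y => simp [counitTail, Q.counit_alpha, mul_comm]
    | add a b ha hb => simp only [map_add, ha, hb]
  have h1 := key (Q.Δ h)
  have h2 : Q.evα (Q.Δ h) = Q.ε h • Q.α := Q.antipode_alpha h
  rw [h2, Q.counit_right] at h1
  simpa [Q.counit_alpha] using h1.symm

theorem ε_Sinv (h : H) : Q.ε (Q.Sinv h) = Q.ε h := by
  rw [← Q.ε_S, S_Sinv]

theorem counitHead_SSΔcop (h : H) : counitHead Q.ε H (Q.SSΔcop h) = Q.S h := by
  have key : ∀ t, counitHead Q.ε H (Q.SS t) = Q.S (counitTail Q.ε H t) := fun t => by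
    induction t with
    | zero => simp
    | tmul x y => simp [counitTail, counitHead, ε_S]
    | add a b ha hb => simp only [map_add, ha, hb]
  rw [SSΔcop_apply, key, Q.counit_right]

theorem counitTail_SSΔcop (h : H) : counitTail Q.ε H (Q.SSΔcop h) = Q.S h := by
  have key : ∀ t, counitTail Q.ε H (Q.SS t) = Q.S (counitHead Q.ε H t) := fun t => by
    induction t with
    | zero => simp
    | tmul x y => simp [counitTail, counitHead, ε_S]
    | add a b ha hb => simp only [map_add, ha, hb]
  rw [SSΔcop_apply, key, Q.counit_left]

theorem counitHead_γ : counitHead Q.ε H Q.γ = Q.α := by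
  have key : ∀ t, counitHead Q.ε H (Q.capcap t) =
      Q.evα (pair (pair (Q.e (H ⊗[k] H)) (Q.e _)) (AlgHom.id k _) t) := fun t => by
    induction t using tensor_induction₂₂ with
    | zero => simp
    | tmul x y z w =>
      simp [counitHead, counitTail, ε_S, Q.counit_alpha, Algebra.algebraMap_eq_smul_one, smul_smul,
        mul_comm]
    | add a b ha hb => simp only [map_add, ha, hb]
  rw [γ_eq, key, ← ap_val, ap_nest]
  simp only [← AlgHom.comp_assoc, pair_comp_padLeft, pair_comp_includeLeft, AlgHom.id_comp]
  rw [QuasiBialgebra.nest, Q.P_mid, Q.P_mid]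
  simp [Algebra.TensorProduct.one_def, S_one]

theorem counitTail_γ : counitTail Q.ε H Q.γ = Q.α := by
  have key : ∀ t, counitTail Q.ε H (Q.capcap t) =
      Q.evα (pair (AlgHom.id k _) (pair (Q.e (H ⊗[k] H)) (Q.e _)) t) := fun t => by
    induction t using tensor_induction₂₂ with
    | zero => simp
    | tmul x y z w =>
      simp [counitTail, ε_S, Q.counit_alpha, Algebra.algebraMap_eq_smul_one, mul_smul]
      first | done | rw [smul_comm]
    | add a b ha hb => simp only [map_add, ha, hb]
  rw [γ_eq, key, ← ap_val, ap_nest]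
  simp only [← AlgHom.comp_assoc, pair_comp_padLeft, pair_comp_includeLeft, AlgHom.id_comp]
  rw [QuasiBialgebra.nest, Q.P_left, Q.P_right]
  simp [Algebra.TensorProduct.one_def, S_one]

theorem counitHead_f : counitHead Q.ε H Q.f = 1 := by
  have key : ∀ t, counitHead Q.ε H (mulMap (LinearMap.mulRight k Q.γ ∘ₗ Q.SSΔcop)
      (Q.Δ.toLinearMap ∘ₗ Q.evβ) t) = Q.std.capMap (Q.std.cupMap Q.S) t := fun t => by
    induction t using tensor_induction₃ with
    | zero => simp
    | tmul x y z =>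
      simp only [mulMap_tmul, LinearMap.comp_apply, LinearMap.mulRight_apply, map_mul,
        counitHead_SSΔcop, counitHead_γ, AlgHom.toLinearMap_apply, Q.counit_left]
      rfl
    | add a b ha hb => simp only [map_add, ha, hb]
  rw [f, key]; exact Q.antipode_reassociator_inv

theorem counitTail_f : counitTail Q.ε H Q.f = 1 := by
  have key : ∀ t, counitTail Q.ε H (mulMap (LinearMap.mulRight k Q.γ ∘ₗ Q.SSΔcop)
      (Q.Δ.toLinearMap ∘ₗ Q.evβ) t) = Q.std.capMap (Q.std.cupMap Q.S) t := fun t => by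
    induction t using tensor_induction₃ with
    | zero => simp
    | tmul x y z =>
      simp only [mulMap_tmul, LinearMap.comp_apply, LinearMap.mulRight_apply, map_mul,
        counitTail_SSΔcop, counitTail_γ, AlgHom.toLinearMap_apply, Q.counit_right]
      rfl
    | add a b ha hb => simp only [map_add, ha, hb]
  rw [f, key]; exact Q.antipode_reassociator_inv

end QuasiHopfAlgebra

/-! ### Letters acting on tensor products of modules -/

section Operators

variable {k : Type*} [Field k] {X Y Z : Type*} [Ring X] [Algebra k X] [Ring Y] [Algebra k Y]
  [Ring Z] [Algebra k Z]
  {V W U : Type*} [AddCommGroup V] [Module k V] [AddCommGroup W] [Module k W] [AddCommGroup U]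
  [Module k U]

/-- A letter acting on the first tensor factor. -/
def hd (F : X →ₐ[k] Module.End k V) : X →ₐ[k] Module.End k (V ⊗[k] W) :=
  (Module.End.rTensorAlgHom k V W).comp F

/-- A letter acting on the second tensor factor. -/
def sh (F : X →ₐ[k] Module.End k W) : X →ₐ[k] Module.End k (V ⊗[k] W) :=
  (Module.End.lTensorAlgHom k W V).comp F

@[simp]
theorem hd_tmul (F : X →ₐ[k] Module.End k V) (x : X) (v : V) (w : W) :
    hd F x (v ⊗ₜ[k] w) = F x v ⊗ₜ w := rfl

@[simp]
theorem sh_tmul (F : X →ₐ[k] Module.End k W) (x : X) (v : V) (w : W) :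
    sh F x (v ⊗ₜ[k] w) = v ⊗ₜ F x w := rfl

instance Comm.hd_sh (F : X →ₐ[k] Module.End k V) (G : Y →ₐ[k] Module.End k W) :
    Comm (hd F) (sh G) := ⟨fun x y => TensorProduct.ext' fun v w => by simp⟩

instance Comm.hd_hd (F : X →ₐ[k] Module.End k V) (G : Y →ₐ[k] Module.End k V) [Comm F G] :
    Comm (hd (W := W) F) (hd G) := by unfold hd; infer_instance

instance Comm.sh_sh (F : X →ₐ[k] Module.End k W) (G : Y →ₐ[k] Module.End k W) [Comm F G] :
    Comm (sh (V := V) F) (sh G) := by unfold sh; infer_instance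

theorem sh_pair (F : X →ₐ[k] Module.End k W) (G : Y →ₐ[k] Module.End k W) [Comm F G] :
    sh (V := V) (pair F G) = pair (sh F) (sh G) := by
  simp only [sh, comp_pair]

theorem sh_comp (F : X →ₐ[k] Module.End k W) (f : Y →ₐ[k] X) :
    sh (V := V) (F.comp f) = (sh F).comp f := rfl

theorem sh_scalar (ε : X →ₐ[k] k) :
    sh (V := V) (scalarLetter (Module.End k W) ε) = scalarLetter _ ε := comp_scalarLetter _ _

/-- The linear map `T` is equivariant for the letters `F` and `F'`. -/
class Eqv (T : V →ₗ[k] W) (F : X →ₐ[k] Module.End k V) (F' : X →ₐ[k] Module.End k W) : Prop where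
  eqv : ∀ x v, T (F x v) = F' x (T v)

instance (priority := 900) Eqv.comp (T : V →ₗ[k] W) (F : X →ₐ[k] Module.End k V)
    (F' : X →ₐ[k] Module.End k W) [h : Eqv T F F'] (f : Y →ₐ[k] X) :
    Eqv T (F.comp f) (F'.comp f) := ⟨fun x v => h.eqv (f x) v⟩

instance Eqv.pair (T : V →ₗ[k] W) (F : X →ₐ[k] Module.End k V) (F' : X →ₐ[k] Module.End k W)
    (G : Y →ₐ[k] Module.End k V) (G' : Y →ₐ[k] Module.End k W) [Comm F G] [Comm F' G']
    [h : Eqv T F F'] [h' : Eqv T G G'] : Eqv T (pair F G) (pair F' G') := ⟨fun t v => by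
  induction t with
  | zero => simp
  | tmul x y => simp only [pair_tmul, Module.End.mul_apply, h.eqv, h'.eqv]
  | add a b ha hb => simp only [map_add, LinearMap.add_apply, ha, hb]⟩

instance Eqv.scalar (T : V →ₗ[k] W) (ε : X →ₐ[k] k) :
    Eqv T (scalarLetter _ ε) (scalarLetter _ ε) := ⟨fun x v => by simp⟩

instance Eqv.lTensor_hd (T : W →ₗ[k] U) (F : X →ₐ[k] Module.End k V) :
    Eqv (T.lTensor V) (hd F) (hd F) := ⟨fun x t => by
  induction t with
  | zero => simp
  | tmul v w => simp
  | add a b ha hb => simp only [map_add, ha, hb]⟩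

instance Eqv.lTensor_sh (T : W →ₗ[k] U) (F : X →ₐ[k] Module.End k W) (F' : X →ₐ[k] Module.End k U)
    [h : Eqv T F F'] : Eqv (T.lTensor V) (sh F) (sh F') := ⟨fun x t => by
  induction t with
  | zero => simp
  | tmul v w => simp [h.eqv]
  | add a b ha hb => simp only [map_add, ha, hb]⟩

theorem Eqv.ap {T : V →ₗ[k] W} {F : X →ₐ[k] Module.End k V} {F' : X →ₐ[k] Module.End k W}
    [h : Eqv T F F'] (u : Xˣ) (v : V) :
    T ((QuasiHopf.ap F u).val v) = (QuasiHopf.ap F' u).val (T v) := h.eqv _ _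

theorem Eqv.ap_inv {T : V →ₗ[k] W} {F : X →ₐ[k] Module.End k V} {F' : X →ₐ[k] Module.End k W}
    [h : Eqv T F F'] (u : Xˣ) (v : V) :
    T (((QuasiHopf.ap F u)⁻¹).val v) = ((QuasiHopf.ap F' u)⁻¹).val (T v) := by
  rw [← map_inv, ← map_inv]; exact h.eqv _ _

end Operators

/-! ### Bimodule algebras in letters -/

namespace BimoduleAlgebra

variable {k H : Type*} [Field k] [Ring H] [Algebra k H] {Q : QuasiHopfAlgebra k H}
  {𝒜 : Type*} [NonAssocRing 𝒜] [Module k 𝒜] [SMulCommClass k 𝒜 𝒜] [IsScalarTower k 𝒜 𝒜]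
  (M : BimoduleAlgebra Q.toQuasiBialgebra 𝒜) {W W' : Type*} [AddCommGroup W] [Module k W]
  [AddCommGroup W'] [Module k W']

/-- The left action `h ↦ (φ ↦ h · φ)` as a letter. -/
def L : H →ₐ[k] Module.End k 𝒜 :=
  AlgHom.ofLinearMap M.lact (LinearMap.ext M.one_lact)
    fun x y => LinearMap.ext fun φ => M.mul_lact x y φ

/-- The right action turned into a left action by `S⁻¹`, `h ↦ (φ ↦ φ · S⁻¹(h))`, as a letter. -/
def R : H →ₐ[k] Module.End k 𝒜 :=
  AlgHom.ofLinearMap (M.ract ∘ₗ Q.Sinv)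
    (LinearMap.ext fun φ => by
      rw [LinearMap.comp_apply, Q.Sinv_one, M.one_ract, Module.End.one_apply])
    fun x y => LinearMap.ext fun φ => by
      rw [LinearMap.comp_apply, Q.Sinv_mul, M.mul_ract]; rfl

theorem L_apply (h : H) (φ : 𝒜) : M.L h φ = M.lact h φ := rfl

theorem R_apply (h : H) (φ : 𝒜) : M.R h φ = M.ract (Q.Sinv h) φ := rfl

instance comm_L_R : Comm M.L M.R := ⟨fun _ _ => LinearMap.ext fun _ => M.lact_ract _ _ _⟩

variable (𝒜 W) in
/-- `φ ⊗ φ' ⊗ w ↦ φ φ' ⊗ w`. -/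
def mulHead : 𝒜 ⊗[k] (𝒜 ⊗[k] W) →ₗ[k] 𝒜 ⊗[k] W :=
  (LinearMap.mul' k 𝒜).rTensor W ∘ₗ (TensorProduct.assoc k 𝒜 𝒜 W).symm.toLinearMap

@[simp]
theorem mulHead_tmul (φ φ' : 𝒜) (w : W) :
    mulHead 𝒜 W (φ ⊗ₜ[k] (φ' ⊗ₜ[k] w)) = (φ * φ') ⊗ₜ w := rfl

theorem mulHead_pair_L (y : H ⊗[k] H) (φ φ' : 𝒜) (w : W) :
    mulHead 𝒜 W (pair (hd M.L) (sh (hd M.L)) y (φ ⊗ₜ[k] (φ' ⊗ₜ[k] w))) =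
      LinearMap.mul' k 𝒜 (TensorProduct.map₂ M.lact M.lact y (φ ⊗ₜ[k] φ')) ⊗ₜ w := by
  induction y with
  | zero => simp
  | tmul a b => simp [L_apply]
  | add a b ha hb => simp only [map_add, LinearMap.add_apply, ha, hb, TensorProduct.add_tmul]

theorem mulHead_pair_R (y : H ⊗[k] H) (φ φ' : 𝒜) (w : W) :
    mulHead 𝒜 W (pair (sh (hd M.R)) (hd M.R) (Q.SS y) (φ ⊗ₜ[k] (φ' ⊗ₜ[k] w))) =
      LinearMap.mul' k 𝒜 (TensorProduct.map₂ M.ract M.ract y (φ ⊗ₜ[k] φ')) ⊗ₜ w := by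
  induction y with
  | zero => simp
  | tmul a b => simp [R_apply]
  | add a b ha hb => simp only [map_add, LinearMap.add_apply, ha, hb, TensorProduct.add_tmul]

theorem ext_three {V₁ V₂ V₃ N : Type*} [AddCommGroup V₁] [Module k V₁] [AddCommGroup V₂]
    [Module k V₂] [AddCommGroup V₃] [Module k V₃] [AddCommGroup N] [Module k N]
    {f g : V₁ ⊗[k] (V₂ ⊗[k] V₃) →ₗ[k] N}
    (h : ∀ x y z, f (x ⊗ₜ (y ⊗ₜ z)) = g (x ⊗ₜ (y ⊗ₜ z))) (t : V₁ ⊗[k] (V₂ ⊗[k] V₃)) :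
    f t = g t := by
  have : f = g := TensorProduct.ext (LinearMap.ext fun x =>
    TensorProduct.ext (LinearMap.ext₂ fun y z => h x y z))
  rw [this]

theorem ext_four {V₁ V₂ V₃ V₄ N : Type*} [AddCommGroup V₁] [Module k V₁] [AddCommGroup V₂]
    [Module k V₂] [AddCommGroup V₃] [Module k V₃] [AddCommGroup V₄] [Module k V₄]
    [AddCommGroup N] [Module k N]
    {f g : V₁ ⊗[k] (V₂ ⊗[k] (V₃ ⊗[k] V₄)) →ₗ[k] N}
    (h : ∀ x y z w, f (x ⊗ₜ (y ⊗ₜ (z ⊗ₜ w))) = g (x ⊗ₜ (y ⊗ₜ (z ⊗ₜ w))))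
    (t : V₁ ⊗[k] (V₂ ⊗[k] (V₃ ⊗[k] V₄))) : f t = g t := by
  have : f = g := TensorProduct.ext (LinearMap.ext fun x => LinearMap.ext fun y =>
    ext_three (fun y z w => h x y z w) y)
  rw [this]

instance eqv_mulHead_L : Eqv (mulHead 𝒜 W) (Q.cv (hd M.L) (sh (hd M.L))) (hd M.L) :=
  ⟨fun h t => by
    refine ext_three (f := mulHead 𝒜 W ∘ₗ (Q.cv (hd M.L) (sh (hd M.L)) h : Module.End k _))
      (g := (hd M.L h : Module.End k _) ∘ₗ mulHead 𝒜 W) (fun φ φ' w => ?_) t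
    simp only [LinearMap.comp_apply, AlgHom.comp_apply, mulHead_tmul, hd_tmul, L_apply, M.lact_mul]
    exact M.mulHead_pair_L _ _ _ _⟩

theorem SS_Δ_Sinv (h : H) : Q.SS (Q.Δ (Q.Sinv h)) = Q.f * Q.Δ h * Q.fInv := by
  rw [← Q.S_Sinv h, Q.f_mul_Δ_S, mul_assoc, Q.f_mul_fInv, mul_one, Q.S_Sinv]

/-- The right action through `S⁻¹` is compatible with the multiplication up to conjugation by the
Drinfeld twist, because `S⁻¹` is anti-comonoidal up to `f`. -/
theorem hd_R_mulHead (h : H) (t : 𝒜 ⊗[k] (𝒜 ⊗[k] W)) : hd M.R h (mulHead 𝒜 W t) =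
    mulHead 𝒜 W (pair (sh (hd M.R)) (hd M.R) (Q.f * Q.Δ h * Q.fInv) t) := by
  rw [← SS_Δ_Sinv]
  refine ext_three (f := (hd M.R h : Module.End k _) ∘ₗ mulHead 𝒜 W)
    (g := mulHead 𝒜 W ∘ₗ (pair (sh (hd M.R)) (hd M.R) (Q.SS (Q.Δ (Q.Sinv h))) : Module.End k _))
      (fun φ φ' w => ?_) t
  simp only [LinearMap.comp_apply, mulHead_tmul, hd_tmul, R_apply, M.ract_mul]
  exact (M.mulHead_pair_R _ _ _ _).symm

instance eqv_mulHead_sh {X : Type*} [Ring X] [Algebra k X] (F : X →ₐ[k] Module.End k W) :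
    Eqv (mulHead 𝒜 W) (sh (sh F)) (sh F) := ⟨fun h t => by
  exact ext_three (f := mulHead 𝒜 W ∘ₗ (sh (sh F) h : Module.End k _))
    (g := (sh F h : Module.End k _) ∘ₗ mulHead 𝒜 W) (fun φ φ' w => by simp) t⟩

end BimoduleAlgebra

/-! ### The twisted product on a bimodule algebra -/

namespace BimoduleAlgebra

open QuasiHopfAlgebra

variable {k H : Type*} [Field k] [Ring H] [Algebra k H] {Q : QuasiHopfAlgebra k H}
  {𝒜 : Type*} [NonAssocRing 𝒜] [Module k 𝒜] [SMulCommClass k 𝒜 𝒜] [IsScalarTower k 𝒜 𝒜]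
  (M : BimoduleAlgebra Q.toQuasiBialgebra 𝒜) {W W' : Type*} [AddCommGroup W] [Module k W]
  [AddCommGroup W'] [Module k W']

variable (W) in
/-- `φ ⊗ φ' ⊗ w ↦ (φ · S⁻¹(f²)) (φ' · S⁻¹(f¹)) ⊗ w`. -/
def star : 𝒜 ⊗[k] (𝒜 ⊗[k] W) →ₗ[k] 𝒜 ⊗[k] W :=
  mulHead 𝒜 W ∘ₗ (pair (sh (hd M.R)) (hd M.R) Q.f : Module.End k _)

theorem star_apply (t : 𝒜 ⊗[k] (𝒜 ⊗[k] W)) :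
    M.star W t = mulHead 𝒜 W (pair (sh (hd M.R)) (hd M.R) Q.f t) := rfl

instance eqv_star_L : Eqv (M.star W) (Q.cv (hd M.L) (sh (hd M.L))) (hd M.L) := ⟨fun h t => by
  rw [star_apply, star_apply, ← (M.eqv_mulHead_L).eqv, ← Module.End.mul_apply,
    ← Module.End.mul_apply, (Comm.comm (i := pair (sh (hd M.R)) (hd M.R)) Q.f h).eq]⟩

instance eqv_star_R : Eqv (M.star W) (Q.cv (sh (hd M.R)) (hd M.R)) (hd M.R) := ⟨fun h t => by
  rw [star_apply, star_apply, hd_R_mulHead, ← Module.End.mul_apply, ← Module.End.mul_apply,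
    ← map_mul, mul_assoc _ Q.fInv, Q.fInv_mul_f, mul_one, map_mul]; rfl⟩

instance eqv_star_sh {X : Type*} [Ring X] [Algebra k X] (F : X →ₐ[k] Module.End k W) :
    Eqv (M.star W) (sh (sh F)) (sh F) := ⟨fun h t => by
  rw [star_apply, star_apply, ← (eqv_mulHead_sh F).eqv, ← Module.End.mul_apply,
    ← Module.End.mul_apply, (Comm.comm (i := pair (sh (hd M.R)) (hd M.R)) Q.f h).eq]⟩

instance eqv_lTensor_star_L :
    Eqv ((M.star W).lTensor 𝒜) (Q.cv (sh (hd M.L)) (sh (sh (hd M.L)))) (sh (hd M.L)) := by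
  have : Eqv ((M.star W).lTensor 𝒜) (sh (Q.cv (hd M.L) (sh (hd M.L)))) (sh (hd M.L)) :=
    inferInstance
  rwa [sh_comp, sh_pair] at this

instance eqv_lTensor_star_R :
    Eqv ((M.star W).lTensor 𝒜) (Q.cv (sh (sh (hd M.R))) (sh (hd M.R))) (sh (hd M.R)) := by
  have : Eqv ((M.star W).lTensor 𝒜) (sh (Q.cv (sh (hd M.R)) (hd M.R))) (sh (hd M.R)) :=
    inferInstance
  rwa [sh_comp, sh_pair] at this

/-- The twisted product is natural in the spectator factor. -/
theorem lTensor_star (g : W →ₗ[k] W') (t : 𝒜 ⊗[k] (𝒜 ⊗[k] W)) :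
    g.lTensor 𝒜 (M.star W t) = M.star W' ((g.lTensor 𝒜).lTensor 𝒜 t) := by
  have h : ∀ s, g.lTensor 𝒜 (mulHead 𝒜 W s) = mulHead 𝒜 W' ((g.lTensor 𝒜).lTensor 𝒜 s) :=
    fun s => ext_three (f := g.lTensor 𝒜 ∘ₗ mulHead 𝒜 W)
      (g := mulHead 𝒜 W' ∘ₗ (g.lTensor 𝒜).lTensor 𝒜) (fun φ φ' w => by simp) s
  rw [star_apply, star_apply, h]
  exact congrArg _ (Eqv.eqv (T := (g.lTensor 𝒜).lTensor 𝒜) (F := pair (sh (hd M.R)) (hd M.R))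
    (F' := pair (sh (hd M.R)) (hd M.R)) _ _)

theorem pair_R_mulHead (y : H ⊗[k] H) (t : 𝒜 ⊗[k] (𝒜 ⊗[k] (𝒜 ⊗[k] W))) :
    pair (sh (hd M.R)) (hd M.R) y (mulHead 𝒜 (𝒜 ⊗[k] W) t) = mulHead 𝒜 (𝒜 ⊗[k] W)
      ((pair (sh (hd M.R)) (hd M.R) Q.f *
        pair (sh (sh (hd M.R))) (Q.cv (sh (hd M.R)) (hd M.R)) y *
        pair (sh (hd M.R)) (hd M.R) Q.fInv : Module.End k _) t) := by
  induction y with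
  | zero => simp
  | tmul a b =>
    rw [pair_tmul, Module.End.mul_apply, hd_R_mulHead, ← (eqv_mulHead_sh (hd M.R)).eqv,
      ← Module.End.mul_apply, pair_tmul, map_mul, map_mul, ← mul_assoc, ← mul_assoc, ← mul_assoc,
      (Comm.comm (i := sh (sh (hd M.R))) (j := pair (sh (hd M.R)) (hd M.R)) a Q.f).eq]
    rfl
  | add a b ha hb => simp only [map_add, LinearMap.add_apply, ha, hb, mul_add, add_mul]

theorem sh_R_lTensor_mulHead (h : H) (t : 𝒜 ⊗[k] (𝒜 ⊗[k] (𝒜 ⊗[k] W))) :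
    sh (hd M.R) h ((mulHead 𝒜 W).lTensor 𝒜 t) = (mulHead 𝒜 W).lTensor 𝒜
      (pair (sh (sh (hd M.R))) (sh (hd M.R)) (Q.f * Q.Δ h * Q.fInv) t) := by
  rw [← sh_pair]
  induction t with
  | zero => simp
  | tmul φ t => simp only [LinearMap.lTensor_tmul, sh_tmul, hd_R_mulHead]
  | add a b ha hb => simp only [map_add, ha, hb]

theorem pair_R_lTensor_mulHead (y : H ⊗[k] H) (t : 𝒜 ⊗[k] (𝒜 ⊗[k] (𝒜 ⊗[k] W))) :
    pair (sh (hd M.R)) (hd M.R) y ((mulHead 𝒜 W).lTensor 𝒜 t) = (mulHead 𝒜 W).lTensor 𝒜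
      ((pair (sh (sh (hd M.R))) (sh (hd M.R)) Q.f *
        pair (Q.cv (sh (sh (hd M.R))) (sh (hd M.R))) (hd M.R) y *
        pair (sh (sh (hd M.R))) (sh (hd M.R)) Q.fInv : Module.End k _) t) := by
  induction y with
  | zero => simp
  | tmul a b =>
    rw [pair_tmul, Module.End.mul_apply, ← (Eqv.lTensor_hd (mulHead 𝒜 W) M.R).eqv,
      sh_R_lTensor_mulHead,
      ← Module.End.mul_apply, pair_tmul, map_mul, map_mul, mul_assoc, mul_assoc, mul_assoc,
      (Comm.comm (i := pair (sh (sh (hd M.R))) (sh (hd M.R))) (j := hd M.R) Q.fInv b).eq]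
    rfl
  | add a b ha hb => simp only [map_add, LinearMap.add_apply, ha, hb, mul_add, add_mul]

/-- Associativity of the bimodule algebra up to `Φ` on the left and, through `S⁻¹`, the antipode
image of `Φ⁻¹` on the right. -/
theorem mulHead_mulHead (t : 𝒜 ⊗[k] (𝒜 ⊗[k] (𝒜 ⊗[k] W))) :
    mulHead 𝒜 W (mulHead 𝒜 (𝒜 ⊗[k] W) t) = mulHead 𝒜 W ((mulHead 𝒜 W).lTensor 𝒜
      ((pair (hd M.L) (pair (sh (hd M.L)) (sh (sh (hd M.L)))) Q.Φ.val *
        pair (sh (sh (hd M.R))) (pair (sh (hd M.R)) (hd M.R)) (Q.SSS (Q.Φ⁻¹).val)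
          : Module.End k _) t)) := by
  have key : ∀ (x y : H ⊗[k] (H ⊗[k] H)) (φ φ' φ'' : 𝒜) (w : W),
      mulHead 𝒜 W ((mulHead 𝒜 W).lTensor 𝒜
      ((pair (hd M.L) (pair (sh (hd M.L)) (sh (sh (hd M.L)))) x *
        pair (sh (sh (hd M.R))) (pair (sh (hd M.R)) (hd M.R)) (Q.SSS y)
          : Module.End k _) (φ ⊗ₜ (φ' ⊗ₜ (φ'' ⊗ₜ w))))) =
      (LinearMap.mul' k 𝒜 ∘ₗ (LinearMap.mul' k 𝒜).lTensor 𝒜)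
      (TensorProduct.map₂ M.lact (TensorProduct.map₂ M.lact M.lact) x
        (TensorProduct.map₂ M.ract (TensorProduct.map₂ M.ract M.ract) y
          (φ ⊗ₜ[k] (φ' ⊗ₜ[k] φ'')))) ⊗ₜ w := fun x y φ φ' φ'' w => by
    induction x using tensor_induction₃ with
    | zero => simp
    | tmul a b c =>
      induction y using tensor_induction₃ with
      | zero => simp
      | tmul a b c => simp [L_apply, R_apply]
      | add a b ha hb =>
        simp only [map_add, mul_add, LinearMap.add_apply, ha, hb, TensorProduct.add_tmul]
    | add a b ha hb =>
      simp only [map_add, add_mul, LinearMap.add_apply, ha, hb, TensorProduct.add_tmul]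
  refine ext_four (f := mulHead 𝒜 W ∘ₗ mulHead 𝒜 (𝒜 ⊗[k] W)) (g := mulHead 𝒜 W ∘ₗ
    (mulHead 𝒜 W).lTensor 𝒜 ∘ₗ (pair (hd M.L) (pair (sh (hd M.L)) (sh (sh (hd M.L)))) Q.Φ.val *
        pair (sh (sh (hd M.R))) (pair (sh (hd M.R)) (hd M.R)) (Q.SSS (Q.Φ⁻¹).val)
          : Module.End k _)) (fun φ φ' φ'' w => ?_) t
  exact (congrArg (· ⊗ₜ[k] w) (M.quasi_assoc φ φ' φ'')).trans (key _ _ _ _ _ _).symm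

theorem SSS_f_cocycle : Q.SSS (Q.Φ⁻¹).val *
    (pair (pos₂ k H) (pos₃ k H) Q.f *
      pair (pos₁ k H) (Q.cv (pos₂ k H) (pos₃ k H)) Q.f) =
    pair (pos₁ k H) (pos₂ k H) Q.f *
      pair (Q.cv (pos₁ k H) (pos₂ k H)) (pos₃ k H) Q.f *
        (Q.Φ⁻¹).val := by
  rw [Units.eq_mul_inv_iff_mul_eq, mul_assoc, Q.f_cocycle, ← mul_assoc, ← Q.SSS_mul,
    Units.mul_inv, ← map_one (pos₁ k H), Q.SSS_p₁, Q.S_one,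
    map_one, one_mul]

/-- The twisted product is associative up to the reassociator acting on the left and, in reversed
order, its inverse acting on the right. -/
theorem star_star (t : 𝒜 ⊗[k] (𝒜 ⊗[k] (𝒜 ⊗[k] W))) :
    M.star W (M.star (𝒜 ⊗[k] W) t) = M.star W ((M.star W).lTensor 𝒜
      ((Q.P (hd M.L) (sh (hd M.L)) (sh (sh (hd M.L))) *
        (Q.P (sh (sh (hd M.R))) (sh (hd M.R)) (hd M.R))⁻¹ : (Module.End k _)ˣ).val t)) := by
  have hl : ∀ s : 𝒜 ⊗[k] (𝒜 ⊗[k] (𝒜 ⊗[k] W)), M.star W ((M.star W).lTensor 𝒜 s) =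
      mulHead 𝒜 W ((mulHead 𝒜 W).lTensor 𝒜 ((pair (sh (sh (hd M.R))) (sh (hd M.R)) Q.f *
        pair (Q.cv (sh (sh (hd M.R))) (sh (hd M.R))) (hd M.R) Q.f : Module.End k _) s)) :=
    fun s => by
    rw [star, LinearMap.lTensor_comp, LinearMap.comp_apply, LinearMap.comp_apply,
      pair_R_lTensor_mulHead]
    have : (pair (sh (hd M.R)) (hd M.R) Q.f : Module.End k (𝒜 ⊗[k] (𝒜 ⊗[k] W))).lTensor 𝒜 s =
      pair (sh (sh (hd M.R))) (sh (hd M.R)) Q.f s := by rw [← sh_pair]; rfl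
    rw [this, ← Module.End.mul_apply, mul_assoc _ (pair _ _ Q.fInv), ← map_mul, Q.fInv_mul_f,
      map_one, mul_one]
  rw [hl, star_apply, star_apply, pair_R_mulHead, ← Module.End.mul_apply,
    mul_assoc _ (pair _ _ Q.fInv), ← map_mul, Q.fInv_mul_f, map_one, mul_one, M.mulHead_mulHead,
    ← Module.End.mul_apply, ← Module.End.mul_apply]
  have h1 := congrArg (pair (sh (sh (hd M.R))) (pair (sh (hd M.R)) (hd M.R)) :
    _ →ₐ[k] Module.End k (𝒜 ⊗[k] (𝒜 ⊗[k] (𝒜 ⊗[k] W)))) (SSS_f_cocycle (Q := Q))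
  simp only [map_mul, apply_pair, Q.comp_cv, ← AlgHom.comp_assoc,
    pair_comp_padLeft, pair_comp_includeLeft] at h1
  rw [mul_assoc, h1, Units.val_mul, ap_val, ap_inv_val, ← mul_assoc, ← mul_assoc (_ * _)]
  have c := (Comm.comm (i := (pair (hd M.L) (pair (sh (hd M.L)) (sh (sh (hd M.L)))) :
      _ →ₐ[k] Module.End k (𝒜 ⊗[k] (𝒜 ⊗[k] (𝒜 ⊗[k] W)))))
    (j := pair (sh (sh (hd M.R))) (pair (sh (hd M.R)) (hd M.R))) Q.Φ.val
      (pair (pos₁ k H) (pos₂ k H) Q.f *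
      pair (Q.cv (pos₁ k H) (pos₂ k H)) (pos₃ k H) Q.f)).eq
  simp only [map_mul, apply_pair, Q.comp_cv, ← AlgHom.comp_assoc,
    pair_comp_padLeft, pair_comp_includeLeft] at c
  rw [c]

variable (k 𝒜) in
/-- `w ↦ 1 ⊗ w`. -/
def unitHead (W : Type*) [AddCommGroup W] [Module k W] : W →ₗ[k] 𝒜 ⊗[k] W :=
  TensorProduct.mk k 𝒜 W 1

@[simp]
theorem unitHead_apply {k 𝒜 : Type*} [Field k] [NonAssocRing 𝒜] [Module k 𝒜] {W : Type*}
    [AddCommGroup W] [Module k W] (w : W) : unitHead k 𝒜 W w = 1 ⊗ₜ w := rfl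

instance eqv_unitHead_L : Eqv (unitHead k 𝒜 W) (Q.e _) (hd M.L) := ⟨fun h w => by
  simp [L_apply, M.lact_one, Algebra.algebraMap_eq_smul_one, TensorProduct.smul_tmul']⟩

instance eqv_unitHead_R : Eqv (unitHead k 𝒜 W) (Q.e _) (hd M.R) := ⟨fun h w => by
  simp [R_apply, M.ract_one, Q.ε_Sinv, Algebra.algebraMap_eq_smul_one, TensorProduct.smul_tmul']⟩

instance eqv_unitHead_sh {X : Type*} [Ring X] [Algebra k X] (F : X →ₐ[k] Module.End k W) :
    Eqv (unitHead k 𝒜 W) F (sh F) := ⟨fun h w => by simp⟩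

instance eqv_lTensor_unitHead_L : Eqv ((unitHead k 𝒜 W).lTensor 𝒜) (Q.e _) (sh (hd M.L)) := by
  have : Eqv ((unitHead k 𝒜 W).lTensor 𝒜) (sh (Q.e _)) (sh (hd M.L)) := inferInstance
  rwa [sh_scalar] at this

instance eqv_lTensor_unitHead_R : Eqv ((unitHead k 𝒜 W).lTensor 𝒜) (Q.e _) (sh (hd M.R)) := by
  have : Eqv ((unitHead k 𝒜 W).lTensor 𝒜) (sh (Q.e _)) (sh (hd M.R)) := inferInstance
  rwa [sh_scalar] at this

theorem star_unitHead (t : 𝒜 ⊗[k] W) : M.star W (unitHead k 𝒜 _ t) = t := by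
  have h := Eqv.eqv (T := unitHead k 𝒜 (𝒜 ⊗[k] W)) (F := pair (hd M.R) (Q.e _))
    (F' := pair (sh (hd M.R)) (hd M.R)) Q.f t
  rw [star_apply, ← h, pair_scalar_right, AlgHom.comp_apply, Q.counitTail_f, map_one,
    Module.End.one_apply]
  clear h
  induction t with
  | zero => simp
  | tmul φ w => simp
  | add a b ha hb => simp only [map_add, ha, hb]

theorem star_lTensor_unitHead (t : 𝒜 ⊗[k] W) :
    M.star W ((unitHead k 𝒜 W).lTensor 𝒜 t) = t := by
  have h := Eqv.eqv (T := (unitHead k 𝒜 W).lTensor 𝒜) (F := pair (Q.e _) (hd M.R))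
    (F' := pair (sh (hd M.R)) (hd M.R)) Q.f t
  rw [star_apply, ← h, pair_scalar_left, AlgHom.comp_apply, Q.counitHead_f, map_one,
    Module.End.one_apply]
  clear h
  induction t with
  | zero => simp
  | tmul φ w => simp
  | add a b ha hb => simp only [map_add, ha, hb]

end BimoduleAlgebra

/-- Induction principle for additive predicates on a fivefold tensor product. -/
theorem tensor_induction₅ {k X Y Z V W : Type*} [Field k] [Ring X] [Algebra k X] [Ring Y]
    [Algebra k Y] [Ring Z] [Algebra k Z] [Ring V] [Algebra k V] [Ring W] [Algebra k W]
    {p : X ⊗[k] (Y ⊗[k] (Z ⊗[k] (V ⊗[k] W))) → Prop} (t : X ⊗[k] (Y ⊗[k] (Z ⊗[k] (V ⊗[k] W))))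
    (zero : p 0) (tmul : ∀ x y z v w, p (x ⊗ₜ (y ⊗ₜ (z ⊗ₜ (v ⊗ₜ w)))))
    (add : ∀ a b, p a → p b → p (a + b)) : p t := by
  induction t using tensor_induction₃ with
  | zero => exact zero
  | tmul x y t =>
    induction t using tensor_induction₃ with
    | zero => simpa using zero
    | tmul z v w => exact tmul x y z v w
    | add a b ha hb => simp only [TensorProduct.tmul_add]; exact add _ _ ha hb
  | add a b ha hb => exact add _ _ ha hb

/-! ### Two-sided coactions in letters -/

namespace CoactionData

variable {k H A : Type*} [Field k] [Ring H] [Algebra k H] [Ring A] [Algebra k A]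
  (c : CoactionData k H A) {R : Type*} [Ring R] [Algebra k R]

/-- The letter `u ↦ i(u₍₋₁₎) n(u₍₀₎) j(u₍₁₎)`. -/
abbrev dl (i : H →ₐ[k] R) (n : A →ₐ[k] R) (j : H →ₐ[k] R) [Comm i n] [Comm i j] [Comm n j] :
    A →ₐ[k] R := (pair i (pair n j)).comp c.δ

variable (i j : H →ₐ[k] R) (n : A →ₐ[k] R) (l m : H →ₐ[k] R)
    [Comm i j] [Comm i n] [Comm i l] [Comm i m] [Comm j n] [Comm j l] [Comm j m] [Comm n l]
    [Comm n m] [Comm l m]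

/-- The element `Ψ` in letters, as a unit. -/
abbrev Ps : Rˣ := ap (pair i (pair j (pair n (pair l m)))) c.Ψ

variable {i j n l m} {i' j' : H →ₐ[k] R} {n' : A →ₐ[k] R} {l' m' : H →ₐ[k] R}
    [Comm i' j'] [Comm i' n'] [Comm i' l'] [Comm i' m'] [Comm j' n'] [Comm j' l'] [Comm j' m']
    [Comm n' l'] [Comm n' m'] [Comm l' m']

theorem Ps_nat (u : Rˣ) [Intw u i i'] [Intw u j j'] [Intw u n n'] [Intw u l l'] [Intw u m m'] :
    u * c.Ps i j n l m = c.Ps i' j' n' l' m' * u := Intw.ap _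

theorem Ps_conj (u : Rˣ) [Intw u i i'] [Intw u j j'] [Intw u n n'] [Intw u l l'] [Intw u m m'] :
    c.Ps i j n l m = u⁻¹ * c.Ps i' j' n' l' m' * u := by
  rw [mul_assoc, ← c.Ps_nat u (i := i) (j := j) (n := n) (l := l) (m := m), inv_mul_cancel_left]

theorem Ps_conj' (u : Rˣ) [Intw u i i'] [Intw u j j'] [Intw u n n'] [Intw u l l'] [Intw u m m'] :
    c.Ps i' j' n' l' m' = u * c.Ps i j n l m * u⁻¹ := by
  rw [c.Ps_nat u (i' := i') (j' := j') (n' := n') (l' := l') (m' := m'), mul_inv_cancel_right]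

end CoactionData

namespace TwoSidedCoaction

variable {k H : Type*} [Field k] [Ring H] [Algebra k H] {Q : QuasiBialgebra k H} {A : Type*}
  [Ring A] [Algebra k A] (D : TwoSidedCoaction Q A) {R : Type*} [Ring R] [Algebra k R]

section Words

variable (a₁ a₂ a₃ : H →ₐ[k] R) (n : A →ₐ[k] R) (b₁ b₂ b₃ : H →ₐ[k] R)
    [Comm a₁ a₂] [Comm a₁ a₃] [Comm a₁ n] [Comm a₁ b₁] [Comm a₁ b₂] [Comm a₁ b₃] [Comm a₂ a₃]
    [Comm a₂ n] [Comm a₂ b₁] [Comm a₂ b₂] [Comm a₂ b₃] [Comm a₃ n] [Comm a₃ b₁] [Comm a₃ b₂]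
    [Comm a₃ b₃] [Comm n b₁] [Comm n b₂] [Comm n b₃] [Comm b₁ b₂] [Comm b₁ b₃] [Comm b₂ b₃]

/-- The cocycle condition on `Ψ`, read in seven letters. -/
theorem hexagon :
    D.Ps a₂ a₃ n b₁ b₂ * D.Ps a₁ (Q.cv a₂ a₃) n (Q.cv b₁ b₂) b₃ *
      (Q.P a₁ a₂ a₃ * (Q.P b₁ b₂ b₃)⁻¹) =
    D.Ps a₁ a₂ (D.dl a₃ n b₁) b₂ b₃ * D.Ps (Q.cv a₁ a₂) a₃ n b₁ (Q.cv b₂ b₃) := by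
  have := congrArg (pair a₁ (pair a₂ (pair a₃ (pair n (pair b₁ (pair b₂ b₃)))))) D.cocycle
  simp only [map_mul, pair_padLeft, pair_tail, pair_comp_tail, pair_comp_splitHead,
    pair_splitHead, pair_comp_splitHead₃, pair_comp_includeLeft, pair_join₃, pair_tmul, map_one,
    one_mul] at this
  refine Units.ext ?_
  simp only [Units.val_mul, ap_val, ap_inv_val, this]

theorem hexagon_inv :
    Q.P a₁ a₂ a₃ * (Q.P b₁ b₂ b₃)⁻¹ * (D.Ps (Q.cv a₁ a₂) a₃ n b₁ (Q.cv b₂ b₃))⁻¹ *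
      (D.Ps a₁ a₂ (D.dl a₃ n b₁) b₂ b₃)⁻¹ =
    (D.Ps a₁ (Q.cv a₂ a₃) n (Q.cv b₁ b₂) b₃)⁻¹ * (D.Ps a₂ a₃ n b₁ b₂)⁻¹ := by
  rw [mul_assoc _ _⁻¹ _⁻¹, ← mul_inv_rev, ← mul_inv_rev, mul_inv_eq_iff_eq_mul, ← D.hexagon]
  group

end Words

/-- Quasi-coassociativity of `δ`, read in five letters. -/
instance intw_Ps (i j : H →ₐ[k] R) (n : A →ₐ[k] R) (l m : H →ₐ[k] R)
    [Comm i j] [Comm i n] [Comm i l] [Comm i m] [Comm j n] [Comm j l] [Comm j m] [Comm n l]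
    [Comm n m] [Comm l m] :
    Intw (D.Ps i j n l m) (D.dl (Q.cv i j) n (Q.cv l m)) (D.dl i (D.dl j n l) m) := ⟨fun u => by
  have := congrArg (pair i (pair j (pair n (pair l m)))) (D.coassoc u)
  simp only [map_mul, pair_tail, pair_splitHead, pair_comp_splitHead₃, pair_comp_tail] at this
  simp only [AlgHom.comp_apply, ap_val]
  exact this.symm⟩

theorem dl_e_e (n : A →ₐ[k] R) : D.dl (Q.e R) n (Q.e R) = n := AlgHom.ext fun u => by
  have key : ∀ t, pair (Q.e R) (pair n (Q.e R)) t =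
      n (counitHead Q.ε A (tail H (counitTail Q.ε A) t)) := fun t => by
    induction t using tensor_induction₃ with
    | zero => simp
    | tmul x y z =>
      simp [counitHead, counitTail]
      exact smul_comm _ _ _
    | add a b ha hb => simp only [map_add, ha, hb]
  rw [AlgHom.comp_apply, key, D.counit]

/-- Normalisation of `Ψ` in the first and fifth factors. -/
theorem Ps_outer (j : H →ₐ[k] R) (n : A →ₐ[k] R) (l : H →ₐ[k] R) [Comm j n] [Comm j l] [Comm n l] :
    D.Ps (Q.e R) j n l (Q.e R) = 1 := Units.ext <| by
  have key : ∀ t, pair (Q.e R) (pair j (pair n (pair l (Q.e R)))) t = pair j (pair n l)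
      (counitHead Q.ε (H ⊗[k] (A ⊗[k] H)) (tail H (tail H (tail A (counitTail Q.ε H))) t)) :=
    fun t => by
    induction t using tensor_induction₅ with
    | zero => simp
    | tmul x y z v w =>
      simp [counitHead, counitTail]
      exact smul_comm _ _ _
    | add a b ha hb => simp only [map_add, ha, hb]
  rw [ap_val, key, D.counit_outer, map_one, Units.val_one]

/-- Normalisation of `Ψ` in the second and fourth factors. -/
theorem Ps_inner (i : H →ₐ[k] R) (n : A →ₐ[k] R) (m : H →ₐ[k] R) [Comm i n] [Comm i m] [Comm n m] :
    D.Ps i (Q.e R) n (Q.e R) m = 1 := Units.ext <| by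
  have key : ∀ t, pair i (pair (Q.e R) (pair n (pair (Q.e R) m))) t = pair i (pair n m)
      (tail H (counitHead Q.ε (A ⊗[k] H)) (tail H (tail H (tail A (counitHead Q.ε H))) t)) :=
    fun t => by
    induction t using tensor_induction₅ with
    | zero => simp
    | tmul x y z v w =>
      simp [counitHead]
      exact smul_comm _ _ _
    | add a b ha hb => simp only [map_add, ha, hb]
  rw [ap_val, key, D.counit_inner, map_one, Units.val_one]

end TwoSidedCoaction

/-! ### The left crossed product -/

section LeftCrossed

variable {k H : Type*} [Field k] [Ring H] [Algebra k H] {Q : QuasiHopfAlgebra k H}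
  {A : Type*} [Ring A] [Algebra k A] (c : CoactionData k H A)
  {𝒜 : Type*} [NonAssocRing 𝒜] [Module k 𝒜] [SMulCommClass k 𝒜 𝒜] [IsScalarTower k 𝒜 𝒜]
  (M : BimoduleAlgebra Q.toQuasiBialgebra 𝒜)

variable (k A) in
/-- Left multiplication as a letter. -/
abbrev lm : A →ₐ[k] Module.End k A := Algebra.lmul k A

namespace CoactionData

/-- The action `u · (φ ⊗ v) = u₍₋₁₎ · φ · S⁻¹(u₍₁₎) ⊗ u₍₀₎ v` of `A` on `𝒜 ⊗ A`. -/
abbrev act : A →ₐ[k] Module.End k (𝒜 ⊗[k] A) := c.dl (hd M.L) (sh (lm k A)) (hd M.R)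

/-- `φ ⊗ u ↦ φ ⊗ u · ξ`. -/
def ins (ξ : 𝒜 ⊗[k] A) : 𝒜 ⊗[k] A →ₗ[k] 𝒜 ⊗[k] (𝒜 ⊗[k] A) :=
  ((c.act M).toLinearMap.flip ξ).lTensor 𝒜

@[simp]
theorem ins_tmul (ξ : 𝒜 ⊗[k] A) (φ : 𝒜) (u : A) :
    c.ins M ξ (φ ⊗ₜ u) = φ ⊗ₜ c.act M u ξ := rfl

instance eqv_flip_act (ξ : 𝒜 ⊗[k] A) :
    Eqv ((c.act M).toLinearMap.flip ξ) (lm k A) (c.act M) := ⟨fun x v => by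
  simp only [LinearMap.flip_apply, AlgHom.toLinearMap_apply, Algebra.coe_lmul_eq_mul,
    LinearMap.mul_apply', map_mul, Module.End.mul_apply]⟩

/-- `Ψ` acting on `𝒜 ⊗ 𝒜 ⊗ A`. -/
abbrev PsAct : (Module.End k (𝒜 ⊗[k] (𝒜 ⊗[k] A)))ˣ :=
  c.Ps (hd M.L) (sh (hd M.L)) (sh (sh (lm k A))) (sh (hd M.R)) (hd M.R)

theorem opLeft_starLeft (g : H ⊗[k] H) (t : H ⊗[k] (H ⊗[k] (A ⊗[k] (H ⊗[k] H))))
    (s : H ⊗[k] (A ⊗[k] H)) (φ φ' : 𝒜) (u' : A) :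
    opLeft M (starLeft Q (((((TensorProduct.map Q.Sinv Q.Sinv).lTensor A).lTensor H).lTensor H)
      ((1 : H) ⊗ₜ[k] ((1 : H) ⊗ₜ[k] ((1 : A) ⊗ₜ[k] g)) * t)) s) ((φ ⊗ₜ[k] φ') ⊗ₜ[k] u') =
    BimoduleAlgebra.mulHead 𝒜 A (pair (sh (hd M.R)) (hd M.R) g
      (pair (hd M.L) (pair (sh (hd M.L)) (pair (sh (sh (lm k A))) (pair (sh (hd M.R)) (hd M.R)))) t
        (φ ⊗ₜ (pair (hd M.L) (pair (sh (lm k A)) (hd M.R)) s (φ' ⊗ₜ u'))))) := by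
  induction s using tensor_induction₃ with
  | zero => simp
  | tmul x v y =>
    induction t using tensor_induction₅ with
    | zero => simp
    | tmul x₁ x₂ x₃ x₄ x₅ =>
      induction g with
      | zero => simp
      | tmul g₁ g₂ =>
        simp [starLeft_tmul, opLeft_tmul, M.L_apply, M.R_apply, Q.Sinv_mul, M.mul_lact, M.mul_ract,
          M.lact_ract, mul_assoc]
      | add a b ha hb =>
        simp only [map_add, LinearMap.add_apply, TensorProduct.tmul_add, add_mul, ha, hb]
    | add a b ha hb =>
      simp only [map_add, LinearMap.add_apply, mul_add, ha, hb]
  | add a b ha hb => simp only [map_add, LinearMap.add_apply, TensorProduct.tmul_add, ha, hb]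

/-- The product of the left crossed product: let `u` act on the second factor through `δ`, apply
`Ψ⁻¹`, then multiply with the twisted product. The Drinfeld twist in `Ω` is absorbed in `star`. -/
theorem leftCrossed_mul (ξ ζ : 𝒜 ⊗[k] A) : (leftCrossed c M).mul ξ ζ =
    M.star A (((c.PsAct M)⁻¹).val (c.ins M ζ ξ)) := by
  induction ξ with
  | zero => simp
  | tmul φ u =>
    induction ζ with
    | zero => simp
    | tmul φ' u' =>
      rw [leftCrossed_mul_tmul, Ω, opLeft_starLeft, M.star_apply, ap_inv_val]; rfl
    | add a b ha hb => simp only [map_add, ha, hb, ins_tmul, TensorProduct.tmul_add]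
  | add a b ha hb => simp only [map_add, LinearMap.add_apply, ha, hb]

end CoactionData

end LeftCrossed

section LeftCrossedAssoc

variable {k H : Type*} [Field k] [Ring H] [Algebra k H] {Q : QuasiHopfAlgebra k H}
  {A : Type*} [Ring A] [Algebra k A]
  {𝒜 : Type*} [NonAssocRing 𝒜] [Module k 𝒜] [SMulCommClass k 𝒜 𝒜] [IsScalarTower k 𝒜 𝒜]

namespace CoactionData

variable (c : CoactionData k H A) (M : BimoduleAlgebra Q.toQuasiBialgebra 𝒜)

theorem PsAct_inv_star (t : 𝒜 ⊗[k] (𝒜 ⊗[k] (𝒜 ⊗[k] A))) :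
    ((c.PsAct M)⁻¹).val (M.star (𝒜 ⊗[k] A) t) = M.star (𝒜 ⊗[k] A)
      (((c.Ps (Q.cv (hd M.L) (sh (hd M.L))) (sh (sh (hd M.L))) (sh (sh (sh (lm k A))))
        (sh (sh (hd M.R))) (Q.cv (sh (hd M.R)) (hd M.R)))⁻¹).val t) :=
  (Eqv.ap_inv c.Ψ t).symm

theorem PsAct_inv_lTensor_star (t : 𝒜 ⊗[k] (𝒜 ⊗[k] (𝒜 ⊗[k] A))) :
    ((c.PsAct M)⁻¹).val ((M.star A).lTensor 𝒜 t) = (M.star A).lTensor 𝒜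
      (((c.Ps (hd M.L) (Q.cv (sh (hd M.L)) (sh (sh (hd M.L)))) (sh (sh (sh (lm k A))))
        (Q.cv (sh (sh (hd M.R))) (sh (hd M.R))) (hd M.R))⁻¹).val t) :=
  (Eqv.ap_inv c.Ψ t).symm

theorem sh_dl {V W : Type*} [AddCommGroup V] [Module k V] [AddCommGroup W] [Module k W]
    (i j : H →ₐ[k] Module.End k W) (n : A →ₐ[k] Module.End k W) [Comm i n] [Comm i j] [Comm n j] :
    sh (V := V) (c.dl i n j) = c.dl (sh i) (sh n) (sh j) := by
  simp only [dl, sh_comp, sh_pair]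

theorem sh_act : sh (V := 𝒜) (c.act M) =
    c.dl (sh (hd M.L)) (sh (sh (lm k A))) (sh (hd M.R)) :=
  c.sh_dl _ _ _

/-- The action through `δ` of an element of `A` standing in a product is an iterated action through
`δ`, moved past the twisted product. -/
theorem ins_star (ζ : 𝒜 ⊗[k] A) (φ φ' : 𝒜) (u u' : A) :
    c.ins M ζ (M.star A (((c.PsAct M)⁻¹).val (c.ins M (φ' ⊗ₜ u') (φ ⊗ₜ u)))) =
      M.star (𝒜 ⊗[k] A) (((c.Ps (hd M.L) (sh (hd M.L))
        (c.dl (sh (sh (hd M.L))) (sh (sh (sh (lm k A)))) (sh (sh (hd M.R))))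
        (sh (hd M.R)) (hd M.R))⁻¹).val (c.dl (sh (hd M.L))
          (c.dl (sh (sh (hd M.L))) (sh (sh (sh (lm k A)))) (sh (sh (hd M.R)))) (sh (hd M.R)) u
          (φ ⊗ₜ (φ' ⊗ₜ c.act M u' ζ)))) := by
  have hs : sh (V := 𝒜) (sh (V := 𝒜) (c.act M)) =
      c.dl (sh (sh (hd M.L))) (sh (sh (sh (lm k A)))) (sh (sh (hd M.R))) := by
    rw [sh_act, sh_dl]
  rw [ins, M.lTensor_star]
  simp only [← hs]
  refine congrArg _ ((Eqv.ap_inv (F := pair (hd M.L) (pair (sh (hd M.L)) (pair (sh (sh (lm k A)))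
    (pair (sh (hd M.R)) (hd M.R))))) (F' := pair (hd M.L) (pair (sh (hd M.L))
      (pair (sh (sh (c.act M))) (pair (sh (hd M.R)) (hd M.R))))) c.Ψ _).trans (congrArg _ ?_))
  have h1 : c.dl (sh (hd M.L)) (sh (sh (c.act M))) (sh (hd M.R)) =
      sh (V := 𝒜) (c.dl (hd M.L) (sh (c.act M)) (hd M.R)) :=
    (c.sh_dl _ _ _).symm
  rw [ins_tmul, h1, sh_tmul, LinearMap.lTensor_tmul]
  refine congrArg _ ((Eqv.eqv (T := ((c.act M).toLinearMap.flip ζ).lTensor 𝒜)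
    (F' := c.dl (hd M.L) (sh (c.act M)) (hd M.R)) u (φ' ⊗ₜ u')).trans ?_)
  rfl

theorem act_star (φ : 𝒜) (u : A) (t : 𝒜 ⊗[k] (𝒜 ⊗[k] A)) : φ ⊗ₜ c.act M u (M.star A t) =
    (M.star A).lTensor 𝒜 (c.dl (Q.cv (sh (hd M.L)) (sh (sh (hd M.L)))) (sh (sh (sh (lm k A))))
        (Q.cv (sh (sh (hd M.R))) (sh (hd M.R))) u (φ ⊗ₜ[k] t)) := by
  refine Eq.trans ?_ (Eqv.eqv (T := (M.star A).lTensor 𝒜) (F' := c.dl (sh (hd M.L))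
    (sh (sh (lm k A))) (sh (hd M.R))) u (φ ⊗ₜ t)).symm
  rw [← sh_act]; rfl

theorem tmul_PsAct_inv (φ : 𝒜) (t : 𝒜 ⊗[k] (𝒜 ⊗[k] A)) : φ ⊗ₜ[k] ((c.PsAct M)⁻¹).val t =
    ((c.Ps (sh (hd M.L)) (sh (sh (hd M.L))) (sh (sh (sh (lm k A)))) (sh (sh (hd M.R)))
      (sh (hd M.R)))⁻¹).val (φ ⊗ₜ t) := by
  simp only [ap_inv_val, ← sh_pair, sh_tmul]

end CoactionData

namespace TwoSidedCoaction

variable (D : TwoSidedCoaction Q.toQuasiBialgebra A) (M : BimoduleAlgebra Q.toQuasiBialgebra 𝒜)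

/-- Associativity: both bracketings are threefold twisted products of `φ ⊗ φ' ⊗ ζ` after the action
of a word in seven letters, and `star_star` with `hexagon` identifies the two words. -/
theorem leftCrossed_mul_assoc_tmul (φ φ' : 𝒜) (u u' : A) (ζ : 𝒜 ⊗[k] A) :
    (leftCrossed D.toCoactionData M).mul ((leftCrossed D.toCoactionData M).mul (φ ⊗ₜ u) (φ' ⊗ₜ u'))
      ζ = (leftCrossed D.toCoactionData M).mul (φ ⊗ₜ u)
        ((leftCrossed D.toCoactionData M).mul (φ' ⊗ₜ u') ζ) := by
  simp only [CoactionData.leftCrossed_mul]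
  rw [CoactionData.ins_star, CoactionData.PsAct_inv_star, M.star_star, CoactionData.ins_tmul,
    CoactionData.act_star, CoactionData.PsAct_inv_lTensor_star, CoactionData.ins_tmul,
    CoactionData.tmul_PsAct_inv]
  refine congrArg (M.star A) (congrArg ((M.star A).lTensor 𝒜) ?_)
  have h := D.hexagon_inv (hd M.L) (sh (hd M.L)) (sh (sh (hd M.L))) (sh (sh (sh (lm k A))))
    (sh (sh (hd M.R))) (sh (hd M.R)) (hd M.R)
  have h' := (Intw.inv _ _ _ (h := D.intw_Ps (sh (V := 𝒜) (hd M.L)) (sh (sh (hd M.L)))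
    (sh (sh (sh (lm k A)))) (sh (sh (hd M.R))) (sh (hd M.R)))).intw u
  simp only [← Module.End.mul_apply, ← mul_assoc, ← Units.val_mul]
  rw [h, mul_assoc _ (D.dl _ _ _ _), ← h', Units.val_mul, mul_assoc]

theorem PsAct_inv_unitHead (t : 𝒜 ⊗[k] A) :
    ((D.PsAct M)⁻¹).val (BimoduleAlgebra.unitHead k 𝒜 _ t) = BimoduleAlgebra.unitHead k 𝒜 _ t := by
  refine (Eqv.ap_inv
    (F := pair (Q.e _) (pair (hd M.L) (pair (sh (lm k A)) (pair (hd M.R) (Q.e _)))))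
    D.Ψ t).symm.trans ?_
  have h := D.Ps_outer (hd (W := A) M.L) (sh (lm k A)) (hd M.R)
  refine (congrArg (fun w : (Module.End k (𝒜 ⊗[k] A))ˣ =>
    BimoduleAlgebra.unitHead k 𝒜 _ (w⁻¹.val t)) h).trans ?_
  rw [inv_one, Units.val_one, Module.End.one_apply]

theorem PsAct_inv_lTensor_unitHead (t : 𝒜 ⊗[k] A) :
    ((D.PsAct M)⁻¹).val ((BimoduleAlgebra.unitHead k 𝒜 A).lTensor 𝒜 t) =
      (BimoduleAlgebra.unitHead k 𝒜 A).lTensor 𝒜 t := by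
  refine (Eqv.ap_inv
    (F := pair (hd M.L) (pair (Q.e _) (pair (sh (lm k A)) (pair (Q.e _) (hd M.R)))))
    D.Ψ t).symm.trans ?_
  have h := D.Ps_inner (hd (W := A) M.L) (sh (lm k A)) (hd M.R)
  refine (congrArg (fun w : (Module.End k (𝒜 ⊗[k] A))ˣ =>
    (BimoduleAlgebra.unitHead k 𝒜 A).lTensor 𝒜 (w⁻¹.val t)) h).trans ?_
  rw [inv_one, Units.val_one, Module.End.one_apply]

theorem act_one_tmul (u v : A) : D.act M u (1 ⊗ₜ v) = 1 ⊗ₜ (u * v) := by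
  refine (Eqv.eqv (T := BimoduleAlgebra.unitHead k 𝒜 A) (F := D.dl (Q.e _) (lm k A) (Q.e _))
    u v).symm.trans ?_
  rw [D.dl_e_e]; rfl

theorem leftCrossed_one_tmul_mul (u : A) (ξ : 𝒜 ⊗[k] A) :
    (leftCrossed D.toCoactionData M).mul (1 ⊗ₜ u) ξ = D.act M u ξ := by
  rw [CoactionData.leftCrossed_mul, CoactionData.ins_tmul]
  refine (congrArg (M.star A) (D.PsAct_inv_unitHead M _)).trans (M.star_unitHead _)

theorem leftCrossed_mul_one_tmul (ξ : 𝒜 ⊗[k] A) (v : A) :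
    (leftCrossed D.toCoactionData M).mul ξ (1 ⊗ₜ v) = (LinearMap.mulRight k v).lTensor 𝒜 ξ := by
  have h : D.ins M (1 ⊗ₜ v) ξ =
      (BimoduleAlgebra.unitHead k 𝒜 A).lTensor 𝒜 ((LinearMap.mulRight k v).lTensor 𝒜 ξ) := by
    induction ξ with
    | zero => simp
    | tmul φ u => rw [CoactionData.ins_tmul, act_one_tmul]; rfl
    | add a b ha hb => simp only [map_add, ha, hb]
  rw [CoactionData.leftCrossed_mul, h, PsAct_inv_lTensor_unitHead, M.star_lTensor_unitHead]

theorem leftCrossed_isUnitalAlgebra : (leftCrossed D.toCoactionData M).IsUnitalAlgebra where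
  mul_assoc x y z := by
    induction x with
    | zero => simp
    | tmul φ u =>
      induction y with
      | zero => simp
      | tmul φ' u' => exact D.leftCrossed_mul_assoc_tmul M φ φ' u u' z
      | add a b ha hb => simp only [map_add, LinearMap.add_apply, ha, hb]
    | add a b ha hb => simp only [map_add, LinearMap.add_apply, ha, hb]
  one_mul x := by
    refine (D.leftCrossed_one_tmul_mul M 1 x).trans ?_
    rw [map_one, Module.End.one_apply]
  mul_one x := by
    refine (D.leftCrossed_mul_one_tmul M x 1).trans ?_
    rw [LinearMap.mulRight_one, LinearMap.lTensor_id, LinearMap.id_apply]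

end TwoSidedCoaction

end LeftCrossedAssoc

/-! ### The elements `p` and `q` -/

section MoreReductions

variable {k X Y R R' E E' : Type*} [Field k] [Ring X] [Algebra k X] [Ring Y] [Algebra k Y] [Ring R]
  [Algebra k R] [Ring R'] [Algebra k R'] [AddCommGroup E] [Module k E] [AddCommGroup E']
  [Module k E']

instance RRed.postcomp (g : E →ₗ[k] E') (ζ : R →ₗ[k] E) (F F' : X →ₐ[k] R) [h : RRed ζ F F'] :
    RRed (g ∘ₗ ζ) F F' := ⟨fun t x => congrArg g (h.red t x)⟩

instance LRed.postcomp (g : E →ₗ[k] E') (ζ : R →ₗ[k] E) (F F' : X →ₐ[k] R) [h : LRed ζ F F'] :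
    LRed (g ∘ₗ ζ) F F' := ⟨fun t x => congrArg g (h.red t x)⟩

theorem RRed.precomp (g : R →ₐ[k] R') (ζ : R' →ₗ[k] E) (F F' : X →ₐ[k] R)
    (h : RRed ζ (g.comp F) (g.comp F')) : RRed (ζ ∘ₗ g.toLinearMap) F F' := ⟨fun t x => by
  simpa using h.red (g t) x⟩

theorem LRed.precomp (g : R →ₐ[k] R') (ζ : R' →ₗ[k] E) (F F' : X →ₐ[k] R)
    (h : LRed ζ (g.comp F) (g.comp F')) : LRed (ζ ∘ₗ g.toLinearMap) F F' := ⟨fun t x => by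
  simpa using h.red (g t) x⟩

end MoreReductions

namespace TwoSidedCoaction

variable {k H : Type*} [Field k] [Ring H] [Algebra k H] {Q : QuasiBialgebra k H} {A : Type*}
  [Ring A] [Algebra k A] (D : TwoSidedCoaction Q A) {R : Type*} [Ring R] [Algebra k R]
  {E : Type*} [AddCommGroup E] [Module k E] (ζ : R →ₗ[k] E)

section Reductions

variable (i j : H →ₐ[k] R) (n : A →ₐ[k] R) (l m : H →ₐ[k] R)
    [Comm i j] [Comm i n] [Comm i l] [Comm i m] [Comm j n] [Comm j l] [Comm j m] [Comm n l]
    [Comm n m] [Comm l m]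

theorem Ps_outer_lred [LRed ζ i (Q.e R)] [LRed ζ m (Q.e R)] (t : Rˣ) :
    ζ (D.Ps i j n l m * t : Rˣ) = ζ (t : Rˣ) := by
  have h := LRed.ap (ζ := ζ) (F := pair i (pair j (pair n (pair l m))))
    (F' := pair (Q.e R) (pair j (pair n (pair l (Q.e R))))) t D.Ψ
  have h' := D.Ps_outer j n l
  rw [h]
  exact (congrArg (fun w : Rˣ => ζ (w * t : Rˣ)) h').trans (by rw [one_mul])

theorem Ps_inner_lred [LRed ζ j (Q.e R)] [LRed ζ l (Q.e R)] (t : Rˣ) :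
    ζ (D.Ps i j n l m * t : Rˣ) = ζ (t : Rˣ) := by
  have h := LRed.ap (ζ := ζ) (F := pair i (pair j (pair n (pair l m))))
    (F' := pair i (pair (Q.e R) (pair n (pair (Q.e R) m)))) t D.Ψ
  have h' := D.Ps_inner i n m
  rw [h]
  exact (congrArg (fun w : Rˣ => ζ (w * t : Rˣ)) h').trans (by rw [one_mul])

theorem Ps_inner_rred [RRed ζ j (Q.e R)] [RRed ζ l (Q.e R)] (t : Rˣ) :
    ζ (t * D.Ps i j n l m : Rˣ) = ζ (t : Rˣ) := by
  have h := RRed.ap (ζ := ζ) (F := pair i (pair j (pair n (pair l m))))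
    (F' := pair i (pair (Q.e R) (pair n (pair (Q.e R) m)))) t D.Ψ
  have h' := D.Ps_inner i n m
  rw [h]
  exact (congrArg (fun w : Rˣ => ζ (t * w : Rˣ)) h').trans (by rw [mul_one])

theorem Ps_outer_inv_rred [RRed ζ i (Q.e R)] [RRed ζ m (Q.e R)] (t : Rˣ) :
    ζ (t * (D.Ps i j n l m)⁻¹ : Rˣ) = ζ (t : Rˣ) := by
  have h := RRed.ap (ζ := ζ) (F := pair i (pair j (pair n (pair l m))))
    (F' := pair (Q.e R) (pair j (pair n (pair l (Q.e R))))) t D.Ψ⁻¹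
  have h' := D.Ps_outer j n l
  rw [← map_inv, h, map_inv]
  exact (congrArg (fun w : Rˣ => ζ (t * w⁻¹ : Rˣ)) h').trans (by rw [inv_one, mul_one])

theorem Ps_inner_inv_rred [RRed ζ j (Q.e R)] [RRed ζ l (Q.e R)] (t : Rˣ) :
    ζ (t * (D.Ps i j n l m)⁻¹ : Rˣ) = ζ (t : Rˣ) := by
  have h := RRed.ap (ζ := ζ) (F := pair i (pair j (pair n (pair l m))))
    (F' := pair i (pair (Q.e R) (pair n (pair (Q.e R) m)))) t D.Ψ⁻¹
  have h' := D.Ps_inner i n m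
  rw [← map_inv, h, map_inv]
  exact (congrArg (fun w : Rˣ => ζ (t * w⁻¹ : Rˣ)) h').trans (by rw [inv_one, mul_one])

end Reductions

section InverseWords

variable (a₁ a₂ a₃ : H →ₐ[k] R) (n : A →ₐ[k] R) (b₁ b₂ b₃ : H →ₐ[k] R)
    [Comm a₁ a₂] [Comm a₁ a₃] [Comm a₁ n] [Comm a₁ b₁] [Comm a₁ b₂] [Comm a₁ b₃] [Comm a₂ a₃]
    [Comm a₂ n] [Comm a₂ b₁] [Comm a₂ b₂] [Comm a₂ b₃] [Comm a₃ n] [Comm a₃ b₁] [Comm a₃ b₂]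
    [Comm a₃ b₃] [Comm n b₁] [Comm n b₂] [Comm n b₃] [Comm b₁ b₂] [Comm b₁ b₃] [Comm b₂ b₃]

/-- The `q`-contraction of `Ψ⁻¹` against the `p`-contraction of `Ψ`: in the hexagon, the factors other
than `Φ` are normalised away. -/
theorem q_p_word [LRed ζ (Q.cv a₁ a₂) (Q.e R)] [LRed ζ (Q.cv b₂ b₃) (Q.e R)]
    [RRed ζ (Q.cv a₂ a₃) (Q.e R)] [RRed ζ (Q.cv b₁ b₂) (Q.e R)] :
    ζ ((D.Ps a₁ a₂ (D.dl a₃ n b₁) b₂ b₃)⁻¹ * D.Ps a₂ a₃ n b₁ b₂ : Rˣ) =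
      ζ (Q.P b₁ b₂ b₃ * (Q.P a₁ a₂ a₃)⁻¹ : Rˣ) := by
  have h : (D.Ps a₁ a₂ (D.dl a₃ n b₁) b₂ b₃)⁻¹ * D.Ps a₂ a₃ n b₁ b₂ =
      D.Ps (Q.cv a₁ a₂) a₃ n b₁ (Q.cv b₂ b₃) * (Q.P b₁ b₂ b₃ * (Q.P a₁ a₂ a₃)⁻¹ *
        (D.Ps a₁ (Q.cv a₂ a₃) n (Q.cv b₁ b₂) b₃)⁻¹) := by
    rw [inv_mul_eq_iff_eq_mul, ← mul_assoc, ← D.hexagon]; group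
  rw [h, Ps_outer_lred, Ps_inner_inv_rred]

/-- The counterpart of `q_p_word` with `p` and `q` exchanged. -/
theorem p_q_word [LRed ζ (Q.cv a₂ a₃) (Q.e R)] [LRed ζ (Q.cv b₁ b₂) (Q.e R)]
    [RRed ζ (Q.cv a₁ a₂) (Q.e R)] [RRed ζ (Q.cv b₂ b₃) (Q.e R)] :
    ζ ((D.Ps a₂ a₃ n b₁ b₂)⁻¹ * D.Ps a₁ a₂ (D.dl a₃ n b₁) b₂ b₃ : Rˣ) =
      ζ (Q.P a₁ a₂ a₃ * (Q.P b₁ b₂ b₃)⁻¹ : Rˣ) := by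
  have h : (D.Ps a₂ a₃ n b₁ b₂)⁻¹ * D.Ps a₁ a₂ (D.dl a₃ n b₁) b₂ b₃ =
      D.Ps a₁ (Q.cv a₂ a₃) n (Q.cv b₁ b₂) b₃ * (Q.P a₁ a₂ a₃ * (Q.P b₁ b₂ b₃)⁻¹ *
        (D.Ps (Q.cv a₁ a₂) a₃ n b₁ (Q.cv b₂ b₃))⁻¹) := by
    rw [inv_mul_eq_iff_eq_mul, ← mul_assoc, ← mul_assoc, ← mul_assoc, mul_assoc (_ * _) (Q.P _ _ _),
      D.hexagon, mul_inv_cancel_right]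
  rw [h, Ps_inner_lred, Ps_outer_inv_rred]

end InverseWords

end TwoSidedCoaction

namespace QuasiHopfAlgebra

variable {k H : Type*} [Field k] [Ring H] [Algebra k H] (Q : QuasiHopfAlgebra k H)
  {A : Type*} [Ring A] [Algebra k A]

/-- `x ⊗ y ↦ y S⁻¹(x β)`. -/
def κ : H ⊗[k] H →ₗ[k] H :=
  mulMap LinearMap.id (Q.Sinv ∘ₗ LinearMap.mulRight k Q.β) ∘ₗ (TensorProduct.comm k H H).toLinearMap

/-- `x ⊗ y ↦ S⁻¹(α y) x`. -/
def κ' : H ⊗[k] H →ₗ[k] H :=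
  mulMap (Q.Sinv ∘ₗ LinearMap.mulLeft k Q.α) LinearMap.id ∘ₗ (TensorProduct.comm k H H).toLinearMap

@[simp] theorem κ_tmul (x y : H) : Q.κ (x ⊗ₜ y) = y * Q.Sinv (x * Q.β) := rfl
@[simp] theorem κ'_tmul (x y : H) : Q.κ' (x ⊗ₜ y) = Q.Sinv (Q.α * y) * x := rfl

theorem Sinv_evβ (t : H ⊗[k] H) : Q.Sinv (Q.evβ t) = Q.κ t := by
  induction t with
  | zero => simp
  | tmul x y => simp [Sinv_mul]
  | add a b ha hb => simp only [map_add, ha, hb]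

theorem Sinv_evα (t : H ⊗[k] H) : Q.Sinv (Q.evα t) = Q.κ' t := by
  induction t with
  | zero => simp
  | tmul x y => simp [Sinv_mul, mul_assoc]
  | add a b ha hb => simp only [map_add, ha, hb]

instance rred_κ : RRed Q.κ (Q.cv inl inr) (Q.e _) := by
  have h : Q.κ = Q.Sinv ∘ₗ Q.evβ := LinearMap.ext fun t => (Q.Sinv_evβ t).symm
  rw [h]; infer_instance

instance lred_κ' : LRed Q.κ' (Q.cv inl inr) (Q.e _) := by
  have h : Q.κ' = Q.Sinv ∘ₗ Q.evα := LinearMap.ext fun t => (Q.Sinv_evα t).symm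
  rw [h]; infer_instance

/-- The first of the five positions in `H ⊗ (H ⊗ (A ⊗ (H ⊗ H)))`. -/
abbrev fiveLetter₁ (k H A : Type*) [Field k] [Ring H] [Algebra k H] [Ring A] [Algebra k A] :
    H →ₐ[k] H ⊗[k] (H ⊗[k] (A ⊗[k] (H ⊗[k] H))) := inl
/-- The second of the five positions in `H ⊗ (H ⊗ (A ⊗ (H ⊗ H)))`. -/
abbrev fiveLetter₂ (k H A : Type*) [Field k] [Ring H] [Algebra k H] [Ring A] [Algebra k A] :
    H →ₐ[k] H ⊗[k] (H ⊗[k] (A ⊗[k] (H ⊗[k] H))) := inr.comp inl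
/-- The middle one of the five positions in `H ⊗ (H ⊗ (A ⊗ (H ⊗ H)))`. -/
abbrev fiveLetter₃ (k H A : Type*) [Field k] [Ring H] [Algebra k H] [Ring A] [Algebra k A] :
    A →ₐ[k] H ⊗[k] (H ⊗[k] (A ⊗[k] (H ⊗[k] H))) := inr.comp (inr.comp inl)
/-- The fourth of the five positions in `H ⊗ (H ⊗ (A ⊗ (H ⊗ H)))`. -/
abbrev fiveLetter₄ (k H A : Type*) [Field k] [Ring H] [Algebra k H] [Ring A] [Algebra k A] :
    H →ₐ[k] H ⊗[k] (H ⊗[k] (A ⊗[k] (H ⊗[k] H))) := inr.comp (inr.comp (inr.comp inl))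
/-- The fifth of the five positions in `H ⊗ (H ⊗ (A ⊗ (H ⊗ H)))`. -/
abbrev fiveLetter₅ (k H A : Type*) [Field k] [Ring H] [Algebra k H] [Ring A] [Algebra k A] :
    H →ₐ[k] H ⊗[k] (H ⊗[k] (A ⊗[k] (H ⊗[k] H))) := inr.comp (inr.comp (inr.comp inr))

local notation "o₁" => fiveLetter₁ k H A
local notation "o₂" => fiveLetter₂ k H A
local notation "o₃" => fiveLetter₃ k H A
local notation "o₄" => fiveLetter₄ k H A
local notation "o₅" => fiveLetter₅ k H A

theorem pair_o : pair o₁ (pair o₂ (pair o₃ (pair o₄ o₅))) = AlgHom.id k _ := by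
  refine AlgHom.ext fun t => ?_
  induction t using tensor_induction₅ with
  | zero => simp
  | tmul x y z v w => simp
  | add a b ha hb => simp only [map_add, ha, hb]

variable (k H A) in
/-- `x ⊗ y ⊗ v ⊗ z ⊗ w ↦ (x ⊗ y) ⊗ (v ⊗ (z ⊗ w))`. -/
abbrev regroup : H ⊗[k] (H ⊗[k] (A ⊗[k] (H ⊗[k] H))) →ₐ[k] (H ⊗[k] H) ⊗[k] (A ⊗[k] (H ⊗[k] H)) :=
  (Algebra.TensorProduct.assoc k k k H H (A ⊗[k] (H ⊗[k] H))).symm.toAlgHom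

variable (A) in
/-- `x ⊗ y ⊗ v ⊗ z ⊗ w ↦ y S⁻¹(x β) ⊗ v ⊗ z β S(w)`. -/
def pFun : H ⊗[k] (H ⊗[k] (A ⊗[k] (H ⊗[k] H))) →ₗ[k] H ⊗[k] (A ⊗[k] H) :=
  TensorProduct.map Q.κ (TensorProduct.map LinearMap.id Q.evβ) ∘ₗ (regroup k H A).toLinearMap

variable (A) in
/-- `x ⊗ y ⊗ v ⊗ z ⊗ w ↦ S(x) α y ⊗ v ⊗ S⁻¹(α w) z`. -/
def qFun : H ⊗[k] (H ⊗[k] (A ⊗[k] (H ⊗[k] H))) →ₗ[k] H ⊗[k] (A ⊗[k] H) :=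
  TensorProduct.map Q.evα (TensorProduct.map LinearMap.id Q.κ') ∘ₗ (regroup k H A).toLinearMap

@[simp]
theorem pFun_tmul (x y z w : H) (v : A) : Q.pFun A (x ⊗ₜ (y ⊗ₜ (v ⊗ₜ (z ⊗ₜ w)))) =
    (y * Q.Sinv (x * Q.β)) ⊗ₜ (v ⊗ₜ (z * Q.β * Q.S w)) := rfl

@[simp]
theorem qFun_tmul (x y z w : H) (v : A) : Q.qFun A (x ⊗ₜ (y ⊗ₜ (v ⊗ₜ (z ⊗ₜ w)))) =
    (Q.S x * Q.α * y) ⊗ₜ (v ⊗ₜ (Q.Sinv (Q.α * w) * z)) := rfl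

theorem pElt_eq (c : CoactionData k H A) : pElt Q c = Q.pFun A c.Ψ.val := rfl

theorem qElt_eq (c : CoactionData k H A) : qElt Q c = Q.qFun A (c.Ψ⁻¹).val := rfl

theorem regroup_comp_o₁ : (regroup k H A).comp o₁ = inl.comp inl := AlgHom.ext fun _ => rfl
theorem regroup_comp_o₂ : (regroup k H A).comp o₂ = inl.comp inr := AlgHom.ext fun _ => rfl
theorem regroup_comp_o₄ : (regroup k H A).comp o₄ = inr.comp (inr.comp inl) :=
  AlgHom.ext fun _ => rfl
theorem regroup_comp_o₅ : (regroup k H A).comp o₅ = inr.comp (inr.comp inr) :=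
  AlgHom.ext fun _ => rfl

instance rred_pFun_left : RRed (Q.pFun A) (Q.cv o₁ o₂) (Q.e _) := by
  refine RRed.precomp _ _ _ _ ?_
  simp only [Q.comp_cv, Q.comp_e, regroup_comp_o₁, regroup_comp_o₂]
  infer_instance

instance rred_pFun_right : RRed (Q.pFun A) (Q.cv o₄ o₅) (Q.e _) := by
  refine RRed.precomp _ _ _ _ ?_
  simp only [Q.comp_cv, Q.comp_e, regroup_comp_o₄, regroup_comp_o₅]
  infer_instance

instance lred_qFun_left : LRed (Q.qFun A) (Q.cv o₁ o₂) (Q.e _) := by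
  refine LRed.precomp _ _ _ _ ?_
  simp only [Q.comp_cv, Q.comp_e, regroup_comp_o₁, regroup_comp_o₂]
  infer_instance

instance lred_qFun_right : LRed (Q.qFun A) (Q.cv o₄ o₅) (Q.e _) := by
  refine LRed.precomp _ _ _ _ ?_
  simp only [Q.comp_cv, Q.comp_e, regroup_comp_o₄, regroup_comp_o₅]
  infer_instance

theorem pFun_mul_o₃ (t : H ⊗[k] (H ⊗[k] (A ⊗[k] (H ⊗[k] H)))) (v : A) :
    Q.pFun A (t * o₃ v) = Q.pFun A t * (1 ⊗ₜ (v ⊗ₜ 1)) := by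
  induction t using tensor_induction₅ with
  | zero => simp
  | tmul x y z v w => simp
  | add a b ha hb => simp only [add_mul, map_add, ha, hb]

theorem qFun_o₃_mul (t : H ⊗[k] (H ⊗[k] (A ⊗[k] (H ⊗[k] H)))) (v : A) :
    Q.qFun A (o₃ v * t) = (1 ⊗ₜ (v ⊗ₜ 1)) * Q.qFun A t := by
  induction t using tensor_induction₅ with
  | zero => simp
  | tmul x y z v w => simp
  | add a b ha hb => simp only [mul_add, map_add, ha, hb]

variable (k H A) in
/-- `x ⊗ v ⊗ y ↦ 1 ⊗ x ⊗ v ⊗ y ⊗ 1`. -/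
def oIn : H ⊗[k] (A ⊗[k] H) →ₐ[k] H ⊗[k] (H ⊗[k] (A ⊗[k] (H ⊗[k] H))) :=
  pair o₂ (pair o₃ o₄)

@[simp]
theorem oIn_tmul (x y : H) (v : A) :
    oIn k H A (x ⊗ₜ (v ⊗ₜ y)) = 1 ⊗ₜ (x ⊗ₜ (v ⊗ₜ (y ⊗ₜ 1))) := by
  simp [oIn]

theorem pFun_outer_mul (a b : H) (s : H ⊗[k] (A ⊗[k] H))
    (t : H ⊗[k] (H ⊗[k] (A ⊗[k] (H ⊗[k] H)))) :
    Q.pFun A (a ⊗ₜ (1 ⊗ₜ (1 ⊗ₜ (1 ⊗ₜ b))) * (oIn k H A s * t)) =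
      s * Q.pFun A t * (Q.Sinv a ⊗ₜ (1 ⊗ₜ Q.S b)) := by
  induction t using tensor_induction₅ with
  | zero => simp only [mul_zero, zero_mul, map_zero]
  | tmul x y z v w =>
    induction s using tensor_induction₃ with
    | zero => simp only [mul_zero, zero_mul, map_zero]
    | tmul s₁ s₂ s₃ =>
      simp only [oIn_tmul, Algebra.TensorProduct.tmul_mul_tmul, one_mul, mul_one, pFun_tmul,
        Sinv_mul, S_mul, mul_assoc]
    | add s s' hs hs' => simp only [add_mul, mul_add, map_add, hs, hs']
  | add t t' ht ht' => simp only [add_mul, mul_add, map_add, ht, ht']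

theorem qFun_mul_outer (a b : H) (s : H ⊗[k] (A ⊗[k] H))
    (t : H ⊗[k] (H ⊗[k] (A ⊗[k] (H ⊗[k] H)))) :
    Q.qFun A (t * (a ⊗ₜ (1 ⊗ₜ (1 ⊗ₜ (1 ⊗ₜ b))) * oIn k H A s)) =
      (Q.S a ⊗ₜ (1 ⊗ₜ Q.Sinv b)) * Q.qFun A t * s := by
  induction t using tensor_induction₅ with
  | zero => simp only [mul_zero, zero_mul, map_zero]
  | tmul x y z v w =>
    induction s using tensor_induction₃ with
    | zero => simp only [mul_zero, map_zero]
    | tmul s₁ s₂ s₃ =>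
      simp only [oIn_tmul, Algebra.TensorProduct.tmul_mul_tmul, one_mul, mul_one, qFun_tmul,
        Sinv_mul, S_mul, mul_assoc]
    | add s s' hs hs' => simp only [mul_add, map_add, hs, hs']
  | add t t' ht ht' => simp only [add_mul, mul_add, map_add, ht, ht']

end QuasiHopfAlgebra

/-! ### The linear isomorphism between the two crossed products -/

theorem pair_tmul₅ {k X₁ X₂ X₃ X₄ X₅ R : Type*} [Field k] [Ring X₁] [Algebra k X₁] [Ring X₂]
    [Algebra k X₂] [Ring X₃] [Algebra k X₃] [Ring X₄] [Algebra k X₄] [Ring X₅] [Algebra k X₅]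
    [Ring R] [Algebra k R] (f₁ : X₁ →ₐ[k] R) (f₂ : X₂ →ₐ[k] R) (f₃ : X₃ →ₐ[k] R) (f₄ : X₄ →ₐ[k] R)
    (f₅ : X₅ →ₐ[k] R) [Comm f₁ f₂] [Comm f₁ f₃] [Comm f₁ f₄] [Comm f₁ f₅] [Comm f₂ f₃] [Comm f₂ f₄]
    [Comm f₂ f₅] [Comm f₃ f₄] [Comm f₃ f₅] [Comm f₄ f₅] (x₁ : X₁) (x₂ : X₂) (x₃ : X₃) (x₄ : X₄)
    (x₅ : X₅) : pair f₁ (pair f₂ (pair f₃ (pair f₄ f₅))) (x₁ ⊗ₜ (x₂ ⊗ₜ (x₃ ⊗ₜ (x₄ ⊗ₜ x₅)))) =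
      f₁ x₁ * (f₂ x₂ * (f₃ x₃ * (f₄ x₄ * f₅ x₅))) := by
  simp only [pair_tmul]

section Theta

open QuasiHopfAlgebra

variable {k H : Type*} [Field k] [Ring H] [Algebra k H] {Q : QuasiHopfAlgebra k H}
  {A : Type*} [Ring A] [Algebra k A]
  {𝒜 : Type*} [NonAssocRing 𝒜] [Module k 𝒜] [SMulCommClass k 𝒜 𝒜] [IsScalarTower k 𝒜 𝒜]
  (M : BimoduleAlgebra Q.toQuasiBialgebra 𝒜)

variable (A) in
/-- `a ⊗ v ⊗ b` acts on `𝒜 ⊗ A` by `φ ⊗ u ↦ a · φ · S⁻¹(b) ⊗ v u`. -/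
def BimoduleAlgebra.actTensor : H ⊗[k] (A ⊗[k] H) →ₐ[k] Module.End k (𝒜 ⊗[k] A) :=
  pair (hd M.L) (pair (sh (lm k A)) (hd M.R))

theorem BimoduleAlgebra.actTensor_tmul (a b : H) (v u : A) (φ : 𝒜) :
    M.actTensor A (a ⊗ₜ (v ⊗ₜ b)) (φ ⊗ₜ u) = M.lact a (M.ract (Q.Sinv b) φ) ⊗ₜ (v * u) := by
  simp [BimoduleAlgebra.actTensor, M.L_apply, M.R_apply]

theorem thetaInvTerm_eq (φ : 𝒜) (t : H ⊗[k] (A ⊗[k] H)) :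
    thetaInvTerm M φ t = M.actTensor A t (φ ⊗ₜ 1) := by
  induction t using tensor_induction₃ with
  | zero => simp
  | tmul a v b => rw [thetaInvTerm_tmul, M.actTensor_tmul, mul_one]
  | add a b ha hb => simp only [map_add, ha, hb, LinearMap.add_apply]

theorem thetaInvTerm_lact_ract (φ : 𝒜) (a b : H) (t : H ⊗[k] (A ⊗[k] H)) :
    thetaInvTerm M (M.lact (Q.Sinv a) (M.ract b φ)) t =
      thetaInvTerm M φ (t * (Q.Sinv a ⊗ₜ (1 ⊗ₜ Q.S b))) := by
  induction t using tensor_induction₃ with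
  | zero => simp only [map_zero, zero_mul]
  | tmul x v y =>
    simp only [Algebra.TensorProduct.tmul_mul_tmul, thetaInvTerm_tmul, mul_one, M.mul_lact,
      M.lact_ract, Sinv_mul, Sinv_S, M.mul_ract]
  | add s t hs ht => simp only [map_add, hs, ht, add_mul]

theorem thetaTerm_lact_ract (φ : 𝒜) (a b : H) (t : H ⊗[k] (A ⊗[k] H)) :
    thetaTerm M (M.lact a (M.ract (Q.Sinv b) φ)) t =
      thetaTerm M φ ((Q.S a ⊗ₜ (1 ⊗ₜ Q.Sinv b)) * t) := by
  induction t using tensor_induction₃ with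
  | zero => simp only [map_zero, mul_zero]
  | tmul x v y =>
    simp only [Algebra.TensorProduct.tmul_mul_tmul, thetaTerm_tmul, one_mul, M.mul_lact,
      M.lact_ract, Sinv_mul, Sinv_S, M.mul_ract]
  | add s t hs ht => simp only [map_add, hs, ht, mul_add]

variable (A) in
/-- `thetaTerm` as a bilinear map. -/
def thetaBilin : 𝒜 →ₗ[k] H ⊗[k] (A ⊗[k] H) →ₗ[k] A ⊗[k] 𝒜 :=
  LinearMap.mk₂ k (fun φ t => thetaTerm M φ t)
    (fun φ φ' t => by
      induction t using tensor_induction₃ with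
      | zero => simp
      | tmul x v y => simp only [thetaTerm_tmul, map_add, TensorProduct.tmul_add]
      | add s t hs ht => simp only [map_add, hs, ht]; abel)
    (fun r φ t => by
      induction t using tensor_induction₃ with
      | zero => simp
      | tmul x v y => simp only [thetaTerm_tmul, map_smul, TensorProduct.tmul_smul]
      | add s t hs ht => simp only [map_add, hs, ht, smul_add])
    (fun φ s t => map_add _ s t) (fun r φ t => map_smul _ r t)

local notation "o₁" => QuasiHopfAlgebra.fiveLetter₁ k H A
local notation "o₂" => QuasiHopfAlgebra.fiveLetter₂ k H A
local notation "o₃" => QuasiHopfAlgebra.fiveLetter₃ k H A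
local notation "o₄" => QuasiHopfAlgebra.fiveLetter₄ k H A
local notation "o₅" => QuasiHopfAlgebra.fiveLetter₅ k H A

namespace CoactionData

variable (c : CoactionData k H A)

/-- The linear map `φ ⊗ u ↦ q² u₍₀₎ ⊗ S⁻¹(q¹ u₍₋₁₎) · φ · q³ u₍₁₎`. -/
def theta : 𝒜 ⊗[k] A →ₗ[k] A ⊗[k] 𝒜 :=
  TensorProduct.lift ((thetaBilin A M).compl₂ (LinearMap.mulLeft k (qElt Q c) ∘ₗ c.δ.toLinearMap))

@[simp]
theorem theta_tmul (φ : 𝒜) (u : A) :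
    c.theta M (φ ⊗ₜ u) = thetaTerm M φ (qElt Q c * c.δ u) := rfl

/-- `φ ↦ p¹ · φ · S⁻¹(p³) ⊗ p²`. -/
def lead : 𝒜 →ₗ[k] 𝒜 ⊗[k] A := M.actTensor A (pElt Q c) ∘ₗ (TensorProduct.mk k 𝒜 A).flip 1

theorem lead_apply (φ : 𝒜) : c.lead M φ = M.actTensor A (pElt Q c) (φ ⊗ₜ 1) := rfl

/-- The linear map `u ⊗ φ ↦ u₍₋₁₎ p¹ · φ · S⁻¹(u₍₁₎ p³) ⊗ u₍₀₎ p²`. -/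
def thetaInv : A ⊗[k] 𝒜 →ₗ[k] 𝒜 ⊗[k] A :=
  TensorProduct.lift ((c.act M).toLinearMap.compl₂ (c.lead M))

theorem thetaInv_tmul_eq_act (u : A) (φ : 𝒜) :
    c.thetaInv M (u ⊗ₜ φ) = c.act M u (c.lead M φ) := rfl

@[simp]
theorem thetaInv_tmul (u : A) (φ : 𝒜) :
    c.thetaInv M (u ⊗ₜ φ) = thetaInvTerm M φ (c.δ u * pElt Q c) := by
  rw [thetaInvTerm_eq, map_mul, thetaInv_tmul_eq_act, lead_apply]; rfl

/-- `a ⊗ v ⊗ b ↦ a ⊗ v₍₋₁₎ ⊗ v₍₀₎ ⊗ v₍₁₎ ⊗ b`. -/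
abbrev spread : H ⊗[k] (A ⊗[k] H) →ₐ[k] H ⊗[k] (H ⊗[k] (A ⊗[k] (H ⊗[k] H))) :=
  pair o₁ (pair (c.dl o₂ o₃ o₄) o₅)

theorem spread_tmul (a b : H) (v : A) :
    c.spread (a ⊗ₜ (v ⊗ₜ b)) = a ⊗ₜ (1 ⊗ₜ (1 ⊗ₜ (1 ⊗ₜ b))) * oIn k H A (c.δ v) := by
  have h : a ⊗ₜ (1 ⊗ₜ (1 ⊗ₜ (1 ⊗ₜ b))) = o₁ a * o₅ b := by
    simp
  rw [pair_tmul, pair_tmul, h, mul_assoc]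
  refine congrArg (o₁ a * ·) ?_
  exact (Comm.comm (i := c.dl o₂ o₃ o₄) (j := o₅) v b).eq

/-- The composite of `ϑ` and its inverse on a pure tensor is a `p`-contraction. -/
theorem thetaInv_thetaTerm (φ : 𝒜) (y : H ⊗[k] (A ⊗[k] H)) :
    c.thetaInv M (thetaTerm M φ y) = thetaInvTerm M φ (Q.pFun A (c.spread y * c.Ψ.val)) := by
  induction y using tensor_induction₃ with
  | zero => simp only [map_zero, zero_mul]
  | tmul a v b =>
    rw [thetaTerm_tmul, thetaInv_tmul, thetaInvTerm_lact_ract, spread_tmul,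
      mul_assoc _ _ c.Ψ.val, pFun_outer_mul, ← pElt_eq]
  | add s t hs ht => simp only [map_add, hs, ht, add_mul]

theorem theta_thetaInvTerm (φ : 𝒜) (y : H ⊗[k] (A ⊗[k] H)) :
    c.theta M (thetaInvTerm M φ y) = thetaTerm M φ (Q.qFun A ((c.Ψ⁻¹).val * c.spread y)) := by
  induction y using tensor_induction₃ with
  | zero => simp only [map_zero, mul_zero]
  | tmul a v b =>
    rw [thetaInvTerm_tmul, theta_tmul, thetaTerm_lact_ract, spread_tmul,
      qFun_mul_outer, ← qElt_eq, mul_assoc]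
  | add s t hs ht => simp only [map_add, hs, ht, mul_add]

variable (k H A) in
/-- The seven-fold tensor product carrying the letters `1, 2, 3, n, 4, 5, 6`. -/
abbrev Seven : Type _ := (H ⊗[k] (H ⊗[k] H)) ⊗[k] (A ⊗[k] (H ⊗[k] (H ⊗[k] H)))

section Letters

variable (k H A : Type*) [Field k] [Ring H] [Algebra k H] [Ring A] [Algebra k A]

abbrev sevenLetter₁ : H →ₐ[k] Seven k H A := inl.comp inl
abbrev sevenLetter₂ : H →ₐ[k] Seven k H A := inl.comp (inr.comp inl)
abbrev sevenLetter₃ : H →ₐ[k] Seven k H A := inl.comp (inr.comp inr)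
/-- The letter at `A`; the letters `1` to `3` stand to its left and `4` to `6` to its right. -/
abbrev sevenLetter₀ : A →ₐ[k] Seven k H A := inr.comp inl
abbrev sevenLetter₄ : H →ₐ[k] Seven k H A := inr.comp (inr.comp inl)
abbrev sevenLetter₅ : H →ₐ[k] Seven k H A := inr.comp (inr.comp (inr.comp inl))
abbrev sevenLetter₆ : H →ₐ[k] Seven k H A := inr.comp (inr.comp (inr.comp inr))

end Letters

local notation "s₀" => sevenLetter₀ k H A
local notation "s₁" => sevenLetter₁ k H A
local notation "s₂" => sevenLetter₂ k H A
local notation "s₃" => sevenLetter₃ k H A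
local notation "s₄" => sevenLetter₄ k H A
local notation "s₅" => sevenLetter₅ k H A
local notation "s₆" => sevenLetter₆ k H A

variable (Q A) in
/-- `1 ⊗ 2 ⊗ 3 ⊗ n ⊗ 4 ⊗ 5 ⊗ 6 ↦ S⁻¹(S(1) α 2 β S(3)) ⊗ n ⊗ 4 β S(5) α 6`. -/
abbrev zagZig : Seven k H A →ₗ[k] H ⊗[k] (A ⊗[k] H) :=
  TensorProduct.map (Q.Sinv ∘ₗ Q.std.zagMap) (TensorProduct.map LinearMap.id Q.std.zigMap)

variable (Q A) in
/-- `1 ⊗ 2 ⊗ 3 ⊗ n ⊗ 4 ⊗ 5 ⊗ 6 ↦ 1 β S(2) α 3 ⊗ n ⊗ S⁻¹(S(4) α 5 β S(6))`. -/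
abbrev zigZag : Seven k H A →ₗ[k] H ⊗[k] (A ⊗[k] H) :=
  TensorProduct.map Q.std.zigMap (TensorProduct.map LinearMap.id (Q.Sinv ∘ₗ Q.std.zagMap))

theorem std_zigMap_tmul (x y z : H) : Q.std.zigMap (x ⊗ₜ (y ⊗ₜ z)) =
    x * Q.β * (Q.S y * Q.α * z) := rfl

theorem std_zagMap_tmul (x y z : H) : Q.std.zagMap (x ⊗ₜ (y ⊗ₜ z)) =
    Q.S x * Q.α * (y * Q.β * Q.S z) := rfl

variable (k H A) in
/-- `x ⊗ v ⊗ y` placed at the letters adjacent to `A` and at `A`. -/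
def sIn : H ⊗[k] (A ⊗[k] H) →ₐ[k] Seven k H A := pair s₃ (pair s₀ s₄)

variable (k H A) in
/-- `H ⊗ H ⊗ A ⊗ H ⊗ H` placed at the five innermost letters. -/
def tIn : H ⊗[k] (H ⊗[k] (A ⊗[k] (H ⊗[k] H))) →ₐ[k] Seven k H A :=
  pair s₂ (pair s₃ (pair s₀ (pair s₄ s₅)))

theorem sIn_tmul (x y : H) (v : A) : sIn k H A (x ⊗ₜ (v ⊗ₜ y)) =
    (1 ⊗ₜ (1 ⊗ₜ x)) ⊗ₜ (v ⊗ₜ (y ⊗ₜ (1 ⊗ₜ 1))) := by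
  refine (pair_tmul _ _ _ _).trans ((congrArg (_ * ·) (pair_tmul _ _ _ _)).trans ?_)
  simp only [AlgHom.comp_apply, Algebra.TensorProduct.includeLeft_apply,
    Algebra.TensorProduct.includeRight_apply, Algebra.TensorProduct.tmul_mul_tmul, one_mul,
    mul_one, Algebra.TensorProduct.one_def]

theorem tIn_tmul (x y z w : H) (v : A) : tIn k H A (x ⊗ₜ (y ⊗ₜ (v ⊗ₜ (z ⊗ₜ w)))) =
    (1 ⊗ₜ (x ⊗ₜ y)) ⊗ₜ (v ⊗ₜ (z ⊗ₜ (w ⊗ₜ 1))) := by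
  refine (pair_tmul₅ _ _ _ _ _ _ _ _ _ _).trans ?_
  simp only [AlgHom.comp_apply, Algebra.TensorProduct.includeLeft_apply,
    Algebra.TensorProduct.includeRight_apply, Algebra.TensorProduct.tmul_mul_tmul, one_mul,
    mul_one, Algebra.TensorProduct.one_def]

theorem zagZig_mul (x₁ x₂ x₄ x₅ : H) (d : H ⊗[k] (A ⊗[k] H))
    (t : H ⊗[k] (H ⊗[k] (A ⊗[k] (H ⊗[k] H)))) :
    zagZig Q A (((x₁ ⊗ₜ (x₂ ⊗ₜ 1)) ⊗ₜ 1) * (sIn k H A d * (1 ⊗ₜ (1 ⊗ₜ (1 ⊗ₜ (x₄ ⊗ₜ x₅))))) *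
      tIn k H A t) = Q.pFun A ((Q.S x₁ * Q.α * x₂) ⊗ₜ (1 ⊗ₜ (1 ⊗ₜ (1 ⊗ₜ (Q.Sinv (Q.α * x₅) * x₄)))) *
        oIn k H A d * t) := by
  induction d using tensor_induction₃ with
  | zero => simp only [map_zero, zero_mul, mul_zero]
  | tmul a u b =>
    induction t using tensor_induction₅ with
    | zero => simp only [map_zero, mul_zero]
    | tmul y₁ y₂ w y₄ y₅ =>
      simp only [Algebra.TensorProduct.one_def, sIn_tmul, tIn_tmul, oIn_tmul,
        Algebra.TensorProduct.tmul_mul_tmul, one_mul, mul_one, pFun_tmul,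
        TensorProduct.map_tmul, LinearMap.comp_apply, LinearMap.id_apply, std_zigMap_tmul,
        std_zagMap_tmul, Sinv_mul, S_mul, S_Sinv, Sinv_S, mul_assoc]
    | add t t' ht ht' => simp only [map_add, mul_add, ht, ht']
  | add d d' hd hd' => simp only [map_add, mul_add, add_mul, hd, hd']

theorem zigZag_mul (x₁ x₂ x₄ x₅ : H) (d : H ⊗[k] (A ⊗[k] H))
    (t : H ⊗[k] (H ⊗[k] (A ⊗[k] (H ⊗[k] H)))) :
    zigZag Q A (tIn k H A t *
      (((x₁ ⊗ₜ (x₂ ⊗ₜ 1)) ⊗ₜ 1) * (sIn k H A d * (1 ⊗ₜ (1 ⊗ₜ (1 ⊗ₜ (x₄ ⊗ₜ x₅))))))) =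
      Q.qFun A (t * ((x₂ * Q.Sinv (x₁ * Q.β)) ⊗ₜ (1 ⊗ₜ (1 ⊗ₜ (1 ⊗ₜ (x₄ * Q.β * Q.S x₅)))) *
        oIn k H A d)) := by
  induction d using tensor_induction₃ with
  | zero => simp only [map_zero, zero_mul, mul_zero]
  | tmul a u b =>
    induction t using tensor_induction₅ with
    | zero => simp only [map_zero, zero_mul]
    | tmul y₁ y₂ w y₄ y₅ =>
      simp only [Algebra.TensorProduct.one_def, sIn_tmul, tIn_tmul, oIn_tmul,
        Algebra.TensorProduct.tmul_mul_tmul, one_mul, mul_one, qFun_tmul,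
        TensorProduct.map_tmul, LinearMap.comp_apply, LinearMap.id_apply, std_zigMap_tmul,
        std_zagMap_tmul, Sinv_mul, S_mul, S_Sinv, Sinv_S, mul_assoc]
    | add t t' ht ht' => simp only [map_add, add_mul, ht, ht']
  | add d d' hd hd' => simp only [map_add, mul_add, add_mul, hd, hd']

/-- `a ⊗ b ⊗ v ⊗ c ⊗ d` placed at the letters `1, 2, (3 n 4), 5, 6`. -/
abbrev wide : H ⊗[k] (H ⊗[k] (A ⊗[k] (H ⊗[k] H))) →ₐ[k] Seven k H A :=
  pair s₁ (pair s₂ (pair (c.dl s₃ s₀ s₄) (pair s₅ s₆)))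

theorem wide_tmul (x₁ x₂ x₄ x₅ : H) (v : A) : c.wide (x₁ ⊗ₜ (x₂ ⊗ₜ (v ⊗ₜ (x₄ ⊗ₜ x₅)))) =
    ((x₁ ⊗ₜ (x₂ ⊗ₜ 1)) ⊗ₜ 1) *
      (sIn k H A (c.δ v) * (1 ⊗ₜ (1 ⊗ₜ (1 ⊗ₜ (x₄ ⊗ₜ x₅))))) := by
  refine (pair_tmul₅ _ _ _ _ _ _ _ _ _ _).trans ?_
  have h₁ : (s₁ x₁ * s₂ x₂ : Seven k H A) = (x₁ ⊗ₜ (x₂ ⊗ₜ 1)) ⊗ₜ 1 := by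
    simp only [AlgHom.comp_apply, Algebra.TensorProduct.includeLeft_apply,
    Algebra.TensorProduct.includeRight_apply, Algebra.TensorProduct.tmul_mul_tmul,
      one_mul, mul_one]
  have h₂ : (s₅ x₄ * s₆ x₅ : Seven k H A) = 1 ⊗ₜ (1 ⊗ₜ (1 ⊗ₜ (x₄ ⊗ₜ x₅))) := by
    simp only [AlgHom.comp_apply, Algebra.TensorProduct.includeLeft_apply,
    Algebra.TensorProduct.includeRight_apply, Algebra.TensorProduct.tmul_mul_tmul,
      one_mul, mul_one]
  rw [← mul_assoc, h₁, h₂]; rfl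

theorem pFun_spread_qFun (s t : H ⊗[k] (H ⊗[k] (A ⊗[k] (H ⊗[k] H)))) :
    Q.pFun A (c.spread (Q.qFun A s) * t) = zagZig Q A (c.wide s * tIn k H A t) := by
  induction s using tensor_induction₅ with
  | zero => simp only [map_zero, zero_mul]
  | tmul x₁ x₂ v x₄ x₅ => rw [qFun_tmul, spread_tmul, wide_tmul, zagZig_mul]
  | add s s' hs hs' => simp only [map_add, add_mul, hs, hs']

theorem qFun_spread_pFun (t s : H ⊗[k] (H ⊗[k] (A ⊗[k] (H ⊗[k] H)))) :
    Q.qFun A (t * c.spread (Q.pFun A s)) = zigZag Q A (tIn k H A t * c.wide s) := by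
  induction s using tensor_induction₅ with
  | zero => simp only [map_zero, mul_zero]
  | tmul x₁ x₂ v x₄ x₅ => rw [pFun_tmul, spread_tmul, wide_tmul, zigZag_mul]
  | add s s' hs hs' => simp only [map_add, mul_add, hs, hs']

end CoactionData

namespace TwoSidedCoaction

open CoactionData

variable (D : TwoSidedCoaction Q.toQuasiBialgebra A)

local notation "s₀" => sevenLetter₀ k H A
local notation "s₁" => sevenLetter₁ k H A
local notation "s₂" => sevenLetter₂ k H A
local notation "s₃" => sevenLetter₃ k H A
local notation "s₄" => sevenLetter₄ k H A
local notation "s₅" => sevenLetter₅ k H A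
local notation "s₆" => sevenLetter₆ k H A

theorem pair_s_left (t : H ⊗[k] (H ⊗[k] H)) :
    pair s₁ (pair s₂ s₃) t = t ⊗ₜ 1 :=
  DFunLike.congr_fun (pair_comp_p (inl : _ →ₐ[k] Seven k H A)) t

theorem pair_s_right (t : H ⊗[k] (H ⊗[k] H)) :
    pair s₄ (pair s₅ s₆) t = 1 ⊗ₜ (1 ⊗ₜ t) :=
  DFunLike.congr_fun (pair_comp_p ((inr.comp inr : _ →ₐ[k] Seven k H A))) t

/-- `p` and `q` are inverse to each other in the order that gives `ϑ⁻¹ ∘ ϑ = id`. -/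
theorem pFun_spread_qElt_mul :
    Q.pFun A (D.spread (qElt Q D.toCoactionData) * D.Ψ.val) = 1 := by
  rw [qElt_eq, pFun_spread_qFun]
  refine (D.q_p_word (zagZig Q A) s₁ s₂ s₃ s₀ s₄ s₅ s₆).trans ?_
  change zagZig Q A (pair s₄ (pair s₅ s₆) Q.Φ.val *
    pair s₁ (pair s₂ s₃) (Q.Φ⁻¹).val) = 1
  rw [pair_s_left, pair_s_right, Algebra.TensorProduct.tmul_mul_tmul, one_mul, mul_one,
    TensorProduct.map_tmul, TensorProduct.map_tmul, LinearMap.comp_apply, Q.std.zagMap_Phi_inv,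
    Q.std.zigMap_Phi, Sinv_one]
  rfl

theorem qFun_inv_mul_spread_pElt :
    Q.qFun A ((D.Ψ⁻¹).val * D.spread (pElt Q D.toCoactionData)) = 1 := by
  rw [pElt_eq, qFun_spread_pFun]
  refine (D.p_q_word (zigZag Q A) s₁ s₂ s₃ s₀ s₄ s₅ s₆).trans ?_
  change zigZag Q A (pair s₁ (pair s₂ s₃) Q.Φ.val *
    pair s₄ (pair s₅ s₆) (Q.Φ⁻¹).val) = 1
  rw [pair_s_left, pair_s_right, Algebra.TensorProduct.tmul_mul_tmul, one_mul, mul_one,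
    TensorProduct.map_tmul, TensorProduct.map_tmul, LinearMap.comp_apply, Q.std.zagMap_Phi_inv,
    Q.std.zigMap_Phi, Sinv_one]
  rfl

theorem spread_δ (u : A) : D.spread (D.δ u) = D.dl o₁ (D.dl o₂ o₃ o₄) o₅ u := rfl

/-- Moving `δ(u)` through `Ψ` turns it into `u`, since the `p`-contraction absorbs the rest. -/
theorem pFun_mul_spread_δ_mul (t : H ⊗[k] (H ⊗[k] (A ⊗[k] (H ⊗[k] H)))) (u : A) :
    Q.pFun A (t * D.spread (D.δ u) * D.Ψ.val) = Q.pFun A (t * D.Ψ.val) * (1 ⊗ₜ (u ⊗ₜ 1)) := by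
  have h := (D.intw_Ps o₁ o₂ o₃ o₄ o₅).intw u
  rw [ap_val, pair_o] at h
  have h' : Q.pFun A (t * D.Ψ.val * D.dl (Q.cv o₁ o₂) o₃ (Q.cv o₄ o₅) u) =
      Q.pFun A (t * D.Ψ.val * D.dl (Q.e _) o₃ (Q.e _) u) := RRed.red _ _
  rw [D.dl_e_e, pFun_mul_o₃] at h'
  rw [← h', spread_δ, mul_assoc, mul_assoc]
  exact congrArg (fun w => Q.pFun A (t * w)) h.symm

theorem qFun_inv_mul_spread_δ_mul (u : A) (t : H ⊗[k] (H ⊗[k] (A ⊗[k] (H ⊗[k] H)))) :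
    Q.qFun A ((D.Ψ⁻¹).val * (D.spread (D.δ u) * t)) =
      (1 ⊗ₜ (u ⊗ₜ 1)) * Q.qFun A ((D.Ψ⁻¹).val * t) := by
  have h := (D.intw_Ps o₁ o₂ o₃ o₄ o₅).intw u
  rw [ap_val, pair_o] at h
  have h' : ∀ t, Q.qFun A (D.dl (Q.cv o₁ o₂) o₃ (Q.cv o₄ o₅) u * t) =
      Q.qFun A (D.dl (Q.e _) o₃ (Q.e _) u * t) := fun t => LRed.red _ _
  rw [D.dl_e_e] at h'
  rw [← qFun_o₃_mul, ← h', ← mul_assoc, ← mul_assoc, spread_δ]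
  refine congrArg (fun w => Q.qFun A (w * t)) ?_
  rw [Units.inv_mul_eq_iff_eq_mul, ← mul_assoc, Units.eq_mul_inv_iff_mul_eq]
  exact h.symm

theorem thetaInvTerm_mul_mid (φ : 𝒜) (t : H ⊗[k] (A ⊗[k] H)) (u : A) :
    thetaInvTerm M φ (t * (1 ⊗ₜ (u ⊗ₜ 1))) = M.actTensor A t (φ ⊗ₜ u) := by
  rw [thetaInvTerm_eq, map_mul, Module.End.mul_apply, M.actTensor_tmul, Sinv_one, M.one_lact,
    M.one_ract, mul_one]

theorem thetaInv_thetaTerm_δ (φ : 𝒜) (u : A) :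
    D.thetaInv M (thetaTerm M φ (D.δ u)) =
      M.actTensor A (pElt Q D.toCoactionData) (φ ⊗ₜ u) := by
  rw [thetaInv_thetaTerm, ← one_mul (D.spread _), pFun_mul_spread_δ_mul, one_mul, ← pElt_eq,
    thetaInvTerm_mul_mid]

theorem thetaInv_theta (ξ : 𝒜 ⊗[k] A) : D.thetaInv M (D.theta M ξ) = ξ := by
  induction ξ with
  | zero => simp
  | tmul φ u =>
    rw [theta_tmul, thetaInv_thetaTerm, map_mul D.spread, pFun_mul_spread_δ_mul,
      pFun_spread_qElt_mul, thetaInvTerm_mul_mid, map_one, Module.End.one_apply]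
  | add a b ha hb => simp only [map_add, ha, hb]

theorem theta_thetaInv (ξ : A ⊗[k] 𝒜) : D.theta M (D.thetaInv M ξ) = ξ := by
  induction ξ with
  | zero => simp
  | tmul u φ =>
    rw [thetaInv_tmul, theta_thetaInvTerm, map_mul D.spread, qFun_inv_mul_spread_δ_mul,
      qFun_inv_mul_spread_pElt, mul_one, thetaTerm_tmul, Sinv_one, M.one_lact, M.one_ract]
  | add a b ha hb => simp only [map_add, ha, hb]

end TwoSidedCoaction

end Theta

/-! ### The coherence behind multiplicativity -/

namespace TwoSidedCoaction

variable {k H : Type*} [Field k] [Ring H] [Algebra k H] {Q : QuasiBialgebra k H} {A : Type*}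
  [Ring A] [Algebra k A] (D : TwoSidedCoaction Q A) {R : Type*} [Ring R] [Algebra k R]
  {E : Type*} [AddCommGroup E] [Module k E] (ζ : R →ₗ[k] E)
  (a₁ a₂ a₃ a₄ : H →ₐ[k] R) (n : A →ₐ[k] R) (a₅ a₆ a₇ a₈ : H →ₐ[k] R)
    [Comm a₁ a₂] [Comm a₁ a₃] [Comm a₁ a₄] [Comm a₁ n] [Comm a₁ a₅] [Comm a₁ a₆] [Comm a₁ a₇]
    [Comm a₁ a₈] [Comm a₂ a₃] [Comm a₂ a₄] [Comm a₂ n] [Comm a₂ a₅] [Comm a₂ a₆] [Comm a₂ a₇]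
    [Comm a₂ a₈] [Comm a₃ a₄] [Comm a₃ n] [Comm a₃ a₅] [Comm a₃ a₆] [Comm a₃ a₇] [Comm a₃ a₈]
    [Comm a₄ n] [Comm a₄ a₅] [Comm a₄ a₆] [Comm a₄ a₇] [Comm a₄ a₈] [Comm n a₅] [Comm n a₆]
    [Comm n a₇] [Comm n a₈] [Comm a₅ a₆] [Comm a₅ a₇] [Comm a₅ a₈] [Comm a₆ a₇] [Comm a₆ a₈]
    [Comm a₇ a₈]

/-- An identity of words that holds before any contraction: hexagons, pentagons and naturality. -/
theorem product_word :
    D.Ps a₁ a₂ (D.dl (Q.cv a₃ a₄) n (Q.cv a₅ a₆)) a₇ a₈ *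
        D.Ps (Q.cv a₁ a₂) (Q.cv a₃ a₄) n (Q.cv a₅ a₆) (Q.cv a₇ a₈) *
          (Q.unfold a₁ a₂ a₃ a₄ * Q.unfold a₅ a₆ a₇ a₈) =
      (D.Ps a₃ a₄ n a₅ a₆)⁻¹ * D.Ps a₂ a₃ (D.dl a₄ n a₅) a₆ a₇ *
        D.Ps a₁ (Q.cv a₂ a₃) (D.dl a₄ n a₅) (Q.cv a₆ a₇) a₈ *
          (D.Ps (Q.cv a₁ (Q.cv a₂ a₃)) a₄ n a₅ (Q.cv (Q.cv a₆ a₇) a₈) *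
            Q.P a₅ (Q.cv a₆ a₇) a₈) := by
  have h₁ := D.hexagon (Q.cv a₁ a₂) a₃ a₄ n a₅ a₆ (Q.cv a₇ a₈)
  have h₂ := D.hexagon a₁ a₂ a₃ (D.dl a₄ n a₅) a₆ a₇ a₈
  have n₁ := D.Ps_conj' (D.Ps a₃ a₄ n a₅ a₆) (i := a₁) (i' := a₁) (j := a₂) (j' := a₂)
    (n := D.dl (Q.cv a₃ a₄) n (Q.cv a₅ a₆)) (n' := D.dl a₃ (D.dl a₄ n a₅) a₆)
    (l := a₇) (l' := a₇) (m := a₈) (m' := a₈)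
  have n₂ := D.Ps_conj' (Q.P a₁ a₂ a₃) (i := Q.cv (Q.cv a₁ a₂) a₃) (i' := Q.cv a₁ (Q.cv a₂ a₃))
    (j := a₄) (j' := a₄) (n := n) (n' := n) (l := a₅) (l' := a₅) (m := Q.cv (Q.cv a₆ a₇) a₈)
    (m' := Q.cv (Q.cv a₆ a₇) a₈)
  have n₃ := D.Ps_conj (Q.P a₆ a₇ a₈) (i := Q.cv (Q.cv a₁ a₂) a₃) (i' := Q.cv (Q.cv a₁ a₂) a₃)
    (j := a₄) (j' := a₄) (n := n) (n' := n) (l := a₅) (l' := a₅) (m := Q.cv (Q.cv a₆ a₇) a₈)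
    (m' := Q.cv a₆ (Q.cv a₇ a₈))
  have c₁ : Q.P a₁ a₂ a₃ * Q.P a₅ (Q.cv a₆ a₇) a₈ = Q.P a₅ (Q.cv a₆ a₇) a₈ * Q.P a₁ a₂ a₃ :=
    Q.P_nat _
  have c₂ : Q.P a₁ a₂ a₃ * Q.P a₅ a₆ a₇ = Q.P a₅ a₆ a₇ * Q.P a₁ a₂ a₃ := Q.P_nat _
  have c₃ : Q.P a₁ a₂ a₃ * Q.P (Q.cv a₅ a₆) a₇ a₈ = Q.P (Q.cv a₅ a₆) a₇ a₈ * Q.P a₁ a₂ a₃ :=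
    Q.P_nat _
  have pt := Q.pentagon a₅ a₆ a₇ a₈
  rw [QuasiBialgebra.unfold, QuasiBialgebra.unfold, n₂, n₃]
  rw [n₁] at h₂
  -- With the factors named, what remains is a computation in a group.
  generalize D.Ps a₁ a₂ (D.dl (Q.cv a₃ a₄) n (Q.cv a₅ a₆)) a₇ a₈ = X₁ at *
  generalize D.Ps (Q.cv a₁ a₂) (Q.cv a₃ a₄) n (Q.cv a₅ a₆) (Q.cv a₇ a₈) = X₂ at *
  generalize D.Ps a₃ a₄ n a₅ a₆ = U at *
  generalize D.Ps (Q.cv (Q.cv a₁ a₂) a₃) a₄ n a₅ (Q.cv a₆ (Q.cv a₇ a₈)) = W at *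
  generalize Q.P a₁ a₂ a₃ = F at *
  generalize Q.P a₆ a₇ a₈ = L at *
  generalize Q.P a₅ (Q.cv a₆ a₇) a₈ = N at *
  generalize Q.P a₅ a₆ (Q.cv a₇ a₈) = K at *
  generalize Q.P (Q.cv a₁ a₂) a₃ a₄ = G at *
  generalize D.Ps (Q.cv a₁ a₂) a₃ (D.dl a₄ n a₅) a₆ (Q.cv a₇ a₈) = V at *
  generalize D.Ps a₁ (Q.cv a₂ a₃) (D.dl a₄ n a₅) (Q.cv a₆ a₇) a₈ = Z at *
  generalize D.Ps a₂ a₃ (D.dl a₄ n a₅) a₆ a₇ = T at *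
  generalize Q.P a₅ a₆ a₇ = J at *
  generalize Q.P (Q.cv a₅ a₆) a₇ a₈ = M at *
  have h₁' : X₂ * G = U⁻¹ * (V * W) * K := by rw [← h₁]; group
  have h₂' : T * Z * F * L⁻¹ = U * X₁ * U⁻¹ * V := by rw [← h₂]; group
  have pt' : L * N = K * M * J⁻¹ := by rw [← pt]; group
  have c₁' : F⁻¹ * N = N * F⁻¹ := by rw [inv_mul_eq_iff_eq_mul, ← mul_assoc, c₁]; group
  have c₃' : F⁻¹ * M * J⁻¹ = M * J⁻¹ * F⁻¹ := by
    rw [mul_assoc M, ← mul_inv_rev, c₂, mul_inv_rev, ← mul_assoc, mul_left_inj,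
      inv_mul_eq_iff_eq_mul, ← mul_assoc, c₃, mul_inv_cancel_right]
  calc X₁ * X₂ * (G * F⁻¹ * (M * J⁻¹)) = X₁ * (X₂ * G) * (F⁻¹ * M * J⁻¹) := by group
    _ = U⁻¹ * (U * X₁ * U⁻¹ * V) * W * (K * M * J⁻¹) * F⁻¹ := by rw [h₁', c₃']; group
    _ = U⁻¹ * (T * Z) * (F * L⁻¹ * W * L) * (N * F⁻¹) := by rw [← h₂', ← pt']; group
    _ = U⁻¹ * T * Z * (F * (L⁻¹ * W * L) * F⁻¹ * N) := by rw [← c₁']; group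

/-- The coherence identity behind the multiplicativity of `ϑ⁻¹`: after contraction of `(2, 3)` and
`(6, 7)`, the word of a product of two leading terms is the word coming from `Ω'`. -/
theorem product_coherence [RRed ζ (Q.cv a₂ a₃) (Q.e R)] [RRed ζ (Q.cv a₆ a₇) (Q.e R)] :
    ζ (D.Ps a₁ a₂ (D.dl (Q.cv a₃ a₄) n (Q.cv a₅ a₆)) a₇ a₈ *
        D.Ps (Q.cv a₁ a₂) (Q.cv a₃ a₄) n (Q.cv a₅ a₆) (Q.cv a₇ a₈) *
          (Q.unfold a₁ a₂ a₃ a₄ * Q.unfold a₅ a₆ a₇ a₈) : Rˣ) =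
      ζ ((D.Ps a₃ a₄ n a₅ a₆)⁻¹ * D.Ps a₂ a₃ (D.dl a₄ n a₅) a₆ a₇ * D.Ps a₁ a₄ n a₅ a₈ : Rˣ) := by
  rw [product_word]
  generalize (D.Ps a₃ a₄ n a₅ a₆)⁻¹ * D.Ps a₂ a₃ (D.dl a₄ n a₅) a₆ a₇ = t
  rw [← mul_assoc, Q.P_rred _ _ _ a₅ (Q.e R) a₈, Q.P_mid, mul_one]
  have h₁ : RRed ζ (pair (Q.cv a₁ (Q.cv a₂ a₃)) (pair a₄ (pair n (pair a₅
      (Q.cv (Q.cv a₆ a₇) a₈))))) (pair a₁ (pair a₄ (pair n (pair a₅ a₈)))) := inferInstance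
  refine (RRed.ap (h := h₁) (t * D.Ps a₁ (Q.cv a₂ a₃) (D.dl a₄ n a₅) (Q.cv a₆ a₇) a₈)
    D.Ψ).trans ?_
  have r₁ : RRed (ζ ∘ₗ LinearMap.mulRight k (D.Ps a₁ a₄ n a₅ a₈ : R)) (Q.cv a₂ a₃) (Q.e R) :=
    RRed.mulRight _
  have r₂ : RRed (ζ ∘ₗ LinearMap.mulRight k (D.Ps a₁ a₄ n a₅ a₈ : R)) (Q.cv a₆ a₇) (Q.e R) :=
    RRed.mulRight _
  have h₂ := D.Ps_inner_rred (ζ ∘ₗ LinearMap.mulRight k (D.Ps a₁ a₄ n a₅ a₈ : R)) a₁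
    (Q.cv a₂ a₃) (D.dl a₄ n a₅) (Q.cv a₆ a₇) a₈ t
  simpa only [LinearMap.comp_apply, LinearMap.mulRight_apply, ← Units.val_mul] using h₂

end TwoSidedCoaction

/-! ### The product of leading terms, in tensors -/

namespace QuasiHopfAlgebra

variable {k H : Type*} [Field k] [Ring H] [Algebra k H] (Q : QuasiHopfAlgebra k H)

/-- `x ⊗ y ↦ S⁻¹(y) ⊗ S⁻¹(x)`. -/
def SSinv : H ⊗[k] H →ₗ[k] H ⊗[k] H :=
  TensorProduct.map Q.Sinv Q.Sinv ∘ₗ (TensorProduct.comm k H H).toLinearMap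

@[simp] theorem SSinv_tmul (x y : H) : Q.SSinv (x ⊗ₜ y) = Q.Sinv y ⊗ₜ Q.Sinv x := rfl

theorem SSinv_mul (s t : H ⊗[k] H) : Q.SSinv (s * t) = Q.SSinv t * Q.SSinv s := by
  induction s with
  | zero => simp
  | tmul x y =>
    induction t with
    | zero => simp
    | tmul z w => simp [Sinv_mul]
    | add a b ha hb => simp only [mul_add, add_mul, map_add, ha, hb]
  | add a b ha hb => simp only [mul_add, add_mul, map_add, ha, hb]

theorem SSinv_SS (t : H ⊗[k] H) : Q.SSinv (Q.SS t) = t := by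
  induction t with
  | zero => simp
  | tmul x y => simp [Sinv_S]
  | add a b ha hb => simp only [map_add, ha, hb]

section Quad

variable (k H : Type*) [Field k] [Ring H] [Algebra k H]

/-- The first of the four letters of `(H ⊗ H) ⊗ (H ⊗ H)`, placed as `(1 ⊗ 4) ⊗ (2 ⊗ 3)`. -/
abbrev quadLetter₁ : H →ₐ[k] (H ⊗[k] H) ⊗[k] (H ⊗[k] H) := inl.comp inl
/-- The second of the four letters of `(H ⊗ H) ⊗ (H ⊗ H)`, placed as `(1 ⊗ 4) ⊗ (2 ⊗ 3)`. -/
abbrev quadLetter₂ : H →ₐ[k] (H ⊗[k] H) ⊗[k] (H ⊗[k] H) := inr.comp inl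
/-- The third of the four letters of `(H ⊗ H) ⊗ (H ⊗ H)`, placed as `(1 ⊗ 4) ⊗ (2 ⊗ 3)`. -/
abbrev quadLetter₃ : H →ₐ[k] (H ⊗[k] H) ⊗[k] (H ⊗[k] H) := inr.comp inr
/-- The fourth of the four letters of `(H ⊗ H) ⊗ (H ⊗ H)`, placed as `(1 ⊗ 4) ⊗ (2 ⊗ 3)`. -/
abbrev quadLetter₄ : H →ₐ[k] (H ⊗[k] H) ⊗[k] (H ⊗[k] H) := inl.comp inr

end Quad

local notation "d₁" => quadLetter₁ k H
local notation "d₂" => quadLetter₂ k H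
local notation "d₃" => quadLetter₃ k H
local notation "d₄" => quadLetter₄ k H

theorem cupcup_unfold (u v : H ⊗[k] H) :
    Q.cupcup (pair d₁ d₂ u * pair d₃ d₄ v * (Q.unfold d₁ d₂ d₃ d₄).val) = u * Q.δ₀ * Q.SS v := by
  rw [δ₀_eq, mul_cupcup_SS]

theorem SSinv_cupcup_unfold (u v : H ⊗[k] H) :
    Q.SSinv (Q.cupcup (pair d₁ d₂ u * pair d₃ d₄ v * (Q.unfold d₁ d₂ d₃ d₄).val)) =
      v * Q.SSinv (u * Q.δ₀) := by
  rw [cupcup_unfold, SSinv_mul, SSinv_SS]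

theorem Δ_evβ_mul (b x y : H) (w : H ⊗[k] H) :
    Q.Δ (b * (x * Q.β * Q.S y)) * Q.fInv * Q.SS w =
      Q.Δ (b * x) * Q.δ₀ * Q.SS (w * Q.Δ y) := by
  rw [SS_mul, ← Δ_β_mul_fInv]
  simp only [map_mul, mul_assoc]
  rw [← mul_assoc (Q.Δ (Q.S y)), ← fInv_mul_SS, mul_assoc]

theorem Δ_κ_mul (a x y : H) (w : H ⊗[k] H) :
    Q.Δ (a * (y * Q.Sinv (x * Q.β))) * Q.SSinv (w * Q.fInv) =
      Q.Δ (a * y) * Q.SSinv (w * Q.Δ x * Q.δ₀) := by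
  have h : Q.Δ (Q.Sinv (x * Q.β)) = Q.SSinv (Q.SS (Q.Δ (Q.Sinv (x * Q.β)))) := (SSinv_SS _ _).symm
  rw [← mul_assoc a, map_mul, h, mul_assoc, ← SSinv_mul, mul_assoc w, fInv_mul_SS, S_Sinv,
    map_mul Q.Δ x, mul_assoc (Q.Δ x), Δ_β_mul_fInv, mul_assoc w]

end QuasiHopfAlgebra

namespace CoactionData

open QuasiHopfAlgebra

variable {k H : Type*} [Field k] [Ring H] [Algebra k H] {Q : QuasiHopfAlgebra k H}
  {A : Type*} [Ring A] [Algebra k A] (c : CoactionData k H A)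

variable (k H A) in
/-- The nine-fold tensor product carrying the letters `1, …, 8` and `n`, placed as
`((1 ⊗ 4) ⊗ (2 ⊗ 3)) ⊗ (n ⊗ ((5 ⊗ 8) ⊗ (6 ⊗ 7)))`. -/
abbrev Nine : Type _ :=
  ((H ⊗[k] H) ⊗[k] (H ⊗[k] H)) ⊗[k] (A ⊗[k] ((H ⊗[k] H) ⊗[k] (H ⊗[k] H)))

section Letters

variable (k H A : Type*) [Field k] [Ring H] [Algebra k H] [Ring A] [Algebra k A]

abbrev nineLetter₁ : H →ₐ[k] Nine k H A := inl.comp (quadLetter₁ k H)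
abbrev nineLetter₂ : H →ₐ[k] Nine k H A := inl.comp (quadLetter₂ k H)
abbrev nineLetter₃ : H →ₐ[k] Nine k H A := inl.comp (quadLetter₃ k H)
abbrev nineLetter₄ : H →ₐ[k] Nine k H A := inl.comp (quadLetter₄ k H)
/-- The letter at `A`; the letters `1` to `4` stand to its left and `5` to `8` to its right. -/
abbrev nineLetter₀ : A →ₐ[k] Nine k H A := inr.comp inl
abbrev nineLetter₅ : H →ₐ[k] Nine k H A := inr.comp (inr.comp (quadLetter₁ k H))
abbrev nineLetter₆ : H →ₐ[k] Nine k H A := inr.comp (inr.comp (quadLetter₂ k H))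
abbrev nineLetter₇ : H →ₐ[k] Nine k H A := inr.comp (inr.comp (quadLetter₃ k H))
abbrev nineLetter₈ : H →ₐ[k] Nine k H A := inr.comp (inr.comp (quadLetter₄ k H))

end Letters

local notation "d₁" => quadLetter₁ k H
local notation "d₂" => quadLetter₂ k H
local notation "d₃" => quadLetter₃ k H
local notation "d₄" => quadLetter₄ k H
local notation "l₀" => nineLetter₀ k H A
local notation "l₁" => nineLetter₁ k H A
local notation "l₂" => nineLetter₂ k H A
local notation "l₃" => nineLetter₃ k H A
local notation "l₄" => nineLetter₄ k H A
local notation "l₅" => nineLetter₅ k H A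
local notation "l₆" => nineLetter₆ k H A
local notation "l₇" => nineLetter₇ k H A
local notation "l₈" => nineLetter₈ k H A

variable (Q A) in
/-- The map pairing the letters `(2,3)`, `(1,4)` by `x ⊗ y ↦ S⁻¹(x β S(y))` and the letters
`(5,8)`, `(6,7)` by `x ⊗ y ↦ x β S(y)`. -/
abbrev zip : Nine k H A →ₗ[k] (H ⊗[k] H) ⊗[k] (A ⊗[k] (H ⊗[k] H)) :=
  TensorProduct.map (Q.SSinv ∘ₗ Q.cupcup) (TensorProduct.map LinearMap.id Q.cupcup)

instance rred_zip_left : RRed (zip Q A) (Q.cv l₂ l₃) (Q.e _) := inferInstance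
instance rred_zip_right : RRed (zip Q A) (Q.cv l₆ l₇) (Q.e _) := inferInstance

variable (k H A) in
/-- `H ⊗ A ⊗ H` placed at the letters adjacent to `A` and at `A`. -/
def dIn : H ⊗[k] (A ⊗[k] H) →ₐ[k] Nine k H A := pair l₄ (pair l₀ l₅)

variable (k H A) in
/-- `H ⊗ H ⊗ A ⊗ H ⊗ H` placed at the five innermost letters. -/
def rIn : H ⊗[k] (H ⊗[k] (A ⊗[k] (H ⊗[k] H))) →ₐ[k] Nine k H A :=
  pair l₃ (pair l₄ (pair l₀ (pair l₅ l₆)))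

variable (k H A) in
/-- `H ⊗ H ⊗ A ⊗ H ⊗ H` placed at the letters adjacent to `A`, at `A`, and at the two
outermost letters. -/
def uIn : H ⊗[k] (H ⊗[k] (A ⊗[k] (H ⊗[k] H))) →ₐ[k] Nine k H A :=
  pair l₁ (pair l₄ (pair l₀ (pair l₅ l₈)))

theorem dIn_tmul (x y : H) (v : A) : dIn k H A (x ⊗ₜ (v ⊗ₜ y)) =
    ((1 ⊗ₜ x) ⊗ₜ (1 ⊗ₜ 1)) ⊗ₜ (v ⊗ₜ ((y ⊗ₜ 1) ⊗ₜ (1 ⊗ₜ 1))) := by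
  refine (pair_tmul _ _ _ _).trans ((congrArg (_ * ·) (pair_tmul _ _ _ _)).trans ?_)
  simp only [AlgHom.comp_apply, Algebra.TensorProduct.includeLeft_apply,
    Algebra.TensorProduct.includeRight_apply, Algebra.TensorProduct.tmul_mul_tmul, one_mul,
    mul_one, Algebra.TensorProduct.one_def]

theorem rIn_tmul (x y z w : H) (v : A) : rIn k H A (x ⊗ₜ (y ⊗ₜ (v ⊗ₜ (z ⊗ₜ w)))) =
    ((1 ⊗ₜ y) ⊗ₜ (1 ⊗ₜ x)) ⊗ₜ (v ⊗ₜ ((z ⊗ₜ 1) ⊗ₜ (w ⊗ₜ 1))) := by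
  refine (pair_tmul₅ _ _ _ _ _ _ _ _ _ _).trans ?_
  simp only [AlgHom.comp_apply, Algebra.TensorProduct.includeLeft_apply,
    Algebra.TensorProduct.includeRight_apply, Algebra.TensorProduct.tmul_mul_tmul, one_mul,
    mul_one, Algebra.TensorProduct.one_def]

theorem uIn_tmul (x y z w : H) (v : A) : uIn k H A (x ⊗ₜ (y ⊗ₜ (v ⊗ₜ (z ⊗ₜ w)))) =
    ((x ⊗ₜ y) ⊗ₜ (1 ⊗ₜ 1)) ⊗ₜ (v ⊗ₜ ((z ⊗ₜ w) ⊗ₜ (1 ⊗ₜ 1))) := by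
  refine (pair_tmul₅ _ _ _ _ _ _ _ _ _ _).trans ?_
  simp only [AlgHom.comp_apply, Algebra.TensorProduct.includeLeft_apply,
    Algebra.TensorProduct.includeRight_apply, Algebra.TensorProduct.tmul_mul_tmul, one_mul,
    mul_one, Algebra.TensorProduct.one_def]

/-- `a ⊗ b ⊗ v ⊗ c ⊗ d` placed at the letters `2, 3, (4 n 5), 6, 7`. -/
abbrev midIn : H ⊗[k] (H ⊗[k] (A ⊗[k] (H ⊗[k] H))) →ₐ[k] Nine k H A :=
  pair l₂ (pair l₃ (pair (c.dl l₄ l₀ l₅) (pair l₆ l₇)))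

theorem midIn_tmul (x y z w : H) (v : A) : c.midIn (x ⊗ₜ (y ⊗ₜ (v ⊗ₜ (z ⊗ₜ w)))) =
    (((1 ⊗ₜ 1) ⊗ₜ (x ⊗ₜ y)) ⊗ₜ (1 ⊗ₜ ((1 ⊗ₜ 1) ⊗ₜ (1 ⊗ₜ 1)))) * (dIn k H A (c.δ v) *
      (((1 ⊗ₜ 1) ⊗ₜ (1 ⊗ₜ 1)) ⊗ₜ (1 ⊗ₜ ((1 ⊗ₜ 1) ⊗ₜ (z ⊗ₜ w))))) := by
  refine (pair_tmul₅ _ _ _ _ _ _ _ _ _ _).trans ?_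
  have h₁ : (l₂ x * l₃ y : Nine k H A) =
      ((1 ⊗ₜ 1) ⊗ₜ (x ⊗ₜ y)) ⊗ₜ (1 ⊗ₜ ((1 ⊗ₜ 1) ⊗ₜ (1 ⊗ₜ 1))) := by
    simp only [AlgHom.comp_apply, Algebra.TensorProduct.includeLeft_apply,
      Algebra.TensorProduct.includeRight_apply, Algebra.TensorProduct.tmul_mul_tmul, one_mul,
      mul_one, Algebra.TensorProduct.one_def]
  have h₂ : (l₆ z * l₇ w : Nine k H A) =
      ((1 ⊗ₜ 1) ⊗ₜ (1 ⊗ₜ 1)) ⊗ₜ (1 ⊗ₜ ((1 ⊗ₜ 1) ⊗ₜ (z ⊗ₜ w))) := by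
    simp only [AlgHom.comp_apply, Algebra.TensorProduct.includeLeft_apply,
      Algebra.TensorProduct.includeRight_apply, Algebra.TensorProduct.tmul_mul_tmul, one_mul,
      mul_one, Algebra.TensorProduct.one_def]
  rw [← mul_assoc, h₁, h₂]; rfl

theorem zip_tmul (x₁ x₂ x₃ x₄ x₅ x₆ x₇ x₈ : H) (v : A) :
    zip Q A (((x₁ ⊗ₜ x₄) ⊗ₜ (x₂ ⊗ₜ x₃)) ⊗ₜ (v ⊗ₜ ((x₅ ⊗ₜ x₈) ⊗ₜ (x₆ ⊗ₜ x₇)))) =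
      ((x₃ * Q.Sinv (x₂ * Q.β)) ⊗ₜ (x₄ * Q.Sinv (x₁ * Q.β))) ⊗ₜ
        (v ⊗ₜ ((x₅ * Q.β * Q.S x₈) ⊗ₜ (x₆ * Q.β * Q.S x₇))) := by
  simp only [TensorProduct.map_tmul, LinearMap.comp_apply, LinearMap.id_apply, evβ_tmul,
    SSinv_tmul, Sinv_mul, Sinv_S, mul_assoc]

/-- The product of two leading terms, as a contraction of three copies of `Ψ` or `Ψ⁻¹`. -/
theorem regroup_spread_pFun (r s t : H ⊗[k] (H ⊗[k] (A ⊗[k] (H ⊗[k] H)))) :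
    regroup k H A (r * c.spread (Q.pFun A s) * oIn k H A (Q.pFun A t)) =
      zip Q A (rIn k H A r * c.midIn s * uIn k H A t) := by
  induction s using tensor_induction₅ with
  | zero => simp only [map_zero, mul_zero, zero_mul]
  | tmul x₁ x₂ v x₄ x₅ =>
    rw [pFun_tmul, spread_tmul, midIn_tmul]
    generalize c.δ v = d
    induction d using tensor_induction₃ with
    | zero => simp only [map_zero, zero_mul, mul_zero]
    | tmul a u b =>
      induction t using tensor_induction₅ with
      | zero => simp only [map_zero, mul_zero]
      | tmul y₁ y₂ w y₄ y₅ =>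
        induction r using tensor_induction₅ with
        | zero => simp only [map_zero, zero_mul]
        | tmul z₁ z₂ q z₄ z₅ =>
          rw [rIn_tmul, uIn_tmul, dIn_tmul, pFun_tmul, oIn_tmul, oIn_tmul]
          simp only [Algebra.TensorProduct.tmul_mul_tmul, one_mul, mul_one]
          rw [zip_tmul]
          simp only [Sinv_mul, mul_assoc]
          rfl
        | add t t' ht ht' => simp only [map_add, add_mul, ht, ht']
      | add t t' ht ht' => simp only [map_add, mul_add, ht, ht']
    | add d d' hd hd' => simp only [map_add, mul_add, add_mul, hd, hd']
  | add s s' hs hs' => simp only [map_add, mul_add, add_mul, hs, hs']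

variable (Q A) in
/-- `Δ ⊗ id ⊗ Δ`. -/
def ΔΔ : H ⊗[k] (A ⊗[k] H) →ₐ[k] (H ⊗[k] H) ⊗[k] (A ⊗[k] (H ⊗[k] H)) :=
  Algebra.TensorProduct.map Q.Δ (Algebra.TensorProduct.map (AlgHom.id k A) Q.Δ)

theorem ΔΔ_tmul (x y : H) (v : A) : ΔΔ Q A (x ⊗ₜ (v ⊗ₜ y)) = Q.Δ x ⊗ₜ (v ⊗ₜ Q.Δ y) := rfl

variable (Q) in
/-- `H ⊗ H ⊗ A ⊗ H ⊗ H` placed with its outer factors at the four outer letters, and its middle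
factor spread over the five inner ones by `(Δ ⊗ id ⊗ Δ) ∘ δ`. -/
abbrev farIn : H ⊗[k] (H ⊗[k] (A ⊗[k] (H ⊗[k] H))) →ₐ[k] Nine k H A :=
  pair l₁ (pair l₂ (pair (c.dl (Q.cv l₃ l₄) l₀ (Q.cv l₅ l₆)) (pair l₇ l₈)))

variable (Q A) in
/-- `H ⊗ H ⊗ A ⊗ H ⊗ H` with every factor in `H` spread over two letters by `Δ`. -/
abbrev allIn : H ⊗[k] (H ⊗[k] (A ⊗[k] (H ⊗[k] H))) →ₐ[k] Nine k H A :=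
  pair (Q.cv l₁ l₂) (pair (Q.cv l₃ l₄) (pair l₀ (pair (Q.cv l₅ l₆) (Q.cv l₇ l₈))))

variable (Q A) in
/-- `H ⊗ A ⊗ H` with its factors in `H` spread by `Δ` over the two nearest letters on their side. -/
abbrev splitIn : H ⊗[k] (A ⊗[k] H) →ₐ[k] Nine k H A :=
  pair (Q.cv l₃ l₄) (pair l₀ (Q.cv l₅ l₆))

theorem pair_l₁₂ (t : H ⊗[k] H) :
    pair l₁ l₂ t = pair d₁ d₂ t ⊗ₜ 1 := by
  rw [← apply_pair, Algebra.TensorProduct.includeLeft_apply]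

theorem pair_l₃₄ (t : H ⊗[k] H) :
    pair l₃ l₄ t = pair d₃ d₄ t ⊗ₜ 1 := by
  rw [← apply_pair, Algebra.TensorProduct.includeLeft_apply]

theorem pair_l₅₆ (t : H ⊗[k] H) :
    pair l₅ l₆ t = 1 ⊗ₜ (1 ⊗ₜ pair d₁ d₂ t) := by
  rw [← apply_pair, ← apply_pair, Algebra.TensorProduct.includeRight_apply,
    Algebra.TensorProduct.includeRight_apply]

theorem pair_l₇₈ (t : H ⊗[k] H) :
    pair l₇ l₈ t = 1 ⊗ₜ (1 ⊗ₜ pair d₃ d₄ t) := by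
  rw [← apply_pair, ← apply_pair, Algebra.TensorProduct.includeRight_apply,
    Algebra.TensorProduct.includeRight_apply]

theorem cv_l₁₂ (h : H) : Q.cv l₁ l₂ h = pair d₁ d₂ (Q.Δ h) ⊗ₜ 1 :=
  pair_l₁₂ _

theorem cv_l₃₄ (h : H) : Q.cv l₃ l₄ h = pair d₃ d₄ (Q.Δ h) ⊗ₜ 1 :=
  pair_l₃₄ _

theorem cv_l₅₆ (h : H) :
    Q.cv l₅ l₆ h = 1 ⊗ₜ (1 ⊗ₜ pair d₁ d₂ (Q.Δ h)) := pair_l₅₆ _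

theorem cv_l₇₈ (h : H) :
    Q.cv l₇ l₈ h = 1 ⊗ₜ (1 ⊗ₜ pair d₃ d₄ (Q.Δ h)) := pair_l₇₈ _

theorem splitIn_tmul (a b : H) (u : A) : splitIn Q A (a ⊗ₜ (u ⊗ₜ b)) =
    pair d₃ d₄ (Q.Δ a) ⊗ₜ (u ⊗ₜ pair d₁ d₂ (Q.Δ b)) := by
  refine (pair_tmul _ _ _ _).trans ((congrArg (_ * ·) (pair_tmul _ _ _ _)).trans ?_)
  rw [cv_l₃₄, cv_l₅₆]
  simp only [AlgHom.comp_apply, Algebra.TensorProduct.includeLeft_apply,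
    Algebra.TensorProduct.includeRight_apply, Algebra.TensorProduct.tmul_mul_tmul, one_mul,
    mul_one]

theorem allIn_tmul (x y z w : H) (v : A) : allIn Q A (x ⊗ₜ (y ⊗ₜ (v ⊗ₜ (z ⊗ₜ w)))) =
    (pair d₁ d₂ (Q.Δ x) * pair d₃ d₄ (Q.Δ y)) ⊗ₜ
      (v ⊗ₜ (pair d₁ d₂ (Q.Δ z) * pair d₃ d₄ (Q.Δ w))) := by
  refine (pair_tmul₅ _ _ _ _ _ _ _ _ _ _).trans ?_
  rw [cv_l₁₂, cv_l₃₄, cv_l₅₆, cv_l₇₈]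
  simp only [AlgHom.comp_apply, Algebra.TensorProduct.includeLeft_apply,
    Algebra.TensorProduct.includeRight_apply, Algebra.TensorProduct.tmul_mul_tmul, one_mul,
    mul_one]

theorem farIn_tmul (x y z w : H) (v : A) : c.farIn Q (x ⊗ₜ (y ⊗ₜ (v ⊗ₜ (z ⊗ₜ w)))) =
    (pair d₁ d₂ (x ⊗ₜ y) ⊗ₜ 1) * (splitIn Q A (c.δ v) * (1 ⊗ₜ (1 ⊗ₜ pair d₃ d₄ (z ⊗ₜ w)))) := by
  refine (pair_tmul₅ _ _ _ _ _ _ _ _ _ _).trans ?_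
  rw [← pair_l₁₂, ← pair_l₇₈, pair_tmul, pair_tmul, mul_assoc]
  rfl

theorem unfold_pair : (Q.unfold l₁ l₂ l₃ l₄ * Q.unfold l₅ l₆ l₇ l₈ : (Nine k H A)ˣ).val =
    (Q.unfold d₁ d₂ d₃ d₄).val ⊗ₜ (1 ⊗ₜ (Q.unfold d₁ d₂ d₃ d₄).val) := by
  have h₁ : (Q.unfold l₁ l₂ l₃ l₄).val =
      (Q.unfold d₁ d₂ d₃ d₄).val ⊗ₜ 1 := by
    rw [← ap_unfold, ap_val, Algebra.TensorProduct.includeLeft_apply]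
  have h₂ : (Q.unfold l₅ l₆ l₇ l₈).val =
      1 ⊗ₜ (1 ⊗ₜ (Q.unfold d₁ d₂ d₃ d₄).val) := by
    rw [← ap_unfold, ← ap_unfold, ap_val, ap_val, Algebra.TensorProduct.includeRight_apply,
      Algebra.TensorProduct.includeRight_apply]
  rw [Units.val_mul, h₁, h₂, Algebra.TensorProduct.tmul_mul_tmul, one_mul, mul_one]

/-- The contraction of the word on the right of `product_word` in terms of `δ`, the `p`-contraction,
and the antipode image of the outer factors. -/
theorem zip_farIn_allIn (x₁ x₂ x₄ x₅ : H) (v : A)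
    (t : H ⊗[k] (H ⊗[k] (A ⊗[k] (H ⊗[k] H)))) :
    zip Q A (c.farIn Q (x₁ ⊗ₜ (x₂ ⊗ₜ (v ⊗ₜ (x₄ ⊗ₜ x₅)))) * allIn Q A t *
        (Q.unfold l₁ l₂ l₃ l₄ * Q.unfold l₅ l₆ l₇ l₈ : (Nine k H A)ˣ).val) =
      ΔΔ Q A (c.δ v * Q.pFun A t) * (1 ⊗ₜ (1 ⊗ₜ Q.fInv)) *
        (Q.SSinv ((x₁ ⊗ₜ x₂) * Q.fInv) ⊗ₜ (1 ⊗ₜ Q.SS (x₄ ⊗ₜ x₅))) := by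
  rw [unfold_pair, farIn_tmul]
  generalize c.δ v = d
  induction d using tensor_induction₃ with
  | zero => simp only [map_zero, zero_mul, mul_zero]
  | tmul a u b =>
    induction t using tensor_induction₅ with
    | zero => simp only [map_zero, mul_zero, zero_mul]
    | tmul y₁ y₂ w y₄ y₅ =>
      rw [splitIn_tmul, allIn_tmul, pFun_tmul]
      simp only [Algebra.TensorProduct.tmul_mul_tmul, one_mul, mul_one, ΔΔ_tmul,
        TensorProduct.map_tmul, LinearMap.comp_apply, LinearMap.id_apply]
      rw [Δ_κ_mul, Δ_evβ_mul]
      have e₁ : pair d₁ d₂ (x₁ ⊗ₜ[k] x₂) * pair d₃ d₄ (Q.Δ a) *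
          (pair d₁ d₂ (Q.Δ y₁) * pair d₃ d₄ (Q.Δ y₂)) =
          pair d₁ d₂ ((x₁ ⊗ₜ x₂) * Q.Δ y₁) * pair d₃ d₄ (Q.Δ (a * y₂)) := by
        rw [map_mul, map_mul Q.Δ, map_mul, (Comm.comm (i := pair d₃ d₄) (j := pair d₁ d₂) (Q.Δ a)
          (Q.Δ y₁)).mul_mul_mul_comm]
      have e₂ : pair d₁ d₂ (Q.Δ b) * pair d₃ d₄ (x₄ ⊗ₜ[k] x₅) *
          (pair d₁ d₂ (Q.Δ y₄) * pair d₃ d₄ (Q.Δ y₅)) =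
          pair d₁ d₂ (Q.Δ (b * y₄)) * pair d₃ d₄ ((x₄ ⊗ₜ x₅) * Q.Δ y₅) := by
        rw [map_mul Q.Δ, map_mul, map_mul, (Comm.comm (i := pair d₃ d₄) (j := pair d₁ d₂)
          (x₄ ⊗ₜ[k] x₅) (Q.Δ y₄)).mul_mul_mul_comm]
      rw [e₁, e₂, SSinv_cupcup_unfold, cupcup_unfold]
    | add t t' ht ht' => simp only [map_add, mul_add, add_mul, ht, ht']
  | add d d' hd hd' => simp only [map_add, mul_add, add_mul, hd, hd']

end CoactionData

/-! ### The right crossed product -/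

section RightCrossed

open QuasiHopfAlgebra

variable {k H : Type*} [Field k] [Ring H] [Algebra k H] {Q : QuasiHopfAlgebra k H}
  {A : Type*} [Ring A] [Algebra k A]
  {𝒜 : Type*} [NonAssocRing 𝒜] [Module k 𝒜] [SMulCommClass k 𝒜 𝒜] [IsScalarTower k 𝒜 𝒜]
  (M : BimoduleAlgebra Q.toQuasiBialgebra 𝒜)

variable (A) in
/-- `a ⊗ b ⊗ v ⊗ c ⊗ d` acts on `𝒜 ⊗ 𝒜 ⊗ A` by
`φ ⊗ φ' ⊗ u ↦ a · φ · S⁻¹(d) ⊗ b · φ' · S⁻¹(c) ⊗ v u`. -/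
abbrev BimoduleAlgebra.actFive :
    H ⊗[k] (H ⊗[k] (A ⊗[k] (H ⊗[k] H))) →ₐ[k] Module.End k (𝒜 ⊗[k] (𝒜 ⊗[k] A)) :=
  pair (hd M.L) (pair (sh (hd M.L)) (pair (sh (sh (lm k A))) (pair (sh (hd M.R)) (hd M.R))))

variable (A) in
/-- `actFive`, with the two outer pairs of factors grouped together. -/
abbrev BimoduleAlgebra.actGrouped :
    (H ⊗[k] H) ⊗[k] (A ⊗[k] (H ⊗[k] H)) →ₐ[k] Module.End k (𝒜 ⊗[k] (𝒜 ⊗[k] A)) :=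
  pair (pair (hd M.L) (sh (hd M.L))) (pair (sh (sh (lm k A))) (pair (sh (hd M.R)) (hd M.R)))

theorem BimoduleAlgebra.actGrouped_regroup (t : H ⊗[k] (H ⊗[k] (A ⊗[k] (H ⊗[k] H)))) :
    M.actGrouped A (regroup k H A t) = M.actFive A t := by
  induction t using tensor_induction₅ with
  | zero => simp only [map_zero]
  | tmul x y v z w =>
    refine Eq.trans ?_ (pair_tmul₅ _ _ _ _ _ _ _ _ _ _).symm
    refine (pair_tmul _ _ (x ⊗ₜ y) _).trans ?_
    rw [pair_tmul, pair_tmul, pair_tmul, mul_assoc]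
  | add s t hs ht => simp only [map_add, hs, ht]

local notation "l₀" => CoactionData.nineLetter₀ k H A
local notation "l₁" => CoactionData.nineLetter₁ k H A
local notation "l₂" => CoactionData.nineLetter₂ k H A
local notation "l₃" => CoactionData.nineLetter₃ k H A
local notation "l₄" => CoactionData.nineLetter₄ k H A
local notation "l₅" => CoactionData.nineLetter₅ k H A
local notation "l₆" => CoactionData.nineLetter₆ k H A
local notation "l₇" => CoactionData.nineLetter₇ k H A
local notation "l₈" => CoactionData.nineLetter₈ k H A

namespace CoactionData

variable (c : CoactionData k H A)

theorem actFive_oIn (t : H ⊗[k] (A ⊗[k] H)) :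
    M.actFive A (oIn k H A t) = sh (V := 𝒜) (M.actTensor A) t := by
  induction t using tensor_induction₃ with
  | zero => simp only [map_zero]
  | tmul x v y =>
    simp only [oIn_tmul, BimoduleAlgebra.actTensor, sh_pair]
    refine (pair_tmul₅ _ _ _ _ _ _ _ _ _ _).trans ?_
    rw [pair_tmul, pair_tmul, map_one, map_one, one_mul, mul_one]
  | add s t hs ht => simp only [map_add, hs, ht]

theorem actFive_spread (t : H ⊗[k] (A ⊗[k] H)) : M.actFive A (c.spread t) =
    pair (hd M.L) (pair (sh (c.act M)) (hd M.R)) t := by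
  induction t using tensor_induction₃ with
  | zero => simp only [map_zero]
  | tmul x v y =>
    have h : M.actFive A (x ⊗ₜ (1 ⊗ₜ (1 ⊗ₜ (1 ⊗ₜ y)))) = hd M.L x * hd M.R y := by
      refine (pair_tmul₅ _ _ _ _ _ _ _ _ _ _).trans ?_
      rw [map_one, map_one, map_one, one_mul, one_mul, one_mul]
    rw [spread_tmul, map_mul, h, actFive_oIn, pair_tmul, pair_tmul, mul_assoc]
    exact congrArg _ (Comm.comm (i := hd (W := 𝒜 ⊗[k] A) M.R) (j := sh (c.act M)) y v).eq
  | add s t hs ht => simp only [map_add, hs, ht]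

theorem ins_actTensor (t : H ⊗[k] (A ⊗[k] H)) (φ : 𝒜) (ξ : 𝒜 ⊗[k] A) :
    c.ins M ξ (M.actTensor A t (φ ⊗ₜ 1)) = M.actFive A (c.spread t) (φ ⊗ₜ ξ) := by
  rw [actFive_spread]
  refine (Eqv.eqv (T := ((c.act M).toLinearMap.flip ξ).lTensor 𝒜)
    (F := pair (hd M.L) (pair (sh (lm k A)) (hd M.R)))
    (F' := pair (hd M.L) (pair (sh (c.act M)) (hd M.R))) t (φ ⊗ₜ 1)).trans ?_
  refine congrArg _ ((c.ins_tmul M ξ φ 1).trans ?_)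
  rw [map_one, Module.End.one_apply]

/-- The product of two leading terms as a single action of `Ψ⁻¹` and two copies of `p`. -/
theorem leftCrossed_mul_lead (φ φ' : 𝒜) : (leftCrossed c M).mul (c.lead M φ) (c.lead M φ') =
    M.star A (M.actGrouped A (regroup k H A ((c.Ψ⁻¹).val * c.spread (pElt Q c) *
      oIn k H A (pElt Q c))) (φ ⊗ₜ (φ' ⊗ₜ 1))) := by
  rw [leftCrossed_mul, c.lead_apply M φ, ins_actTensor, M.actGrouped_regroup, map_mul, map_mul,
    Module.End.mul_apply, Module.End.mul_apply, actFive_oIn, sh_tmul, ← lead_apply, ap_inv_val]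

theorem star_actGrouped_ΔΔ (s : H ⊗[k] (A ⊗[k] H)) (t : 𝒜 ⊗[k] (𝒜 ⊗[k] A)) :
    M.star A (M.actGrouped A (ΔΔ Q A s) t) = M.actTensor A s (M.star A t) := by
  have h : (M.actGrouped A).comp (ΔΔ Q A) = pair (Q.cv (hd M.L) (sh (hd M.L)))
      (pair (sh (sh (lm k A))) (Q.cv (sh (hd M.R)) (hd M.R))) := by
    refine AlgHom.ext fun s => ?_
    induction s using tensor_induction₃ with
    | zero => simp only [map_zero]
    | tmul x v y =>
      refine (pair_tmul _ _ (Q.Δ x) (v ⊗ₜ Q.Δ y)).trans ?_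
      rw [pair_tmul, pair_tmul, pair_tmul]; rfl
    | add s t hs ht => simp only [map_add, hs, ht]
  have h' := DFunLike.congr_fun h s
  rw [AlgHom.comp_apply] at h'
  rw [h']
  exact Eqv.eqv (T := M.star A) (F' := pair (hd M.L) (pair (sh (lm k A)) (hd M.R))) s t

theorem star_actGrouped_fInv (t : 𝒜 ⊗[k] (𝒜 ⊗[k] A)) :
    M.star A (M.actGrouped A (1 ⊗ₜ (1 ⊗ₜ Q.fInv)) t) = BimoduleAlgebra.mulHead 𝒜 A t := by
  have h : M.actGrouped A (1 ⊗ₜ (1 ⊗ₜ Q.fInv)) = pair (sh (hd M.R)) (hd M.R) Q.fInv := by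
    rw [pair_tmul, pair_tmul, map_one, map_one, one_mul, one_mul]
  rw [h, M.star_apply, ← Module.End.mul_apply, ← map_mul, Q.f_mul_fInv, map_one,
    Module.End.one_apply]

theorem actGrouped_SSinv (a b x y : H) (φ φ' : 𝒜) :
    M.actGrouped A (Q.SSinv (a ⊗ₜ b) ⊗ₜ (1 ⊗ₜ Q.SS (x ⊗ₜ y))) (φ ⊗ₜ (φ' ⊗ₜ 1)) =
      M.lact (Q.Sinv b) (M.ract x φ) ⊗ₜ (M.lact (Q.Sinv a) (M.ract y φ') ⊗ₜ 1) := by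
  rw [SSinv_tmul, SS_tmul, pair_tmul, pair_tmul, pair_tmul, pair_tmul]
  simp [M.L_apply, M.R_apply, Sinv_S]

/-- `s¹ ⊗ ⋯ ⊗ s⁵ ↦ S⁻¹(s¹ g¹) ⊗ S⁻¹(s² g²) ⊗ s³ ⊗ s⁴ ⊗ s⁵`. -/
def Ω'Fun (Q : QuasiHopfAlgebra k H) (A : Type*) [Ring A] [Algebra k A] :
    H ⊗[k] (H ⊗[k] (A ⊗[k] (H ⊗[k] H))) →ₗ[k] H ⊗[k] (H ⊗[k] (A ⊗[k] (H ⊗[k] H))) :=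
  TensorProduct.map Q.Sinv (TensorProduct.map Q.Sinv LinearMap.id) ∘ₗ
    LinearMap.mulRight k (TensorProduct.assoc k H H (A ⊗[k] (H ⊗[k] H)) (Q.fInv ⊗ₜ[k] 1))

theorem Ω'_eq : Ω' Q c = Ω'Fun Q A c.Ψ.val := rfl

theorem thetaInv_opRight_aux (w : H ⊗[k] H) (x y : H) (v : A) (φ φ' : 𝒜) :
    c.thetaInv M (opRight M (TensorProduct.map Q.Sinv (TensorProduct.map Q.Sinv LinearMap.id)
      (TensorProduct.assoc k H H (A ⊗[k] (H ⊗[k] H)) (w ⊗ₜ (v ⊗ₜ (x ⊗ₜ y)))))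
        (1 ⊗ₜ (φ ⊗ₜ φ'))) =
    M.star A (M.actGrouped A (ΔΔ Q A (c.δ v * pElt Q c) * (1 ⊗ₜ (1 ⊗ₜ Q.fInv)) *
      (Q.SSinv w ⊗ₜ (1 ⊗ₜ Q.SS (x ⊗ₜ y)))) (φ ⊗ₜ (φ' ⊗ₜ 1))) := by
  induction w with
  | zero => simp
  | tmul a b =>
    rw [map_mul (M.actGrouped A), map_mul (M.actGrouped A), Module.End.mul_apply,
      Module.End.mul_apply, star_actGrouped_ΔΔ, star_actGrouped_fInv, actGrouped_SSinv,
      BimoduleAlgebra.mulHead_tmul]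
    simp only [TensorProduct.assoc_tmul, TensorProduct.map_tmul, LinearMap.id_apply]
    rw [opRight_tmul, one_mul, thetaInv_tmul, thetaInvTerm_eq]
  | add w w' hw hw' =>
    simp only [TensorProduct.add_tmul, map_add, LinearMap.add_apply, hw, hw', mul_add]

/-- The image under `ϑ⁻¹` of the product of `1 ⋈ φ` and `1 ⋈ φ'`, as one action of a word on
`φ ⊗ φ'` followed by the twisted product. -/
theorem thetaInv_opRight (s : H ⊗[k] (H ⊗[k] (A ⊗[k] (H ⊗[k] H)))) (φ φ' : 𝒜) :
    c.thetaInv M (opRight M (Ω'Fun Q A s) (1 ⊗ₜ (φ ⊗ₜ φ'))) =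
    M.star A (M.actGrouped A (zip Q A (c.farIn Q s * allIn Q A c.Ψ.val *
        (Q.unfold l₁ l₂ l₃ l₄ * Q.unfold l₅ l₆ l₇ l₈ : (Nine k H A)ˣ).val))
          (φ ⊗ₜ (φ' ⊗ₜ 1))) := by
  induction s using tensor_induction₅ with
  | zero => simp
  | tmul x₁ x₂ v x₄ x₅ =>
    rw [zip_farIn_allIn, ← pElt_eq, ← thetaInv_opRight_aux]
    have h : ∀ g : H ⊗[k] H, (x₁ ⊗ₜ[k] (x₂ ⊗ₜ[k] (v ⊗ₜ[k] (x₄ ⊗ₜ[k] x₅)))) *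
        TensorProduct.assoc k H H (A ⊗[k] (H ⊗[k] H)) (g ⊗ₜ[k] 1) =
        TensorProduct.assoc k H H (A ⊗[k] (H ⊗[k] H))
          (((x₁ ⊗ₜ x₂) * g) ⊗ₜ[k] (v ⊗ₜ[k] (x₄ ⊗ₜ[k] x₅))) := fun g => by
      induction g with
      | zero => simp
      | tmul a b => simp
      | add a b ha hb => simp only [TensorProduct.add_tmul, map_add, mul_add, ha, hb]
    rw [← h]; rfl
  | add s s' hs hs' => simp only [map_add, LinearMap.add_apply, add_mul, hs, hs']

end CoactionData

namespace TwoSidedCoaction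

open CoactionData

variable (D : TwoSidedCoaction Q.toQuasiBialgebra A)

/-- The product of two leading terms. -/
theorem leftCrossed_mul_lead_eq (φ φ' : 𝒜) :
    (leftCrossed D.toCoactionData M).mul (D.lead M φ) (D.lead M φ') =
      D.thetaInv M (opRight M (Ω' Q D.toCoactionData) (1 ⊗ₜ (φ ⊗ₜ φ'))) := by
  rw [leftCrossed_mul_lead, Ω'_eq, thetaInv_opRight, pElt_eq, regroup_spread_pFun]
  refine congrArg (fun w => M.star A (M.actGrouped A w _)) ?_
  have h := D.product_coherence (zip Q A) l₁ l₂ l₃ l₄ l₀ l₅ l₆ l₇ l₈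
  refine Eq.trans ?_ h.symm
  rw [Units.val_mul, Units.val_mul, ap_inv_val]
  rfl

theorem act_mul (v : A) (ξ ζ : 𝒜 ⊗[k] A) :
    D.act M v ((leftCrossed D.toCoactionData M).mul ξ ζ) =
      (leftCrossed D.toCoactionData M).mul (D.act M v ξ) ζ := by
  rw [← leftCrossed_one_tmul_mul, ← leftCrossed_one_tmul_mul,
    (D.leftCrossed_isUnitalAlgebra M).mul_assoc]

theorem lead_mul_one_tmul (φ : 𝒜) (u : A) :
    (leftCrossed D.toCoactionData M).mul (D.lead M φ) (1 ⊗ₜ u) =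
      M.actTensor A (pElt Q D.toCoactionData) (φ ⊗ₜ u) := by
  rw [leftCrossed_mul_one_tmul, lead_apply]
  have : Eqv (LinearMap.mulRight k u) (lm k A) (lm k A) := ⟨fun x v => by simp [mul_assoc]⟩
  refine (Eqv.eqv (T := (LinearMap.mulRight k u).lTensor 𝒜)
    (F := pair (hd M.L) (pair (sh (lm k A)) (hd M.R)))
    (F' := pair (hd M.L) (pair (sh (lm k A)) (hd M.R))) _ _).trans ?_
  rw [LinearMap.lTensor_tmul, LinearMap.mulRight_apply, one_mul]; rfl

theorem thetaInv_mul_left (u : A) (ξ : A ⊗[k] 𝒜) :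
    D.thetaInv M ((LinearMap.mulLeft k u).rTensor 𝒜 ξ) = D.act M u (D.thetaInv M ξ) := by
  induction ξ with
  | zero => simp
  | tmul v φ =>
    rw [LinearMap.rTensor_tmul, LinearMap.mulLeft_apply, thetaInv_tmul_eq_act,
      thetaInv_tmul_eq_act, map_mul, Module.End.mul_apply]
  | add a b ha hb => simp only [map_add, ha, hb]

theorem opRight_mul_left (w : H ⊗[k] (H ⊗[k] (A ⊗[k] (H ⊗[k] H)))) (u v : A) (φ φ' : 𝒜) :
    opRight M w ((u * v) ⊗ₜ (φ ⊗ₜ φ')) =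
      (LinearMap.mulLeft k u).rTensor 𝒜 (opRight M w (v ⊗ₜ (φ ⊗ₜ φ'))) := by
  induction w using tensor_induction₅ with
  | zero => simp
  | tmul x y z a b =>
    rw [opRight_tmul, opRight_tmul, LinearMap.rTensor_tmul, LinearMap.mulLeft_apply, mul_assoc]
  | add s t hs ht => simp only [map_add, LinearMap.add_apply, hs, ht]

theorem opRight_starRight (w : H ⊗[k] (H ⊗[k] (A ⊗[k] (H ⊗[k] H)))) (s : H ⊗[k] (A ⊗[k] H))
    (u : A) (φ φ' : 𝒜) :
    opRight M (starRight Q w s) (u ⊗ₜ (φ ⊗ₜ φ')) = (LinearMap.mulLeft k u).rTensor 𝒜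
      (opRight M w (((TensorProduct.mk k 𝒜 𝒜).flip φ').lTensor A (thetaTerm M φ s))) := by
  induction s using tensor_induction₃ with
  | zero => simp
  | tmul a v b =>
    rw [thetaTerm_tmul, LinearMap.lTensor_tmul]
    induction w using tensor_induction₅ with
    | zero => simp
    | tmul x y z c d =>
      rw [starRight_tmul, opRight_tmul, LinearMap.flip_apply, TensorProduct.mk_apply, opRight_tmul,
        LinearMap.rTensor_tmul, LinearMap.mulLeft_apply]
      simp only [M.mul_lact, M.mul_ract, M.lact_ract]
    | add s t hs ht => simp only [map_add, LinearMap.add_apply, hs, ht]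
  | add s t hs ht => simp only [map_add, LinearMap.add_apply, hs, ht]

theorem thetaInv_opRight_Ω' (ξ : A ⊗[k] 𝒜) (φ' : 𝒜) :
    D.thetaInv M (opRight M (Ω' Q D.toCoactionData)
      (((TensorProduct.mk k 𝒜 𝒜).flip φ').lTensor A ξ)) =
      (leftCrossed D.toCoactionData M).mul (D.thetaInv M ξ) (D.lead M φ') := by
  induction ξ with
  | zero => simp
  | tmul v φ =>
    rw [LinearMap.lTensor_tmul, LinearMap.flip_apply, TensorProduct.mk_apply, ← mul_one v,
      opRight_mul_left, thetaInv_mul_left, ← leftCrossed_mul_lead_eq, mul_one, act_mul,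
      thetaInv_tmul_eq_act]
  | add a b ha hb => simp only [map_add, LinearMap.add_apply, ha, hb]

/-- `ϑ⁻¹` is multiplicative: left `A`-linearity and associativity of the left crossed product reduce
the identity to products of leading terms. -/
theorem thetaInv_mul (x y : A ⊗[k] 𝒜) :
    D.thetaInv M ((rightCrossed D.toCoactionData M).mul x y) =
      (leftCrossed D.toCoactionData M).mul (D.thetaInv M x) (D.thetaInv M y) := by
  induction x with
  | zero => simp
  | tmul u φ =>
    induction y with
    | zero => simp
    | tmul u' φ' =>
      rw [rightCrossed_mul_tmul, opRight_starRight, thetaInv_mul_left, thetaInv_opRight_Ω',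
        thetaInv_thetaTerm_δ, ← lead_mul_one_tmul, (D.leftCrossed_isUnitalAlgebra M).mul_assoc,
        leftCrossed_one_tmul_mul, act_mul, thetaInv_tmul_eq_act, thetaInv_tmul_eq_act]
    | add a b ha hb => simp only [map_add, ha, hb]
  | add a b ha hb => simp only [map_add, LinearMap.add_apply, ha, hb]

theorem actTensor_one_tmul_one (t : H ⊗[k] (A ⊗[k] H)) : M.actTensor A t ((1 : 𝒜) ⊗ₜ (1 : A)) =
    (1 : 𝒜) ⊗ₜ pair (Q.e A) (pair (AlgHom.id k A) (Q.e A)) t := by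
  induction t using tensor_induction₃ with
  | zero => simp
  | tmul a v b =>
    rw [M.actTensor_tmul, M.ract_one, map_smul, M.lact_one, ε_Sinv, pair_tmul, pair_tmul]
    simp [Algebra.algebraMap_eq_smul_one, TensorProduct.smul_tmul, smul_smul, mul_comm]
  | add s t hs ht => simp only [map_add, LinearMap.add_apply, hs, ht, TensorProduct.tmul_add]

theorem counit_pFun (t : H ⊗[k] (H ⊗[k] (A ⊗[k] (H ⊗[k] H)))) :
    pair (Q.e A) (pair (AlgHom.id k A) (Q.e A)) (Q.pFun A t) = pair (Q.e A) (pair (Q.e A)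
      (pair (AlgHom.id k A) (pair (Q.e A) (Q.e A)))) t := by
  induction t using tensor_induction₅ with
  | zero => simp only [map_zero]
  | tmul x y v z w =>
    rw [pFun_tmul, pair_tmul, pair_tmul, pair_tmul₅]
    simp [ε_S, ε_Sinv, Q.counit_beta, Algebra.algebraMap_eq_smul_one, smul_smul, mul_comm,
      mul_left_comm]
  | add s t hs ht => simp only [map_add, hs, ht]

theorem thetaInv_one : D.thetaInv M ((1 : A) ⊗ₜ (1 : 𝒜)) = 1 ⊗ₜ 1 := by
  have h := congrArg Units.val (D.Ps_outer (Q.e A) (AlgHom.id k A) (Q.e A))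
  rw [ap_val, Units.val_one] at h
  rw [thetaInv_tmul, map_one, one_mul, thetaInvTerm_eq, actTensor_one_tmul_one, pElt_eq,
    counit_pFun, h]

/-- The linear isomorphism `ϑ` from the left to the right crossed product. -/
def thetaEquiv : 𝒜 ⊗[k] A ≃ₗ[k] A ⊗[k] 𝒜 :=
  LinearEquiv.ofLinearMap (D.theta M) (D.thetaInv M) (LinearMap.ext (D.theta_thetaInv M))
    (LinearMap.ext (D.thetaInv_theta M))

end TwoSidedCoaction

section Transport

variable {k X Y Z : Type*} [Field k] [AddCommGroup X] [Module k X] [AddCommGroup Y] [Module k Y]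
  [AddCommGroup Z] [Module k Z] {P : AlgebraData k X} {P' : AlgebraData k Y}
  {P'' : AlgebraData k Z}

theorem IsAlgebraIso.symm {e : X ≃ₗ[k] Y} (h : IsAlgebraIso P P' e) :
    IsAlgebraIso P' P e.symm where
  map_mul x y := e.injective (by simp [h.map_mul])
  map_one := e.injective (by simp [h.map_one])

theorem IsAlgebraIso.trans {e : X ≃ₗ[k] Y} {e' : Y ≃ₗ[k] Z} (h : IsAlgebraIso P P' e)
    (h' : IsAlgebraIso P' P'' e') : IsAlgebraIso P P'' (e.trans e') where
  map_mul x y := by simp [h.map_mul, h'.map_mul]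
  map_one := by simp [h.map_one, h'.map_one]

theorem IsAlgebraIso.isUnitalAlgebra {e : X ≃ₗ[k] Y} (h : IsAlgebraIso P P' e)
    (hP : P'.IsUnitalAlgebra) : P.IsUnitalAlgebra where
  mul_assoc x y z := e.injective (by simp only [h.map_mul, hP.mul_assoc])
  one_mul x := e.injective (by rw [h.map_mul, h.map_one, hP.one_mul])
  mul_one x := e.injective (by rw [h.map_mul, h.map_one, hP.mul_one])

end Transport

namespace TwoSidedCoaction

variable (D : TwoSidedCoaction Q.toQuasiBialgebra A)

theorem thetaEquiv_symm_isAlgebraIso :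
    IsAlgebraIso (rightCrossed D.toCoactionData M) (leftCrossed D.toCoactionData M)
      (D.thetaEquiv M).symm where
  map_mul := D.thetaInv_mul M
  map_one := D.thetaInv_one M

theorem thetaEquiv_isAlgebraIso :
    IsAlgebraIso (leftCrossed D.toCoactionData M) (rightCrossed D.toCoactionData M)
      (D.thetaEquiv M) := (D.thetaEquiv_symm_isAlgebraIso M).symm

theorem rightCrossed_isUnitalAlgebra : (rightCrossed D.toCoactionData M).IsUnitalAlgebra :=
  (D.thetaEquiv_symm_isAlgebraIso M).isUnitalAlgebra (D.leftCrossed_isUnitalAlgebra M)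

end TwoSidedCoaction

end RightCrossed

/-! ### Bicomodule algebras in letters -/

section Bicomodule

variable {k H : Type*} [Field k] [Ring H] [Algebra k H] {Q : QuasiBialgebra k H} {A : Type*}
  [Ring A] [Algebra k A] {R : Type*} [Ring R] [Algebra k R]

namespace LeftComoduleAlgebra

variable (B : LeftComoduleAlgebra Q A)

/-- The letter `u ↦ i(u₍₋₁₎) n(u₍₀₎)`. -/
abbrev la (i : H →ₐ[k] R) (n : A →ₐ[k] R) [Comm i n] : A →ₐ[k] R := (pair i n).comp B.lam

/-- The element `Φ_λ` in letters, as a unit. -/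
abbrev FL (i j : H →ₐ[k] R) (n : A →ₐ[k] R) [Comm i j] [Comm i n] [Comm j n] : Rˣ :=
  ap (pair i (pair j n)) B.Φlam

instance intw_FL (i j : H →ₐ[k] R) (n : A →ₐ[k] R) [Comm i j] [Comm i n] [Comm j n] :
    Intw (B.FL i j n) (B.la (Q.cv i j) n) (B.la i (B.la j n)) := ⟨fun u => by
  have := congrArg (pair i (pair j n)) (B.coassoc_left u)
  simp only [map_mul, pair_tail, pair_splitHead] at this
  exact this.symm⟩

theorem pentagon_FL (i j l : H →ₐ[k] R) (n : A →ₐ[k] R) [Comm i j] [Comm i l] [Comm i n]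
    [Comm j l] [Comm j n] [Comm l n] :
    B.FL j l n * B.FL i (Q.cv j l) n * Q.P i j l = B.FL i j (B.la l n) * B.FL (Q.cv i j) l n := by
  have := congrArg (pair i (pair j (pair l n))) B.cocycle_left
  simp only [map_mul, pair_padLeft, pair_tail, pair_comp_splitHead, pair_padRight,
    pair_comp_tail, pair_splitHead] at this
  exact Units.ext this

theorem la_e (n : A →ₐ[k] R) : B.la (Q.e R) n = n := AlgHom.ext fun u => by
  rw [la, pair_scalar_left, AlgHom.comp_apply, AlgHom.comp_apply, B.counit_left]

theorem FL_e_right (i : H →ₐ[k] R) (n : A →ₐ[k] R) [Comm i n] : B.FL i (Q.e R) n = 1 :=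
  Units.ext <| by
    have := congrArg (pair i n) B.counit_mid_left
    rw [pair_tail, map_one] at this
    simpa only [ap_val, pair_scalar_left, Units.val_one] using this

theorem FL_e_left (j : H →ₐ[k] R) (n : A →ₐ[k] R) [Comm j n] : B.FL (Q.e R) j n = 1 :=
  Units.ext <| by
    have := congrArg (pair j n) B.counit_first_left
    rw [map_one] at this
    simpa only [ap_val, pair_scalar_left, Units.val_one, AlgHom.comp_apply] using this

variable {i j : H →ₐ[k] R} {n : A →ₐ[k] R} {i' j' : H →ₐ[k] R} {n' : A →ₐ[k] R}
  [Comm i j] [Comm i n] [Comm j n] [Comm i' j'] [Comm i' n'] [Comm j' n']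

theorem FL_nat (u : Rˣ) [Intw u i i'] [Intw u j j'] [Intw u n n'] :
    u * B.FL i j n = B.FL i' j' n' * u := Intw.ap _

end LeftComoduleAlgebra

namespace RightComoduleAlgebra

variable (B : RightComoduleAlgebra Q A)

/-- The letter `u ↦ n(u₍₀₎) j(u₍₁₎)`. -/
abbrev rh (n : A →ₐ[k] R) (j : H →ₐ[k] R) [Comm n j] : A →ₐ[k] R := (pair n j).comp B.ρ

/-- The element `Φ_ρ` in letters, as a unit. -/
abbrev FR (n : A →ₐ[k] R) (j l : H →ₐ[k] R) [Comm n j] [Comm n l] [Comm j l] : Rˣ :=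
  ap (pair n (pair j l)) B.Φρ

instance intw_FR (n : A →ₐ[k] R) (j l : H →ₐ[k] R) [Comm n j] [Comm n l] [Comm j l] :
    Intw (B.FR n j l) (B.rh (B.rh n j) l) (B.rh n (Q.cv j l)) := ⟨fun u => by
  have := congrArg (pair n (pair j l)) (B.coassoc_right u)
  simp only [map_mul, pair_tail, pair_splitHead] at this
  exact this⟩

theorem pentagon_FR (n : A →ₐ[k] R) (j l m : H →ₐ[k] R) [Comm n j] [Comm n l] [Comm n m]
    [Comm j l] [Comm j m] [Comm l m] :
    Q.P j l m * B.FR n (Q.cv j l) m * B.FR n j l = B.FR n j (Q.cv l m) * B.FR (B.rh n j) l m := by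
  have := congrArg (pair n (pair j (pair l m))) B.cocycle_right
  simp only [map_mul, pair_padLeft, pair_tail, pair_comp_splitHead, pair_padRight,
    pair_comp_tail, pair_splitHead] at this
  exact Units.ext this

theorem rh_e (n : A →ₐ[k] R) : B.rh n (Q.e R) = n := AlgHom.ext fun u => by
  rw [rh, pair_scalar_right, AlgHom.comp_apply, AlgHom.comp_apply, B.counit_right]

theorem FR_e_left (n : A →ₐ[k] R) (l : H →ₐ[k] R) [Comm n l] : B.FR n (Q.e R) l = 1 :=
  Units.ext <| by
    have := congrArg (pair n l) B.counit_mid_right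
    rw [pair_tail, map_one] at this
    simpa only [ap_val, pair_scalar_left, Units.val_one] using this

theorem FR_e_right (n : A →ₐ[k] R) (j : H →ₐ[k] R) [Comm n j] : B.FR n j (Q.e R) = 1 :=
  Units.ext <| by
    have := congrArg (pair n j) B.counit_last_right
    rw [pair_tail, map_one] at this
    simpa only [ap_val, pair_scalar_right, Units.val_one] using this

variable {n : A →ₐ[k] R} {j l : H →ₐ[k] R} {n' : A →ₐ[k] R} {j' l' : H →ₐ[k] R}
  [Comm n j] [Comm n l] [Comm j l] [Comm n' j'] [Comm n' l'] [Comm j' l']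

theorem FR_nat (u : Rˣ) [Intw u n n'] [Intw u j j'] [Intw u l l'] :
    u * B.FR n j l = B.FR n' j' l' * u := Intw.ap _

end RightComoduleAlgebra

namespace BicomoduleAlgebra

variable (B : BicomoduleAlgebra Q A)

/-- The element `Φ_{λ,ρ}` in letters, as a unit. -/
abbrev FLR (i : H →ₐ[k] R) (n : A →ₐ[k] R) (j : H →ₐ[k] R) [Comm i n] [Comm i j] [Comm n j] : Rˣ :=
  ap (pair i (pair n j)) B.Φlr

instance intw_FLR (i : H →ₐ[k] R) (n : A →ₐ[k] R) (j : H →ₐ[k] R) [Comm i n] [Comm i j]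
    [Comm n j] : Intw (B.FLR i n j) (B.rh (B.la i n) j) (B.la i (B.rh n j)) := ⟨fun u => by
  have := congrArg (pair i (pair n j)) (B.compat u)
  simp only [map_mul, pair_tail, pair_splitHead] at this
  exact this⟩

theorem FLR_left (i j : H →ₐ[k] R) (n : A →ₐ[k] R) (l : H →ₐ[k] R) [Comm i j] [Comm i n]
    [Comm i l] [Comm j n] [Comm j l] [Comm n l] :
    B.FLR j n l * B.FLR i (B.la j n) l * B.FL i j n =
      B.FL i j (B.rh n l) * B.FLR (Q.cv i j) n l := by
  have := congrArg (pair i (pair j (pair n l))) B.compat_left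
  simp only [map_mul, pair_padLeft, pair_tail, pair_comp_splitHead, pair_padRight,
    pair_comp_tail, pair_splitHead] at this
  exact Units.ext this

theorem FLR_right (i : H →ₐ[k] R) (n : A →ₐ[k] R) (j l : H →ₐ[k] R) [Comm i n] [Comm i j]
    [Comm i l] [Comm n j] [Comm n l] [Comm j l] :
    B.FR n j l * B.FLR i (B.rh n j) l * B.FLR i n j =
      B.FLR i n (Q.cv j l) * B.FR (B.la i n) j l := by
  have := congrArg (pair i (pair n (pair j l))) B.compat_right
  simp only [map_mul, pair_padLeft, pair_tail, pair_comp_splitHead, pair_padRight,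
    pair_comp_tail, pair_splitHead] at this
  exact Units.ext this

/-- The normalisations of `Φ_{λ,ρ}` are consequences of the compatibility with `Φ_λ` and `Φ_ρ`. -/
theorem FLR_e_left (n : A →ₐ[k] R) (l : H →ₐ[k] R) [Comm n l] : B.FLR (Q.e R) n l = 1 := by
  have h := B.FLR_left (Q.e R) (Q.e R) n l
  simpa only [B.la_e, B.FL_e_right, Q.cv_e_left, mul_one, one_mul, mul_eq_right] using h

theorem FLR_e_right (i : H →ₐ[k] R) (n : A →ₐ[k] R) [Comm i n] : B.FLR i n (Q.e R) = 1 := by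
  have h := B.FLR_right i n (Q.e R) (Q.e R)
  rw [B.FR_e_right, B.FR_e_right, one_mul, mul_one] at h
  simp only [B.rh_e, Q.cv_e_left] at h
  exact mul_eq_right.mp h

variable {i : H →ₐ[k] R} {n : A →ₐ[k] R} {j : H →ₐ[k] R} {i' : H →ₐ[k] R} {n' : A →ₐ[k] R}
  {j' : H →ₐ[k] R} [Comm i n] [Comm i j] [Comm n j] [Comm i' n'] [Comm i' j'] [Comm n' j']

theorem FLR_nat (u : Rˣ) [Intw u i i'] [Intw u n n'] [Intw u j j'] :
    u * B.FLR i n j = B.FLR i' n' j' * u := Intw.ap _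

end BicomoduleAlgebra

end Bicomodule

open QuasiHopfAlgebra

section Bicomodule

variable {k H : Type*} [Field k] [Ring H] [Algebra k H] {Q : QuasiBialgebra k H} {A : Type*}
  [Ring A] [Algebra k A] {R : Type*} [Ring R] [Algebra k R]

/-! ### Two-sided coactions from their axioms in letters -/

theorem pair_positions₇ {X₁ X₂ X₃ X₄ X₅ X₆ X₇ : Type*} [Ring X₁] [Algebra k X₁] [Ring X₂]
    [Algebra k X₂] [Ring X₃] [Algebra k X₃] [Ring X₄] [Algebra k X₄] [Ring X₅] [Algebra k X₅]
    [Ring X₆] [Algebra k X₆] [Ring X₇] [Algebra k X₇] :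
    pair (inl : X₁ →ₐ[k] X₁ ⊗[k] (X₂ ⊗[k] (X₃ ⊗[k] (X₄ ⊗[k] (X₅ ⊗[k] (X₆ ⊗[k] X₇))))))
      (pair (inr.comp inl) (pair (inr.comp (inr.comp inl)) (pair (inr.comp (inr.comp (inr.comp inl)))
        (pair (inr.comp (inr.comp (inr.comp (inr.comp inl))))
          (pair (inr.comp (inr.comp (inr.comp (inr.comp (inr.comp inl)))))
            (inr.comp (inr.comp (inr.comp (inr.comp (inr.comp inr)))))))))) = AlgHom.id k _ := by
  simp only [← comp_pair, pair_inl_inr, AlgHom.comp_id]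

theorem pair_positions₃ {X₁ X₂ X₃ : Type*} [Ring X₁] [Algebra k X₁] [Ring X₂]
    [Algebra k X₂] [Ring X₃] [Algebra k X₃] :
    pair (inl : X₁ →ₐ[k] X₁ ⊗[k] (X₂ ⊗[k] X₃)) (pair (inr.comp inl) (inr.comp inr)) =
      AlgHom.id k _ := by
  simp only [← comp_pair, pair_inl_inr, AlgHom.comp_id]

namespace QuasiBialgebra

theorem pair_counit_outer₃ (Q : QuasiBialgebra k H) (n : A →ₐ[k] R) (t : H ⊗[k] (A ⊗[k] H)) :
    pair (Q.e R) (pair n (Q.e R)) t = n (counitHead Q.ε A (tail H (counitTail Q.ε A) t)) := by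
  induction t using tensor_induction₃ with
  | zero => simp
  | tmul x y z =>
    simp [counitHead, counitTail]
    exact smul_comm _ _ _
  | add a b ha hb => simp only [map_add, ha, hb]

theorem pair_counit_outer (Q : QuasiBialgebra k H) (j : H →ₐ[k] R) (n : A →ₐ[k] R) (l : H →ₐ[k] R)
    [Comm j n] [Comm j l] [Comm n l] (t : H ⊗[k] (H ⊗[k] (A ⊗[k] (H ⊗[k] H)))) :
    pair (Q.e R) (pair j (pair n (pair l (Q.e R)))) t = pair j (pair n l)
      (counitHead Q.ε (H ⊗[k] (A ⊗[k] H)) (tail H (tail H (tail A (counitTail Q.ε H))) t)) := by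
  induction t using tensor_induction₅ with
  | zero => simp
  | tmul x y z v w =>
    simp [counitHead, counitTail]
    exact smul_comm _ _ _
  | add a b ha hb => simp only [map_add, ha, hb]

theorem pair_counit_inner (Q : QuasiBialgebra k H) (i : H →ₐ[k] R) (n : A →ₐ[k] R) (m : H →ₐ[k] R)
    [Comm i n] [Comm i m] [Comm n m] (t : H ⊗[k] (H ⊗[k] (A ⊗[k] (H ⊗[k] H)))) :
    pair i (pair (Q.e R) (pair n (pair (Q.e R) m))) t = pair i (pair n m)
      (tail H (counitHead Q.ε (A ⊗[k] H)) (tail H (tail H (tail A (counitHead Q.ε H))) t)) := by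
  induction t using tensor_induction₅ with
  | zero => simp
  | tmul x y z v w =>
    simp [counitHead]
    exact smul_comm _ _ _
  | add a b ha hb => simp only [map_add, ha, hb]

end QuasiBialgebra

local notation "o₁" => QuasiHopfAlgebra.fiveLetter₁ k H A
local notation "o₂" => QuasiHopfAlgebra.fiveLetter₂ k H A
local notation "o₃" => QuasiHopfAlgebra.fiveLetter₃ k H A
local notation "o₄" => QuasiHopfAlgebra.fiveLetter₄ k H A
local notation "o₅" => QuasiHopfAlgebra.fiveLetter₅ k H A

/-- The axioms of a two-sided coaction may be checked in letters. -/
def TwoSidedCoaction.ofLetters (c : CoactionData k H A)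
    (hδ : Intw (c.Ps o₁ o₂ o₃ o₄ o₅)
      (c.dl (Q.cv o₁ o₂) o₃ (Q.cv o₄ o₅)) (c.dl o₁ (c.dl o₂ o₃ o₄) o₅))
    (hex : ∀ (a₁ a₂ a₃ : H →ₐ[k] H ⊗[k] (H ⊗[k] (H ⊗[k] (A ⊗[k] (H ⊗[k] (H ⊗[k] H))))))
      (n : A →ₐ[k] H ⊗[k] (H ⊗[k] (H ⊗[k] (A ⊗[k] (H ⊗[k] (H ⊗[k] H))))))
      (b₁ b₂ b₃ : H →ₐ[k] H ⊗[k] (H ⊗[k] (H ⊗[k] (A ⊗[k] (H ⊗[k] (H ⊗[k] H))))))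
    [Comm a₁ a₂] [Comm a₁ a₃] [Comm a₁ n] [Comm a₁ b₁] [Comm a₁ b₂] [Comm a₁ b₃] [Comm a₂ a₃]
    [Comm a₂ n] [Comm a₂ b₁] [Comm a₂ b₂] [Comm a₂ b₃] [Comm a₃ n] [Comm a₃ b₁] [Comm a₃ b₂]
    [Comm a₃ b₃] [Comm n b₁] [Comm n b₂] [Comm n b₃] [Comm b₁ b₂] [Comm b₁ b₃] [Comm b₂ b₃],
      c.Ps a₂ a₃ n b₁ b₂ * c.Ps a₁ (Q.cv a₂ a₃) n (Q.cv b₁ b₂) b₃ *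
        (Q.P a₁ a₂ a₃ * (Q.P b₁ b₂ b₃)⁻¹) =
      c.Ps a₁ a₂ (c.dl a₃ n b₁) b₂ b₃ * c.Ps (Q.cv a₁ a₂) a₃ n b₁ (Q.cv b₂ b₃))
    (hε : c.dl (Q.e A) (AlgHom.id k A) (Q.e A) = AlgHom.id k A)
    (hin : c.Ps (inl : H →ₐ[k] H ⊗[k] (A ⊗[k] H)) (Q.e _) (inr.comp inl) (Q.e _)
      (inr.comp inr) = 1)
    (hout : c.Ps (Q.e _) (inl : H →ₐ[k] H ⊗[k] (A ⊗[k] H)) (inr.comp inl) (inr.comp inr)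
      (Q.e _) = 1) : TwoSidedCoaction Q A where
  toCoactionData := c
  coassoc u := by
    have inj : Function.Injective (AlgHom.id k (H ⊗[k] (H ⊗[k] (A ⊗[k] (H ⊗[k] H))))) :=
      fun _ _ h => h
    rw [← pair_o] at inj
    refine inj ?_
    simp only [map_mul, pair_tail, pair_splitHead, pair_comp_splitHead₃, pair_comp_tail]
    exact (hδ.intw u).symm
  cocycle := by
    have inj : Function.Injective (AlgHom.id k
        (H ⊗[k] (H ⊗[k] (H ⊗[k] (A ⊗[k] (H ⊗[k] (H ⊗[k] H))))))) := fun _ _ h => h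
    rw [← pair_positions₇] at inj
    have h := congrArg Units.val (hex inl (inr.comp inl) (inr.comp (inr.comp inl))
      (inr.comp (inr.comp (inr.comp inl)))
      (inr.comp (inr.comp (inr.comp (inr.comp inl))))
      (inr.comp (inr.comp (inr.comp (inr.comp (inr.comp inl)))))
      (inr.comp (inr.comp (inr.comp (inr.comp (inr.comp inr))))))
    simp only [Units.val_mul, ap_val, ap_inv_val] at h
    refine inj ?_
    simp only [map_mul, pair_padLeft, pair_tail, pair_comp_tail, pair_comp_splitHead,
      pair_splitHead, pair_comp_splitHead₃, pair_comp_includeLeft, pair_join₃, pair_tmul, map_one,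
      one_mul]
    exact h
  counit u := by
    have h := DFunLike.congr_fun hε u
    rwa [AlgHom.comp_apply, Q.pair_counit_outer₃] at h
  counit_inner := by
    have h := congrArg Units.val hin
    rwa [ap_val, Q.pair_counit_inner, pair_positions₃] at h
  counit_outer := by
    have h := congrArg Units.val hout
    rwa [ap_val, Q.pair_counit_outer, pair_positions₃] at h

end Bicomodule

open QuasiHopfAlgebra

namespace BicomoduleAlgebra

variable {k H : Type*} [Field k] [Ring H] [Algebra k H] {Q : QuasiBialgebra k H} {A : Type*}
  [Ring A] [Algebra k A] (B : BicomoduleAlgebra Q A) {R : Type*} [Ring R] [Algebra k R]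

/-! ### The coaction `(λ ⊗ id) ∘ ρ` of a bicomodule algebra -/

section FiveLetters

variable (i j : H →ₐ[k] R) (n : A →ₐ[k] R) (l m : H →ₐ[k] R)
    [Comm i j] [Comm i n] [Comm i l] [Comm i m] [Comm j n] [Comm j l] [Comm j m] [Comm n l]
    [Comm n m] [Comm l m]

theorem coactionL_dl (i : H →ₐ[k] R) (n : A →ₐ[k] R) (j : H →ₐ[k] R) [Comm i n] [Comm i j]
    [Comm n j] : B.coactionL.dl i n j = B.rh (B.la i n) j := by
  rw [CoactionData.dl, coactionL, ← AlgHom.comp_assoc, pair_comp_splitHead]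

/-- `Ψ_l` read in letters. -/
theorem coactionL_Ps : B.coactionL.Ps i j n l m =
    B.FLR i (B.la j n) l * (B.FR (B.la i (B.la j n)) l m)⁻¹ * B.FL i j n := by
  have p₁ : (pair i (pair (B.la j n) (pair l m))).comp (padRight H) = pair i (pair (B.la j n) l) :=
    AlgHom.ext fun t => pair_padRight _ _ _ _ t
  have p₂ : (pair i (pair j (pair n (pair l m)))).comp (padRight (H ⊗[k] H)) = pair i (pair j n) :=
    AlgHom.ext fun t => pair_padRight _ _ _ _ t
  change ap (pair i (pair j (pair n (pair l m))))
    (ap (tail H (splitHead B.lam (H ⊗[k] H))) (ap (padRight H) B.Φlr *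
      ap (splitHead B.lam (H ⊗[k] H)) B.Φρ⁻¹) * ap (padRight (H ⊗[k] H)) B.Φlam) = _
  simp only [map_mul, ← ap_comp, ← AlgHom.comp_assoc, pair_comp_tail, pair_comp_splitHead, p₁, p₂,
    map_inv]

theorem coactionR_dl (i : H →ₐ[k] R) (n : A →ₐ[k] R) (j : H →ₐ[k] R) [Comm i n] [Comm i j]
    [Comm n j] : B.coactionR.dl i n j = B.la i (B.rh n j) := by
  rw [CoactionData.dl, coactionR, ← AlgHom.comp_assoc, pair_comp_tail]

/-- `Ψ_r` read in letters. -/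
theorem coactionR_Ps : B.coactionR.Ps i j n l m =
    (B.FLR j (B.rh n l) m)⁻¹ * B.FL i j (B.rh (B.rh n l) m) * (B.FR n l m)⁻¹ := by
  change ap (pair i (pair j (pair n (pair l m))))
    (ap (tail H (tail H (splitHead B.ρ H))) (ap (padLeft H) B.Φlr⁻¹ *
      ap (tail H (tail H B.ρ)) B.Φlam) * ap ((padLeft H).comp (padLeft H)) B.Φρ⁻¹) = _
  simp only [map_mul, ← ap_comp, ← AlgHom.comp_assoc, pair_comp_tail, pair_comp_splitHead,
    pair_comp_padLeft, map_inv]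

theorem intw_coactionL_Ps : Intw (B.coactionL.Ps i j n l m)
    (B.coactionL.dl (Q.cv i j) n (Q.cv l m)) (B.coactionL.dl i (B.coactionL.dl j n l) m) := by
  have h₁ : Intw (B.FL i j n) (B.rh (B.la (Q.cv i j) n) (Q.cv l m))
    (B.rh (B.la i (B.la j n)) (Q.cv l m)) := inferInstance
  have h₂ : Intw (B.FR (B.la i (B.la j n)) l m)⁻¹ (B.rh (B.la i (B.la j n)) (Q.cv l m))
    (B.rh (B.rh (B.la i (B.la j n)) l) m) := inferInstance
  have h₃ : Intw (B.FLR i (B.la j n) l) (B.rh (B.rh (B.la i (B.la j n)) l) m)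
    (B.rh (B.la i (B.rh (B.la j n) l)) m) := inferInstance
  rw [coactionL_Ps]
  simp only [coactionL_dl]
  exact (h₃.mul h₂).mul h₁

/-- `Φ_{λ,ρ}` intertwines `(λ ⊗ id) ∘ ρ` and `(id ⊗ ρ) ∘ λ`. -/
theorem intw_FLR_coaction (i : H →ₐ[k] R) (n : A →ₐ[k] R) (j : H →ₐ[k] R) [Comm i n] [Comm i j]
    [Comm n j] : Intw (B.FLR i n j) (B.coactionL.dl i n j) (B.coactionR.dl i n j) := by
  rw [coactionL_dl, coactionR_dl]; infer_instance

theorem intw_coactionR_Ps : Intw (B.coactionR.Ps i j n l m)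
    (B.coactionR.dl (Q.cv i j) n (Q.cv l m)) (B.coactionR.dl i (B.coactionR.dl j n l) m) := by
  have h₁ : Intw (B.FR n l m)⁻¹ (B.la (Q.cv i j) (B.rh n (Q.cv l m)))
    (B.la (Q.cv i j) (B.rh (B.rh n l) m)) := inferInstance
  have h₂ : Intw (B.FL i j (B.rh (B.rh n l) m)) (B.la (Q.cv i j) (B.rh (B.rh n l) m))
    (B.la i (B.la j (B.rh (B.rh n l) m))) := inferInstance
  have h₃ : Intw (B.FLR j (B.rh n l) m)⁻¹ (B.la i (B.la j (B.rh (B.rh n l) m)))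
    (B.la i (B.rh (B.la j (B.rh n l)) m)) := inferInstance
  rw [coactionR_Ps]
  simp only [coactionR_dl]
  exact (h₃.mul h₂).mul h₁

/-- `Φ_{λ,ρ}` twists the coaction `(λ ⊗ id) ∘ ρ` into `(id ⊗ ρ) ∘ λ`. -/
theorem coactionR_Ps_mul_FLR : B.coactionR.Ps i j n l m * B.FLR (Q.cv i j) n (Q.cv l m) =
    B.FLR j n l * B.FLR i (B.coactionL.dl j n l) m * B.coactionL.Ps i j n l m := by
  rw [coactionR_Ps, coactionL_Ps]
  simp only [coactionL_dl]
  have h₁ := B.FLR_right i (B.la j n) l m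
  have h₂ := B.FLR_left i j n (Q.cv l m)
  have h₃ := B.FLR_right j n l m
  have h₄ := B.FL_nat (B.FR n l m) (i := i) (j := j) (n := B.rh (B.rh n l) m)
    (i' := i) (j' := j) (n' := B.rh n (Q.cv l m))
  generalize B.FLR j (B.rh n l) m = X₁ at *
  generalize B.FL i j (B.rh (B.rh n l) m) = X₂ at *
  generalize B.FL i j (B.rh n (Q.cv l m)) = X₃ at *
  generalize B.FR n l m = X₄ at *
  generalize B.FLR (Q.cv i j) n (Q.cv l m) = X₅ at *
  generalize B.FLR j n l = X₆ at *
  generalize B.FLR i (B.rh (B.la j n) l) m = X₇ at *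
  generalize B.FLR i (B.la j n) l = X₈ at *
  generalize B.FR (B.la i (B.la j n)) l m = X₉ at *
  generalize B.FL i j n = Y₁ at *
  generalize B.FR (B.la j n) l m = Y₂ at *
  generalize B.FLR i (B.la j n) (Q.cv l m) = Y₃ at *
  generalize B.FLR j n (Q.cv l m) = Y₄ at *
  have h₁' : X₇ * X₈ * X₉⁻¹ = Y₂⁻¹ * Y₃ := by
    rw [mul_inv_eq_iff_eq_mul, mul_assoc, ← h₁]; group
  have h₂' : X₃ * X₅ = Y₄ * Y₃ * Y₁ := h₂.symm
  have h₃' : X₁⁻¹ * X₄⁻¹ = X₆ * Y₂⁻¹ * Y₄⁻¹ := by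
    rw [← mul_inv_rev, eq_mul_inv_iff_mul_eq, inv_mul_eq_iff_eq_mul, ← mul_assoc, h₃]; group
  have h₄' : X₂ * X₄⁻¹ = X₄⁻¹ * X₃ := by
    rw [mul_inv_eq_iff_eq_mul, mul_assoc, ← h₄]; group
  calc X₁⁻¹ * X₂ * X₄⁻¹ * X₅ = X₁⁻¹ * (X₂ * X₄⁻¹) * X₅ := by group
    _ = (X₁⁻¹ * X₄⁻¹) * (X₃ * X₅) := by rw [h₄']; group
    _ = X₆ * (Y₂⁻¹ * Y₃) * Y₁ := by rw [h₂', h₃']; group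
    _ = X₆ * X₇ * (X₈ * X₉⁻¹ * Y₁) := by rw [← h₁']; group

end FiveLetters

section SevenLetters

variable (a₁ a₂ a₃ : H →ₐ[k] R) (n : A →ₐ[k] R) (b₁ b₂ b₃ : H →ₐ[k] R)
    [Comm a₁ a₂] [Comm a₁ a₃] [Comm a₁ n] [Comm a₁ b₁] [Comm a₁ b₂] [Comm a₁ b₃] [Comm a₂ a₃]
    [Comm a₂ n] [Comm a₂ b₁] [Comm a₂ b₂] [Comm a₂ b₃] [Comm a₃ n] [Comm a₃ b₁] [Comm a₃ b₂]
    [Comm a₃ b₃] [Comm n b₁] [Comm n b₂] [Comm n b₃] [Comm b₁ b₂] [Comm b₁ b₃] [Comm b₂ b₃]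

/-- The cocycle condition for `Ψ_l`: the two hexagons of `Φ_{λ,ρ}`, the pentagons of `Φ_λ` and
`Φ_ρ`, and naturality. -/
theorem hexagon_coactionL :
    B.coactionL.Ps a₂ a₃ n b₁ b₂ * B.coactionL.Ps a₁ (Q.cv a₂ a₃) n (Q.cv b₁ b₂) b₃ *
        (Q.P a₁ a₂ a₃ * (Q.P b₁ b₂ b₃)⁻¹) =
      B.coactionL.Ps a₁ a₂ (B.coactionL.dl a₃ n b₁) b₂ b₃ *
        B.coactionL.Ps (Q.cv a₁ a₂) a₃ n b₁ (Q.cv b₂ b₃) := by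
  simp only [coactionL_dl, coactionL_Ps]
  have r₁ := B.FLR_right a₁ (B.la a₂ (B.la a₃ n)) b₁ b₂
  have r₂ := B.FLR_left a₁ a₂ (B.la a₃ n) b₁
  have p₁ := B.pentagon_FL a₁ a₂ a₃ n
  have p₂ := B.pentagon_FR (B.la a₁ (B.la a₂ (B.la a₃ n))) b₁ b₂ b₃
  have n₁ := B.FLR_nat (B.FL a₂ a₃ n) (i := a₁) (i' := a₁) (n := B.la (Q.cv a₂ a₃) n)
    (n' := B.la a₂ (B.la a₃ n)) (j := Q.cv b₁ b₂) (j' := Q.cv b₁ b₂)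
  have n₂ := B.FR_nat (B.FL a₂ a₃ n) (n := B.la a₁ (B.la (Q.cv a₂ a₃) n))
    (n' := B.la a₁ (B.la a₂ (B.la a₃ n))) (j := Q.cv b₁ b₂) (j' := Q.cv b₁ b₂) (l := b₃) (l' := b₃)
  have n₃ := B.FR_nat (B.FL a₁ a₂ (B.la a₃ n)) (n := B.la (Q.cv a₁ a₂) (B.la a₃ n))
    (n' := B.la a₁ (B.la a₂ (B.la a₃ n))) (j := b₁) (j' := b₁) (l := Q.cv b₂ b₃)
    (l' := Q.cv b₂ b₃)
  have n₄ := B.FLR_nat (B.FLR a₂ (B.la a₃ n) b₁) (i := a₁) (i' := a₁)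
    (n := B.rh (B.la a₂ (B.la a₃ n)) b₁) (n' := B.la a₂ (B.rh (B.la a₃ n) b₁)) (j := b₂) (j' := b₂)
  have n₅ := B.FR_nat (B.FLR a₂ (B.la a₃ n) b₁) (n := B.la a₁ (B.rh (B.la a₂ (B.la a₃ n)) b₁))
    (n' := B.la a₁ (B.la a₂ (B.rh (B.la a₃ n) b₁))) (j := b₂) (j' := b₂) (l := b₃) (l' := b₃)
  have n₆ := B.FR_nat (B.FLR a₁ (B.la a₂ (B.la a₃ n)) b₁)
    (n := B.rh (B.la a₁ (B.la a₂ (B.la a₃ n))) b₁)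
    (n' := B.la a₁ (B.rh (B.la a₂ (B.la a₃ n)) b₁)) (j := b₂) (j' := b₂) (l := b₃) (l' := b₃)
  have c₁ := B.FL_nat (Q.P b₁ b₂ b₃) (i := a₁) (i' := a₁) (j := a₂) (j' := a₂) (n := B.la a₃ n)
    (n' := B.la a₃ n)
  have c₂ := B.FL_nat (Q.P b₁ b₂ b₃) (i := Q.cv a₁ a₂) (i' := Q.cv a₁ a₂) (j := a₃) (j' := a₃)
    (n := n) (n' := n)
  -- With the factors named, the hypotheses are relations in a group, and the claim follows from
  -- them by eliminating all conjugated factors.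
  generalize B.FLR a₂ (B.la a₃ n) b₁ = A₁ at *
  generalize B.FR (B.la a₂ (B.la a₃ n)) b₁ b₂ = A₂ at *
  generalize B.FL a₂ a₃ n = A₃ at *
  generalize B.FLR a₁ (B.la (Q.cv a₂ a₃) n) (Q.cv b₁ b₂) = A₄ at *
  generalize B.FLR a₁ (B.la a₂ (B.la a₃ n)) (Q.cv b₁ b₂) = A₅ at *
  generalize B.FR (B.la a₁ (B.la (Q.cv a₂ a₃) n)) (Q.cv b₁ b₂) b₃ = A₆ at *
  generalize B.FR (B.la a₁ (B.la a₂ (B.la a₃ n))) (Q.cv b₁ b₂) b₃ = A₇ at *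
  generalize B.FL a₁ (Q.cv a₂ a₃) n = A₈ at *
  generalize Q.P a₁ a₂ a₃ = P₁ at *
  generalize Q.P b₁ b₂ b₃ = P₂ at *
  generalize B.FLR a₁ (B.la a₂ (B.rh (B.la a₃ n) b₁)) b₂ = C₁ at *
  generalize B.FLR a₁ (B.rh (B.la a₂ (B.la a₃ n)) b₁) b₂ = C₂ at *
  generalize B.FR (B.la a₁ (B.la a₂ (B.rh (B.la a₃ n) b₁))) b₂ b₃ = C₃ at *
  generalize B.FR (B.la a₁ (B.rh (B.la a₂ (B.la a₃ n)) b₁)) b₂ b₃ = C₄ at *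
  generalize B.FR (B.rh (B.la a₁ (B.la a₂ (B.la a₃ n))) b₁) b₂ b₃ = C₅ at *
  generalize B.FL a₁ a₂ (B.rh (B.la a₃ n) b₁) = C₆ at *
  generalize B.FL a₁ a₂ (B.la a₃ n) = C₇ at *
  generalize B.FLR (Q.cv a₁ a₂) (B.la a₃ n) b₁ = C₈ at *
  generalize B.FR (B.la (Q.cv a₁ a₂) (B.la a₃ n)) b₁ (Q.cv b₂ b₃) = E₁ at *
  generalize B.FR (B.la a₁ (B.la a₂ (B.la a₃ n))) b₁ (Q.cv b₂ b₃) = E₂ at *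
  generalize B.FL (Q.cv a₁ a₂) a₃ n = E₃ at *
  generalize B.FLR a₁ (B.la a₂ (B.la a₃ n)) b₁ = E₄ at *
  generalize B.FR (B.la a₁ (B.la a₂ (B.la a₃ n))) b₁ b₂ = E₅ at *
  have n₁' : A₄ = A₃⁻¹ * A₅ * A₃ := by rw [mul_assoc, ← n₁]; group
  have n₂' : A₆ = A₃⁻¹ * A₇ * A₃ := by rw [mul_assoc, ← n₂]; group
  have n₃' : E₁ = C₇⁻¹ * E₂ * C₇ := by rw [mul_assoc, ← n₃]; group
  have n₄' : C₁ = A₁ * C₂ * A₁⁻¹ := by rw [n₄]; group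
  have n₅' : C₃ = A₁ * C₄ * A₁⁻¹ := by rw [n₅]; group
  have n₆' : C₄ = E₄ * C₅ * E₄⁻¹ := by rw [n₆]; group
  have r₁' : A₅ = A₂ * C₂ * E₄ * E₅⁻¹ := by rw [r₁]; group
  have r₂' : C₈ = C₆⁻¹ * (A₁ * E₄ * C₇) := by rw [r₂]; group
  have p₁' : P₁ = A₈⁻¹ * A₃⁻¹ * (C₇ * E₃) := by rw [← p₁]; group
  have p₂' : A₇ = P₂⁻¹ * (E₂ * C₅) * E₅⁻¹ := by rw [← p₂]; group
  have c : P₂ * (C₇ * E₃) * P₂⁻¹ = C₇ * E₃ := by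
    rw [← mul_assoc, c₁, mul_assoc C₇, c₂]; group
  calc A₁ * A₂⁻¹ * A₃ * (A₄ * A₆⁻¹ * A₈) * (P₁ * P₂⁻¹)
      = A₁ * C₂ * E₄ * C₅⁻¹ * E₂⁻¹ * (P₂ * (C₇ * E₃) * P₂⁻¹) := by
        rw [n₁', n₂', r₁', p₁', p₂']; group
    _ = C₁ * C₃⁻¹ * C₆ * (C₈ * E₁⁻¹ * E₃) := by
        rw [c, n₃', n₄', n₅', n₆', r₂']; group

/-- The cocycle condition for `Ψ_r`, transported from that for `Ψ_l` along the twist `Φ_{λ,ρ}`. -/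
theorem hexagon_coactionR :
    B.coactionR.Ps a₂ a₃ n b₁ b₂ * B.coactionR.Ps a₁ (Q.cv a₂ a₃) n (Q.cv b₁ b₂) b₃ *
        (Q.P a₁ a₂ a₃ * (Q.P b₁ b₂ b₃)⁻¹) =
      B.coactionR.Ps a₁ a₂ (B.coactionR.dl a₃ n b₁) b₂ b₃ *
        B.coactionR.Ps (Q.cv a₁ a₂) a₃ n b₁ (Q.cv b₂ b₃) := by
  have hx := B.hexagon_coactionL a₁ a₂ a₃ n b₁ b₂ b₃
  have t₁ := B.coactionR_Ps_mul_FLR a₁ (Q.cv a₂ a₃) n (Q.cv b₁ b₂) b₃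
  have t₂ := B.coactionR_Ps_mul_FLR a₂ a₃ n b₁ b₂
  have t₃ := B.coactionR_Ps_mul_FLR (Q.cv a₁ a₂) a₃ n b₁ (Q.cv b₂ b₃)
  have t₄ := B.coactionR_Ps_mul_FLR a₁ a₂ (B.coactionL.dl a₃ n b₁) b₂ b₃
  have i₁ := B.intw_coactionL_Ps a₂ a₃ n b₁ b₂
  have i₂ := B.intw_FLR_coaction a₃ n b₁
  have n₁ := B.FLR_nat (B.coactionL.Ps a₂ a₃ n b₁ b₂) (i := a₁) (i' := a₁)
    (n := B.coactionL.dl (Q.cv a₂ a₃) n (Q.cv b₁ b₂))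
    (n' := B.coactionL.dl a₂ (B.coactionL.dl a₃ n b₁) b₂) (j := b₃) (j' := b₃)
  have n₂ := B.coactionR.Ps_nat (B.FLR a₃ n b₁) (i := a₁) (i' := a₁) (j := a₂) (j' := a₂)
    (n := B.coactionL.dl a₃ n b₁) (n' := B.coactionR.dl a₃ n b₁) (l := b₂) (l' := b₂)
    (m := b₃) (m' := b₃)
  have n₃ := B.FLR_nat (Q.P a₁ a₂ a₃) (i := Q.cv (Q.cv a₁ a₂) a₃) (i' := Q.cv a₁ (Q.cv a₂ a₃))
    (n := n) (n' := n) (j := Q.cv b₁ (Q.cv b₂ b₃)) (j' := Q.cv b₁ (Q.cv b₂ b₃))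
  have n₄ := B.FLR_nat (Q.P b₁ b₂ b₃)⁻¹ (i := Q.cv a₁ (Q.cv a₂ a₃)) (i' := Q.cv a₁ (Q.cv a₂ a₃))
    (n := n) (n' := n) (j := Q.cv b₁ (Q.cv b₂ b₃)) (j' := Q.cv (Q.cv b₁ b₂) b₃)
  have c : Q.P a₁ a₂ a₃ * (Q.P b₁ b₂ b₃)⁻¹ = (Q.P b₁ b₂ b₃)⁻¹ * Q.P a₁ a₂ a₃ := by
    rw [eq_inv_mul_iff_mul_eq, ← mul_assoc, ← Q.P_nat (Q.P a₁ a₂ a₃) (i := b₁) (j := b₂) (l := b₃),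
      mul_inv_cancel_right]
  -- both sides are compared after transport to the other coaction along `Φ_{λ,ρ}`
  rw [← mul_left_inj (B.FLR (Q.cv (Q.cv a₁ a₂) a₃) n (Q.cv b₁ (Q.cv b₂ b₃)))]
  generalize B.coactionR.Ps a₂ a₃ n b₁ b₂ = R₁ at *
  generalize B.coactionR.Ps a₁ (Q.cv a₂ a₃) n (Q.cv b₁ b₂) b₃ = R₂ at *
  generalize Q.P a₁ a₂ a₃ = P₁ at *
  generalize (Q.P b₁ b₂ b₃)⁻¹ = P₂ at *
  generalize B.coactionR.Ps a₁ a₂ (B.coactionR.dl a₃ n b₁) b₂ b₃ = R₃ at *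
  generalize B.coactionR.Ps (Q.cv a₁ a₂) a₃ n b₁ (Q.cv b₂ b₃) = R₄ at *
  generalize B.coactionR.Ps a₁ a₂ (B.coactionL.dl a₃ n b₁) b₂ b₃ = R₅ at *
  generalize B.coactionL.Ps a₂ a₃ n b₁ b₂ = L₁ at *
  generalize B.coactionL.Ps a₁ (Q.cv a₂ a₃) n (Q.cv b₁ b₂) b₃ = L₂ at *
  generalize B.coactionL.Ps a₁ a₂ (B.coactionL.dl a₃ n b₁) b₂ b₃ = L₃ at *
  generalize B.coactionL.Ps (Q.cv a₁ a₂) a₃ n b₁ (Q.cv b₂ b₃) = L₄ at *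
  generalize B.FLR (Q.cv (Q.cv a₁ a₂) a₃) n (Q.cv b₁ (Q.cv b₂ b₃)) = X at *
  generalize B.FLR (Q.cv a₁ (Q.cv a₂ a₃)) n (Q.cv b₁ (Q.cv b₂ b₃)) = X' at *
  generalize B.FLR (Q.cv a₁ (Q.cv a₂ a₃)) n (Q.cv (Q.cv b₁ b₂) b₃) = X'' at *
  generalize B.FLR (Q.cv a₂ a₃) n (Q.cv b₁ b₂) = U₁ at *
  generalize B.FLR a₁ (B.coactionL.dl (Q.cv a₂ a₃) n (Q.cv b₁ b₂)) b₃ = U₂ at *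
  generalize B.FLR a₁ (B.coactionL.dl a₂ (B.coactionL.dl a₃ n b₁) b₂) b₃ = U₃ at *
  generalize B.FLR a₃ n b₁ = U₄ at *
  generalize B.FLR a₂ (B.coactionL.dl a₃ n b₁) b₂ = U₅ at *
  generalize B.FLR (Q.cv a₁ a₂) (B.coactionL.dl a₃ n b₁) (Q.cv b₂ b₃) = U₆ at *
  calc R₁ * R₂ * (P₁ * P₂) * X = R₁ * (R₂ * X'') * (P₁ * P₂) := by
        rw [c, mul_assoc, mul_assoc P₂, n₃, ← mul_assoc P₂, n₄]; group
    _ = (R₁ * U₁) * U₂ * L₂ * (P₁ * P₂) := by rw [t₁]; group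
    _ = U₄ * U₅ * (L₁ * U₂) * L₂ * (P₁ * P₂) := by rw [t₂]; group
    _ = U₄ * U₅ * U₃ * (L₁ * L₂ * (P₁ * P₂)) := by rw [n₁]; group
    _ = U₄ * (U₅ * U₃ * L₃) * L₄ := by rw [hx]; group
    _ = U₄ * R₅ * U₆ * L₄ := by rw [← t₄]; group
    _ = R₃ * R₄ * X := by rw [n₂, mul_assoc R₃, mul_assoc R₃, ← t₃]; group

end SevenLetters

/-- The two-sided coaction `(λ ⊗ id) ∘ ρ` of a bicomodule algebra. -/
def twoSidedL : TwoSidedCoaction Q A := TwoSidedCoaction.ofLetters B.coactionL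
  (B.intw_coactionL_Ps _ _ _ _ _)
  (fun a₁ a₂ a₃ n b₁ b₂ b₃ => B.hexagon_coactionL a₁ a₂ a₃ n b₁ b₂ b₃)
  (by rw [coactionL_dl, B.rh_e, B.la_e])
  (by simp only [coactionL_Ps, FLR_e_right, B.FR_e_left, B.FL_e_right, inv_one, mul_one])
  (by simp only [coactionL_Ps, FLR_e_left, B.FR_e_right, B.FL_e_left, inv_one, mul_one])

/-- The two-sided coaction `(id ⊗ ρ) ∘ λ` of a bicomodule algebra. -/
def twoSidedR : TwoSidedCoaction Q A := TwoSidedCoaction.ofLetters B.coactionR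
  (B.intw_coactionR_Ps _ _ _ _ _)
  (fun a₁ a₂ a₃ n b₁ b₂ b₃ => B.hexagon_coactionR a₁ a₂ a₃ n b₁ b₂ b₃)
  (by rw [coactionR_dl, B.la_e, B.rh_e])
  (by simp only [coactionR_Ps, FLR_e_left, B.FR_e_left, B.FL_e_right, inv_one, mul_one])
  (by simp only [coactionR_Ps, FLR_e_right, B.FR_e_right, B.FL_e_left, inv_one, mul_one])

end BicomoduleAlgebra

/-! ### The crossed products of a bicomodule algebra -/

namespace BicomoduleAlgebra

variable {k H : Type*} [Field k] [Ring H] [Algebra k H] {Q : QuasiHopfAlgebra k H}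
  {A : Type*} [Ring A] [Algebra k A]
  {𝒜 : Type*} [NonAssocRing 𝒜] [Module k 𝒜] [SMulCommClass k 𝒜 𝒜] [IsScalarTower k 𝒜 𝒜]
  (B : BicomoduleAlgebra Q.toQuasiBialgebra A) (M : BimoduleAlgebra Q.toQuasiBialgebra 𝒜)

/-- `Φ_{λ,ρ}` acting on `𝒜 ⊗ A`. -/
abbrev twistAct : (Module.End k (𝒜 ⊗[k] A))ˣ := B.FLR (hd M.L) (sh (lm k A)) (hd M.R)

theorem twistAct_star (t : 𝒜 ⊗[k] (𝒜 ⊗[k] A)) : (B.twistAct M).val (M.star A t) =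
    M.star A ((B.FLR (Q.cv (hd M.L) (sh (hd M.L))) (sh (sh (lm k A)))
      (Q.cv (sh (hd M.R)) (hd M.R))).val t) :=
  (Eqv.ap B.Φlr t).symm

theorem tmul_twistAct (φ : 𝒜) (ξ : 𝒜 ⊗[k] A) : φ ⊗ₜ[k] (B.twistAct M).val ξ =
    (B.FLR (sh (hd M.L)) (sh (sh (lm k A))) (sh (hd M.R))).val (φ ⊗ₜ ξ) := by
  simp only [ap_val, ← sh_pair, sh_tmul]

theorem twistAct_act (u : A) (ζ : 𝒜 ⊗[k] A) : (B.twistAct M).val (B.coactionL.act M u ζ) =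
    B.coactionR.act M u ((B.twistAct M).val ζ) :=
  LinearMap.congr_fun
    ((B.intw_FLR_coaction (hd M.L) (sh (lm k A)) (hd (V := 𝒜) M.R)).intw u) ζ

/-- `Φ_{λ,ρ}` carries the action through `(λ ⊗ id) ∘ ρ` to the action through `(id ⊗ ρ) ∘ λ`. -/
theorem FLR_ins (ζ ξ : 𝒜 ⊗[k] A) :
    (B.FLR (sh (hd M.L)) (sh (sh (lm k A))) (sh (hd M.R))).val (B.coactionL.ins M ζ ξ) =
      B.coactionR.ins M ((B.twistAct M).val ζ) ξ := by
  induction ξ with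
  | zero => simp only [map_zero]
  | tmul φ u =>
    rw [CoactionData.ins_tmul, CoactionData.ins_tmul, ← tmul_twistAct, twistAct_act]
  | add a b ha hb => simp only [map_add, ha, hb]

theorem ins_twistAct (ζ ξ : 𝒜 ⊗[k] A) : B.coactionL.ins M ζ ((B.twistAct M).val ξ) =
    (B.FLR (hd M.L) (B.coactionL.dl (sh (hd M.L)) (sh (sh (lm k A))) (sh (hd M.R)))
      (hd M.R)).val (B.coactionL.ins M ζ ξ) := by
  simp only [← CoactionData.sh_act]
  exact Eqv.ap (T := ((B.coactionL.act M).toLinearMap.flip ζ).lTensor 𝒜) B.Φlr ξ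

/-- The action of `Φ_{λ,ρ}` on `𝒜 ⊗ A` is multiplicative between the two crossed products, because
`Φ_{λ,ρ}` twists `Ψ_l` into `Ψ_r`. -/
theorem twistAct_mul (ξ ζ : 𝒜 ⊗[k] A) :
    (B.twistAct M).val ((leftCrossed B.coactionL M).mul ξ ζ) =
      (leftCrossed B.coactionR M).mul ((B.twistAct M).val ξ) ((B.twistAct M).val ζ) := by
  have h := B.coactionR_Ps_mul_FLR (hd M.L) (sh (hd M.L)) (sh (sh (lm k A))) (sh (hd M.R))
    (hd (V := 𝒜) (W := 𝒜 ⊗[k] A) M.R)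
  rw [← eq_inv_mul_iff_mul_eq, ← mul_assoc, ← mul_inv_eq_iff_eq_mul] at h
  rw [CoactionData.leftCrossed_mul, CoactionData.leftCrossed_mul, twistAct_star, ← FLR_ins,
    ins_twistAct]
  refine congrArg (M.star A) ?_
  simp only [← Module.End.mul_apply, ← Units.val_mul]
  rw [h]

theorem twistAct_one : (B.twistAct M).val ((1 : 𝒜) ⊗ₜ (1 : A)) = 1 ⊗ₜ 1 := by
  have h := B.FLR_e_left (lm k A) (Q.e _)
  refine (Eqv.ap (T := BimoduleAlgebra.unitHead k 𝒜 A) (F := pair (Q.e _) (pair (lm k A) (Q.e _)))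
    B.Φlr (1 : A)).symm.trans ?_
  refine (congrArg (fun w : (Module.End k A)ˣ => BimoduleAlgebra.unitHead k 𝒜 A (w.val 1)) h).trans
    ?_
  rfl

/-- The action of `Φ_{λ,ρ}` as a linear automorphism of `𝒜 ⊗ A`. -/
def twistEquiv : 𝒜 ⊗[k] A ≃ₗ[k] 𝒜 ⊗[k] A :=
  LinearMap.GeneralLinearGroup.toLinearEquiv (B.twistAct M)

theorem twistEquiv_isAlgebraIso :
    IsAlgebraIso (leftCrossed B.coactionL M) (leftCrossed B.coactionR M) (B.twistEquiv M) where
  map_mul := B.twistAct_mul M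
  map_one := B.twistAct_one M

end BicomoduleAlgebra

end QuasiHopf

end

theorem mainTheorem2 {k H A 𝒜 : Type*} [Field k] [Ring H] [Algebra k H]
    [Ring A] [Algebra k A]
    [NonAssocRing 𝒜] [Module k 𝒜] [SMulCommClass k 𝒜 𝒜] [IsScalarTower k 𝒜 𝒜]
    (Q : QuasiHopf.QuasiHopfAlgebra k H)
    (M : QuasiHopf.BimoduleAlgebra Q.toQuasiBialgebra 𝒜) :
    (∀ D : QuasiHopf.TwoSidedCoaction Q.toQuasiBialgebra A,
      (QuasiHopf.leftCrossed D.toCoactionData M).IsUnitalAlgebra ∧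
      (QuasiHopf.rightCrossed D.toCoactionData M).IsUnitalAlgebra ∧
      ∃ ϑ : 𝒜 ⊗[k] A ≃ₗ[k] A ⊗[k] 𝒜,
        (∀ (φ : 𝒜) (u : A), ϑ (φ ⊗ₜ[k] u) =
          QuasiHopf.thetaTerm M φ (QuasiHopf.qElt Q D.toCoactionData * D.δ u)) ∧
        (∀ (φ : 𝒜) (u : A), ϑ.symm (u ⊗ₜ[k] φ) =
          QuasiHopf.thetaInvTerm M φ (D.δ u * QuasiHopf.pElt Q D.toCoactionData)) ∧
        QuasiHopf.IsAlgebraIso (QuasiHopf.leftCrossed D.toCoactionData M)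
          (QuasiHopf.rightCrossed D.toCoactionData M) ϑ) ∧
    (∀ B : QuasiHopf.BicomoduleAlgebra Q.toQuasiBialgebra A,
      (QuasiHopf.leftCrossed B.coactionL M).IsUnitalAlgebra ∧
      (QuasiHopf.rightCrossed B.coactionL M).IsUnitalAlgebra ∧
      (QuasiHopf.leftCrossed B.coactionR M).IsUnitalAlgebra ∧
      (QuasiHopf.rightCrossed B.coactionR M).IsUnitalAlgebra ∧
      (∃ e : 𝒜 ⊗[k] A ≃ₗ[k] A ⊗[k] 𝒜,
        QuasiHopf.IsAlgebraIso (QuasiHopf.leftCrossed B.coactionL M)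
          (QuasiHopf.rightCrossed B.coactionL M) e) ∧
      (∃ e : 𝒜 ⊗[k] A ≃ₗ[k] 𝒜 ⊗[k] A,
        QuasiHopf.IsAlgebraIso (QuasiHopf.leftCrossed B.coactionL M)
          (QuasiHopf.leftCrossed B.coactionR M) e) ∧
      (∃ e : 𝒜 ⊗[k] A ≃ₗ[k] A ⊗[k] 𝒜,
        QuasiHopf.IsAlgebraIso (QuasiHopf.leftCrossed B.coactionL M)
          (QuasiHopf.rightCrossed B.coactionR M) e)) := by
  refine ⟨fun D => ⟨D.leftCrossed_isUnitalAlgebra M, D.rightCrossed_isUnitalAlgebra M,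
    D.thetaEquiv M, fun _ _ => rfl, fun φ u => D.thetaInv_tmul M u φ,
    D.thetaEquiv_isAlgebraIso M⟩, fun B => ?_⟩
  have hR := B.twoSidedR.thetaEquiv_isAlgebraIso M
  exact ⟨B.twoSidedL.leftCrossed_isUnitalAlgebra M, B.twoSidedL.rightCrossed_isUnitalAlgebra M,
    B.twoSidedR.leftCrossed_isUnitalAlgebra M, B.twoSidedR.rightCrossed_isUnitalAlgebra M,
    ⟨_, B.twoSidedL.thetaEquiv_isAlgebraIso M⟩, ⟨_, B.twistEquiv_isAlgebraIso M⟩,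
    ⟨_, (B.twistEquiv_isAlgebraIso M).trans hR⟩⟩
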